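/- **Setting.** Let $n\ge 4$ and let $(\mathbf W,S)$ be a Coxeter system of type $\tilde D_n$, $S=\{0,1,\dots,n\}$, with Coxeter graph $\Gamma$ having the edges $0-2$, $i-(i+1)$ for $1\le i\le n-2$, and $(n-2)-n$ (all labelled $3$). For $\sigma\subseteq S$ let $\mathbf W_\sigma$ be the parabolic subgroup generated by $\sigma$, let $K_n=\{\sigma\subseteq S:\mathbf W_\sigma \text{ finite}\}$ (with $\varnothing\in K_n$), and let $\Gamma(\sigma)$ be the subgraph of $\Gamma$ induced by $\sigma$. For $d\ge 2$ let $v_{\varphi_d}(\sigma)$, $\sigma\in K_n$, be the multiplicity of the $d$-th cyclotomic polynomial $\varphi_d$ in the Poincaré polynomial $\mathbf W_\sigma(q)=\sum_{w\in \mathbf W_\sigma}q^{\ell(w)}$. Let $G$ be the directed graph with vertex set $K_n$ and an edge $\sigma\to\tau$ whenever $\tau\lhd\sigma$, i.e. $\tau\subset\sigma$ and $|\sigma|=|\tau|+1$; $[\sigma:\tau]=\pm1$ are the simplicial incidence numbers. A *matching* on $G$ is a set $\mathcal M$ of edges such that every simplex is adjacent to at most one edge of $\mathcal M$; a simplex adjacent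 to none is *critical*. An *alternating path* from $\sigma$ to $\tau$ is a sequence $\sigma\rhd\tau_1\lhd\sigma_1\rhd\tau_2\lhd\cdots\rhd\tau_m\lhd\sigma_m\rhd\tau$ ($m\ge0$) whose pairs $\tau_i\lhd\sigma_i$ are in $\mathcal M$ and whose other pairs are not. $\mathcal M$ is *acyclic* if there is no non-trivial closed alternating path. For $\mathcal M$ acyclic and $\sigma,\tau$ critical, $[\sigma:\tau]^{\mathcal M}$ is the sum over all alternating paths from $\sigma$ to $\tau$ of $(-1)^m[\sigma:\tau_1][\sigma_1:\tau_1][\sigma_1:\tau_2]\cdots[\sigma_m:\tau_m][\sigma_m:\tau]$. $\mathcal M$ is *$\varphi_d$-precise* if it is an acyclic matching, $v_{\varphi_d}(\sigma)=v_{\varphi_d}(\tau)$ for all $(\sigma\to\tau)\in\mathcal M$, and $v_{\varphi_d}(\sigma)=v_{\varphi_d}(\tau)+1$ for all critical $\sigma,\tau$ with $[\sigma:\tau]^{\mathcal M}\ne0$. Write $\sigma\veebar v$ for the symmetric difference of $\sigma$ and $\{v\}$. "Toggle $v$" means: match $\sigma$ with $\sigma\veebar v$. In each list below the first applicable case is used.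 "Construct as in $X$ via $u_1,\dots,u_m$" means: ignore the vertices other than $u_1,\dots,u_m$, relabel $u_i$ as $i$, and follow the rule $X$. Put $h=d/2$ when $d$ is even. **Rule $A_{m,f,g}$** (subsets $\sigma$ of $\{1,\dots,m\}$ containing the first $f$ and the last $g$ elements). (a) If $f+g\ge m$: $\sigma$ is critical. (b) If $f\ge d$: as in $A_{m-d,f-d,g}$ via $d+1,\dots,m$. (c) If $m\ge d+g$: (c1) if $\{1,\dots,d-1\}\subseteq\sigma$, toggle $d$; (c2) if $f+1\in\sigma$, toggle $f+1$; (c3) if $\{f+2,\dots,d-1\}\nsubseteq\sigma$, toggle $f+1$; (c4) otherwise as in $A_{m-f-1,\,d-2-f,\,g}$ via $f+2,\dots,m$. (d) If $m<d+g$: (d1) if $m\equiv-1,0,1,\dots,f-1\pmod d$ and $\sigma$ is $\{1,\dots,m\}$ or $\{1,\dots,f,f+2,\dots,m\}$, then $\sigma$ is critical; (d2) otherwise toggle $f+1$. **Rule $D_m$ for $d$ odd** (subsets of $\{1,\dots,m\}$). (a) If $1\in\sigma$, toggle $2$. (b) Otherwise as in $A_{m-1,0,0}$ via $2,\dots,m$.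 **Rule $D_{m,g}$ for $d$ even** (subsets of $\{1,\dots,m\}$ containing the last $g$ elements; connected components are taken in the graph of type $D_m$ with edges $1-3$ and $i-(i+1)$, $2\le i\le m-1$; the same text is used for small $m$). (a) If $2\notin\sigma$: as in $A_{m-1,0,g}$ via $1,3,4,\dots,m$. (b) If $d=2$ and $\{1,2,3,4\}\nsubseteq\sigma$: (b1) if $\{1,2,4\}\subseteq\sigma$, toggle $5$ if $m-g\ge5$, else critical; (b2) otherwise toggle $3$ if $m-g\ge3$, else critical. (c) If $d\ge4$ and $3\notin\sigma$: toggle $1$. (d) If $d=4$ and $4\notin\sigma$: as in $A_{m-4,0,g}$ via $5,\dots,m$. (e) If $d\ge6$ and $4\notin\sigma$: toggle $1$. (f) If $d\ge4$ and $1\notin\sigma$: (f1) if $\{2,\dots,h+1\}\subseteq\sigma$, as in $A_{m-1,\max(h,3),g}$ via $2,\dots,m$; (f2) otherwise toggle $1$. (g) Otherwise let $k$ be the size of the component of $1$ and write $k=qh+r$ with $0<r<h$ if $h\nmid k$, and $r\in\{0,h\}$, $q$ even if $h\mid k$ (*). Let $v=qh+1$ if $q$ is even, $v=qh+2$ if $q$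 is odd. (g1) If $v\in\sigma$: toggle $v$ if $v\le m-g$, else critical. (g2) If $v\notin\sigma$: (g2.1) if $v>m$, critical; (g2.2) if $q$ is even and $\{qh+2,\dots,(q+1)h+1\}\subseteq\sigma$, as in $A_{m-qh-1,\,h,\,g}$ via $qh+2,\dots,m$; (g2.3) if $q$ is odd and $\{qh+3,\dots,(q+1)h\}\subseteq\sigma$, as in $A_{m-qh-2,\,h-2,\,g}$ via $qh+3,\dots,m$; otherwise toggle $v$. **Matching on $K_n$, $d$ odd.** (a) $\sigma=\{1,\dots,n\}$ is critical. (b) If $1\notin\sigma$: as in $D_n$ via $n,n-1,\dots,3,2,0$. (c) Otherwise toggle $0$. **Matching on $K_n$, $d$ even.** For $n=4$ and $d\le6$: $d=2$: if $|\sigma|=1$ and $2\notin\sigma$, or $|\sigma|=2$, or $|\sigma|=3$ and $2\in\sigma$, toggle $2$; otherwise critical. $d=4$: if $2\notin\sigma$ or $\sigma\cap\{1,3,4\}=\varnothing$, toggle $0$; otherwise critical. $d=6$: if $2\in\sigma$, $0\notin\sigma$, $|\sigma|\ge3$, or if $\{0,2\}\subseteq\sigma$, $|\sigma|=4$, then $\sigma$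 is critical; otherwise toggle $0$. For $n\ge5$ or $d\ge8$: (a) If $1\notin\sigma$: as in $D_{n,0}$ via $n,n-1,\dots,3,2,0$. (b) If $d=2$ and $\{0,1,2,3\}\nsubseteq\sigma$: (b1) if $\{0,1,3\}\subseteq\sigma$, toggle $4$ if $\{5,\dots,n\}\nsubseteq\sigma$, else critical; (b2) otherwise toggle $2$ if $\{1,3,4,\dots,n\}\nsubseteq\sigma$, else critical. (c) If $d\ge4$ and $0\notin\sigma$: (c1) if $\{1,\dots,h\}\subseteq\sigma$, as in $D_{n,h}$ via $n,n-1,\dots,1$; (c2) if $n=h+1$ and $\sigma=\{1,\dots,n-2,n\}$, critical; (c3) if $\sigma=\{1,\dots,n\}$, critical; (c4) otherwise toggle $0$. (d) If $d\ge4$ and $2\notin\sigma$: toggle $0$. (e) If $d=4$ and $3\notin\sigma$: as in $D_{n-3,0}$ via $n,n-1,\dots,4$. (f) If $d\ge6$ and $3\notin\sigma$: toggle $0$. (g) Otherwise let $k$ be the size of the component of $0$ in $\Gamma(\sigma)$, write $k=qh+r$ as in (*), and let $v=qh$ if $q$ is even, $v=qh+1$ if $q$ is odd. (g1) If $d=4$,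 $q$ is odd and $r=1$: as in $D_{n-k,0}$ via $n,n-1,\dots,k+1$ if $k\le n-2$, else critical. (g2) If $\sigma=\{0,1,\dots,n-2,n\}$ and $v\ge n-1$: critical. (g3) If $v\in\sigma$: toggle $v$. (g4) If $v\ge n$: critical. (g5) Otherwise let $C$ be the vertex set of the component of $v+1$ in $\Gamma(\sigma)$ (empty if $v+1\notin\sigma$), except that $C=\sigma\cap\{n-1,n\}$ if $v=n-2$; let $c=|C|$, and let $\ell=h$ if $q$ is even, $\ell=h-2$ if $q$ is odd. (g5.1) If $\{n-1,n\}\subseteq C$ and $c\le\ell$, critical. (g5.2) If $c<\ell$, toggle $v$. (g5.3) If $c=\ell$, $n-1\notin C$ and $n\in C$, critical. (g5.4) Otherwise as in $D_{n-v,\ell}$ via $n,n-1,\dots,v+1$. **Lemma 9.1.** Let $n\ge4$ and $d\ge2$. The edges prescribed above form a well-defined matching on the incidence graph $G$ of $K_n$, whose critical simplices are exactly those declared critical by the construction, and this matching is $\varphi_d$-precise (for $d$ odd and for $d$ even). In addition, for $d$ odd the values of $|\sigma|-v_{\varphi_d}(\sigma)$ on the critical simplices, with multiplicity, are: - if $n\equiv0\pmod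 d$: three critical simplices, with values $n-\frac nd$ (once) and $n-2\frac nd$ (twice); - if $n\equiv1\pmod d$: three critical simplices, with values $n-\frac{n-1}d$ (once) and $n-2\frac{n-1}d-1$ (twice); - otherwise: exactly one critical simplex, with value $n-\lfloor\frac nd\rfloor$. -/

import Mathlib

namespace PreciseMatching

/-! ### Matchings on the incidence graph of a simplicial complex -/

section Morse

/-- Edges `σ → τ` (with `τ ⋖ σ`, i.e. `τ` is a facet of `σ`) of the incidence graph of `K`;
the empty simplex is allowed. -/
def incidenceGraph {V : Type*} (K : Set (Finset V)) : Set (Finset V × Finset V) :=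
  {e | e.1 ∈ K ∧ e.2 ∈ K ∧ e.2 ⋖ e.1}

/-- A set of edges of the incidence graph such that each simplex is adjacent to at most one of
them. -/
def IsMatching {V : Type*} (K : Set (Finset V)) (M : Set (Finset V × Finset V)) : Prop :=
  M ⊆ incidenceGraph K ∧
    ∀ σ ∈ K, ∀ e ∈ M, ∀ e' ∈ M, (e.1 = σ ∨ e.2 = σ) → (e'.1 = σ ∨ e'.2 = σ) → e = e'

def IsCritical {V : Type*} (K : Set (Finset V)) (M : Set (Finset V × Finset V))
    (σ : Finset V) : Prop :=
  σ ∈ K ∧ ∀ e ∈ M, e.1 ≠ σ ∧ e.2 ≠ σ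

/-- One step `τ ⋖ σ ⋗ τ'` of an alternating path, with `σ → τ` in `M` and `σ → τ'` not in `M`. -/
def AltStep {V : Type*} (M : Set (Finset V × Finset V)) (τ τ' : Finset V) : Prop :=
  ∃ σ, (σ, τ) ∈ M ∧ τ' ⋖ σ ∧ (σ, τ') ∉ M

/-- There is no alternating cycle with at least one step. -/
def IsAcyclic {V : Type*} (M : Set (Finset V × Finset V)) : Prop :=
  ∀ τ, ¬ Relation.TransGen (AltStep M) τ τ

/-- The incidence number `[σ : τ]` for `τ ⋖ σ`, the simplices being oriented by the order of the
vertices: `(-1) ^ i` if `τ` is obtained by removing the `i`-th vertex of `σ` (counted from `0`). -/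
def inc {V : Type*} [LinearOrder V] (σ τ : Finset V) : ℤ :=
  ∏ x ∈ σ \ τ, (-1) ^ (σ.filter (· < x)).card

/-- The list `[(τ₁, σ₁), …, (τₘ, σₘ)]` is the interior of an alternating path
`σ ⋗ τ₁ ⋖ σ₁ ⋗ τ₂ ⋖ σ₂ ⋗ ⋯ ⋗ τₘ ⋖ σₘ ⋗ ρ` from `σ` to `ρ`. -/
def IsAltPath {V : Type*} (M : Set (Finset V × Finset V)) :
    Finset V → List (Finset V × Finset V) → Finset V → Prop
  | σ, [], ρ => ρ ⋖ σ ∧ (σ, ρ) ∉ M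
  | σ, (τ, σ') :: p, ρ => τ ⋖ σ ∧ (σ, τ) ∉ M ∧ (σ', τ) ∈ M ∧ IsAltPath M σ' p ρ

/-- `(-1)^m [σ:τ₁][σ₁:τ₁][σ₁:τ₂] ⋯ [σₘ:τₘ][σₘ:ρ]`. -/
def pathSign {V : Type*} [LinearOrder V] :
    Finset V → List (Finset V × Finset V) → Finset V → ℤ
  | σ, [], ρ => inc σ ρ
  | σ, (τ, σ') :: p, ρ => -(inc σ τ * inc σ' τ) * pathSign σ' p ρ

/-- The incidence number `[σ : ρ]^M` of the Morse complex: the sum over all alternating paths from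
`σ` to `ρ` (there are finitely many of them if `M` is acyclic and `V` is finite). -/
noncomputable def morseInc {V : Type*} [LinearOrder V] (M : Set (Finset V × Finset V))
    (σ ρ : Finset V) : ℤ :=
  ∑ᶠ (p : List (Finset V × Finset V)) (_ : IsAltPath M σ p ρ), pathSign σ p ρ

end Morse

/-! ### The weighted complex of a Coxeter system -/

section Coxeter

variable {B W : Type*} [Group W] {C : CoxeterMatrix B} (cs : CoxeterSystem C W)

/-- The parabolic subgroup generated by `σ`. -/
def parabolic (σ : Finset B) : Subgroup W := Subgroup.closure (cs.simple '' (σ : Set B))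

/-- The simplicial complex `K_W` (containing the empty simplex). -/
def simplices : Set (Finset B) := {σ | (parabolic cs σ : Set W).Finite}

/-- The Poincaré polynomial `∑ q ^ ℓ(w)`, over the `w` in the (finite) parabolic subgroup of `σ`. -/
noncomputable def poincare (σ : Finset B) : Polynomial ℚ :=
  ∑ᶠ (w : W) (_ : w ∈ parabolic cs σ), Polynomial.X ^ cs.length w

/-- The weight: multiplicity of the `d`-th cyclotomic polynomial in the Poincaré polynomial. -/
noncomputable def weight (d : ℕ) (σ : Finset B) : ℕ :=
  multiplicity (Polynomial.cyclotomic d ℚ) (poincare cs σ)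

/-- `M` is a `φ_d`-precise matching on the incidence graph of `K_W`. -/
def IsPrecise [LinearOrder B] (d : ℕ) (M : Set (Finset B × Finset B)) : Prop :=
  IsMatching (simplices cs) M ∧ IsAcyclic M ∧
    (∀ e ∈ M, weight cs d e.1 = weight cs d e.2) ∧
    ∀ σ τ, IsCritical (simplices cs) M σ → IsCritical (simplices cs) M τ →
      morseInc M σ τ ≠ 0 → weight cs d σ = weight cs d τ + 1

end Coxeter

/-! ### Recursive recipes

A recipe is a function `π : Finset ℕ → Option ℕ`: the value `some v` says that `σ` is matched with
`σ ⊻ v` (add `v` if it is missing, remove it if it is present), and the value `none` says that `σ`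
is critical. -/

/-- Relabel the vertices `ρ 1, …, ρ m` as `1, …, m`, ignore all others, and apply the
recipe `π`. -/
def relabel (m : ℕ) (ρ : ℕ → ℕ) (π : Finset ℕ → Option ℕ) (σ : Finset ℕ) : Option ℕ :=
  (π ((Finset.Icc 1 m).filter (fun j => ρ j ∈ σ))).map ρ

open Classical in
/-- Vertex set of the connected component of `v` in the subgraph of `Γ` induced by `σ`
(empty if `v ∉ σ`). -/
noncomputable def component (Γ : SimpleGraph ℕ) (σ : Finset ℕ) (v : ℕ) : Finset ℕ :=
  σ.filter (fun u => ∃ (hv : v ∈ σ) (hu : u ∈ σ),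
    (Γ.induce {x | x ∈ σ}).Reachable ⟨v, hv⟩ ⟨u, hu⟩)

/-- The matching on `K^A_{n,f,g}`, i.e. on the subsets of `{1, …, n}` containing the first `f` and
the last `g` vertices (for `d ≥ 2`). -/
def pivotA (d n f g : ℕ) (σ : Finset ℕ) : Option ℕ :=
  if hd : d = 0 then none
  -- (a)
  else if hn : n ≤ f + g then none
  -- (b)
  else if d ≤ f then relabel (n - d) (fun j => j + d) (pivotA d (n - d) (f - d) g) σ
  -- (c)
  else if d + g ≤ n then
    if Finset.Icc 1 (d - 1) ⊆ σ then some d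
    else if f + 1 ∈ σ then some (f + 1)
    else if ¬ Finset.Icc (f + 2) (d - 1) ⊆ σ then some (f + 1)
    else relabel (n - f - 1) (fun j => j + f + 1) (pivotA d (n - f - 1) (d - 2 - f) g) σ
  -- (d), where `(n + 1) % d ≤ f` says that `n ≡ -1, 0, …, f - 1` modulo `d`
  else if (n + 1) % d ≤ f ∧
      (σ = Finset.Icc 1 n ∨ σ = Finset.Icc 1 f ∪ Finset.Icc (f + 2) n) then none
  else some (f + 1)
termination_by n
decreasing_by all_goals omega

/-- The Coxeter graph of type `D` on the vertices `1, 2, 3, …`, with edges `1 - 3` and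
`2 - 3 - 4 - ⋯` (type `D_n` is the induced graph on `1, …, n`). -/
def graphD : SimpleGraph ℕ :=
  SimpleGraph.fromRel fun a b => (a = 1 ∧ b = 3) ∨ (2 ≤ a ∧ b = a + 1)

/-- The matching on `K^D_n` for `d` odd. -/
def pivotDOdd (d n : ℕ) (σ : Finset ℕ) : Option ℕ :=
  if 1 ∈ σ then some 2
  else relabel (n - 1) (fun j => j + 1) (pivotA d (n - 1) 0 0) σ

/-- The integer `q` with `k = q h + r` where `0 < r < h` if `h ∤ k`, and `r ∈ {0, h}` and `q` is
even if `h ∣ k`. -/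
def evenQuot (h k : ℕ) : ℕ :=
  if k % h ≠ 0 then k / h else if Even (k / h) then k / h else k / h - 1

/-- The matching on `K^D_{n,g}`, i.e. on the subsets of `{1, …, n}` containing the last `g`
vertices, for `d` even. -/
noncomputable def pivotDEven (d n g : ℕ) (σ : Finset ℕ) : Option ℕ :=
  let h := d / 2
  -- (a)
  if 2 ∉ σ then
    relabel (n - 1) (fun j => if j = 1 then 1 else j + 1) (pivotA d (n - 1) 0 g) σ
  -- (b)
  else if d = 2 ∧ ¬ {1, 2, 3, 4} ⊆ σ then
    if {1, 2, 4} ⊆ σ then (if g + 5 ≤ n then some 5 else none)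
    else (if g + 3 ≤ n then some 3 else none)
  -- (c)
  else if 4 ≤ d ∧ 3 ∉ σ then some 1
  -- (d)
  else if d = 4 ∧ 4 ∉ σ then relabel (n - 4) (fun j => j + 4) (pivotA d (n - 4) 0 g) σ
  -- (e)
  else if 6 ≤ d ∧ 4 ∉ σ then some 1
  -- (f)
  else if 4 ≤ d ∧ 1 ∉ σ then
    if Finset.Icc 2 (h + 1) ⊆ σ then
      relabel (n - 1) (fun j => j + 1) (pivotA d (n - 1) (max h 3) g) σ
    else some 1
  -- (g)
  else
    let k := (component graphD σ 1).card
    let q := evenQuot h k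
    let v := if Even q then q * h + 1 else q * h + 2
    if v ∈ σ then (if v + g ≤ n then some v else none)
    else if n < v then none
    else if Even q ∧ Finset.Icc (q * h + 2) ((q + 1) * h + 1) ⊆ σ then
      relabel (n - q * h - 1) (fun j => j + q * h + 1) (pivotA d (n - q * h - 1) h g) σ
    else if ¬ Even q ∧ Finset.Icc (q * h + 3) ((q + 1) * h) ⊆ σ then
      relabel (n - q * h - 2) (fun j => j + q * h + 2) (pivotA d (n - q * h - 2) (h - 2) g) σ
    else some v

/-! ### Type `D̃_n` -/

/-- The Coxeter graph of type `D̃_n` (`n ≥ 4`) on the vertices `0, …, n`: the path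
`1 - 2 - ⋯ - (n-1)` together with the edges `0 - 2` and `(n-2) - n`. -/
def graphDTilde (n : ℕ) : SimpleGraph ℕ :=
  SimpleGraph.fromRel fun a b =>
    (a = 0 ∧ b = 2) ∨ (1 ≤ a ∧ b = a + 1 ∧ b + 1 ≤ n) ∨ (a + 2 = n ∧ b = n)

open Classical in
/-- The Coxeter matrix of type `D̃_n`. -/
noncomputable def matrixDTilde (n : ℕ) : CoxeterMatrix (Fin (n + 1)) where
  M := Matrix.of fun i j =>
    if i = j then 1 else if (graphDTilde n).Adj (i : ℕ) (j : ℕ) then 3 else 2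
  isSymm := by
    ext i j
    simp [Matrix.transpose_apply, SimpleGraph.adj_comm, eq_comm]
  diagonal := by simp
  off_diagonal := by
    intro i j hij
    simp only [Matrix.of_apply, if_neg hij]
    split_ifs <;> norm_num

/-- The matching on `K_n` of type `D̃_n`, for `d` odd. -/
def pivotTOdd (d n : ℕ) (σ : Finset ℕ) : Option ℕ :=
  if σ = Finset.Icc 1 n then none
  else if 1 ∉ σ then relabel n (fun j => if j = n then 0 else n + 1 - j) (pivotDOdd d n) σ
  else some 0

/-- The three small cases `n = 4`, `d ∈ {2, 4, 6}`. -/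
def pivotTFour (d : ℕ) (σ : Finset ℕ) : Option ℕ :=
  if d = 2 then
    if (σ.card = 1 ∧ 2 ∉ σ) ∨ σ.card = 2 ∨ (σ.card = 3 ∧ 2 ∈ σ) then some 2 else none
  else if d = 4 then
    if 2 ∉ σ ∨ σ ∩ {1, 3, 4} = ∅ then some 0 else none
  else
    if (2 ∈ σ ∧ 0 ∉ σ ∧ 3 ≤ σ.card) ∨ ({0, 2} ⊆ σ ∧ σ.card = 4) then none else some 0

/-- The matching on `K_n` of type `D̃_n`, for `d` even. -/
noncomputable def pivotTEven (d n : ℕ) (σ : Finset ℕ) : Option ℕ :=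
  let h := d / 2
  if n = 4 ∧ d ≤ 6 then pivotTFour d σ
  -- (a)
  else if 1 ∉ σ then relabel n (fun j => if j = n then 0 else n + 1 - j) (pivotDEven d n 0) σ
  -- (b)
  else if d = 2 ∧ ¬ {0, 1, 2, 3} ⊆ σ then
    if {0, 1, 3} ⊆ σ then (if ¬ Finset.Icc 5 n ⊆ σ then some 4 else none)
    else (if ¬ insert 1 (Finset.Icc 3 n) ⊆ σ then some 2 else none)
  -- (c)
  else if 4 ≤ d ∧ 0 ∉ σ then
    if Finset.Icc 1 h ⊆ σ then relabel n (fun j => n + 1 - j) (pivotDEven d n h) σ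
    else if n = h + 1 ∧ σ = insert n (Finset.Icc 1 (n - 2)) then none
    else if σ = Finset.Icc 1 n then none
    else some 0
  -- (d)
  else if 4 ≤ d ∧ 2 ∉ σ then some 0
  -- (e)
  else if d = 4 ∧ 3 ∉ σ then relabel (n - 3) (fun j => n + 1 - j) (pivotDEven d (n - 3) 0) σ
  -- (f)
  else if 6 ≤ d ∧ 3 ∉ σ then some 0
  -- (g)
  else
    let k := (component (graphDTilde n) σ 0).card
    let q := evenQuot h k
    let v := if Even q then q * h else q * h + 1
    -- (g1), where `k = q h + 1` says that `r = 1`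
    if d = 4 ∧ ¬ Even q ∧ k = q * h + 1 then
      if k ≤ n - 2 then relabel (n - k) (fun j => n + 1 - j) (pivotDEven d (n - k) 0) σ
      else none
    -- (g2)
    else if σ = insert n (Finset.Icc 0 (n - 2)) ∧ n - 1 ≤ v then none
    -- (g3)
    else if v ∈ σ then some v
    -- (g4)
    else if n ≤ v then none
    -- (g5); both `n - 1` and `n` are neighbours of `v` if `v = n - 2`
    else
      let D := if v + 2 = n then σ ∩ {n - 1, n} else component (graphDTilde n) σ (v + 1)
      let l := if Even q then h else h - 2
      if {n - 1, n} ⊆ D ∧ D.card ≤ l then none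
      else if D.card < l then some v
      else if D.card = l ∧ n - 1 ∉ D ∧ n ∈ D then none
      else relabel (n - v) (fun j => n + 1 - j) (pivotDEven d (n - v) l) σ

/-- The recipe on `K_n` of type `D̃_n`, for `d` odd and for `d` even, applied to simplices with
vertices in `Fin (n + 1)`. -/
noncomputable def recipe (d n : ℕ) (σ : Finset (Fin (n + 1))) : Option ℕ :=
  if Odd d then pivotTOdd d n (σ.map Fin.valEmbedding) else pivotTEven d n (σ.map Fin.valEmbedding)

/-- The edges `σ → σ \ {v}` prescribed by the recipe, at either of the two ends, on the simplices of
the complex of a Coxeter system of type `D̃_n`. -/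
def matching {W : Type*} [Group W] {n : ℕ} (cs : CoxeterSystem (matrixDTilde n) W) (d : ℕ) :
    Set (Finset (Fin (n + 1)) × Finset (Fin (n + 1))) :=
  {e | ∃ v ∈ e.1, e.2 = e.1.erase v ∧
    ((e.1 ∈ simplices cs ∧ recipe d n e.1 = some (v : ℕ)) ∨
      (e.2 ∈ simplices cs ∧ recipe d n e.2 = some (v : ℕ)))}

open Classical in
/-- The values of `|σ| - v(σ)` on the critical simplices of the matching, with multiplicity. -/
noncomputable def criticalValues {W : Type*} [Group W] {n : ℕ}
    (cs : CoxeterSystem (matrixDTilde n) W) (d : ℕ) : Multiset ℤ :=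
  (Finset.univ.filter fun σ => IsCritical (simplices cs) (matching cs d) σ).val.map
    fun σ => (σ.card : ℤ) - weight cs d σ

end PreciseMatching

/-! Weights. Every proper `σ ⊂ S` generates a finite subgroup, and the multiplicity of `φ_d` in its
Poincaré polynomial is found by removing one vertex `p` at the end of a component. The fundamental
weight of `p` is minuscule, and the quotient of the Poincaré polynomials of `σ` and `σ ∖ p` is the
rank generating function of its orbit: `1 + q + ⋯ + q^k` for an end of `A_k`, and `(1 + q^b)(1 + q +
⋯ + q^b)` for the end of the long arm of `D_{b+1}`. The orbit is realized by the numbers game,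
without root systems: greedily chosen coset representatives are compatible with left multiplication
by the braid relations alone (`IsMinuscule.cong_rep`), and lengths add up by the exchange property
(`poincare_factor`). The whole group is infinite because the null root gives an invariant functional
(`infinite_of_invariant`). Telescoping over the vertices, the weight becomes a sum over the
components of `σ`: `⌊(k+1)/d⌋` for `A_k`, and for `D_k` either `⌊k/d⌋` (`d` odd) or `evenQuot h k`
(`d = 2h`); this is `mem_simplices_and_weight_eq`.

Matching. The case distinctions of the recipe can be regrouped so that each tests something monotone
in `σ`: the presence of given vertices, or the weight of a component. They thus cut the complex into
fibres of order-preserving maps, and a matching that is acyclic on the fibres is acyclic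
(`IsGood.of_fibers`). On a final fibre one fixed vertex is toggled, which leaves no alternating step
at all (`IsGood.of_toggle`), or everything is critical, or the rule is a relabelled copy of a
smaller one (`IsGood.of_relabel`). Weights are preserved because the toggled vertex is placed so
that the integer parts of the pieces add up to that of the whole component.

Precision. Along the recursion one records only the number `d(|σ| - v(σ)) - (d-2)n` (`defect`),
which is additive when the vertices are cut into blocks. An alternating path between critical
simplices lowers the size by one; if both ends have the same `|σ| - v(σ)`, the weight drops by
exactly one, as required. For `d = 2h` the defect of a critical simplex depends only on `n` modulo
`d`, except for one family that occurs when `n ≡ 1`; comparing sizes and weights leaves a single bad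
pair, with `n = d + 1` (`CriticalT.drop`). For `d` odd all critical simplices without the vertex `1`
have the same `|σ| - v(σ)`, and the only other one is `{1, …, n}`; again a single pair is bad, with
`n = d`. For both pairs the monotonicity of the weight leaves only two alternating paths, the two
ways around an octagon, and these cancel (`morseInc_eq_zero_of_octagon`). For `d` odd, counting the
critical simplices through the recursion gives the list of values. -/

namespace PreciseMatching

open Finset

/-! ### The exchange property -/

section Exchange

variable {B W : Type*} [Group W] {M : CoxeterMatrix B} (cs : CoxeterSystem M W)

open Classical in
/-- The involution of `W × ZMod 2` by which a simple reflection acts. -/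
noncomputable def reflAct (i : B) : Function.End (W × ZMod 2) :=
  fun p => (cs.simple i * p.1 * cs.simple i, p.2 + if p.1 = cs.simple i then 1 else 0)

/-- Conjugating `t` alternately by `b` and `a`, the moments at which the reflection about to act is
hit are governed by one sequence `b (ab)^r`: even `r` for `b`, odd `r` for `a`. -/
lemma conj_pow_eq_iff {a b t : W} (ha : a * a = 1) (hb : b * b = 1) (k : ℕ) :
    ((a * b) ^ k * t * ((a * b) ^ k)⁻¹ = b ↔ t = b * (a * b) ^ (2 * k)) ∧
      (b * ((a * b) ^ k * t * ((a * b) ^ k)⁻¹) * b = a ↔ t = b * (a * b) ^ (2 * k + 1)) := by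
  have ha' : a⁻¹ = a := inv_eq_of_mul_eq_one_left ha
  have hb' : b⁻¹ = b := inv_eq_of_mul_eq_one_left hb
  have key : ∀ k : ℕ, ((a * b) ^ k)⁻¹ * b = b * (a * b) ^ k := by
    intro k
    induction k with
    | zero => simp
    | succ k ih =>
      rw [pow_succ, mul_inv_rev, mul_assoc, ih, mul_inv_rev, ha', hb', ← pow_succ, pow_succ']
      simp only [mul_assoc]
  have e1 : ∀ c : W, ((a * b) ^ k * t * ((a * b) ^ k)⁻¹ = c ↔
      t = ((a * b) ^ k)⁻¹ * c * (a * b) ^ k) := by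
    intro c; constructor
    · rintro rfl; group
    · rintro rfl; group
  constructor
  · rw [e1, key, two_mul, pow_add, mul_assoc]
  · have : (b * ((a * b) ^ k * t * ((a * b) ^ k)⁻¹) * b = a ↔
        (a * b) ^ k * t * ((a * b) ^ k)⁻¹ = b * (a * b)) := by
      constructor
      · intro h; have h' := congrArg (fun z => b * z * b) h
        simp only [← mul_assoc, hb, one_mul] at h'; rw [mul_assoc _ b b, hb, mul_one] at h'
        simpa only [← mul_assoc] using h'
      · intro h; rw [h]; simp only [← mul_assoc, hb, one_mul]; rw [mul_assoc _ b b, hb, mul_one]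
    rw [this, e1, ← mul_assoc, key, mul_assoc, mul_assoc, ← pow_succ', ← pow_add]
    congr! 3
    ring

open Classical in
-- Each step flips the `ZMod 2` coordinate when it meets its own reflection. Listing the flips by
-- consecutive exponents `r` is what makes the Coxeter relation usable.
lemma reflAct_mul_pow (i j : B) (k : ℕ) (t : W) (e : ZMod 2) :
    ((reflAct cs i * reflAct cs j) ^ k) (t, e) =
      ((cs.simple i * cs.simple j) ^ k * t * ((cs.simple i * cs.simple j) ^ k)⁻¹,
        e + ∑ r ∈ range (2 * k),
          if t = cs.simple j * (cs.simple i * cs.simple j) ^ r then 1 else 0) := by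
  induction k with
  | zero => simp [show (1 : Function.End (W × ZMod 2)) = id from rfl]
  | succ k ih =>
    rw [pow_succ']
    change (reflAct cs i * reflAct cs j) (((reflAct cs i * reflAct cs j) ^ k) (t, e)) = _; rw [ih]
    change reflAct cs i (reflAct cs j _) = _
    obtain ⟨h1, h2⟩ := conj_pow_eq_iff (t := t) (cs.simple_mul_simple_self i)
      (cs.simple_mul_simple_self j) k
    simp only [reflAct, h1, h2]; ext
    · simp only [pow_succ', mul_inv_rev, cs.inv_simple]
      group
    · simp only; rw [show 2 * (k + 1) = 2 * k + 1 + 1 by ring, sum_range_succ, sum_range_succ]; ring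

/-- For `k = M i j` the summand has period `M i j` in `r`, so every flip is counted twice and
vanishes modulo 2. -/
lemma reflAct_isLiftable : M.IsLiftable (reflAct cs) := by
  classical
  intro i j; funext ⟨t, e⟩; rw [reflAct_mul_pow, cs.simple_mul_simple_pow]; change _ = (t, e)
  rw [two_mul, sum_range_add]; simp only [pow_add, cs.simple_mul_simple_pow, one_mul]
  rw [CharTwo.add_self_eq_zero]; simp

open Classical in
-- The left side depends on the group element only, hence so does the parity of the number of
-- occurrences of `t` in the right inversion sequence of a word.
lemma lift_reflAct_wordProd (ω : List B) (t : W) (e : ZMod 2) :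
    cs.lift ⟨reflAct cs, reflAct_isLiftable cs⟩ (cs.wordProd ω) (t, e) =
      (cs.wordProd ω * t * (cs.wordProd ω)⁻¹, e + ((cs.rightInvSeq ω).count t : ℕ)) := by
  induction ω with
  | nil => simp [show (1 : Function.End (W × ZMod 2)) = id from rfl]
  | cons i ω ih =>
    rw [cs.wordProd_cons, map_mul]
    change cs.lift ⟨reflAct cs, reflAct_isLiftable cs⟩ (cs.simple i)
      (cs.lift ⟨reflAct cs, reflAct_isLiftable cs⟩ (cs.wordProd ω) (t, e)) = _
    rw [ih, cs.lift_apply_simple]; simp only [reflAct, CoxeterSystem.rightInvSeq, List.count_cons]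
    ext
    · simp [mul_assoc]
    · have : (cs.wordProd ω * t * (cs.wordProd ω)⁻¹ = cs.simple i) ↔
          (cs.wordProd ω)⁻¹ * cs.simple i * cs.wordProd ω = t := by
        constructor
        · intro h; rw [← h]; group
        · rintro rfl; group
      simp only [this, beq_iff_eq]; push_cast; split_ifs <;> simp [add_assoc]

lemma count_rightInvSeq_congr [DecidableEq W] {ω ω' : List B}
    (h : cs.wordProd ω = cs.wordProd ω') (t : W) :
    (((cs.rightInvSeq ω).count t : ℕ) : ZMod 2) = ((cs.rightInvSeq ω').count t : ℕ) := by
  classical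
  have h1 := lift_reflAct_wordProd cs ω t 0; rw [h, lift_reflAct_wordProd cs ω' t 0] at h1
  have := congrArg Prod.snd h1; simp only [zero_add] at this; convert this.symm

/-- The exchange property. -/
theorem exists_wordProd_eraseIdx (ω : List B) (i : B)
    (h : cs.length (cs.wordProd ω * cs.simple i) < cs.length (cs.wordProd ω)) :
    ∃ j < ω.length, cs.wordProd ω * cs.simple i = cs.wordProd (ω.eraseIdx j) := by
  classical
  obtain ⟨ω', hr, hω'⟩ := cs.exists_isReduced (cs.wordProd ω * cs.simple i)
  have hprod : cs.wordProd ω = cs.wordProd (ω'.concat i) := by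
    rw [cs.wordProd_concat, ← hω', cs.simple_mul_simple_cancel_right]
  -- A reduced word of `w s` cannot have `s` as an inversion, since `w s s = w` is longer.
  have hnot : cs.simple i ∉ cs.rightInvSeq ω' := by
    intro hmem; have := (cs.isRightInversion_of_mem_rightInvSeq hr hmem).2
    rw [← hω', cs.simple_mul_simple_cancel_right] at this; omega
  have hc := count_rightInvSeq_congr cs hprod (cs.simple i)
  rw [cs.rightInvSeq_concat, List.concat_eq_append, List.count_append] at hc
  have h0 : (List.map (MulAut.conj (cs.simple i)) (cs.rightInvSeq ω')).count (cs.simple i) = 0 := by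
    rw [List.count_eq_zero]; intro hm; obtain ⟨t, ht, hte⟩ := List.mem_map.1 hm; apply hnot
    have : t = cs.simple i := by
      have : cs.simple i * t * (cs.simple i)⁻¹ = cs.simple i := by simpa using hte
      rw [mul_inv_eq_iff_eq_mul] at this; exact mul_left_cancel this
    rwa [this] at ht
  rw [h0] at hc
  -- The word `ω' i` has `s` exactly once in its inversion sequence, so by parity the word `ω` of
  -- the same element has it at least once.
  have hmem : cs.simple i ∈ cs.rightInvSeq ω := by
    by_contra hm; rw [List.count_eq_zero.2 hm] at hc; simp at hc
  obtain ⟨j, hj, hje⟩ := List.getElem_of_mem hmem; have hj' : j < ω.length := by simpa using hj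
  refine ⟨j, hj', ?_⟩; rw [← cs.wordProd_mul_getD_rightInvSeq, List.getD_eq_getElem _ _ hj, hje]

end Exchange

/-! ### Parabolic subgroups -/

section Parabolic

variable {B W : Type*} [Group W] {M : CoxeterMatrix B} (cs : CoxeterSystem M W)

lemma simple_mem_parabolic {σ : Finset B} {i : B} (h : i ∈ σ) :
    cs.simple i ∈ parabolic cs σ :=
  Subgroup.subset_closure ⟨i, h, rfl⟩

lemma parabolic_mono {τ σ : Finset B} (h : τ ⊆ σ) : parabolic cs τ ≤ parabolic cs σ :=
  Subgroup.closure_mono (Set.image_mono (by exact_mod_cast h))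

lemma parabolic_induction {σ : Finset B} {p : W → Prop} (one : p 1)
    (mul : ∀ i ∈ σ, ∀ w ∈ parabolic cs σ, p w → p (cs.simple i * w)) {w : W}
    (hw : w ∈ parabolic cs σ) : p w := by
  unfold parabolic at hw
  induction hw using Subgroup.closure_induction_left with
  | one => exact one
  | mul_left x hx y hy ih =>
    obtain ⟨i, hi, rfl⟩ := hx; exact mul i hi y hy ih
  | inv_mul_cancel x hx y hy ih =>
    obtain ⟨i, hi, rfl⟩ := hx; rw [cs.inv_simple]; exact mul i hi y hy ih

lemma wordProd_mem_parabolic {σ : Finset B} {ω : List B} (h : ∀ i ∈ ω, i ∈ σ) :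
    cs.wordProd ω ∈ parabolic cs σ := by
  induction ω with
  | nil => simp [one_mem]
  | cons i ω ih =>
    rw [cs.wordProd_cons]
    exact mul_mem (simple_mem_parabolic cs (h i (by simp)))
      (ih fun j hj => h j (by simp [hj]))

lemma exists_word_of_mem_parabolic {σ : Finset B} {w : W} (hw : w ∈ parabolic cs σ) :
    ∃ ω : List B, (∀ i ∈ ω, i ∈ σ) ∧ w = cs.wordProd ω := by
  refine parabolic_induction cs (p := fun w => ∃ ω : List B, (∀ i ∈ ω, i ∈ σ) ∧ w = cs.wordProd ω)
    ⟨[], by simp⟩ ?_ hw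
  rintro i hi w - ⟨ω, hω, rfl⟩; exact ⟨i :: ω, by simpa [hi] using hω, by rw [cs.wordProd_cons]⟩

/-- If `x` is shortest in `x W_σ`, lengths add up along a shortest word in `σ`. -/
lemma length_mul_wordProd {σ : Finset B} {x : W}
    (hx : ∀ u ∈ parabolic cs σ, cs.length x ≤ cs.length (x * u)) (ω : List B)
    (hω : ∀ i ∈ ω, i ∈ σ)
    (hmin : ∀ ω' : List B, (∀ i ∈ ω', i ∈ σ) → cs.wordProd ω' = cs.wordProd ω →
      ω.length ≤ ω'.length) :
    cs.length (x * cs.wordProd ω) = cs.length x + ω.length := by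
  induction ω using List.reverseRecOn with
  | nil => simp
  | append_singleton ω i ih =>
    have hωσ : ∀ j ∈ ω, j ∈ σ := fun j hj => hω j (by simp [hj]); have hi : i ∈ σ := hω i (by simp)
    have ih' := ih hωσ (by
      intro ω' h1 h2
      have := hmin (ω' ++ [i]) (by
        intro j hj; rcases List.mem_append.1 hj with hj | hj
        · exact h1 j hj
        · rw [List.mem_singleton.1 hj]; exact hi) (by
        rw [cs.wordProd_append, cs.wordProd_append, h2])
      simpa using this)
    have hs : cs.wordProd (ω ++ [i]) = cs.wordProd ω * cs.simple i := by
      rw [cs.wordProd_append]; simp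
    rw [hs, ← mul_assoc]; rcases cs.length_mul_simple (x * cs.wordProd ω) i with h | h
    · rw [h, ih']; simp [add_assoc]
    · exfalso; obtain ⟨ωx, hrx, rfl⟩ := cs.exists_isReduced x
      have hlx : cs.length (cs.wordProd ωx) = ωx.length := hrx; rw [← cs.wordProd_append] at h
      obtain ⟨j, hj, he⟩ := exists_wordProd_eraseIdx cs (ωx ++ ω) i (by omega)
      -- Exchange deletes a letter either of `x`, giving a shorter element of `x W_σ`, or of `ω`,
      -- giving a shorter word in `σ`. Both contradict minimality.
      by_cases hjx : j < ωx.length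
      · rw [List.eraseIdx_append_of_lt_length hjx, cs.wordProd_append, cs.wordProd_append] at he
        have h1 := hx (cs.wordProd ω * cs.simple i * (cs.wordProd ω)⁻¹)
          (mul_mem (mul_mem (wordProd_mem_parabolic cs hωσ) (simple_mem_parabolic cs hi))
            (inv_mem (wordProd_mem_parabolic cs hωσ)))
        rw [← mul_assoc, ← mul_assoc, he, mul_inv_cancel_right] at h1
        have h2 := cs.length_wordProd_le (ωx.eraseIdx j); rw [List.length_eraseIdx_of_lt hjx] at h2
        omega
      · push Not at hjx
        rw [List.eraseIdx_append_of_length_le hjx, cs.wordProd_append, cs.wordProd_append,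
          mul_assoc] at he
        have he' := mul_left_cancel he
        have h1 := hmin (ω.eraseIdx (j - ωx.length))
          (fun k hk => hωσ k (List.mem_of_mem_eraseIdx hk)) (by rw [hs, he'])
        have h2 : (ω.eraseIdx (j - ωx.length)).length ≤ ω.length := List.length_eraseIdx_le ..
        simp at h1; omega

lemma exists_minimal_word {σ : Finset B} {w : W} (hw : w ∈ parabolic cs σ) :
    ∃ ω : List B, (∀ i ∈ ω, i ∈ σ) ∧ w = cs.wordProd ω ∧
      ∀ ω' : List B, (∀ i ∈ ω', i ∈ σ) → cs.wordProd ω' = cs.wordProd ω →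
        ω.length ≤ ω'.length := by
  classical
  have hex : ∃ k, ∃ ω : List B, (∀ i ∈ ω, i ∈ σ) ∧ w = cs.wordProd ω ∧ ω.length = k := by
    obtain ⟨ω, h1, h2⟩ := exists_word_of_mem_parabolic cs hw; exact ⟨_, ω, h1, h2, rfl⟩
  obtain ⟨ω, h1, h2, h3⟩ := Nat.find_spec hex; refine ⟨ω, h1, h2, fun ω' h1' h2' => ?_⟩; rw [h3]
  exact Nat.find_min' hex ⟨ω', h1', by rw [h2', h2], rfl⟩

/-- With `x = 1`, `length_mul_wordProd` says that a shortest word among those in `σ` is reduced in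
the whole group; so its length can be replaced by that of the element. -/
theorem length_mul_of_minimal {σ : Finset B} {x : W}
    (hx : ∀ u ∈ parabolic cs σ, cs.length x ≤ cs.length (x * u)) {u : W}
    (hu : u ∈ parabolic cs σ) : cs.length (x * u) = cs.length x + cs.length u := by
  obtain ⟨ω, h1, rfl, h3⟩ := exists_minimal_word cs hu
  have := length_mul_wordProd cs (x := 1) (by simp) ω h1 h3; rw [length_mul_wordProd cs hx ω h1 h3]
  simp at this; omega

lemma exists_reduced_word {σ : Finset B} {w : W} (hw : w ∈ parabolic cs σ) :
    ∃ ω : List B, (∀ i ∈ ω, i ∈ σ) ∧ w = cs.wordProd ω ∧ ω.length = cs.length w := by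
  obtain ⟨ω, h1, rfl, h3⟩ := exists_minimal_word cs hw
  have := length_mul_wordProd cs (x := 1) (by simp) ω h1 h3; simp at this
  exact ⟨ω, h1, rfl, this.symm⟩

open Polynomial in
/-- Factorization of the Poincaré polynomial along the cosets of a parabolic subgroup. The cosets
are the fibres of `Φ`, and `N` is the length of the shortest elements of the fibres. -/
theorem poincare_factor {τ σ : Finset B} (hτσ : τ ⊆ σ)
    (hτ : (parabolic cs τ : Set W).Finite) {Y : Type*} (Φ : W → Y) (O : Finset Y) (N : Y → ℕ)
    (h1 : ∀ w ∈ parabolic cs σ, Φ w ∈ O)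
    (h2 : ∀ y ∈ O, ∃ x ∈ parabolic cs σ, Φ x = y ∧ cs.length x = N y)
    (h3 : ∀ w ∈ parabolic cs σ, N (Φ w) ≤ cs.length w)
    (h4 : ∀ w ∈ parabolic cs σ, ∀ w' ∈ parabolic cs σ,
      (Φ w = Φ w' ↔ w⁻¹ * w' ∈ parabolic cs τ)) :
    (parabolic cs σ : Set W).Finite ∧
      poincare cs σ = poincare cs τ * ∑ y ∈ O, (X : ℚ[X]) ^ N y := by
  classical
  -- By `h3` the chosen `x y` is a shortest element of its coset, so `length_mul_of_minimal` makes
  -- lengths additive on the products `x y * u`.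
  choose! x hxm hxΦ hxl using h2
  have hadd : ∀ y ∈ O, ∀ u ∈ parabolic cs τ, cs.length (x y * u) = N y + cs.length u := by
    intro y hy u hu; rw [← hxl y hy]; refine length_mul_of_minimal cs (fun v hv => ?_) hu
    have hm := mul_mem (hxm y hy) (parabolic_mono cs hτσ hv)
    have : Φ (x y) = Φ (x y * v) := (h4 _ (hxm y hy) _ hm).2 (by simpa using hv)
    rw [hxΦ y hy] at this; rw [hxl y hy]
    calc N y = N (Φ (x y * v)) := by rw [← this]
      _ ≤ _ := h3 _ hm
  set T := hτ.toFinset with hT; have hTm : ∀ u, u ∈ T ↔ u ∈ parabolic cs τ := by intro u; simp [hT]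
  have hmaps : ∀ w, w ∈ parabolic cs σ ↔ w ∈ (O ×ˢ T).image fun p => x p.1 * p.2 := by
    intro w; simp only [mem_image, mem_product, hTm, Prod.exists]; constructor
    · intro hw; have hO := h1 w hw
      exact ⟨Φ w, (x (Φ w))⁻¹ * w, ⟨hO, (h4 _ (hxm _ hO) _ hw).1 (hxΦ _ hO)⟩, by simp⟩
    · rintro ⟨y, u, ⟨hy, hu⟩, rfl⟩; exact mul_mem (hxm y hy) (parabolic_mono cs hτσ hu)
  have hset : (parabolic cs σ : Set W) = ((O ×ˢ T).image fun p => x p.1 * p.2 : Finset W) := by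
    ext w; rw [mem_coe, ← hmaps]; rfl
  refine ⟨by rw [hset]; exact finite_toSet _, ?_⟩
  have hinj : Set.InjOn (fun p : Y × W => x p.1 * p.2) (O ×ˢ T : Finset (Y × W)) := by
    rintro ⟨y, u⟩ hp ⟨y', u'⟩ hp' he
    simp only [coe_product, Set.mem_prod, mem_coe, hTm] at hp hp' he
    have hy : ∀ y u, y ∈ O → u ∈ parabolic cs τ → Φ (x y * u) = y := by
      intro y u hy hu; refine Eq.trans ?_ (hxΦ y hy); symm
      exact (h4 _ (hxm y hy) _ (mul_mem (hxm y hy) (parabolic_mono cs hτσ hu))).2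
        (by simpa using hu)
    have e : y = y' := by rw [← hy y u hp.1 hp.2, he, hy y' u' hp'.1 hp'.2]
    subst e; simpa using he
  have hσsum : poincare cs σ = ∑ w ∈ (O ×ˢ T).image (fun p => x p.1 * p.2),
      (X : ℚ[X]) ^ cs.length w := by
    unfold poincare; rw [← finsum_mem_coe_finset]; exact finsum_mem_congr hset fun _ _ => rfl
  have hτsum : poincare cs τ = ∑ w ∈ T, (X : ℚ[X]) ^ cs.length w := by
    unfold poincare; rw [← finsum_mem_coe_finset]
    exact finsum_mem_congr (by ext u; simp [hT]) fun _ _ => rfl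
  rw [hσsum, hτsum, sum_image hinj, sum_product, mul_comm, sum_mul_sum]
  refine sum_congr rfl fun y hy => sum_congr rfl fun u hu => ?_
  rw [← pow_add, hadd y hy u ((hTm u).1 hu)]

/-- The quotient is the length generating function of the shortest coset representatives. The
purpose is the monotonicity of weights, which restricts alternating paths. -/
theorem poincare_dvd {τ σ : Finset B} (hτσ : τ ⊆ σ)
    (hσ : (parabolic cs σ : Set W).Finite) : poincare cs τ ∣ poincare cs σ := by
  classical
  have hτ : (parabolic cs τ : Set W).Finite := hσ.subset (parabolic_mono cs hτσ)
  let Φ : W → W ⧸ parabolic cs τ := QuotientGroup.mk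
  have hmin : ∀ y ∈ hσ.toFinset.image Φ, ∃ x ∈ parabolic cs σ, Φ x = y ∧
      ∀ w ∈ parabolic cs σ, Φ w = y → cs.length x ≤ cs.length w := by
    intro y hy
    have hne : (hσ.toFinset.filter fun w => Φ w = y).Nonempty := by
      obtain ⟨w, hw, rfl⟩ := mem_image.1 hy; exact ⟨w, by simpa using hw⟩
    obtain ⟨x, hx, hxm⟩ := exists_min_image _ cs.length hne
    simp only [mem_filter, Set.Finite.mem_toFinset, SetLike.mem_coe] at hx hxm
    exact ⟨x, hx.1, hx.2, fun w h1 h2 => hxm w ⟨h1, h2⟩⟩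
  choose! x hxm hxΦ hxl using hmin
  have := (poincare_factor cs hτσ hτ Φ (hσ.toFinset.image Φ) (fun y => cs.length (x y))
    (fun w hw => mem_image_of_mem _ (by simpa using hw))
    (fun y hy => ⟨x y, hxm y hy, hxΦ y hy, rfl⟩)
    (fun w hw => hxl _ (mem_image_of_mem _ (by simpa using hw)) w hw rfl)
    (fun w _ w' _ => by simp only [Φ]; rw [QuotientGroup.eq])).2
  exact Dvd.intro _ this.symm

end Parabolic

/-! ### The numbers game of a simply laced Coxeter group -/

section NumbersGame

variable {B W : Type*} [DecidableEq B] [Group W] {M : CoxeterMatrix B} (cs : CoxeterSystem M W)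

/-- All labels of the Coxeter graph are `3`. -/
def SimplyLaced (M : CoxeterMatrix B) : Prop := ∀ i j, i ≠ j → M i j = 2 ∨ M i j = 3

/-- Fire the vertex `i`. -/
def fire (M : CoxeterMatrix B) (i : B) : Function.End (B → ℤ) :=
  fun c j => if j = i then -c i else if M i j = 3 then c j + c i else c j

lemma fire_apply (i : B) (c : B → ℤ) (j : B) :
    fire M i c j = if j = i then -c i else if M i j = 3 then c j + c i else c j := rfl

lemma fire_mul_apply (i j : B) (c : B → ℤ) : (fire M i * fire M j) c = fire M i (fire M j c) := rfl

lemma fire_isLiftable (hM : SimplyLaced M) : M.IsLiftable (fire M) := by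
  intro i j; have key : ∀ (f : Function.End (B → ℤ)) c, (f ^ 0) c = c := fun _ _ => rfl
  have key2 : ∀ (f : Function.End (B → ℤ)) n c, (f ^ (n + 1)) c = f ((f ^ n) c) := by
    intro f n c; rw [pow_succ']; rfl
  by_cases hij : i = j
  · subst hij; rw [M.diagonal]; funext c k; rw [key2, key, fire_mul_apply]; change _ = c k
    simp only [fire_apply]
    by_cases h : k = i
    · simp [h]
    · simp only [h, if_false, if_true]; split_ifs <;> ring
  · have hji : ¬ j = i := fun h => hij h.symm; have hs : M j i = M i j := M.symmetric j i
    rcases hM i j hij with h | h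
    · rw [h]; have hs' : M j i ≠ 3 := by omega
      have hs'' : M i j ≠ 3 := by omega
      funext c k; rw [key2, key2, key, fire_mul_apply, fire_mul_apply]; change _ = c k
      simp only [fire_apply, hij, hji, hs', hs'', if_false, if_true]
      by_cases h1 : k = i
      · subst h1; simp [hij]
      · by_cases h2 : k = j
        · subst h2; simp [hji, hs'']
        · simp only [h1, h2, if_false]; split_ifs <;> ring
    · rw [h]; have hs' : M j i = 3 := by omega
      funext c k; rw [key2, key2, key2, key, fire_mul_apply, fire_mul_apply, fire_mul_apply]
      change _ = c k; simp only [fire_apply, hij, hji, hs', h, if_false, if_true]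
      by_cases h1 : k = i
      · subst h1; simp only [hij, hs', if_false, if_true]; ring
      · by_cases h2 : k = j
        · subst h2; simp only [hji, h, if_false, if_true]; ring
        · simp only [h1, h2, if_false]; split_ifs <;> ring

/-- The action of `W` on `B → ℤ` by firing. -/
noncomputable def fireAct (hM : SimplyLaced M) : W →* Function.End (B → ℤ) :=
  cs.lift ⟨fire M, fire_isLiftable hM⟩

lemma fireAct_simple_mul (hM : SimplyLaced M) (i : B) (w : W) (c : B → ℤ) :
    fireAct cs hM (cs.simple i * w) c = fire M i (fireAct cs hM w c) := by
  rw [map_mul, fireAct, cs.lift_apply_simple]; rfl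

lemma fireAct_one (hM : SimplyLaced M) (c : B → ℤ) : fireAct cs hM 1 c = c := by rw [map_one]; rfl

lemma fireAct_mul (hM : SimplyLaced M) (w w' : W) (c : B → ℤ) :
    fireAct cs hM (w * w') c = fireAct cs hM w (fireAct cs hM w' c) := by
  rw [map_mul]; rfl

/-- Firing seen on the coordinates in `σ` only. -/
def fireOn (M : CoxeterMatrix B) (σ : Finset B) (i : B) (c : B → ℤ) : B → ℤ :=
  fun j => if j ∈ σ then fire M i c j else 0

lemma fireOn_of_zero {σ : Finset B} {i : B} {c : B → ℤ} (hc : ∀ j ∉ σ, c j = 0) (h : c i = 0) :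
    fireOn M σ i c = c := by
  funext j; simp only [fireOn, fire_apply, h]
  by_cases hj : j ∈ σ
  · simp only [hj, if_true]; split_ifs with h1
    · rw [h1, h]; rfl
    · ring
    · rfl
  · simp [hj, hc j hj]

lemma fireOn_self {σ : Finset B} {i : B} (hi : i ∈ σ) (c : B → ℤ) : fireOn M σ i c i = -c i := by
  simp [fireOn, fire_apply, hi]

lemma fireOn_adj {σ : Finset B} {i j : B} (hj : j ∈ σ) (hij : j ≠ i) (h : M i j = 3) (c : B → ℤ) :
    fireOn M σ i c j = c j + c i := by
  simp [fireOn, fire_apply, hj, hij, h]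

lemma fireOn_comm {σ : Finset B} {i j : B} (hij : j ≠ i) (h : M i j = 2) (c : B → ℤ) :
    fireOn M σ i c j = if j ∈ σ then c j else 0 := by
  simp [fireOn, fire_apply, hij, h]

lemma fireOn_fireOn {σ : Finset B} {i : B} (hi : i ∈ σ) {c : B → ℤ} (hc : ∀ j ∉ σ, c j = 0) :
    fireOn M σ i (fireOn M σ i c) = c := by
  funext j
  by_cases hj : j ∈ σ
  · simp only [fireOn, fire_apply, hi, hj, if_true]
    by_cases h1 : j = i
    · simp [h1]
    · simp only [h1, if_false]; split_ifs <;> ring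
  · simp [fireOn, hj, hc j hj]

lemma fireOn_fireOn_comm {σ : Finset B} {i j : B} (hi : i ∈ σ) (hj : j ∈ σ) (hij : j ≠ i)
    (h : M i j = 2) (c : B → ℤ) :
    fireOn M σ i (fireOn M σ j c) = fireOn M σ j (fireOn M σ i c) := by
  have hs : M j i = M i j := M.symmetric j i; have hs' : M j i = 2 := by omega
  funext k
  by_cases hk : k ∈ σ
  · simp only [fireOn, fire_apply, hi, hj, hk, if_true, hij, hij.symm, if_false, hs', h]
    by_cases h1 : k = i
    · subst h1; simp [hij.symm, hs']
    · by_cases h2 : k = j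
      · subst h2; simp [hij, h]
      · simp only [h1, h2, if_false]; split_ifs <;> omega
  · simp [fireOn, hk]

/-- A finite orbit of the numbers game on `σ` started from one chip at `p` in which all the numbers
are `-1`, `0` or `1`; `N` counts the number of firings. -/
structure IsMinuscule (M : CoxeterMatrix B) (σ : Finset B) (p : B) (O : Finset (B → ℤ))
    (N : (B → ℤ) → ℕ) : Prop where
  mem : p ∈ σ
  start_mem : Pi.single p 1 ∈ O
  start_rank : N (Pi.single p 1) = 0
  support : ∀ c ∈ O, ∀ i ∉ σ, c i = 0
  fire_mem : ∀ c ∈ O, ∀ i ∈ σ, fireOn M σ i c ∈ O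
  bound : ∀ c ∈ O, ∀ i ∈ σ, c i = -1 ∨ c i = 0 ∨ c i = 1
  rank_fire : ∀ c ∈ O, ∀ i ∈ σ, c i = 1 → N (fireOn M σ i c) = N c + 1
  exists_neg : ∀ c ∈ O, c ≠ Pi.single p 1 → ∃ i ∈ σ, c i = -1

variable {σ : Finset B} {p : B} {O : Finset (B → ℤ)} {N : (B → ℤ) → ℕ}

namespace IsMinuscule

lemma rank_fire_neg (H : IsMinuscule M σ p O N) {c : B → ℤ} (hc : c ∈ O) {i : B} (hi : i ∈ σ)
    (h : c i = -1) : N c = N (fireOn M σ i c) + 1 := by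
  have := H.rank_fire _ (H.fire_mem c hc i hi) i hi (by rw [fireOn_self hi, h]; rfl)
  rwa [fireOn_fireOn hi (H.support c hc)] at this

open Classical in
/-- Coset representatives. -/
noncomputable def rep (cs : CoxeterSystem M W) (σ : Finset B) : ℕ → (B → ℤ) → W
  -- The first argument is meant to be the rank of the configuration, which drops by one each time a
  -- coordinate `-1` is fired.
  | 0, _ => 1
  | k + 1, c => if h : ∃ i ∈ σ, c i = -1 then
      cs.simple h.choose * rep cs σ k (fireOn M σ h.choose c) else 1

lemma rep_eq (H : IsMinuscule M σ p O N) {c : B → ℤ} (hc : c ∈ O) (hne : c ≠ Pi.single p 1) :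
    ∃ i ∈ σ, c i = -1 ∧
      rep cs σ (N c) c = cs.simple i * rep cs σ (N (fireOn M σ i c)) (fireOn M σ i c) := by
  have h := H.exists_neg c hc hne; refine ⟨h.choose, h.choose_spec.1, h.choose_spec.2, ?_⟩
  rw [H.rank_fire_neg hc h.choose_spec.1 h.choose_spec.2, rep, dif_pos h]

lemma rep_start (H : IsMinuscule M σ p O N) :
    rep cs σ (N (Pi.single p 1)) (Pi.single p 1) = 1 := by
  rw [H.start_rank, rep]

/-- `x` and `y` are in the same left coset of the parabolic subgroup of `τ`. -/
def Cong (cs : CoxeterSystem M W) (τ : Finset B) (x y : W) : Prop := x⁻¹ * y ∈ parabolic cs τ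

lemma Cong.refl (τ : Finset B) (x : W) : Cong cs τ x x := by simp [Cong, one_mem]

variable {cs}

lemma Cong.symm {τ : Finset B} {x y : W} (h : Cong cs τ x y) : Cong cs τ y x := by
  have := inv_mem h; simpa [Cong] using this

lemma Cong.trans {τ : Finset B} {x y z : W} (h : Cong cs τ x y) (h' : Cong cs τ y z) :
    Cong cs τ x z := by
  have := mul_mem h h'; simpa [Cong, mul_assoc] using this

lemma Cong.mul {τ : Finset B} {x y : W} (w : W) (h : Cong cs τ x y) :
    Cong cs τ (w * x) (w * y) := by
  simpa [Cong, mul_assoc] using h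

variable (cs)

/-- Let the chosen representative of `c` begin with `s_t`. If `i` and `t` commute, the two firings
form a diamond and induction applies to its lower corners. If they are adjacent, the bound on
coordinates forces `c i = 0`, so `c` is unchanged by `i`, and the braid relation reduces the claim
to configurations of smaller rank. This replaces any knowledge of the stabilizer of the chip. -/
lemma cong_rep (H : IsMinuscule M σ p O N) (hM : SimplyLaced M) (k : ℕ) :
    ∀ c ∈ O, N c ≤ k → ∀ i ∈ σ, c i = -1 ∨ c i = 0 →
      Cong cs (σ.erase p) (cs.simple i * rep cs σ (N c) c)
        (rep cs σ (N (fireOn M σ i c)) (fireOn M σ i c)) := by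
  induction k using Nat.strong_induction_on with
  | _ k IH =>
  intro c hc hk i hi hci
  by_cases hne : c = Pi.single p 1
  · subst hne; have hip : i ≠ p := by rintro rfl; simp at hci
    have h0 : (Pi.single p 1 : B → ℤ) i = 0 := by simp [hip]
    rw [fireOn_of_zero (H.support _ hc) h0, H.rep_start, Cong]; simp only [mul_one, cs.inv_simple]
    exact simple_mem_parabolic cs (mem_erase.2 ⟨hip, hi⟩)
  obtain ⟨t, ht, hct, hrep⟩ := H.rep_eq cs hc hne; set c' := fireOn M σ t c with hc'
  have hc'O : c' ∈ O := H.fire_mem c hc t ht; have hNc : N c = N c' + 1 := H.rank_fire_neg hc ht hct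
  by_cases hit : i = t
  · subst hit; rw [hrep, cs.simple_mul_simple_cancel_left]; exact Cong.refl cs _ _
  have hsym : M t i = M i t := M.symmetric t i; rcases hM i t hit with hm | hm
  · have hcomm : cs.simple i * cs.simple t = cs.simple t * cs.simple i := by
      have := cs.simple_mul_simple_pow i t; rw [hm, pow_two] at this
      have h2 := eq_inv_of_mul_eq_one_left this
      rwa [mul_inv_rev, cs.inv_simple, cs.inv_simple] at h2
    have hc'i : c' i = c i := by rw [hc', fireOn_comm hit (by omega)]; simp [hi]
    have h1 := (IH (N c') (by omega) c' hc'O le_rfl i hi (by rwa [hc'i])).mul (cs.simple t)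
    rw [← mul_assoc, ← hcomm, mul_assoc, ← hrep] at h1; refine h1.trans ?_
    rcases hci with hci | hci
    · set z := fireOn M σ i c with hz; have hzO : z ∈ O := H.fire_mem c hc i hi
      have hNz : N c = N z + 1 := H.rank_fire_neg hc hi hci
      have hzt : z t = -1 := by rw [hz, fireOn_comm (Ne.symm hit) hm]; simp [ht, hct]
      have h2 := (IH (N z) (by omega) z hzO le_rfl t ht (Or.inl hzt)).mul (cs.simple t)
      rw [cs.simple_mul_simple_cancel_left] at h2
      rw [hc', fireOn_fireOn_comm hi ht (Ne.symm hit) hm]; exact h2.symm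
    · rw [fireOn_of_zero (H.support c' hc'O) (by rw [hc'i, hci]),
        fireOn_of_zero (H.support c hc) hci, ← hrep]
      exact Cong.refl cs _ _
  · have hc'i : c' i = c i + c t := fireOn_adj hi hit (by omega) c; have hb := H.bound c' hc'O i hi
    -- Otherwise `c i = -1`, and firing `t` would produce the coordinate `-2`.
    have hci0 : c i = 0 := by omega
    have hc'i' : c' i = -1 := by omega
    have hc't : c' t = 1 := by rw [hc', fireOn_self ht, hct]; rfl
    set c'' := fireOn M σ i c' with hc''; have hc''O : c'' ∈ O := H.fire_mem c' hc'O i hi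
    have hNc' : N c' = N c'' + 1 := H.rank_fire_neg hc'O hi hc'i'
    have hc''t : c'' t = 0 := by rw [hc'', fireOn_adj ht (Ne.symm hit) hm, hc't, hc'i']; rfl
    have hbraid : cs.simple i * cs.simple t * cs.simple i =
        cs.simple t * cs.simple i * cs.simple t := by
      have := cs.simple_mul_simple_pow i t; rw [hm, pow_succ, pow_two] at this
      have h2 : (cs.simple i * cs.simple t * cs.simple i) *
          (cs.simple t * cs.simple i * cs.simple t) = 1 := by
        simpa only [mul_assoc] using this
      have h3 := eq_inv_of_mul_eq_one_left h2
      rwa [mul_inv_rev, mul_inv_rev, cs.inv_simple, cs.inv_simple, ← mul_assoc] at h3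
    have h1 := IH (N c') (by omega) c' hc'O le_rfl i hi (Or.inl hc'i')
    have h2 := IH (N c'') (by omega) c'' hc''O le_rfl t ht (Or.inr hc''t)
    rw [fireOn_of_zero (H.support c'' hc''O) hc''t] at h2; rw [fireOn_of_zero (H.support c hc) hci0]
    have h3 := h1.mul (cs.simple i); rw [cs.simple_mul_simple_cancel_left] at h3
    have h4 := (h3.mul (cs.simple t)).mul (cs.simple i); rw [← hrep] at h4; refine h4.trans ?_
    -- Modulo the subgroup, `s_i s_t s_i` applied to the representative of `c''` equals `s_t s_i
    -- s_t` of it, and `s_t` fixes that coset because `c'' t = 0`.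
    rw [← mul_assoc, ← mul_assoc, hbraid, mul_assoc, mul_assoc]
    refine ((h2.mul (cs.simple i)).mul (cs.simple t)).trans ?_
    refine (h1.symm.mul (cs.simple i)).mul (cs.simple t) |>.trans ?_
    rw [cs.simple_mul_simple_cancel_left, ← hrep]; exact Cong.refl cs _ _

/-- For `c i = 1` this is `cong_rep` for the fired configuration, multiplied by `s_i`. -/
lemma cong_rep' (H : IsMinuscule M σ p O N) (hM : SimplyLaced M) {c : B → ℤ} (hc : c ∈ O) {i : B}
    (hi : i ∈ σ) :
    Cong cs (σ.erase p) (cs.simple i * rep cs σ (N c) c)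
      (rep cs σ (N (fireOn M σ i c)) (fireOn M σ i c)) := by
  rcases H.bound c hc i hi with h | h | h
  · exact H.cong_rep cs hM _ c hc le_rfl i hi (Or.inl h)
  · exact H.cong_rep cs hM _ c hc le_rfl i hi (Or.inr h)
  · have h1 := H.cong_rep cs hM _ _ (H.fire_mem c hc i hi) le_rfl i hi
      (Or.inl (by rw [fireOn_self hi, h]))
    rw [fireOn_fireOn hi (H.support c hc)] at h1; have h2 := h1.mul (cs.simple i)
    rw [cs.simple_mul_simple_cancel_left] at h2; exact h2.symm

open Polynomial in
-- The orbit map of the single chip, truncated to `σ`, has the cosets of the subgroup of `σ ∖ p` as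
-- fibres: this subgroup fixes the chip, and conversely each `w` is congruent to the representative
-- of its configuration. The rank is a lower bound for the length because one letter raises it by at
-- most one, and the bound is attained by firing negative coordinates down to the start.
theorem poincare_eq (H : IsMinuscule M σ p O N) (hM : SimplyLaced M)
    (hτ : (parabolic cs (σ.erase p) : Set W).Finite) :
    (parabolic cs σ : Set W).Finite ∧
      poincare cs σ = poincare cs (σ.erase p) * ∑ c ∈ O, (X : ℚ[X]) ^ N c := by
  let Φ : W → (B → ℤ) := fun w b => if b ∈ σ then fireAct cs hM w (Pi.single p 1) b else 0
  have hΦ1 : Φ 1 = Pi.single p 1 := by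
    funext b; simp only [Φ, fireAct_one]; split_ifs with hb
    · rfl
    · rw [Pi.single_eq_of_ne]; rintro rfl; exact hb H.mem
  have hΦs : ∀ i ∈ σ, ∀ w, Φ (cs.simple i * w) = fireOn M σ i (Φ w) := by
    intro i hi w; funext b; simp only [Φ, fireAct_simple_mul, fireOn, fire_apply, hi, if_true]
    by_cases hb : b ∈ σ <;> simp [hb]
  have hfix : ∀ u ∈ parabolic cs (σ.erase p),
      fireAct cs hM u (Pi.single p 1) = Pi.single p 1 := by
    intro u hu
    refine parabolic_induction cs
      (p := fun u => fireAct cs hM u (Pi.single p 1) = Pi.single p 1) (fireAct_one ..) ?_ hu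
    intro i hi w _ hw; have hip : i ≠ p := ne_of_mem_erase hi; rw [fireAct_simple_mul, hw]; funext j
    rw [fire_apply]
    simp only [ne_eq, hip, not_false_eq_true, Pi.single_eq_of_ne, neg_zero, add_zero, ite_self]
    split_ifs with h
    · rw [h, Pi.single_eq_of_ne hip]
    · rfl
  have hO : ∀ w ∈ parabolic cs σ, Φ w ∈ O := by
    intro w hw
    refine parabolic_induction cs (p := fun w => Φ w ∈ O) (by rw [hΦ1]; exact H.start_mem) ?_ hw
    intro i hi w _ h; rw [hΦs i hi]; exact H.fire_mem _ h i hi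
  have hcong : ∀ w ∈ parabolic cs σ, Cong cs (σ.erase p) w (rep cs σ (N (Φ w)) (Φ w)) := by
    intro w hw
    refine parabolic_induction cs
      (p := fun w => Cong cs (σ.erase p) w (rep cs σ (N (Φ w)) (Φ w))) ?_ ?_ hw
    · rw [hΦ1, H.rep_start]; exact Cong.refl cs _ _
    · intro i hi w hw h; rw [hΦs i hi]; exact (h.mul _).trans (H.cong_rep' cs hM (hO w hw) hi)
  have hrank : ∀ w ∈ parabolic cs σ, N (Φ w) ≤ cs.length w := by
    intro w hw; obtain ⟨ω, h1, rfl, h3⟩ := exists_reduced_word cs hw; rw [← h3]; clear h3 hw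
    induction ω with
    | nil => simp [hΦ1, H.start_rank]
    | cons i ω ih =>
      have hi := h1 i (by simp); have hω : ∀ j ∈ ω, j ∈ σ := fun j hj => h1 j (by simp [hj])
      have ih' := ih hω; rw [cs.wordProd_cons, hΦs i hi]
      have hcO := hO _ (wordProd_mem_parabolic cs hω)
      have : N (fireOn M σ i (Φ (cs.wordProd ω))) ≤ N (Φ (cs.wordProd ω)) + 1 := by
        rcases H.bound _ hcO i hi with h | h | h
        · have := H.rank_fire_neg hcO hi h; omega
        · rw [fireOn_of_zero (H.support _ hcO) h]; omega
        · rw [H.rank_fire _ hcO i hi h]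
      simp only [List.length_cons]; omega
  have hexists : ∀ k, ∀ c ∈ O, N c = k → ∃ x ∈ parabolic cs σ, Φ x = c ∧ cs.length x ≤ k := by
    intro k
    induction k with
    | zero =>
      intro c hc hk
      by_cases hne : c = Pi.single p 1
      · exact ⟨1, one_mem _, by rw [hΦ1, hne], by simp⟩
      · obtain ⟨i, hi, h⟩ := H.exists_neg c hc hne; have := H.rank_fire_neg hc hi h; omega
    | succ k ih =>
      intro c hc hk; have hne : c ≠ Pi.single p 1 := by rintro rfl; rw [H.start_rank] at hk; omega
      obtain ⟨i, hi, h⟩ := H.exists_neg c hc hne; have hr := H.rank_fire_neg hc hi h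
      obtain ⟨x, hx, hxc, hxl⟩ := ih _ (H.fire_mem c hc i hi) (by omega)
      refine ⟨cs.simple i * x, mul_mem (simple_mem_parabolic cs hi) hx, ?_, ?_⟩
      · rw [hΦs i hi, hxc, fireOn_fireOn hi (H.support c hc)]
      · have := cs.length_mul_le (cs.simple i) x; rw [cs.length_simple] at this; omega
  refine poincare_factor cs (erase_subset _ _) hτ Φ O N hO ?_ hrank ?_
  · intro c hc; obtain ⟨x, hx, hxc, hxl⟩ := hexists _ c hc rfl
    refine ⟨x, hx, hxc, le_antisymm hxl ?_⟩; rw [← hxc]; exact hrank x hx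
  · intro w hw w' hw'; constructor
    · intro h; have h1 := hcong w hw; rw [h] at h1; exact h1.trans (hcong w' hw').symm
    · intro h; have : w' = w * (w⁻¹ * w') := by group
      rw [this]; funext b; simp only [Φ]; rw [fireAct_mul, hfix _ h]

end IsMinuscule

/-- A Coxeter group whose numbers game has a positive invariant functional is infinite. -/
theorem infinite_of_invariant [Fintype B] (cs : CoxeterSystem M W) (hM : SimplyLaced M) (δ : B → ℤ)
    (hδ : ∀ i, ∑ j, (if M i j = 3 then δ j else 0) = 2 * δ i) (b : B) (hb : 0 < δ b) :
    Infinite W := by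
  by_contra hfin; have : Finite W := not_infinite_iff_finite.1 hfin; have := Fintype.ofFinite W
  have hinv : ∀ (i : B) (c : B → ℤ), ∑ j, δ j * fire M i c j = ∑ j, δ j * c j := by
    intro i c
    have : ∀ j, δ j * fire M i c j =
        δ j * c j + ((if M i j = 3 then δ j else 0) * c i - if j = i then 2 * δ i * c i else 0) := by
      intro j; rw [fire_apply]
      by_cases h : j = i
      · subst h; have : M j j ≠ 3 := by rw [M.diagonal]; norm_num
        simp; ring
      · simp only [h, if_false]; split_ifs <;> ring
    simp only [this]; rw [sum_add_distrib, sum_sub_distrib, ← sum_mul, hδ]; simp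
  have hinvW : ∀ w c, ∑ j, δ j * fireAct cs hM w c j = ∑ j, δ j * c j := by
    intro w c
    induction w using cs.simple_induction_left with
    | one => rw [fireAct_one]
    | mul_simple_left w i ih => rw [fireAct_simple_mul, hinv, ih]
  let c : B → ℤ := Pi.single b 1
  -- Summing the orbit of a chip over a finite group gives a configuration fixed by all firings, so
  -- each coordinate equals its opposite; but its pairing with `δ` is `|W| δ b`.
  let C : B → ℤ := fun j => ∑ w : W, fireAct cs hM w c j
  have hC : ∀ i, C i = 0 := by
    intro i
    have h1 : C i = ∑ w : W, fireAct cs hM (cs.simple i * w) c i :=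
      (Fintype.sum_equiv (Equiv.mulLeft (cs.simple i)) _ _ fun w => rfl).symm
    have h2 : ∀ w, fireAct cs hM (cs.simple i * w) c i = - fireAct cs hM w c i := by
      intro w; rw [fireAct_simple_mul, fire_apply]; simp
    simp only [h2, sum_neg_distrib] at h1; change C i = - C i at h1; omega
  have h0 : ∑ j, δ j * C j = 0 := by simp [hC]
  have h1 : ∑ j, δ j * C j = Fintype.card W * δ b := by
    simp only [C, mul_sum]; rw [sum_comm]; simp only [hinvW]; simp [c, Pi.single_apply]
  rw [h1] at h0; have : (0 : ℤ) < Fintype.card W := by exact_mod_cast Fintype.card_pos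
  have := mul_pos this hb; omega

end NumbersGame

/-! ### Components of type `A` and `D` -/

/-- The vertices of `C` are labelled by `a, …, b`, and are adjacent if and only if their labels
are consecutive. -/
structure IsLabelling (Γ : SimpleGraph ℕ) (C : Finset ℕ) (lam : ℕ → ℕ) (a b : ℕ) : Prop where
  le : ∀ v ∈ C, a ≤ lam v ∧ lam v ≤ b
  surj : ∀ j, a ≤ j → j ≤ b → ∃ v ∈ C, lam v = j
  adj : ∀ u ∈ C, ∀ v ∈ C, (Γ.Adj u v ↔ lam u + 1 = lam v ∨ lam v + 1 = lam u)

/-- `C` is a path (type `A`). -/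
structure IsPath (Γ : SimpleGraph ℕ) (C : Finset ℕ) (lam : ℕ → ℕ) (a b : ℕ) : Prop extends
    IsLabelling Γ C lam a b where
  inj : ∀ u ∈ C, ∀ v ∈ C, lam u = lam v → u = v

/-- `C` is a path with a doubled end vertex (type `D`). -/
structure IsFork (Γ : SimpleGraph ℕ) (C : Finset ℕ) (lam : ℕ → ℕ) (b u u' : ℕ) : Prop extends
    IsLabelling Γ C lam 1 b where
  ne : u ≠ u'
  mem_left : u ∈ C
  mem_right : u' ∈ C
  lam_left : lam u = 1
  lam_right : lam u' = 1
  eq_or_eq : ∀ v ∈ C, lam v = 1 → v = u ∨ v = u'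
  inj : ∀ v ∈ C, ∀ w ∈ C, lam v = lam w → lam v ≠ 1 → v = w

section Minuscule

variable {B : Type*} [DecidableEq B] {M : CoxeterMatrix B}

lemma fireOn_neg (σ : Finset B) (i : B) (c : B → ℤ) :
    fireOn M σ i (-c) = -fireOn M σ i c := by
  funext j; simp only [fireOn, fire_apply, Pi.neg_apply]; split_ifs <;> ring

/-- Orbits are given as injective families, so that the rank may be defined on indices. No rank is
demanded when firing `-1`, as this undoes the firing of a `1`. -/
lemma isMinuscule_of_index {ι : Type*} {σ : Finset B} {p : B} (I : Finset ι)
    (y : ι → B → ℤ) (rank : ι → ℕ) (hinj : Set.InjOn y I) (hp : p ∈ σ) (i₀ : ι) (hi₀ : i₀ ∈ I)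
    (hy₀ : y i₀ = Pi.single p 1) (hr₀ : rank i₀ = 0) (hsupp : ∀ i ∈ I, ∀ s ∉ σ, y i s = 0)
    (hfire : ∀ i ∈ I, ∀ s ∈ σ, y i s = 0 ∨
      (y i s = 1 ∧ ∃ j ∈ I, fireOn M σ s (y i) = y j ∧ rank j = rank i + 1) ∨
      (y i s = -1 ∧ ∃ j ∈ I, fireOn M σ s (y i) = y j))
    (hneg : ∀ i ∈ I, i ≠ i₀ → ∃ s ∈ σ, y i s = -1) :
    ∃ (O : Finset (B → ℤ)) (N : (B → ℤ) → ℕ), IsMinuscule M σ p O N ∧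
      ∀ x : Polynomial ℚ, ∑ c ∈ O, x ^ N c = ∑ i ∈ I, x ^ rank i := by
  classical
  have : Nonempty ι := ⟨i₀⟩
  let N : (B → ℤ) → ℕ := fun c => rank (Function.invFunOn y I c)
  have hN : ∀ i ∈ I, N (y i) = rank i := by
    intro i hi; simp only [N]; rw [hinj.leftInvOn_invFunOn hi]
  have hex : ∀ c ∈ I.image y, ∃ i ∈ I, y i = c := fun c hc => mem_image.1 hc
  refine ⟨I.image y, N, ⟨hp, ?_, ?_, ?_, ?_, ?_, ?_, ?_⟩, fun x => ?_⟩
  · exact mem_image.2 ⟨i₀, hi₀, hy₀⟩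
  · rw [← hy₀, hN _ hi₀, hr₀]
  · intro c hc; obtain ⟨i, hi, rfl⟩ := hex c hc; exact hsupp i hi
  · intro c hc s hs; obtain ⟨i, hi, rfl⟩ := hex c hc
    rcases hfire i hi s hs with h | ⟨_, j, hj, h, _⟩ | ⟨_, j, hj, h⟩
    · rw [fireOn_of_zero (hsupp i hi) h]; exact hc
    · rw [h]; exact mem_image_of_mem _ hj
    · rw [h]; exact mem_image_of_mem _ hj
  · intro c hc s hs; obtain ⟨i, hi, rfl⟩ := hex c hc
    rcases hfire i hi s hs with h | ⟨h, _⟩ | ⟨h, _⟩ <;> simp [h]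
  · intro c hc s hs h1; obtain ⟨i, hi, rfl⟩ := hex c hc
    rcases hfire i hi s hs with h | ⟨_, j, hj, h, hr⟩ | ⟨h, _⟩
    · omega
    · rw [h, hN _ hj, hN _ hi, hr]
    · omega
  · intro c hc hne; obtain ⟨i, hi, rfl⟩ := hex c hc; exact hneg i hi (fun h => hne (by rw [h, hy₀]))
  · rw [sum_image hinj]; exact sum_congr rfl fun i hi => by rw [hN i hi]

variable {Γ : SimpleGraph ℕ} {e : B ↪ ℕ} {σ : Finset B} {C : Finset ℕ} {lam : ℕ → ℕ} {a b : ℕ}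

/-- The chip configuration with a chip at the label `j - 1` and an antichip at the label `j`. -/
def chip (e : B ↪ ℕ) (C : Finset ℕ) (lam : ℕ → ℕ) (j : ℕ) : B → ℤ := fun v =>
  if e v ∈ C then (if lam (e v) + 1 = j then 1 else 0) - (if lam (e v) = j then 1 else 0) else 0

/-- A chip and an antichip at the two vertices `u` and `u'`. -/
def forkChip (e : B ↪ ℕ) (u u' : ℕ) : B → ℤ := fun v =>
  (if e v = u then 1 else 0) - (if e v = u' then 1 else 0)

lemma forkChip_swap (u u' : ℕ) : forkChip e u' u = -forkChip e u u' := by funext v; simp [forkChip]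

lemma chip_support (hC : C ⊆ σ.map e) (j : ℕ) : ∀ v ∉ σ, chip e C lam j v = 0 := by
  intro v hv; have : e v ∉ C := fun h => hv (by simpa using hC h); simp [chip, this]

/-- Firing the antichip moves the pair one label up. Only the fired vertex is required to be alone
on its label, so the lemma serves paths and the simple part of forks alike. -/
lemma fireOn_chip (hM : ∀ i j, M i j = 3 ↔ Γ.Adj (e i) (e j)) (hC : C ⊆ σ.map e)
    (hcl : ∀ u ∈ C, ∀ v ∈ σ, e v ∉ C → ¬ Γ.Adj u (e v)) (H : IsLabelling Γ C lam a b) {s : B}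
    (hs : e s ∈ C) (huniq : ∀ v ∈ C, lam v = lam (e s) → v = e s) :
    fireOn M σ s (chip e C lam (lam (e s))) = chip e C lam (lam (e s) + 1) := by
  funext v
  by_cases hv : v ∈ σ
  swap
  · simp [fireOn, hv, chip_support hC _ v hv]
  simp only [fireOn, hv, if_true, fire_apply]
  by_cases hvs : v = s
  · subst hvs; simp [chip, hs]
  have hne : e v ≠ e s := fun h => hvs (e.injective h); rw [if_neg hvs]
  by_cases hvC : e v ∈ C
  · have h1 : lam (e v) ≠ lam (e s) := fun h => hne (huniq _ hvC h)
    have hadj := (hM s v).trans (H.adj _ hs _ hvC); simp only [hadj, chip, hs, hvC, if_true]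
    split_ifs <;> omega
  · rw [if_neg (fun h => hcl _ hs v hv hvC ((hM s v).1 h))]; simp [chip, hvC]

lemma fireOn_chip_succ (hM : ∀ i j, M i j = 3 ↔ Γ.Adj (e i) (e j)) (hC : C ⊆ σ.map e)
    (hcl : ∀ u ∈ C, ∀ v ∈ σ, e v ∉ C → ¬ Γ.Adj u (e v)) (H : IsLabelling Γ C lam a b) {s : B}
    (hs : e s ∈ C) (huniq : ∀ v ∈ C, lam v = lam (e s) → v = e s) :
    fireOn M σ s (chip e C lam (lam (e s) + 1)) = chip e C lam (lam (e s)) := by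
  rw [← fireOn_chip hM hC hcl H hs huniq,
    fireOn_fireOn (by simpa using hC hs) (chip_support hC _)]

lemma chip_eq_single (H : IsLabelling Γ C lam a b) {p : B} (hp : e p ∈ C) (hpb : lam (e p) = b)
    (huniq : ∀ v ∈ C, lam v = lam (e p) → v = e p) :
    chip e C lam (b + 1) = Pi.single p 1 := by
  funext v
  by_cases hvp : v = p
  · subst hvp; simp [chip, hp, hpb]
  · rw [Pi.single_eq_of_ne hvp]
    by_cases hv : e v ∈ C
    · have h1 : lam (e v) ≠ lam (e p) := fun h => hvp (e.injective (huniq _ hv h))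
      have h2 := (H.le _ hv).2; have h3 : lam (e v) ≠ b + 1 := by omega
      simp [chip, hpb ▸ h1, h3]
    · simp [chip, hv]

/-- The orbit of the end chip is the chain `chip (b + 1), …, chip a` of weights of the standard
representation of type `A`, with ranks `b + 1 - j`. -/
lemma IsPath.exists_isMinuscule (hM : ∀ i j, M i j = 3 ↔ Γ.Adj (e i) (e j)) (hC : C ⊆ σ.map e)
    (hcl : ∀ u ∈ C, ∀ v ∈ σ, e v ∉ C → ¬ Γ.Adj u (e v)) (H : IsPath Γ C lam a b) {p : B}
    (hp : e p ∈ C) (hpb : lam (e p) = b) :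
    ∃ (O : Finset (B → ℤ)) (N : (B → ℤ) → ℕ), IsMinuscule M σ p O N ∧
      ∀ x : Polynomial ℚ, ∑ c ∈ O, x ^ N c = ∑ i ∈ range (b + 2 - a), x ^ i := by
  have hab : a ≤ b := by have := H.le _ hp; omega
  have huniq : ∀ w ∈ C, ∀ v ∈ C, lam v = lam w → v = w := fun w hw v hv h => H.inj _ hv _ hw h
  have hlift : ∀ v ∈ C, ∃ s ∈ σ, e s = v := fun v hv => by simpa using hC hv
  have hval : ∀ j, a ≤ j → j ≤ b → ∃ s ∈ σ, e s ∈ C ∧ lam (e s) = j := by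
    intro j h1 h2; obtain ⟨v, hv, hl⟩ := H.surj j h1 h2; obtain ⟨s, hs, rfl⟩ := hlift v hv
    exact ⟨s, hs, hv, hl⟩
  obtain ⟨O, N, hm, hsum⟩ : ∃ (O : Finset (B → ℤ)) (N : (B → ℤ) → ℕ), IsMinuscule M σ p O N ∧
      ∀ x : Polynomial ℚ, ∑ c ∈ O, x ^ N c = ∑ j ∈ Icc a (b + 1), x ^ (b + 1 - j) := by
    refine isMinuscule_of_index (M := M) (σ := σ) (p := p)
      (Icc a (b + 1)) (chip e C lam) (fun j => b + 1 - j) ?_ (by simpa using hC hp) (b + 1)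
      (by simp; omega) (chip_eq_single H.toIsLabelling hp hpb (huniq _ hp)) (by simp)
      (fun j _ => chip_support hC j) ?_ ?_
    · intro j hj j' hj' h; simp only [coe_Icc, Set.mem_Icc] at hj hj'; by_contra hne
      have key : ∀ j j', a ≤ j → j ≤ b → j ≠ j' → chip e C lam j ≠ chip e C lam j' := by
        intro j j' h1 h2 hne h; obtain ⟨s, -, hs, hl⟩ := hval j h1 h2; have h0 := congrFun h s
        simp only [chip, hs, if_true, hl] at h0; split_ifs at h0 <;> omega
      by_cases hjb : j ≤ b
      · exact key j j' hj.1 hjb hne h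
      · exact key j' j hj'.1 (by omega) (Ne.symm hne) h.symm
    · intro j hj s hs; simp only [mem_Icc] at hj
      by_cases hsC : e s ∈ C
      swap
      · left; simp [chip, hsC]
      have hle := H.le _ hsC
      by_cases h1 : lam (e s) + 1 = j
      · right; left
        refine ⟨by simp [chip, hsC, h1, show lam (e s) ≠ j by omega], lam (e s), by simp; omega,
          ?_, by omega⟩
        rw [← h1, fireOn_chip_succ hM hC hcl H.toIsLabelling hsC (huniq _ hsC)]
      · by_cases h2 : lam (e s) = j
        · right; right; refine ⟨by simp [chip, hsC, h2], j + 1, by simp; omega, ?_⟩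
          rw [← h2, fireOn_chip hM hC hcl H.toIsLabelling hsC (huniq _ hsC)]
        · left; simp [chip, h1, h2]
    · intro j hj hne; simp only [mem_Icc] at hj; obtain ⟨s, hs, hsC, hl⟩ := hval j hj.1 (by omega)
      exact ⟨s, hs, by simp [chip, hsC, hl]⟩
  refine ⟨O, N, hm, fun x => ?_⟩; rw [hsum]
  refine sum_nbij' (fun j => b + 1 - j) (fun i => b + 1 - i) ?_ ?_ ?_ ?_ ?_ <;>
    intro j hj <;> simp at hj ⊢ <;> omega

/-- `chip 2` has a chip on both twin ends. Firing one of them leaves a chip and an antichip on the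
twins, and this is where the orbit branches. -/
lemma fireOn_chip_two (hM : ∀ i j, M i j = 3 ↔ Γ.Adj (e i) (e j)) (hC : C ⊆ σ.map e)
    (hcl : ∀ u ∈ C, ∀ v ∈ σ, e v ∉ C → ¬ Γ.Adj u (e v)) {u u' : B}
    (H : IsFork Γ C lam b (e u) (e u')) :
    fireOn M σ u (chip e C lam 2) = forkChip e (e u') (e u) ∧
      fireOn M σ u' (chip e C lam 2) = forkChip e (e u) (e u') := by
  have key : ∀ u u' : B, IsFork Γ C lam b (e u) (e u') →
      fireOn M σ u (chip e C lam 2) = forkChip e (e u') (e u) := by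
    intro u u' H; funext v; have huu : u ≠ u' := fun h => H.ne (by rw [h])
    by_cases hv : v ∈ σ
    swap
    · have h1 : v ≠ u := by rintro rfl; exact hv (by simpa using hC H.mem_left)
      have h2 : v ≠ u' := by rintro rfl; exact hv (by simpa using hC H.mem_right)
      simp [fireOn, hv, forkChip, h1, h2]
    have hl := H.lam_left; have hr := H.lam_right; simp only [fireOn, hv, if_true, fire_apply]
    by_cases hvu : v = u
    · subst hvu; simp [chip, H.mem_left, hl, forkChip, huu]
    rw [if_neg hvu]
    by_cases hvC : e v ∈ C
    · have hadj := (hM u v).trans (H.adj _ H.mem_left _ hvC); simp only [hadj]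
      by_cases hvu' : v = u'
      · subst hvu'; simp [chip, hvC, hr, hl, forkChip, huu.symm]
      · have h1 : lam (e v) ≠ 1 := by
          intro h; rcases H.eq_or_eq _ hvC h with h | h
          · exact hvu (e.injective h)
          · exact hvu' (e.injective h)
        have := (H.le _ hvC).1
        simp only [chip, hvC, H.mem_left, if_true, hl, forkChip, e.injective.eq_iff, hvu, hvu']
        split_ifs <;> omega
    · rw [if_neg (fun h => hcl _ H.mem_left v hv hvC ((hM u v).1 h))]
      have h2 : v ≠ u' := by rintro rfl; exact hvC H.mem_right
      simp [chip, hvC, forkChip, hvu, h2]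
  refine ⟨key u u' H, key u' u ?_⟩
  exact ⟨H.toIsLabelling, H.ne.symm, H.mem_right, H.mem_left, H.lam_right, H.lam_left,
    fun v hv h => (H.eq_or_eq v hv h).symm, H.inj⟩

/-- The orbit of type `D`. -/
def forkOrbit (e : B ↪ ℕ) (C : Finset ℕ) (lam : ℕ → ℕ) (u u' : ℕ) (i : Bool × ℕ) : B → ℤ :=
  let c := if i.2 = 1 then forkChip e u u' else chip e C lam i.2
  if i.1 then -c else c

/-- The orbit consists of the `2(b+1)` weights of the vector representation of type `D`: `chip j`
for `j ≥ 2`, the configuration of the twins for `j = 1`, and their opposites. The first half has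
ranks `0, …, b`, the second `b, …, 2b`; the two middle elements both have rank `b`, whence the
factor `1 + x^b`. -/
lemma IsFork.exists_isMinuscule (hM : ∀ i j, M i j = 3 ↔ Γ.Adj (e i) (e j)) (hC : C ⊆ σ.map e)
    (hcl : ∀ u ∈ C, ∀ v ∈ σ, e v ∉ C → ¬ Γ.Adj u (e v)) {u u' : ℕ} (H : IsFork Γ C lam b u u')
    (hb : 2 ≤ b) {p : B} (hp : e p ∈ C) (hpb : lam (e p) = b) :
    ∃ (O : Finset (B → ℤ)) (N : (B → ℤ) → ℕ), IsMinuscule M σ p O N ∧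
      ∀ x : Polynomial ℚ, ∑ c ∈ O, x ^ N c = (1 + x ^ b) * ∑ i ∈ range (b + 1), x ^ i := by
  have hlift : ∀ v ∈ C, ∃ s ∈ σ, e s = v := fun v hv => by simpa using hC hv
  obtain ⟨u, huσ, rfl⟩ := hlift u H.mem_left; obtain ⟨u', hu'σ, rfl⟩ := hlift u' H.mem_right
  have huu : u ≠ u' := fun h => H.ne (by rw [h])
  have huniq : ∀ w ∈ C, lam w ≠ 1 → ∀ v ∈ C, lam v = lam w → v = w :=
    fun w hw h1 v hv h => H.inj _ hv _ hw h (by omega)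
  obtain ⟨hf1, hf2⟩ := fireOn_chip_two hM hC hcl H
  have hg1 : fireOn M σ u (forkChip e (e u) (e u')) = -chip e C lam 2 := by
    rw [forkChip_swap, fireOn_neg, ← hf1, fireOn_fireOn huσ (chip_support hC _)]
  have hg2 : fireOn M σ u' (forkChip e (e u) (e u')) = chip e C lam 2 := by
    rw [← hf2, fireOn_fireOn hu'σ (chip_support hC _)]
  have hval : ∀ j, 1 ≤ j → j ≤ b → ∃ s ∈ σ, e s ∈ C ∧ lam (e s) = j := by
    intro j h1 h2; obtain ⟨v, hv, hl⟩ := H.surj j h1 h2; obtain ⟨s, hs, rfl⟩ := hlift v hv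
    exact ⟨s, hs, hv, hl⟩
  have hval1 : ∀ s, e s ∈ C → lam (e s) = 1 → s = u ∨ s = u' := by
    intro s hs h; rcases H.eq_or_eq _ hs h with h | h
    · exact Or.inl (e.injective h)
    · exact Or.inr (e.injective h)
  have hul := H.lam_left; have hul' := H.lam_right; have huC := H.mem_left; have huC' := H.mem_right
  set y := forkOrbit e C lam (e u) (e u') with hy
  have hyf : ∀ j, j ≠ 1 → y (false, j) = chip e C lam j := by intro j hj; simp [hy, forkOrbit, hj]
  have hyt : ∀ j, y (true, j) = -y (false, j) := by intro j; simp [hy, forkOrbit]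
  have hy1 : y (false, 1) = forkChip e (e u) (e u') := by simp [hy, forkOrbit]
  have hsupp : ∀ i : Bool × ℕ, ∀ s ∉ σ, y i s = 0 := by
    have h0 : ∀ j, ∀ s ∉ σ, y (false, j) s = 0 := by
      intro j s hs
      by_cases hj : j = 1
      · subst hj; have h1 : s ≠ u := by rintro rfl; exact hs huσ
        have h2 : s ≠ u' := by rintro rfl; exact hs hu'σ
        simp [hy1, forkChip, h1, h2]
      · rw [hyf j hj]; exact chip_support hC j s hs
    rintro ⟨_ | _, j⟩ s hs
    · exact h0 j s hs
    · rw [hyt]; simp [h0 j s hs]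
  -- the coordinates of the configurations
  have hcoord : ∀ j, 1 ≤ j → j ≤ b + 1 → ∀ s ∈ σ, y (false, j) s = 0 ∨
      (y (false, j) s = 1 ∧ 2 ≤ j ∧ fireOn M σ s (y (false, j)) = y (false, j - 1)) ∨
      (y (false, j) s = 1 ∧ j = 2 ∧ fireOn M σ s (y (false, j)) = y (true, 1)) ∨
      (y (false, j) s = 1 ∧ j = 1 ∧ fireOn M σ s (y (false, j)) = y (true, 2)) ∨
      (y (false, j) s = -1 ∧ j ≤ b ∧ fireOn M σ s (y (false, j)) = y (false, j + 1)) := by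
    intro j hj hjb s hs
    by_cases hj1 : j = 1
    · subst hj1
      by_cases h1 : s = u
      · subst h1; right; right; right; left; refine ⟨by simp [hy1, forkChip, huu], rfl, ?_⟩
        rw [hyt, hyf 2 (by norm_num), hy1, hg1]
      · by_cases h2 : s = u'
        · subst h2; right; right; right; right
          refine ⟨by simp [hy1, forkChip, huu.symm], by omega, ?_⟩
          rw [hyf (1 + 1) (by norm_num), hy1, hg2]
        · left; simp [hy1, forkChip, h1, h2]
    rw [hyf j hj1]
    by_cases hsC : e s ∈ C
    swap
    · left; simp [chip, hsC]
    have hle := H.le _ hsC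
    by_cases h1 : lam (e s) + 1 = j
    · by_cases h3 : lam (e s) = 1
      · obtain rfl : j = 2 := by omega
        rcases hval1 s hsC h3 with rfl | rfl
        · right; right; left; refine ⟨by simp [chip, hsC, hul], rfl, ?_⟩
          rw [hyt, hy1, hf1, forkChip_swap]
        · right; left; refine ⟨by simp [chip, hsC, hul'], le_rfl, ?_⟩; rw [hy1, hf2]
      · right; left; refine ⟨by simp [chip, hsC, h1, show lam (e s) ≠ j by omega], by omega, ?_⟩
        rw [hyf _ (by omega), ← h1,
          fireOn_chip_succ hM hC hcl H.toIsLabelling hsC (huniq _ hsC h3)]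
        rfl
    · by_cases h2 : lam (e s) = j
      · right; right; right; right; refine ⟨by simp [chip, hsC, h2], by omega, ?_⟩
        rw [hyf _ (by omega), ← h2,
          fireOn_chip hM hC hcl H.toIsLabelling hsC (huniq _ hsC (by omega))]
      · left; simp [chip, h1, h2]
  let rank : Bool × ℕ → ℕ := fun i => if i.1 then b + i.2 - 1 else b + 1 - i.2
  obtain ⟨O, N, hm, hsum⟩ : ∃ (O : Finset (B → ℤ)) (N : (B → ℤ) → ℕ), IsMinuscule M σ p O N ∧
      ∀ x : Polynomial ℚ, ∑ c ∈ O, x ^ N c =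
        ∑ i ∈ (univ : Finset Bool) ×ˢ Icc 1 (b + 1), x ^ rank i := by
    refine isMinuscule_of_index (M := M) (σ := σ) (p := p)
      ((univ : Finset Bool) ×ˢ Icc 1 (b + 1)) y rank ?_
      (by simpa using hC hp) (false, b + 1) (by simp)
      (by rw [hyf _ (by omega)]
          exact chip_eq_single H.toIsLabelling hp hpb (huniq _ hp (by omega))) (by simp [rank])
      (fun i _ => hsupp i) ?_ ?_
    · have key1 : ∀ j j', 1 ≤ j → j ≤ b → j' ≤ b + 1 → j ≠ j' → y (false, j) ≠ y (false, j') := by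
        intro j j' h1 h2 h3 hne h
        by_cases hj : j = 1
        · subst hj; have h0 := congrFun h u'; rw [hy1, hyf j' (by omega)] at h0
          simp only [forkChip, chip, huC', if_true, hul', e.injective.eq_iff, huu.symm] at h0
          split_ifs at h0 <;> omega
        · obtain ⟨s, -, hs, hl⟩ := hval j h1 h2; have h0 := congrFun h s
          by_cases hj' : j' = 1
          · subst hj'; have h4 : s ≠ u := by rintro rfl; omega
            have h5 : s ≠ u' := by rintro rfl; omega
            rw [hy1, hyf j hj] at h0; simp [forkChip, chip, hs, hl, h4, h5] at h0
          · rw [hyf j hj, hyf j' hj'] at h0; simp only [chip, hs, if_true, hl] at h0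
            split_ifs at h0 <;> omega
      have key1' : ∀ j j', 1 ≤ j → 1 ≤ j' → j ≤ b + 1 → j' ≤ b + 1 → y (false, j) = y (false, j') →
          j = j' := by
        intro j j' h1 h2 h3 h4 h; by_contra hne
        by_cases hjb : j ≤ b
        · exact key1 j j' h1 hjb h4 hne h
        · exact key1 j' j h2 (by omega) h3 (Ne.symm hne) h.symm
      have key2 : ∀ j j', 1 ≤ j → 1 ≤ j' → j ≤ b + 1 → j' ≤ b + 1 →
          y (false, j) ≠ -y (false, j') := by
        intro j j' h1 h2 h3 h4 h
        have h5 : ∀ j, 2 ≤ j → y (false, j) u + y (false, j) u' = if j = 2 then 2 else 0 := by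
          intro j hj; rw [hyf j (by omega)]; simp only [chip, huC, huC', if_true, hul, hul']
          split_ifs <;> omega
        have h6 : y (false, 1) u = 1 ∧ y (false, 1) u' = -1 := by
          rw [hy1]; simp [forkChip, huu, huu.symm]
        have e1 := congrFun h u; have e2 := congrFun h u'; simp only [Pi.neg_apply] at e1 e2
        by_cases hj : j = 1
        · subst hj
          by_cases hj' : j' = 1
          · subst hj'; omega
          · have := h5 j' (by omega); rw [hyf j' hj'] at e1 e2
            simp only [chip, huC, huC', if_true, hul, hul'] at e1 e2; split_ifs at e1 e2 <;> omega
        · by_cases hj' : j' = 1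
          · subst hj'; rw [hyf j hj] at e1 e2
            simp only [chip, huC, huC', if_true, hul, hul'] at e1 e2; split_ifs at e1 e2 <;> omega
          · -- look at the smaller of the two labels `j - 1`, `j' - 1`, where a chip is
            have key3 : ∀ j j', 2 ≤ j → j ≤ b + 1 → 2 ≤ j' → j ≤ j' → 
                y (false, j) ≠ -y (false, j') := by
              intro j j' h1 h2 h3 h4 h; obtain ⟨s, -, hs, hl⟩ := hval (j - 1) (by omega) (by omega)
              have h0 := congrFun h s; rw [hyf j (by omega), Pi.neg_apply, hyf j' (by omega)] at h0
              simp only [chip, hs, if_true, hl] at h0; split_ifs at h0 <;> omega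
            rcases le_total j j' with hjj | hjj
            · exact key3 j j' (by omega) h3 (by omega) hjj h
            · exact key3 j' j (by omega) h4 (by omega) hjj (by rw [h, neg_neg])
      rintro ⟨x, j⟩ hj ⟨x', j'⟩ hj' h
      simp only [coe_product, coe_univ, coe_Icc, Set.mem_prod, Set.mem_univ,
        Set.mem_Icc, true_and] at hj hj'
      cases x <;> cases x'
      · rw [key1' j j' hj.1 hj'.1 hj.2 hj'.2 h]
      · rw [hyt] at h; exact absurd h (key2 j j' hj.1 hj'.1 hj.2 hj'.2)
      · rw [hyt] at h; exact absurd h.symm (key2 j' j hj'.1 hj.1 hj'.2 hj.2)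
      · rw [hyt, hyt, neg_inj] at h; rw [key1' j j' hj.1 hj'.1 hj.2 hj'.2 h]
    · rintro ⟨x, j⟩ hj s hs; simp only [mem_product, mem_univ, mem_Icc, true_and] at hj
      have hc := hcoord j hj.1 hj.2 s hs
      cases x
      · rcases hc with h | ⟨h, h2, h3⟩ | ⟨h, h2, h3⟩ | ⟨h, h2, h3⟩ | ⟨h, h2, h3⟩
        · exact Or.inl h
        · exact Or.inr (Or.inl ⟨h, _, by simp; omega, h3, by simp [rank]; omega⟩)
        · exact Or.inr (Or.inl ⟨h, _, by simp, h3, by simp [rank]; omega⟩)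
        · exact Or.inr (Or.inl ⟨h, _, by simp; omega, h3, by simp [rank]; omega⟩)
        · exact Or.inr (Or.inr ⟨h, _, by simp; omega, h3⟩)
      · rw [hyt, fireOn_neg]; simp only [Pi.neg_apply]
        rcases hc with h | ⟨h, h2, h3⟩ | ⟨h, h2, h3⟩ | ⟨h, h2, h3⟩ | ⟨h, h2, h3⟩
        · exact Or.inl (by simp [h])
        · exact Or.inr (Or.inr ⟨by omega, (true, j - 1), by simp; omega, by rw [h3, hyt]⟩)
        · exact Or.inr (Or.inr ⟨by omega, (false, 1), by simp, by rw [h3, hyt, neg_neg]⟩)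
        · exact Or.inr (Or.inr ⟨by omega, (false, 2), by simp; omega, by rw [h3, hyt, neg_neg]⟩)
        · exact Or.inr (Or.inl ⟨by omega, (true, j + 1), by simp; omega, by rw [h3, hyt],
            by simp [rank]; omega⟩)
    · rintro ⟨x, j⟩ hj hne; simp only [mem_product, mem_univ, mem_Icc, true_and] at hj
      cases x
      · have hjb : j ≤ b := by by_contra h; exact hne (by rw [show j = b + 1 by omega])
        by_cases hj1 : j = 1
        · subst hj1; exact ⟨u', hu'σ, by simp [hy1, forkChip, huu.symm]⟩
        · obtain ⟨s, hs, hsC, hl⟩ := hval j hj.1 hjb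
          exact ⟨s, hs, by rw [hyf j hj1]; simp [chip, hsC, hl]⟩
      · by_cases hj1 : j = 1
        · subst hj1; exact ⟨u, huσ, by simp [hyt, hy1, forkChip, huu]⟩
        · obtain ⟨s, hs, hsC, hl⟩ := hval (j - 1) (by omega) (by omega)
          exact ⟨s, hs, by
            rw [hyt, Pi.neg_apply, hyf j hj1]; simp only [chip, hsC, hl, if_true]
            split_ifs <;> omega⟩
  refine ⟨O, N, hm, fun x => ?_⟩
  rw [hsum, sum_product, Fintype.sum_bool, add_mul, one_mul, add_comm]; congr 1
  · refine sum_nbij' (fun j => b + 1 - j) (fun i => b + 1 - i) ?_ ?_ ?_ ?_ ?_ <;>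
      intro j hj <;> simp [rank] at hj ⊢ <;> omega
  · rw [mul_sum]
    refine sum_nbij' (fun j => j - 1) (fun i => i + 1) ?_ ?_ ?_ ?_ ?_ <;>
      intro j hj <;> simp [rank] at hj ⊢ <;> try omega
    rw [← pow_add]; congr 1; omega

end Minuscule

/-! ### Multiplicities of cyclotomic polynomials -/

section Multiplicity

open Polynomial

variable {d : ℕ}

lemma prime_cyclotomic (hd : 2 ≤ d) : Prime (cyclotomic d ℚ) :=
  (cyclotomic.irreducible_rat (by omega)).prime

lemma finiteMultiplicity_cyclotomic (hd : 2 ≤ d) {P : ℚ[X]} (hP : P ≠ 0) :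
    FiniteMultiplicity (cyclotomic d ℚ) P :=
  FiniteMultiplicity.of_prime_left (prime_cyclotomic hd) hP

lemma cyclotomic_dvd_iff (hd : 2 ≤ d) (m : ℕ) : cyclotomic d ℚ ∣ X ^ m - 1 ↔ d ∣ m := by
  constructor
  · intro h; have hζ := Complex.isPrimitiveRoot_exp d (by omega)
    have h0 : aeval (Complex.exp (2 * Real.pi * Complex.I / d)) (cyclotomic d ℚ) = 0 := by
      have := hζ.isRoot_cyclotomic (by omega); rw [aeval_def, ← eval_map, map_cyclotomic]
      exact this
    have h1 := aeval_eq_zero_of_dvd_aeval_eq_zero h h0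
    rw [map_sub, map_pow, aeval_X, map_one, sub_eq_zero] at h1; exact (hζ.pow_eq_one_iff_dvd m).1 h1
  · intro h; refine (cyclotomic.dvd_X_pow_sub_one d ℚ).trans ?_; obtain ⟨k, rfl⟩ := h
    simpa [pow_mul] using sub_dvd_pow_sub_pow (X ^ d : ℚ[X]) 1 k

/-- `X^m - 1` is separable, so no factor is repeated. -/
lemma multiplicity_X_pow_sub_one (hd : 2 ≤ d) {m : ℕ} (hm : 0 < m) :
    multiplicity (cyclotomic d ℚ) (X ^ m - 1) = if d ∣ m then 1 else 0 := by
  have hne : (X ^ m - 1 : ℚ[X]) ≠ 0 := X_pow_sub_C_ne_zero hm 1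
  have hfin := finiteMultiplicity_cyclotomic hd hne
  have hsep : (X ^ m - 1 : ℚ[X]).Separable := by
    have := separable_X_pow_sub_C (1 : ℚ) (n := m) (by exact_mod_cast hm.ne') one_ne_zero
    simpa using this
  have hle : multiplicity (cyclotomic d ℚ) (X ^ m - 1) ≤ 1 := by
    by_contra h
    have h2 : cyclotomic d ℚ ^ 2 ∣ X ^ m - 1 :=
      (pow_dvd_pow _ (by omega)).trans (pow_multiplicity_dvd _ _)
    rw [pow_two] at h2; exact (prime_cyclotomic hd).not_isUnit (hsep.squarefree _ h2)
  split_ifs with h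
  · have : 1 ≤ multiplicity (cyclotomic d ℚ) (X ^ m - 1) :=
      hfin.le_multiplicity_of_pow_dvd (by simpa using (cyclotomic_dvd_iff hd m).2 h)
    omega
  · exact multiplicity_eq_zero.2 fun h' => h ((cyclotomic_dvd_iff hd m).1 h')

lemma geomSum_ne_zero (m : ℕ) : (∑ i ∈ range (m + 1), (X : ℚ[X]) ^ i) ≠ 0 := by
  intro h; have := congrArg (eval 1) h
  simp only [eval_finsetSum, eval_pow, eval_X, one_pow, sum_const, card_range,
    eval_zero, nsmul_eq_mul, mul_one] at this
  norm_cast at this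

lemma one_add_X_pow_ne_zero (b : ℕ) : (1 + X ^ b : ℚ[X]) ≠ 0 := by
  intro h; have := congrArg (eval 1) h; norm_num at this

lemma multiplicity_geomSum (hd : 2 ≤ d) (m : ℕ) :
    multiplicity (cyclotomic d ℚ) (∑ i ∈ range (m + 1), X ^ i) =
      if d ∣ m + 1 then 1 else 0 := by
  have h1 := geom_sum_mul (X : ℚ[X]) (m + 1)
  have h2 := multiplicity_X_pow_sub_one hd (m := m + 1) (by omega)
  have h3 := multiplicity_X_pow_sub_one hd (m := 1) (by omega)
  rw [if_neg (by intro h; have := Nat.le_of_dvd one_pos h; omega), pow_one] at h3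
  rw [← h1, multiplicity_mul (prime_cyclotomic hd), h3] at h2
  · exact h2
  · rw [h1]; exact finiteMultiplicity_cyclotomic hd (X_pow_sub_C_ne_zero (by omega) 1)

/-- `1 + X^b` is the quotient of `X^{2b} - 1` by `X^b - 1`. The subtraction in `ℕ` is exact because
`d ∣ b` implies `d ∣ 2b`. -/
lemma multiplicity_one_add (hd : 2 ≤ d) {b : ℕ} (hb : 0 < b) :
    multiplicity (cyclotomic d ℚ) (1 + X ^ b) =
      (if d ∣ 2 * b then 1 else 0) - if d ∣ b then 1 else 0 := by
  have h1 : (1 + X ^ b) * (X ^ b - 1) = (X ^ (2 * b) - 1 : ℚ[X]) := by ring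
  have h2 := multiplicity_X_pow_sub_one hd (m := 2 * b) (by omega)
  rw [← h1, multiplicity_mul (prime_cyclotomic hd), multiplicity_X_pow_sub_one hd hb] at h2
  · omega
  · rw [h1]; exact finiteMultiplicity_cyclotomic hd (X_pow_sub_C_ne_zero (by omega) 1)

end Multiplicity

/-! ### Weights of simplices and removal of an end vertex -/

section Weight

open Polynomial

variable {B W : Type*} [Group W] {M : CoxeterMatrix B} (cs : CoxeterSystem M W) {d : ℕ}

lemma poincare_ne_zero {σ : Finset B} (hσ : (parabolic cs σ : Set W).Finite) :
    poincare cs σ ≠ 0 := by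
  intro h
  have hs : poincare cs σ = ∑ w ∈ hσ.toFinset, (X : ℚ[X]) ^ cs.length w := by
    unfold poincare; rw [← finsum_mem_coe_finset]
    exact finsum_mem_congr (by ext u; simp) fun _ _ => rfl
  have h1 := congrArg (eval 1) (hs.symm.trans h)
  simp only [eval_finsetSum, eval_pow, eval_X, one_pow, sum_const, eval_zero,
    nsmul_eq_mul, mul_one] at h1
  norm_cast at h1; rw [card_eq_zero] at h1; have : (1 : W) ∈ hσ.toFinset := by simp [one_mem]
  simp [h1] at this

lemma weight_mono (hd : 2 ≤ d) {τ σ : Finset B} (hτσ : τ ⊆ σ) (hσ : σ ∈ simplices cs) :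
    weight cs d τ ≤ weight cs d σ :=
  (finiteMultiplicity_cyclotomic hd (poincare_ne_zero cs hσ)).le_multiplicity_of_pow_dvd
    ((pow_multiplicity_dvd _ _).trans (poincare_dvd cs hτσ hσ))

lemma parabolic_empty : (parabolic cs (∅ : Finset B) : Set W) = {1} := by simp [parabolic]

lemma empty_mem_simplices : (∅ : Finset B) ∈ simplices cs := by simp [simplices, parabolic_empty]

lemma weight_empty (hd : 2 ≤ d) : weight cs d ∅ = 0 := by
  have : poincare cs ∅ = 1 := by
    unfold poincare
    have h : ∀ w : W, w ∈ parabolic cs ∅ ↔ w ∈ ({1} : Set W) := by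
      intro w; rw [← parabolic_empty cs]; rfl
    simp only [h]; simp
  rw [weight, this]
  exact multiplicity_eq_zero.2 fun h => (prime_cyclotomic hd).not_isUnit (isUnit_of_dvd_one h)

variable [DecidableEq B] {Γ : SimpleGraph ℕ} {e : B ↪ ℕ} {σ : Finset B} {C : Finset ℕ}
  {lam : ℕ → ℕ} {a b : ℕ}

lemma weight_mul (hd : 2 ≤ d) {τ : Finset B} {P : ℚ[X]} (hτ : τ ∈ simplices cs) (hP : P ≠ 0)
    (h : poincare cs σ = poincare cs τ * P) :
    weight cs d σ = weight cs d τ + multiplicity (cyclotomic d ℚ) P := by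
  rw [weight, h, multiplicity_mul (prime_cyclotomic hd)]
  · rfl
  · exact finiteMultiplicity_cyclotomic hd (mul_ne_zero (poincare_ne_zero cs hτ) hP)

/-- Removing an end of a component of type `A`. -/
lemma IsPath.weight_eq (hd : 2 ≤ d) (hM : SimplyLaced M)
    (hMΓ : ∀ i j, M i j = 3 ↔ Γ.Adj (e i) (e j)) (hC : C ⊆ σ.map e)
    (hcl : ∀ u ∈ C, ∀ v ∈ σ, e v ∉ C → ¬ Γ.Adj u (e v)) (H : IsPath Γ C lam a b) {p : B}
    (hp : e p ∈ C) (hpb : lam (e p) = b) (hτ : σ.erase p ∈ simplices cs) :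
    σ ∈ simplices cs ∧
      weight cs d σ = weight cs d (σ.erase p) + if d ∣ b + 2 - a then 1 else 0 := by
  obtain ⟨O, N, hm, hsum⟩ := H.exists_isMinuscule hMΓ hC hcl hp hpb
  obtain ⟨hfin, hpo⟩ := hm.poincare_eq cs hM hτ; have hab : a ≤ b := by have := H.le _ hp; omega
  rw [hsum, show b + 2 - a = (b + 1 - a) + 1 by omega] at hpo; refine ⟨hfin, ?_⟩
  rw [weight_mul cs hd hτ (geomSum_ne_zero _) hpo, multiplicity_geomSum hd,
    show b + 2 - a = (b + 1 - a) + 1 by omega]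

/-- Removing the end of a component of type `D`. -/
lemma IsFork.weight_eq (hd : 2 ≤ d) (hM : SimplyLaced M)
    (hMΓ : ∀ i j, M i j = 3 ↔ Γ.Adj (e i) (e j)) (hC : C ⊆ σ.map e)
    (hcl : ∀ u ∈ C, ∀ v ∈ σ, e v ∉ C → ¬ Γ.Adj u (e v)) {u u' : ℕ} (H : IsFork Γ C lam b u u')
    (hb : 2 ≤ b) {p : B} (hp : e p ∈ C) (hpb : lam (e p) = b) (hτ : σ.erase p ∈ simplices cs) :
    σ ∈ simplices cs ∧
      weight cs d σ = weight cs d (σ.erase p) +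
        (((if d ∣ 2 * b then 1 else 0) - if d ∣ b then 1 else 0) +
          if d ∣ b + 1 then 1 else 0) := by
  obtain ⟨O, N, hm, hsum⟩ := H.exists_isMinuscule hMΓ hC hcl hb hp hpb
  obtain ⟨hfin, hpo⟩ := hm.poincare_eq cs hM hτ; rw [hsum] at hpo; refine ⟨hfin, ?_⟩
  have hne := mul_ne_zero (one_add_X_pow_ne_zero b) (geomSum_ne_zero b)
  rw [weight_mul cs hd hτ hne hpo, multiplicity_mul (prime_cyclotomic hd)
    (finiteMultiplicity_cyclotomic hd hne), multiplicity_geomSum hd,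
    multiplicity_one_add hd (by omega)]

end Weight

/-! ### The combinatorial weight -/

section Component

variable {Γ : SimpleGraph ℕ} {σ τ A C : Finset ℕ} {u v w : ℕ}

/-- Adjacency inside `σ`. -/
def Link (Γ : SimpleGraph ℕ) (σ : Finset ℕ) (u v : ℕ) : Prop := u ∈ σ ∧ v ∈ σ ∧ Γ.Adj u v

lemma mem_component_iff :
    u ∈ component Γ σ v ↔ v ∈ σ ∧ Relation.ReflTransGen (Link Γ σ) v u := by
  classical
  unfold component; rw [mem_filter]; constructor
  · rintro ⟨-, hv, hu, h⟩; refine ⟨hv, ?_⟩; rw [SimpleGraph.reachable_iff_reflTransGen] at h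
    have key : ∀ a b : {x | x ∈ σ}, Relation.ReflTransGen (Γ.induce {x | x ∈ σ}).Adj a b →
        Relation.ReflTransGen (Link Γ σ) a b := by
      intro a b hab
      induction hab with
      | refl => exact Relation.ReflTransGen.refl
      | @tail b c _ hbc ih => exact ih.tail ⟨b.2, c.2, by simpa using hbc⟩
    exact key _ _ h
  · rintro ⟨hv, h⟩
    induction h with
    | refl => exact ⟨hv, hv, hv, SimpleGraph.Reachable.refl _⟩
    | tail _ hbc ih =>
      obtain ⟨_, _, hb, hr⟩ := ih; refine ⟨hbc.2.1, hv, hbc.2.1, hr.trans ?_⟩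
      apply SimpleGraph.Adj.reachable; simpa using hbc.2.2

lemma component_subset : component Γ σ v ⊆ σ := by
  classical
  exact filter_subset _ _

lemma self_mem_component (hv : v ∈ σ) : v ∈ component Γ σ v :=
  mem_component_iff.2 ⟨hv, Relation.ReflTransGen.refl⟩

lemma component_eq_empty (hv : v ∉ σ) : component Γ σ v = ∅ := by
  ext u; simp [mem_component_iff, hv]

lemma Link.symm (h : Link Γ σ u v) : Link Γ σ v u := ⟨h.2.1, h.1, h.2.2.symm⟩

lemma mem_component_symm (h : u ∈ component Γ σ v) : v ∈ component Γ σ u := by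
  have hu := component_subset h; rw [mem_component_iff] at h ⊢; refine ⟨hu, ?_⟩; have h2 := h.2
  clear hu h
  induction h2 with
  | refl => exact Relation.ReflTransGen.refl
  | tail _ hbc ih => exact Relation.ReflTransGen.head (Link.symm hbc) ih

lemma mem_component_trans (h : u ∈ component Γ σ v) (h' : w ∈ component Γ σ u) :
    w ∈ component Γ σ v := by
  rw [mem_component_iff] at h h' ⊢; exact ⟨h.1, h.2.trans h'.2⟩

lemma component_eq (h : u ∈ component Γ σ v) : component Γ σ u = component Γ σ v := by
  ext w; exact ⟨mem_component_trans h, mem_component_trans (mem_component_symm h)⟩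

lemma mem_component_of_adj (h : u ∈ component Γ σ v) (hw : w ∈ σ) (hadj : Γ.Adj u w) :
    w ∈ component Γ σ v := by
  have hu := component_subset h; rw [mem_component_iff] at h ⊢; exact ⟨h.1, h.2.tail ⟨hu, hw, hadj⟩⟩

lemma component_mono (h : τ ⊆ σ) : component Γ τ v ⊆ component Γ σ v := by
  intro u hu; rw [mem_component_iff] at hu ⊢; refine ⟨h hu.1, ?_⟩; have h2 := hu.2; clear hu
  induction h2 with
  | refl => exact Relation.ReflTransGen.refl
  | tail _ hbc ih => exact ih.tail ⟨h hbc.1, h hbc.2.1, hbc.2.2⟩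

/-- There is no edge between `A` and `C`. -/
def Separated (Γ : SimpleGraph ℕ) (A C : Finset ℕ) : Prop := ∀ u ∈ A, ∀ v ∈ C, ¬ Γ.Adj u v

lemma Separated.symm (h : Separated Γ A C) : Separated Γ C A :=
  fun u hu v hv hadj => h v hv u hu hadj.symm

lemma Separated.mono {A' C' : Finset ℕ} (h : Separated Γ A C) (hA : A' ⊆ A) (hC : C' ⊆ C) :
    Separated Γ A' C' := fun u hu v hv => h u (hA hu) v (hC hv)

/-- The induced subgraph on `C` is connected (or empty). -/
def PreConn (Γ : SimpleGraph ℕ) (C : Finset ℕ) : Prop := ∀ u ∈ C, ∀ v ∈ C, v ∈ component Γ C u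

lemma component_union (h : Separated Γ A C) (hv : v ∈ A) :
    component Γ (A ∪ C) v = component Γ A v := by
  refine Finset.Subset.antisymm (fun u hu => ?_) (component_mono subset_union_left)
  rw [mem_component_iff] at hu; obtain ⟨-, hu⟩ := hu
  induction hu with
  | refl => exact self_mem_component hv
  | tail _ hbc ih =>
    refine mem_component_of_adj ih ?_ hbc.2.2; rcases mem_union.1 hbc.2.1 with h1 | h1
    · exact h1
    · exact absurd hbc.2.2 (h _ (component_subset ih) _ h1)

lemma PreConn.component_eq (h : PreConn Γ C) (hv : v ∈ C) : component Γ C v = C :=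
  Finset.Subset.antisymm component_subset fun u hu => h v hv u hu

lemma component_eq_of_separated (hC : C ⊆ σ) (hv : v ∈ C) (h : PreConn Γ C)
    (hs : Separated Γ C (σ \ C)) : component Γ σ v = C := by
  have := component_union hs hv; rw [union_sdiff_of_subset hC] at this; rw [this, h.component_eq hv]

end Component

section Weight

/-- The weight of a component of type `D` with `k` vertices. -/
def weightD (d k : ℕ) : ℕ := if Even d then evenQuot (d / 2) k else k / d

open Classical in
/-- The weight of a connected set of vertices: of type `D` if it has a branching vertex, of type `A`
otherwise. -/
noncomputable def compWeight (Γ : SimpleGraph ℕ) (d : ℕ) (C : Finset ℕ) : ℕ :=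
  if ∃ x ∈ C, 3 ≤ (C.filter (Γ.Adj x)).card then weightD d C.card else (C.card + 1) / d

/-- The combinatorial weight of a set of vertices. -/
noncomputable def gweight (Γ : SimpleGraph ℕ) (d : ℕ) (σ : Finset ℕ) : ℕ :=
  ∑ C ∈ σ.image (component Γ σ), compWeight Γ d C

variable {Γ : SimpleGraph ℕ} {d : ℕ} {σ τ A C : Finset ℕ} {u v w : ℕ}

lemma gweight_union (h : Separated Γ A C) (hd : Disjoint A C) :
    gweight Γ d (A ∪ C) = gweight Γ d A + gweight Γ d C := by
  have h1 : ∀ v ∈ A, component Γ (A ∪ C) v = component Γ A v := fun v hv => component_union h hv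
  have h2 : ∀ v ∈ C, component Γ (A ∪ C) v = component Γ C v := fun v hv => by
    rw [union_comm, component_union h.symm hv]
  unfold gweight
  rw [image_union, image_congr (s := A) (g := component Γ A) (fun v hv => h1 v hv),
    image_congr (s := C) (g := component Γ C) (fun v hv => h2 v hv), sum_union]
  rw [disjoint_left]; rintro X hX hX'; obtain ⟨v, hv, rfl⟩ := mem_image.1 hX
  obtain ⟨u, hu, he⟩ := mem_image.1 hX'; have hm := self_mem_component (Γ := Γ) hv; rw [← he] at hm
  exact disjoint_left.1 hd hv (component_subset hm)

lemma gweight_sdiff (hC : C ⊆ σ) (h : Separated Γ C (σ \ C)) :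
    gweight Γ d σ = gweight Γ d C + gweight Γ d (σ \ C) := by
  rw [← gweight_union h disjoint_sdiff, union_sdiff_of_subset hC]

lemma gweight_of_preConn (hd : 2 ≤ d) (h : PreConn Γ C) : gweight Γ d C = compWeight Γ d C := by
  unfold gweight
  by_cases hC : C = ∅
  -- The empty set has no component, whereas `compWeight` treats it as a path with no vertex, of
  -- weight `1 / d = 0`.
  · subst hC; have : 1 / d = 0 := Nat.div_eq_of_lt (by omega); simp [compWeight, this]
  · have : C.image (component Γ C) = {C} := by
      rw [image_congr (g := fun _ => C) (fun v hv => h.component_eq hv),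
        image_const (nonempty_iff_ne_empty.2 hC)]
    rw [this, sum_singleton]

lemma component_image {Γ' : SimpleGraph ℕ} {ρ : ℕ → ℕ}
    (hadj : ∀ i ∈ σ, ∀ j ∈ σ, (Γ'.Adj (ρ i) (ρ j) ↔ Γ.Adj i j)) (hv : v ∈ σ) :
    component Γ' (σ.image ρ) (ρ v) = (component Γ σ v).image ρ := by
  ext u; rw [mem_image]; constructor
  · intro hu; obtain ⟨-, hr⟩ := mem_component_iff.1 hu; clear hu
    induction hr with
    | refl => exact ⟨v, self_mem_component hv, rfl⟩
    | tail _ hbc ih =>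
      obtain ⟨b, hb, rfl⟩ := ih; obtain ⟨c, hc, rfl⟩ := mem_image.1 hbc.2.1
      exact ⟨c, mem_component_of_adj hb hc ((hadj b (component_subset hb) c hc).1 hbc.2.2), rfl⟩
  · rintro ⟨u, hu, rfl⟩; obtain ⟨-, hr⟩ := mem_component_iff.1 hu; clear hu
    induction hr with
    | refl => exact self_mem_component (mem_image_of_mem _ hv)
    | tail _ hbc ih =>
      exact mem_component_of_adj ih (mem_image_of_mem _ hbc.2.1)
        ((hadj _ hbc.1 _ hbc.2.1).2 hbc.2.2)

/-- The weight depends on the induced graph only. This makes every "construct as in" of the recipe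
compatible with weights. -/
lemma gweight_image {Γ' : SimpleGraph ℕ} {ρ : ℕ → ℕ} (hρ : Set.InjOn ρ σ)
    (hadj : ∀ i ∈ σ, ∀ j ∈ σ, (Γ'.Adj (ρ i) (ρ j) ↔ Γ.Adj i j)) :
    gweight Γ' d (σ.image ρ) = gweight Γ d σ := by
  classical
  unfold gweight
  have hw : ∀ C ⊆ σ, compWeight Γ' d (C.image ρ) = compWeight Γ d C := by
    intro C hC; have hinj : Set.InjOn ρ C := hρ.mono (by exact_mod_cast hC)
    have hcard : (C.image ρ).card = C.card := card_image_of_injOn hinj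
    have hf : ∀ x ∈ C, ((C.image ρ).filter (Γ'.Adj (ρ x))).card = (C.filter (Γ.Adj x)).card := by
      intro x hx
      rw [filter_image, card_image_of_injOn (hinj.mono (by
        intro y hy; simp only [coe_filter] at hy; exact hy.1))]
      congr 1; exact filter_congr fun y hy => hadj x (hC hx) y (hC hy)
    have : (∃ x ∈ C.image ρ, 3 ≤ ((C.image ρ).filter (Γ'.Adj x)).card) ↔
        ∃ x ∈ C, 3 ≤ (C.filter (Γ.Adj x)).card := by
      constructor
      · rintro ⟨x, hx, h⟩; obtain ⟨y, hy, rfl⟩ := mem_image.1 hx; exact ⟨y, hy, by rwa [← hf y hy]⟩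
      · rintro ⟨y, hy, h⟩; exact ⟨ρ y, mem_image_of_mem _ hy, by rwa [hf y hy]⟩
    unfold compWeight; simp only [this, hcard]
  have himg : (σ.image ρ).image (component Γ' (σ.image ρ)) =
      (σ.image (component Γ σ)).image (image ρ) := by
    rw [image_image, image_image]; exact image_congr fun v hv => component_image hadj hv
  rw [himg, sum_image]
  · refine sum_congr rfl fun C hC => ?_; obtain ⟨v, hv, rfl⟩ := mem_image.1 hC
    exact hw _ component_subset
  · intro C hC C' hC' h; obtain ⟨v, hv, rfl⟩ := mem_image.1 hC
    obtain ⟨v', hv', rfl⟩ := mem_image.1 hC'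
    have key : ∀ C ⊆ σ, ∀ C' ⊆ σ, C.image ρ = C'.image ρ → C ⊆ C' := by
      intro C h1 C' h2 h x hx; have := mem_image_of_mem ρ hx; rw [h] at this
      obtain ⟨y, hy, he⟩ := mem_image.1 this; rwa [← hρ (h2 hy) (h1 hx) he]
    exact Finset.Subset.antisymm (key _ component_subset _ component_subset h)
      (key _ component_subset _ component_subset h.symm)

end Weight

/-! ### Connected pieces: paths and forks -/

section Labelling

variable {Γ : SimpleGraph ℕ} {d : ℕ} {C : Finset ℕ} {lam : ℕ → ℕ} {a b u u' : ℕ}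

lemma IsLabelling.mem_component (H : IsLabelling Γ C lam a b) {v w : ℕ} (hv : v ∈ C) (hw : w ∈ C)
    (h : lam v < lam w) : w ∈ component Γ C v := by
  obtain ⟨k, hk⟩ : ∃ k, lam w = lam v + 1 + k := ⟨lam w - lam v - 1, by omega⟩
  induction k generalizing w with
  | zero =>
    exact mem_component_of_adj (self_mem_component hv) hw
      ((H.adj v hv w hw).2 (Or.inl (by omega)))
  | succ k ih =>
    have h1 := H.le v hv; have h2 := H.le w hw
    obtain ⟨x, hx, hxl⟩ := H.surj (lam v + 1 + k) (by omega) (by omega)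
    exact mem_component_of_adj (ih hx (by omega) hxl) hw
      ((H.adj x hx w hw).2 (Or.inl (by omega)))

lemma IsPath.preConn (H : IsPath Γ C lam a b) : PreConn Γ C := by
  intro v hv w hw; rcases lt_trichotomy (lam v) (lam w) with h | h | h
  · exact H.mem_component hv hw h
  · rw [H.inj v hv w hw h]; exact self_mem_component hw
  · exact mem_component_symm (H.mem_component hw hv h)

lemma IsFork.preConn (H : IsFork Γ C lam b u u') (hb : 2 ≤ b) : PreConn Γ C := by
  intro v hv w hw; obtain ⟨x, hx, hxl⟩ := H.surj 2 (by omega) hb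
  rcases lt_trichotomy (lam v) (lam w) with h | h | h
  · exact H.mem_component hv hw h
  · by_cases h1 : lam v = 1
    · exact mem_component_trans (H.mem_component hv hx (by omega))
        (mem_component_symm (H.mem_component hw hx (by omega)))
    · rw [H.inj v hv w hw h h1]; exact self_mem_component hw
  · exact mem_component_symm (H.mem_component hw hv h)

lemma IsLabelling.image_eq (H : IsLabelling Γ C lam a b) : C.image lam = Icc a b := by
  ext j; simp only [mem_image, mem_Icc]; constructor
  · rintro ⟨v, hv, rfl⟩; exact H.le v hv
  · rintro ⟨h1, h2⟩; exact H.surj j h1 h2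

lemma IsPath.card_eq (H : IsPath Γ C lam a b) : C.card = b + 1 - a := by
  rw [← Nat.card_Icc, ← H.image_eq, card_image_of_injOn]; exact fun v hv w hw h => H.inj v hv w hw h

lemma IsFork.card_eq (H : IsFork Γ C lam b u u') : C.card = b + 1 := by
  have h1 : (C.erase u').image lam = Icc 1 b := by
    rw [← H.image_eq]; refine Finset.Subset.antisymm (image_subset_image (erase_subset _ _)) ?_
    intro j hj; obtain ⟨v, hv, rfl⟩ := mem_image.1 hj
    by_cases h : v = u'
    · subst h
      exact mem_image.2 ⟨u, mem_erase.2 ⟨H.ne, H.mem_left⟩,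
        by rw [H.lam_left, H.lam_right]⟩
    · exact mem_image_of_mem _ (mem_erase.2 ⟨h, hv⟩)
  have h2 : (C.erase u').card = b := by
    have := congrArg card h1; rw [Nat.card_Icc, card_image_of_injOn] at this
    · simpa using this
    · intro v hv w hw h
      simp only [coe_erase, Set.mem_sdiff, mem_coe, Set.mem_singleton_iff] at hv hw
      by_cases h3 : lam v = 1
      · have e1 := H.eq_or_eq v hv.1 h3; have e2 := H.eq_or_eq w hw.1 (by rw [← h, h3]); grind
      · exact H.inj v hv.1 w hw.1 h h3
  rw [← card_erase_add_one H.mem_right, h2]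

lemma IsPath.compWeight_eq (H : IsPath Γ C lam a b) (hab : a ≤ b + 1) :
    compWeight Γ d C = (b + 2 - a) / d := by
  classical
  unfold compWeight; rw [if_neg, H.card_eq]
  · congr 1; omega
  · rintro ⟨x, hx, h⟩
    have : (C.filter (Γ.Adj x)).card ≤ ({lam x + 1, lam x - 1} : Finset ℕ).card := by
      refine card_le_card_of_injOn lam ?_ ?_
      · intro y hy; simp only [coe_filter, Set.mem_ofPred_eq] at hy
        have := (H.adj x hx y hy.1).1 hy.2; grind
      · intro y hy z hz h; simp only [coe_filter, Set.mem_ofPred_eq] at hy hz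
        exact H.inj y hy.1 z hz.1 h
    grind

/-- `D_3 = A_3`. A fork with three vertices has no vertex of degree three, so `compWeight` regards
it as a path. -/
lemma weightD_three (hd : 2 ≤ d) : weightD d 3 = (3 + 1) / d := by
  unfold weightD; split_ifs with h
  · obtain ⟨h, rfl⟩ := h; rw [show (h + h) / 2 = h by omega]; rcases Nat.lt_or_ge h 4 with h4 | h4
    · interval_cases h <;> simp_all [evenQuot] <;> decide
    · rw [Nat.div_eq_of_lt (by omega)]; unfold evenQuot
      rw [Nat.mod_eq_of_lt (by omega), Nat.div_eq_of_lt (by omega)]; simp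
  · rcases Nat.lt_or_ge d 5 with h4 | h4
    · interval_cases d
      · exact absurd (by decide) h
      · rfl
      · exact absurd (by decide) h
    · rw [Nat.div_eq_of_lt (by omega), Nat.div_eq_of_lt (by omega)]

lemma IsFork.compWeight_eq (hd : 2 ≤ d) (H : IsFork Γ C lam b u u') (hb : 2 ≤ b) :
    compWeight Γ d C = weightD d (b + 1) := by
  classical
  unfold compWeight; rw [H.card_eq]
  by_cases hb3 : 3 ≤ b
  · rw [if_pos]; obtain ⟨x, hx, hxl⟩ := H.surj 2 (by omega) hb
    obtain ⟨y, hy, hyl⟩ := H.surj 3 (by omega) hb3; refine ⟨x, hx, ?_⟩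
    have hsub : ({u, u', y} : Finset ℕ) ⊆ C.filter (Γ.Adj x) := by
      intro z hz; simp only [mem_insert, mem_singleton] at hz; rw [mem_filter]
      have h1 := H.lam_left; have h2 := H.lam_right; rcases hz with rfl | rfl | rfl
      · exact ⟨H.mem_left, (H.adj x hx _ H.mem_left).2 (by omega)⟩
      · exact ⟨H.mem_right, (H.adj x hx _ H.mem_right).2 (by omega)⟩
      · exact ⟨hy, (H.adj x hx _ hy).2 (by omega)⟩
    refine le_trans ?_ (card_le_card hsub); rw [card_eq_three.2 ⟨u, u', y, H.ne, ?_, ?_, rfl⟩]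
    · rintro rfl; have := H.lam_left; omega
    · rintro rfl; have := H.lam_right; omega
  · obtain rfl : b = 2 := by omega
    have hw := weightD_three hd; split_ifs
    · rfl
    · exact hw.symm

lemma IsPath.gweight_eq (hd : 2 ≤ d) (H : IsPath Γ C lam a b) (hab : a ≤ b + 1) :
    gweight Γ d C = (b + 2 - a) / d := by
  rw [gweight_of_preConn hd H.preConn, H.compWeight_eq hab]

lemma IsFork.gweight_eq (hd : 2 ≤ d) (H : IsFork Γ C lam b u u') (hb : 2 ≤ b) :
    gweight Γ d C = weightD d (b + 1) := by
  rw [gweight_of_preConn hd (H.preConn hb), H.compWeight_eq hd hb]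

end Labelling

/-! ### The weight of type `D` as a function of the rank -/

section EvenQuot

variable {h k q r : ℕ}

lemma evenQuot_eq (hq : (0 < r ∧ r < h) ∨ ((r = 0 ∨ r = h) ∧ Even q)) (hh : 0 < h) :
    evenQuot h (q * h + r) = q := by
  have h1 : (q * h + r) % h = r % h := by rw [mul_comm, Nat.mul_add_mod]
  have h2 : (q * h + r) / h = q + r / h := by rw [mul_comm, Nat.mul_add_div hh]
  unfold evenQuot; rw [h1, h2]; rcases hq with ⟨h3, h4⟩ | ⟨rfl | rfl, h4⟩
  · rw [Nat.mod_eq_of_lt h4, Nat.div_eq_of_lt h4]; simp [h3.ne']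
  · simp [h4]
  · rw [Nat.mod_self, Nat.div_self hh]; simp [Nat.even_add_one, h4]

lemma evenQuot_spec (hh : 0 < h) (k : ℕ) : ∃ q r, k = q * h + r ∧ evenQuot h k = q ∧
    ((0 < r ∧ r < h) ∨ ((r = 0 ∨ r = h) ∧ Even q)) := by
  have hk : k / h * h + k % h = k := Nat.div_add_mod' k h; have hlt := Nat.mod_lt k hh
  by_cases h0 : k % h = 0
  · by_cases he : Even (k / h)
    · exact ⟨k / h, 0, by omega, by simp [evenQuot, h0, he], Or.inr ⟨Or.inl rfl, he⟩⟩
    · rw [Nat.not_even_iff_odd] at he; obtain ⟨m, hm⟩ := he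
      refine ⟨2 * m, h, ?_, ?_, Or.inr ⟨Or.inr rfl, by simp⟩⟩
      · rw [← hk, h0, hm]; ring
      · simp [evenQuot, h0, hm]
  · exact ⟨k / h, k % h, hk.symm, by simp [evenQuot, h0], Or.inl ⟨by omega, hlt⟩⟩

lemma evenQuot_bounds (hh : 0 < h) (k : ℕ) :
    evenQuot h k * h ≤ k ∧ k ≤ evenQuot h k * h + h ∧
      (¬ Even (evenQuot h k) → evenQuot h k * h < k ∧ k < evenQuot h k * h + h) := by
  obtain ⟨q, r, rfl, h1, h2⟩ := evenQuot_spec hh k; grind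

/-- The sizes of given weight form an interval, `[qh, (q+1)h]` for `q` even and the open one for `q`
odd. These intervals dictate the pivots `v` and the run lengths `h` and `h - 2` of the recipe. -/
lemma evenQuot_eq_iff (hh : 0 < h) : evenQuot h k = q ↔
    q * h ≤ k ∧ k ≤ q * h + h ∧ (¬ Even q → q * h < k ∧ k < q * h + h) := by
  constructor
  · rintro rfl; exact evenQuot_bounds hh k
  · rintro ⟨h1, h2, h3⟩; obtain ⟨r, rfl⟩ := Nat.exists_eq_add_of_le h1; apply evenQuot_eq _ hh
    grind

lemma evenQuot_mono (hh : 0 < h) {k k' : ℕ} (hk : k ≤ k') : evenQuot h k ≤ evenQuot h k' := by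
  by_contra hlt
  push Not at hlt
  obtain ⟨h1, h2, h3⟩ := evenQuot_bounds hh k; obtain ⟨h4, h5, h6⟩ := evenQuot_bounds hh k'
  have h7 : (evenQuot h k' + 1) * h ≤ evenQuot h k * h := Nat.mul_le_mul_right _ hlt; grind

/-- The increment is the multiplicity of `φ_d` in `(1 + X^b)(1 + ⋯ + X^b)`, the quotient of the
Poincaré polynomials of `D_{b+1}` and `D_b`. For `d = 2h` the first factor counts when `b` is an odd
multiple of `h`, the second when `2h ∣ b + 1`: these are the places where `evenQuot` jumps. -/
lemma weightD_succ {d : ℕ} (hd : 2 ≤ d) {b : ℕ} (hb : 1 ≤ b) :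
    weightD d (b + 1) = weightD d b +
      (((if d ∣ 2 * b then 1 else 0) - if d ∣ b then 1 else 0) + if d ∣ b + 1 then 1 else 0) := by
  unfold weightD
  by_cases hev : Even d
  · obtain ⟨h, rfl⟩ := hev; have hh : 0 < h := by omega
    rw [if_pos (by simp), if_pos (by simp), show (h + h) / 2 = h by omega]
    have e1 : (h + h ∣ 2 * b) ↔ h ∣ b := by
      rw [← two_mul]; exact Nat.mul_dvd_mul_iff_left (by norm_num)
    simp only [e1]; obtain ⟨q, r, hb', hq, hr⟩ := evenQuot_spec hh b
    have hdiv : (h ∣ b) ↔ r = 0 ∨ r = h := by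
      rw [hb', Nat.dvd_add_right (Dvd.intro_left _ rfl)]; constructor
      · rintro ⟨c, rfl⟩; rcases hr with hr | hr
        · exfalso
          have : c < 1 := by
            by_contra hc; have := Nat.mul_le_mul_left h (show 1 ≤ c by omega); omega
          interval_cases c; omega
        · exact hr.1
      · rintro (rfl | rfl) <;> simp
    have hdiv2 : ∀ m s, m = q * h + s → s < h → (h + h ∣ m ↔ s = 0 ∧ Even q) := by
      intro m s hm hs; constructor
      · rintro ⟨c, hc⟩; have h1 : q * h + s = (2 * c) * h := by rw [← hm, hc]; ring
        have h2 : s = 0 := by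
          have := congrArg (· % h) h1; simp only [Nat.mul_mod_left] at this
          rw [mul_comm, Nat.mul_add_mod, Nat.mod_eq_of_lt hs] at this; exact this
        subst h2; have h3 : q = 2 * c := Nat.eq_of_mul_eq_mul_right hh (by simpa using h1)
        exact ⟨rfl, by simp [h3]⟩
      · rintro ⟨rfl, c, rfl⟩; exact ⟨c, by rw [hm]; ring⟩
    rw [hq]; rcases hr with ⟨h1, h2⟩ | ⟨rfl | rfl, h3⟩
    · have n1 : ¬ h ∣ b := by rw [hdiv]; omega
      have n2 : ¬ h + h ∣ b := by rw [hdiv2 b r hb' h2]; omega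
      rw [if_neg n1, if_neg n2]
      by_cases hr1 : r + 1 = h
      · by_cases he : Even q
        · have n3 : ¬ h + h ∣ b + 1 := by
            rintro ⟨c, hc⟩; have : (q + 1) * h = (2 * c) * h := by grind
            have := Nat.eq_of_mul_eq_mul_right hh this; obtain ⟨x, rfl⟩ := he; omega
          rw [if_neg n3, hb', add_assoc, hr1, evenQuot_eq (Or.inr ⟨Or.inr rfl, he⟩) hh]; rfl
        · have he' : Even (q + 1) := by rw [Nat.even_add_one]; exact he
          have n3 : h + h ∣ b + 1 := by obtain ⟨c, hc⟩ := he'; refine ⟨c, ?_⟩; grind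
          rw [if_pos n3, hb', show q * h + r + 1 = (q + 1) * h + 0 by rw [← hr1]; ring,
            evenQuot_eq (Or.inr ⟨Or.inl rfl, he'⟩) hh]
      · have n3 : ¬ h + h ∣ b + 1 := by rw [hdiv2 (b + 1) (r + 1) (by omega) (by omega)]; omega
        rw [if_neg n3, hb', add_assoc, evenQuot_eq (Or.inl ⟨by omega, by omega⟩) hh]; rfl
    · have n1 : h ∣ b := by rw [hdiv]; omega
      have n2 : h + h ∣ b := by rw [hdiv2 b 0 hb' hh]; exact ⟨rfl, h3⟩
      have n3 : ¬ h + h ∣ b + 1 := by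
        intro h4; have := (Nat.dvd_add_right n2).1 h4; have := Nat.le_of_dvd one_pos this; omega
      have h5 : (0 < 1 ∧ 1 < h) ∨ ((1 = 0 ∨ 1 = h) ∧ Even q) := by grind
      rw [if_pos n1, if_pos n2, if_neg n3, hb', add_zero, evenQuot_eq h5 hh]; rfl
    · have n1 : r ∣ b := by rw [hdiv]; omega
      have n2 : ¬ r + r ∣ b := by
        rintro ⟨c, hc⟩; have : (q + 1) * r = (2 * c) * r := by grind
        have := Nat.eq_of_mul_eq_mul_right hh this; obtain ⟨x, rfl⟩ := h3; omega
      rw [if_pos n1, if_neg n2]; have e2 : b + 1 = (q + 1) * r + 1 := by rw [hb']; ring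
      have ho : ¬ Even (q + 1) := by rw [Nat.even_add_one]; simpa using h3
      by_cases h1 : 1 < r
      · have n3 : ¬ r + r ∣ b + 1 := by
          intro h4; have h5 : r ∣ b + 1 := (Dvd.intro_left 2 (by ring)).trans h4
          have := (Nat.dvd_add_right n1).1 h5; have := Nat.le_of_dvd one_pos this; omega
        rw [if_neg n3, e2, evenQuot_eq (Or.inl ⟨one_pos, h1⟩) hh]
      · obtain rfl : r = 1 := by omega
        have n3 : 1 + 1 ∣ b + 1 := by grind
        rw [if_pos n3, e2, show (q + 1) * 1 + 1 = (q + 2) * 1 + 0 by ring]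
        rw [evenQuot_eq (Or.inr ⟨Or.inl rfl, by rw [Nat.even_add]; simpa using h3⟩) hh]
  · rw [if_neg hev, if_neg hev, Nat.succ_div]
    have : (d ∣ 2 * b) ↔ d ∣ b := by
      constructor
      · intro h
        exact (Nat.Coprime.dvd_of_dvd_mul_left
          ((Nat.coprime_two_right).2 (Nat.not_even_iff_odd.1 hev)) h)
      · exact fun h => h.mul_left 2
    simp only [this]; omega

end EvenQuot

/-! ### Components with a removable end -/

section Erase

variable {Γ : SimpleGraph ℕ} {C : Finset ℕ} {lam : ℕ → ℕ} {a b u u' p : ℕ}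

lemma IsPath.erase_top (H : IsPath Γ C lam a b) (hb : 1 ≤ b) (hp : p ∈ C) (hpb : lam p = b) :
    IsPath Γ (C.erase p) lam a (b - 1) where
  le v hv := by
    rw [mem_erase] at hv; have h1 := H.le v hv.2
    have h2 : lam v ≠ b := fun h => hv.1 (H.inj v hv.2 p hp (h.trans hpb.symm)); omega
  surj j h1 h2 := by obtain ⟨v, hv, hj⟩ := H.surj j h1 (by omega); grind
  adj v hv w hw := H.adj v (mem_of_mem_erase hv) w (mem_of_mem_erase hw)
  inj v hv w hw := H.inj v (mem_of_mem_erase hv) w (mem_of_mem_erase hw)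

lemma IsFork.erase_top (H : IsFork Γ C lam b u u') (hb : 2 ≤ b) (hp : p ∈ C) (hpb : lam p = b) :
    IsFork Γ (C.erase p) lam (b - 1) u u' where
  le v hv := by
    rw [mem_erase] at hv; have h1 := H.le v hv.2
    have h2 : lam v ≠ b := fun h => hv.1 (H.inj v hv.2 p hp (h.trans hpb.symm) (by omega)); omega
  surj j h1 h2 := by obtain ⟨v, hv, hj⟩ := H.surj j h1 (by omega); grind
  adj v hv w hw := H.adj v (mem_of_mem_erase hv) w (mem_of_mem_erase hw)
  ne := H.ne
  mem_left := mem_erase.2 ⟨by rintro rfl; have := H.lam_left; omega, H.mem_left⟩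
  mem_right := mem_erase.2 ⟨by rintro rfl; have := H.lam_right; omega, H.mem_right⟩
  lam_left := H.lam_left
  lam_right := H.lam_right
  eq_or_eq v hv := H.eq_or_eq v (mem_of_mem_erase hv)
  inj v hv w hw := H.inj v (mem_of_mem_erase hv) w (mem_of_mem_erase hw)

/-- A set of vertices closed under adjacency in `s` which is a path, or a fork with at least four
vertices. -/
def HasLeaf (Γ : SimpleGraph ℕ) (s : Finset ℕ) : Prop :=
  ∃ C ⊆ s, Separated Γ C (s \ C) ∧ ∃ lam p b, p ∈ C ∧ lam p = b ∧
    ((∃ a, 1 ≤ a ∧ IsPath Γ C lam a b) ∨ ∃ u u', 3 ≤ b ∧ IsFork Γ C lam b u u')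

/-- Only the lowest label may be shared by two vertices. A single lowest vertex gives a path; two of
them give isolated vertices, a path `A_3` or a genuine fork, according as the run has one, two or
more labels. -/
lemma hasLeaf_of_run {s : Finset ℕ} {a b : ℕ} (hab : a ≤ b)
    (hadj : ∀ v ∈ s, ∀ w ∈ s, (Γ.Adj v w ↔ lam v + 1 = lam w ∨ lam w + 1 = lam v))
    (hsurj : ∀ j, a ≤ j → j ≤ b → ∃ v ∈ s, lam v = j)
    (hlow : ∀ v ∈ s, lam v + 1 ≠ a) (hhigh : ∀ v ∈ s, lam v ≠ b + 1)
    (hu : u ∈ s) (hu' : u' ∈ s) (hua : lam u = a) (hua' : lam u' = a)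
    (heq : ∀ v ∈ s, lam v = a → v = u ∨ v = u')
    (hinj : ∀ v ∈ s, ∀ w ∈ s, lam v = lam w → a < lam v → lam v ≤ b → v = w) : HasLeaf Γ s := by
  have hsep : Separated Γ (s.filter fun v => a ≤ lam v ∧ lam v ≤ b)
      (s \ s.filter fun v => a ≤ lam v ∧ lam v ≤ b) := by
    intro v hv w hw h; grind
  by_cases huu : u = u'
  · subst huu; obtain ⟨p, hp, hpb⟩ := hsurj b hab le_rfl
    refine ⟨_, filter_subset _ _, hsep, fun v => lam v + 1, p, b + 1, ?_, by simp [hpb],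
      Or.inl ⟨a + 1, by omega, ?_, ?_⟩⟩
    · rw [mem_filter]; exact ⟨hp, by omega, by omega⟩
    · refine ⟨?_, ?_, ?_⟩
      · intro v hv; rw [mem_filter] at hv; omega
      · intro j h1 h2; obtain ⟨v, hv, hj⟩ := hsurj (j - 1) (by omega) (by omega); grind
      · grind
    · grind
  · by_cases hb : b = a
    · subst hb
      refine ⟨{u}, by simpa using hu, ?_, fun _ => 1, u, 1, by simp, rfl, Or.inl ⟨1, le_rfl, ⟨?_, ?_, ?_⟩,
        ?_⟩⟩
      · intro v hv w hw h; grind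
      · simp
      · intro j h1 h2; exact ⟨u, by simp, by omega⟩
      · grind
      · grind
    · by_cases hb' : b = a + 1
      · obtain ⟨x, hx, hxl⟩ := hsurj b hab le_rfl; have hux : u ≠ x := by rintro rfl; omega
        have hux' : u' ≠ x := by rintro rfl; omega
        have hC : ∀ v, v ∈ s.filter (fun v => a ≤ lam v ∧ lam v ≤ b) ↔ v = u ∨ v = x ∨ v = u' := by
          grind
        have a1 := (hadj u hu x hx).2 (by omega); have a2 := (hadj u' hu' x hx).2 (by omega)
        have a3 : ¬ Γ.Adj u u' := fun h => by have := (hadj u hu u' hu').1 h; omega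
        refine ⟨_, filter_subset _ _, hsep,
          fun v => if v = u then 1 else if v = x then 2 else 3, u', 3, (hC _).2 (by simp),
          by simp [hux', Ne.symm huu],
          Or.inl ⟨1, le_rfl, ⟨?_, ?_, ?_⟩, ?_⟩⟩
        · intro v hv; split_ifs <;> omega
        · intro j h1 h2; interval_cases j
          · exact ⟨u, (hC _).2 (by simp), by simp⟩
          · exact ⟨x, (hC _).2 (by simp), by simp [hux.symm]⟩
          · exact ⟨u', (hC _).2 (by simp), by simp [hux', Ne.symm huu]⟩
        · grind
        · grind
      · obtain ⟨p, hp, hpb⟩ := hsurj b hab le_rfl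
        refine ⟨_, filter_subset _ _, hsep, fun v => lam v + 1 - a, p, b + 1 - a,
          ?_, by simp [hpb], Or.inr ⟨u, u', by omega, ⟨?_, ?_, ?_⟩, huu, ?_, ?_, by omega, by omega, ?_, ?_⟩⟩
        · rw [mem_filter]; exact ⟨hp, by omega, by omega⟩
        · intro v hv; rw [mem_filter] at hv; omega
        · intro j h1 h2; obtain ⟨v, hv, hj⟩ := hsurj (j + a - 1) (by omega) (by omega); grind
        · grind
        · exact mem_filter.2 ⟨hu, by omega, by omega⟩
        · exact mem_filter.2 ⟨hu', by omega, by omega⟩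
        · grind
        · grind

lemma gweight_erase_sdiff {s : Finset ℕ} {d : ℕ} (hC : C ⊆ s) (hsep : Separated Γ C (s \ C))
    (hp : p ∈ C) : gweight Γ d (s.erase p) = gweight Γ d (C.erase p) + gweight Γ d (s \ C) := by
  have h : s.erase p \ C.erase p = s \ C := by grind
  rw [gweight_sdiff (erase_subset_erase _ hC), h]; rw [h]
  exact hsep.mono (erase_subset _ _) (Finset.Subset.refl _)

end Erase

/-! ### The Coxeter graph of type `D̃_n`: finiteness and weights -/

section Affine

variable {n : ℕ}

lemma graphDTilde_adj (hn : 4 ≤ n) (a b : ℕ) : (graphDTilde n).Adj a b ↔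
    ((a = 0 ∧ b = 2) ∨ (1 ≤ a ∧ b = a + 1 ∧ b + 1 ≤ n) ∨ (a + 2 = n ∧ b = n)) ∨
    ((b = 0 ∧ a = 2) ∨ (1 ≤ b ∧ a = b + 1 ∧ a + 1 ≤ n) ∨ (b + 2 = n ∧ a = n)) := by
  unfold graphDTilde; rw [SimpleGraph.fromRel_adj]; omega

/-- The position of a vertex of the graph of type `D̃_n` along the path from `1` to `n - 1`. -/
def place (n v : ℕ) : ℕ := if v = 0 then 1 else if v = n then n - 1 else v

lemma place_cases (n v : ℕ) : (v = 0 ∧ place n v = 1) ∨ (v ≠ 0 ∧ v = n ∧ place n v = n - 1) ∨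
    (v ≠ 0 ∧ v ≠ n ∧ place n v = v) := by
  unfold place; split_ifs <;> tauto

/-- Giving the twins `0, 1` and the twins `n - 1, n` a common place turns the graph into a path as
far as adjacency is concerned. Components are then runs of occupied places. -/
lemma graphDTilde_adj_place (hn : 4 ≤ n) {v w : ℕ} (hv : v ≤ n) (hw : w ≤ n) :
    (graphDTilde n).Adj v w ↔ place n v + 1 = place n w ∨ place n w + 1 = place n v := by
  rw [graphDTilde_adj hn]
  rcases place_cases n v with h | h | h <;> rcases place_cases n w with h' | h' | h' <;> omega

lemma exists_run {P : ℕ → Prop} {N j₀ : ℕ} (h0 : P j₀) (hN : ∀ j, P j → j ≤ N) :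
    ∃ a b, a ≤ b ∧ (∀ j, a ≤ j → j ≤ b → P j) ∧ (∀ j, P j → a ≤ j) ∧ ¬ P (b + 1) := by
  classical
  have hex : ∃ j, P j := ⟨j₀, h0⟩; obtain ⟨a, ha⟩ : ∃ a, a = Nat.find hex := ⟨_, rfl⟩
  have haP : P a := ha ▸ Nat.find_spec hex
  have hmin : ∀ j, P j → a ≤ j := fun j hj => ha ▸ Nat.find_min' hex hj
  have hex2 : ∃ k, ¬ P (a + 1 + k) := ⟨N, fun h => by have := hN _ h; omega⟩
  refine ⟨a, a + Nat.find hex2, by omega, ?_, hmin, ?_⟩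
  · intro j h1 h2; rcases Nat.eq_or_lt_of_le h1 with rfl | h3
    · exact haP
    · have := Nat.find_min hex2 (m := j - a - 1) (by omega); grind
  · grind

/-- Take the first run of occupied places. A run of more than one place with both extreme places
doubled contains all vertices; so in a proper subset at most one end is doubled, and it becomes the
low end after reversing the places if necessary. -/
lemma hasLeaf_graphDTilde (hn : 4 ≤ n) {s : Finset ℕ} (hs : s ⊆ range (n + 1))
    (hne : s.Nonempty) (hfull : s ≠ range (n + 1)) : HasLeaf (graphDTilde n) s := by
  have hle : ∀ v ∈ s, v ≤ n := fun v hv => by have := mem_range.1 (hs hv); omega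
  have hpl : ∀ v ∈ s, 1 ≤ place n v ∧ place n v ≤ n - 1 := fun v hv => by
    have := hle v hv; rcases place_cases n v with h | h | h <;> omega
  obtain ⟨x, hx⟩ := hne
  obtain ⟨a, b, hab, hrun, hmin, hb⟩ := exists_run (P := fun j => ∃ v ∈ s, place n v = j)
    ⟨x, hx, rfl⟩ (N := n) (fun j ⟨v, hv, h⟩ => by have := hpl v hv; omega)
  obtain ⟨u, hu, hua⟩ := hrun a le_rfl hab; obtain ⟨t, ht, htb⟩ := hrun b hab le_rfl
  have hlow : ∀ v ∈ s, a ≤ place n v := fun v hv => hmin _ ⟨v, hv, rfl⟩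
  have two : ∀ j, (∃ v ∈ s, place n v = j) → ∃ u ∈ s, ∃ u' ∈ s, place n u = j ∧ place n u' = j ∧
      ∀ v ∈ s, place n v = j → v = u ∨ v = u' := by
    rintro j ⟨v, hv, hj⟩
    by_cases h : ∀ w ∈ s, place n w = j → w = v
    · grind
    · push Not at h
      obtain ⟨w, hw, hwj, hwv⟩ := h; refine ⟨v, hv, w, hw, hj, hwj, fun z hz hzj => ?_⟩
      have := hle z hz; have := hle v hv; have := hle w hw
      rcases place_cases n v with h | h | h <;> rcases place_cases n w with h' | h' | h' <;>
        rcases place_cases n z with h'' | h'' | h'' <;> omega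
  by_cases hends : n - 1 ∈ s ∧ n ∈ s ∧ b = n - 1 ∧ a < n - 1
  · obtain ⟨h1, h2, rfl, h3⟩ := hends
    have hnot : ¬ (a = 1 ∧ 0 ∈ s ∧ 1 ∈ s) := by
      rintro ⟨rfl, h4, h5⟩; apply hfull; refine Finset.Subset.antisymm hs fun j hj => ?_
      rw [mem_range] at hj
      by_cases h6 : j = 0
      · rwa [h6]
      by_cases h7 : j = 1
      · rwa [h7]
      by_cases h8 : j = n
      · rwa [h8]
      by_cases h9 : j = n - 1
      · rwa [h9]
      obtain ⟨v, hv, hvj⟩ := hrun j (by omega) (by omega)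
      have : v = j := by rcases place_cases n v with h | h | h <;> omega
      rwa [← this]
    have p1 : place n (n - 1) = n - 1 := by rcases place_cases n (n - 1) with h | h | h <;> omega
    have p2 : place n n = n - 1 := by rcases place_cases n n with h | h | h <;> omega
    refine hasLeaf_of_run (lam := fun v => n - place n v) (a := 1) (b := n - a) (u := n - 1)
      (u' := n) (by omega) ?_ ?_ ?_ ?_ h1 h2 (by omega) (by omega) ?_ ?_
    · intro v hv w hw; rw [graphDTilde_adj_place hn (hle v hv) (hle w hw)]; have := hpl v hv
      have := hpl w hw; omega
    · intro j h4 h5; obtain ⟨v, hv, hvj⟩ := hrun (n - j) (by omega) (by omega)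
      exact ⟨v, hv, by omega⟩
    · intro v hv; have := hpl v hv; omega
    · intro v hv; have := hlow v hv; omega
    · intro v hv h0; have := hle v hv; have := hpl v hv
      rcases place_cases n v with h | h | h <;> omega
    · intro v hv w hw h4 h5 h6; replace h4 : n - place n v = n - place n w := h4
      replace h5 : 1 < n - place n v := h5; have hv1 := hlow v hv; have hv3 := hpl v hv
      have hw3 := hpl w hw; have hu3 := hpl u hu; have hw1 := hlow w hw; have hv2 := hle v hv
      have hw2 := hle w hw
      rcases place_cases n v with h | h | h <;> rcases place_cases n w with h' | h' | h' <;>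
        first
        | omega
        | (exfalso; apply hnot
           first
           | (have e1 : v = 0 := by omega
              have e2 : w = 1 := by omega
              subst e1; subst e2; exact ⟨by omega, hv, hw⟩)
           | (have e1 : v = 1 := by omega
              have e2 : w = 0 := by omega
              subst e1; subst e2; exact ⟨by omega, hw, hv⟩))
  · obtain ⟨u, hu, u', hu', hua, hua', heq⟩ := two a ⟨u, hu, hua⟩
    refine hasLeaf_of_run (lam := place n) hab ?_ hrun ?_ ?_ hu hu' hua hua' heq ?_
    · intro v hv w hw; exact graphDTilde_adj_place hn (hle v hv) (hle w hw)
    · intro v hv; have := hlow v hv; omega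
    · intro v hv h; exact hb ⟨v, hv, h⟩
    · intro v hv w hw h4 h5 h6; have hv2 := hle v hv; have hw2 := hle w hw; have hub := hpl t ht
      have hua := hpl u hu
      rcases place_cases n v with h | h | h <;> rcases place_cases n w with h' | h' | h' <;>
        first
        | omega
        | (exfalso; apply hends
           first
           | (have e1 : v = n := by omega
              have e2 : w = n - 1 := by omega
              subst e1; subst e2; exact ⟨hw, hv, by omega, by omega⟩)
           | (have e1 : v = n - 1 := by omega
              have e2 : w = n := by omega
              subst e1; subst e2; exact ⟨hv, hw, by omega, by omega⟩))

lemma simplyLaced_matrixDTilde : SimplyLaced (matrixDTilde n) := by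
  intro i j hij; simp only [matrixDTilde, Matrix.of_apply, if_neg hij]; split_ifs <;> simp

lemma matrixDTilde_eq_three (i j : Fin (n + 1)) : matrixDTilde n i j = 3 ↔
    (graphDTilde n).Adj (Fin.valEmbedding i) (Fin.valEmbedding j) := by
  simp only [matrixDTilde, Matrix.of_apply, Fin.valEmbedding_apply]
  by_cases hij : i = j
  · subst hij; simp
  · simp only [if_neg hij]; split_ifs with h <;> simp [h]

variable {W : Type*} [Group W] (cs : CoxeterSystem (matrixDTilde n) W)

/-- The invariant functional has the coefficients of the null root: `1` on the four leaves and `2`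
on the inner vertices. -/
lemma univ_notMem_simplices (hn : 4 ≤ n) : (univ : Finset (Fin (n + 1))) ∉ simplices cs := by
  intro h
  have hinf : Infinite W := by
    refine infinite_of_invariant cs simplyLaced_matrixDTilde
      (fun j => if (j : ℕ) ≤ 1 ∨ n - 1 ≤ (j : ℕ) then 1 else 2) ?_ 0 (by simp)
    intro i
    have key : ∀ T : Finset ℕ, (∀ j, j ∈ T ↔ j ∈ range (n + 1) ∧ (graphDTilde n).Adj i j) →
        ∑ j : Fin (n + 1), (if matrixDTilde n i j = 3 then
          (if (j : ℕ) ≤ 1 ∨ n - 1 ≤ (j : ℕ) then (1 : ℤ) else 2) else 0) =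
        ∑ j ∈ T, (if j ≤ 1 ∨ n - 1 ≤ j then (1 : ℤ) else 2) := by
      classical
      intro T hT
      have : T = (range (n + 1)).filter ((graphDTilde n).Adj i) := by ext j; rw [hT, mem_filter]
      rw [this, sum_filter, ← Fin.sum_univ_eq_sum_range (fun j =>
        if (graphDTilde n).Adj i j then (if j ≤ 1 ∨ n - 1 ≤ j then (1 : ℤ) else 2) else 0)]
      simp only [matrixDTilde_eq_three, Fin.valEmbedding_apply]
    have hi := i.2
    have cases : (i : ℕ) ≤ 1 ∨ ((i : ℕ) = 2 ∧ n = 4) ∨ ((i : ℕ) = 2 ∧ 5 ≤ n) ∨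
      (3 ≤ (i : ℕ) ∧ (i : ℕ) + 3 ≤ n) ∨ ((i : ℕ) + 2 = n ∧ 5 ≤ n) ∨ n - 1 ≤ (i : ℕ) := by omega
    rcases cases with h | ⟨h, h'⟩ | ⟨h, h'⟩ | ⟨h, h'⟩ | ⟨h, h'⟩ | h
    · rw [key {2} (by intro j; simp only [mem_singleton, mem_range, graphDTilde_adj hn]; omega),
        sum_singleton, if_neg (by omega), if_pos (by omega)]
      rfl
    · rw [key {0, 1, 3, 4} (by
        intro j; simp only [mem_insert, mem_singleton, mem_range, graphDTilde_adj hn]; omega)]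
      rw [h, h']; rfl
    · rw [key {0, 1, 3} (by
        intro j; simp only [mem_insert, mem_singleton, mem_range, graphDTilde_adj hn]; omega),
        sum_insert (by simp), sum_insert (by simp), sum_singleton,
        if_pos (by omega), if_pos (by omega), if_neg (by omega), if_neg (by omega)]
      rfl
    · rw [key {(i : ℕ) - 1, (i : ℕ) + 1} (by
        intro j; simp only [mem_insert, mem_singleton, mem_range, graphDTilde_adj hn]; omega),
        sum_pair (by omega), if_neg (by omega), if_neg (by omega), if_neg (by omega)]
      rfl
    · rw [key {n, n - 1, n - 3} (by
        intro j; simp only [mem_insert, mem_singleton, mem_range, graphDTilde_adj hn]; omega),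
        sum_insert (by simp only [mem_insert, mem_singleton]; omega),
        sum_pair (by omega),
        if_pos (by omega), if_pos (by omega), if_neg (by omega), if_neg (by omega)]
      rfl
    · rw [key {n - 2} (by intro j; simp only [mem_singleton, mem_range, graphDTilde_adj hn]; omega),
        sum_singleton, if_neg (by omega), if_pos (by omega)]
      rfl
  have : (parabolic cs univ : Set W) = Set.univ := by
    simp only [parabolic, coe_univ, Set.image_univ]; rw [cs.subgroup_closure_range_simple]; rfl
  change (parabolic cs univ : Set W).Finite at h; rw [this] at h
  exact (Set.infinite_univ (α := W)) h

/-- Induction on the size, removing the end of a component of type `A` or `D`: finiteness and the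
weight are carried from `σ.erase p` to `σ` by `IsPath.weight_eq` and `IsFork.weight_eq`, and
`gweight` changes by the same increment. -/
theorem mem_simplices_and_weight_eq (hn : 4 ≤ n) {d : ℕ} (hd : 2 ≤ d) (σ : Finset (Fin (n + 1)))
    (hσ : σ ≠ univ) : σ ∈ simplices cs ∧
      weight cs d σ = gweight (graphDTilde n) d (σ.map Fin.valEmbedding) := by
  induction hc : σ.card using Nat.strong_induction_on generalizing σ with
  | _ c ih =>
    rcases σ.eq_empty_or_nonempty with rfl | hne
    · exact ⟨empty_mem_simplices cs, by rw [weight_empty cs hd]; simp [gweight]⟩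
    have hs : σ.map Fin.valEmbedding ⊆ range (n + 1) := by
      intro v hv; obtain ⟨i, -, rfl⟩ := mem_map.1 hv; exact mem_range.2 i.2
    obtain ⟨C, hC, hsep, lam, p', b, hp', hpb, hleaf⟩ := hasLeaf_graphDTilde hn hs (by simpa using hne)
      (fun h => hσ (by
        apply eq_univ_of_card
        rw [← card_map Fin.valEmbedding, h]; simp))
    obtain ⟨p, hpσ, rfl⟩ := mem_map.1 (hC hp'); subst hpb
    have hcl : ∀ u ∈ C, ∀ v ∈ σ, Fin.valEmbedding v ∉ C →
        ¬ (graphDTilde n).Adj u (Fin.valEmbedding v) := fun u hu v hv hvC =>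
      hsep u hu _ (mem_sdiff.2 ⟨mem_map_of_mem _ hv, hvC⟩)
    have hlt := card_erase_lt_of_mem hpσ
    obtain ⟨h1, h2⟩ := ih _ (hc ▸ hlt) (σ.erase p) (fun h => by
      have := mem_univ p; rw [← h] at this; exact notMem_erase _ _ this) rfl
    rw [map_erase, gweight_erase_sdiff hC hsep hp'] at h2; rw [gweight_sdiff hC hsep]
    rcases hleaf with ⟨a, ha, H⟩ | ⟨u, u', hb, H⟩
    · obtain ⟨h3, h4⟩ := H.weight_eq cs hd simplyLaced_matrixDTilde matrixDTilde_eq_three hC hcl hp'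
        rfl h1
      refine ⟨h3, ?_⟩; have hab := H.le _ hp'
      rw [h4, h2, H.gweight_eq hd (by omega),
        (H.erase_top (by omega) hp' rfl).gweight_eq hd (by omega),
        show lam (Fin.valEmbedding p) - 1 + 2 - a = lam (Fin.valEmbedding p) + 1 - a by omega,
        show lam (Fin.valEmbedding p) + 2 - a = (lam (Fin.valEmbedding p) + 1 - a) + 1 by omega,
        Nat.succ_div]
      omega
    · obtain ⟨h3, h4⟩ := H.weight_eq cs hd simplyLaced_matrixDTilde matrixDTilde_eq_three hC hcl
        (by omega) hp' rfl h1
      refine ⟨h3, ?_⟩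
      rw [h4, h2, H.gweight_eq hd (by omega),
        (H.erase_top (by omega) hp' rfl).gweight_eq hd (by omega),
        show lam (Fin.valEmbedding p) - 1 + 1 = lam (Fin.valEmbedding p) by omega,
        weightD_succ hd (by omega)]
      omega

lemma mem_simplices_iff (hn : 4 ≤ n) (σ : Finset (Fin (n + 1))) :
    σ ∈ simplices cs ↔ σ ≠ univ :=
  ⟨fun h h' => univ_notMem_simplices cs hn (h' ▸ h),
    fun h => (mem_simplices_and_weight_eq cs hn le_rfl σ h).1⟩

end Affine

/-! ### Acyclic matchings given by recipes -/

section Good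

/-- The symmetric difference of `σ` and `{v}`. -/
def toggle (v : ℕ) (σ : Finset ℕ) : Finset ℕ := if v ∈ σ then σ.erase v else insert v σ

lemma toggle_of_mem {v : ℕ} {σ : Finset ℕ} (h : v ∈ σ) : toggle v σ = σ.erase v := if_pos h

lemma toggle_of_notMem {v : ℕ} {σ : Finset ℕ} (h : v ∉ σ) : toggle v σ = insert v σ := if_neg h

/-- A step of an alternating path between two lower ends of matched edges. -/
def Step (K : Set (Finset ℕ)) (π : Finset ℕ → Option ℕ) (τ τ' : Finset ℕ) : Prop :=
  ∃ v v' x, τ ∈ K ∧ π τ = some v ∧ v ∉ τ ∧ τ' ∈ K ∧ π τ' = some v' ∧ v' ∉ τ' ∧ τ' ≠ τ ∧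
    τ' = (insert v τ).erase x

/-- The recipe `π` is an acyclic matching on `K` with critical simplices satisfying `L`, and matched
simplices have the same weight. -/
structure IsGood (K : Set (Finset ℕ)) (w : Finset ℕ → ℕ) (π : Finset ℕ → Option ℕ)
    (L : Finset ℕ → Prop) : Prop where
  mate : ∀ σ ∈ K, ∀ v, π σ = some v →
    toggle v σ ∈ K ∧ π (toggle v σ) = some v ∧ w (toggle v σ) = w σ
  acyclic : ∀ τ, ¬ Relation.TransGen (Step K π) τ τ
  crit : ∀ σ ∈ K, π σ = none → L σ

variable {K : Set (Finset ℕ)} {w : Finset ℕ → ℕ} {π : Finset ℕ → Option ℕ} {L : Finset ℕ → Prop}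

/-- A matched edge stays in its fibre and passing to a face cannot increase `φ`, so `φ` decreases
weakly along steps and a closed path never leaves its fibre. -/
theorem IsGood.of_fibers {α : Type*} [PartialOrder α] (φ : Finset ℕ → α)
    (hφ : ∀ σ ∈ K, ∀ τ ∈ K, τ ⊆ σ → φ τ ≤ φ σ) (h : ∀ c, IsGood {σ | σ ∈ K ∧ φ σ = c} w π L) :
    IsGood K w π L where
  mate σ hσ v hv := by obtain ⟨h1, h2, h3⟩ := (h (φ σ)).mate σ ⟨hσ, rfl⟩ v hv; exact ⟨h1.1, h2, h3⟩
  crit σ hσ hn := (h (φ σ)).crit σ ⟨hσ, rfl⟩ hn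
  acyclic τ hτ := by
    have hstep : ∀ τ τ', Step K π τ τ' → φ τ' ≤ φ τ := by
      rintro τ τ' ⟨v, v', x, h1, h2, h3, h4, h5, h6, h7, h8⟩
      obtain ⟨h9, -, -⟩ := (h (φ τ)).mate τ ⟨h1, rfl⟩ v h2; rw [toggle_of_notMem h3] at h9
      rw [← h9.2]; exact hφ _ h9.1 _ h4 (h8 ▸ erase_subset _ _)
    have key : ∀ τ', Relation.TransGen (Step K π) τ τ' → φ τ' ≤ φ τ ∧
        (φ τ' = φ τ → Relation.TransGen (Step {σ | σ ∈ K ∧ φ σ = φ τ} π) τ τ') := by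
      intro τ' h'
      induction h' with
      | @single b hb =>
        refine ⟨hstep _ _ hb, fun he => Relation.TransGen.single ?_⟩
        obtain ⟨v, v', x, h1, h2, h3, h4, h5⟩ := hb
        exact ⟨v, v', x, ⟨h1, rfl⟩, h2, h3, ⟨h4, he⟩, h5⟩
      | @tail b c hb hbc ih =>
        have h0 := hstep _ _ hbc; refine ⟨h0.trans ih.1, fun he => ?_⟩
        have hbe : φ b = φ τ := le_antisymm ih.1 (he ▸ h0); refine (ih.2 hbe).tail ?_
        obtain ⟨v, v', x, h1, h2, h3, h4, h5⟩ := hbc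
        exact ⟨v, v', x, ⟨h1, hbe⟩, h2, h3, ⟨h4, he⟩, h5⟩
    exact (h (φ τ)).acyclic τ ((key τ hτ).2 rfl)

/-- The form used for most case distinctions: an upward closed predicate is an order-preserving map
to `Prop`. -/
theorem IsGood.split (P : Finset ℕ → Prop) (hP : ∀ σ ∈ K, ∀ τ ∈ K, τ ⊆ σ → P τ → P σ)
    (h₁ : IsGood {σ | σ ∈ K ∧ P σ} w π L) (h₂ : IsGood {σ | σ ∈ K ∧ ¬ P σ} w π L) :
    IsGood K w π L := by
  refine IsGood.of_fibers P hP fun c => ?_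
  by_cases hc : c
  · convert h₁ using 3; simp [hc]
  · convert h₂ using 3; simp [hc]

/-- With one fixed vertex there are no steps at all: a step goes up by adding `v`, and the next
lower end must again miss `v`, so it is the simplex one came from. -/
theorem IsGood.of_toggle (v : ℕ)
    (hπ : ∀ σ ∈ K, π σ = some v ∨ (π σ = none ∧ L σ))
    (hK : ∀ σ ∈ K, π σ = some v →
      toggle v σ ∈ K ∧ π (toggle v σ) = some v ∧ w (toggle v σ) = w σ) : IsGood K w π L where
  mate σ hσ u hu := by
    have h := hπ σ hσ; rw [hu] at h; have : u = v := by simpa using h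
    subst this; exact hK σ hσ hu
  crit σ hσ hn := by have h := hπ σ hσ; rw [hn] at h; simpa using h
  acyclic τ hτ := by
    have : ∀ τ τ', ¬ Step K π τ τ' := by
      rintro τ τ' ⟨u, u', x, h1, h2, h3, h4, h5, h6, h7, h8⟩; have e1 := hπ τ h1
      have e2 := hπ τ' h4; rw [h2] at e1; rw [h5] at e2; have e3 : u = v := by simpa using e1
      have e4 : u' = v := by simpa using e2
      subst e3; subst e4; apply h6; rw [h8, mem_erase]; refine ⟨?_, mem_insert_self _ _⟩; rintro rfl
      exact h7 (by rw [h8, erase_insert h3])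
    obtain ⟨_, h, -⟩ := Relation.TransGen.head'_iff.1 hτ; exact this _ _ h

theorem IsGood.of_forall_some (v : ℕ) (hπ : ∀ σ ∈ K, π σ = some v)
    (hK : ∀ σ, v ∉ σ → (σ ∈ K ↔ insert v σ ∈ K))
    (hw : ∀ σ ∈ K, v ∉ σ → w (insert v σ) = w σ) : IsGood K w π L := by
  refine IsGood.of_toggle v (fun σ hσ => Or.inl (hπ σ hσ)) fun σ hσ _ => ?_
  by_cases hv : v ∈ σ
  · rw [toggle_of_mem hv]; have h0 : v ∉ σ.erase v := notMem_erase v σ; have h1 := insert_erase hv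
    have h2 : σ.erase v ∈ K := (hK _ h0).2 (by rwa [h1]); refine ⟨h2, hπ _ h2, ?_⟩
    have := hw _ h2 h0; rw [h1] at this; exact this.symm
  · rw [toggle_of_notMem hv]; have h2 := (hK σ hv).1 hσ; exact ⟨h2, hπ _ h2, hw σ hσ hv⟩

theorem IsGood.of_forall_none (hπ : ∀ σ ∈ K, π σ = none) (hL : ∀ σ ∈ K, L σ) : IsGood K w π L :=
  IsGood.of_toggle 0 (fun σ hσ => Or.inr ⟨hπ σ hσ, hL σ hσ⟩) fun σ hσ h => by
    rw [hπ σ hσ] at h; simp at h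

lemma mem_union_image_iff {m j : ℕ} {ρ : ℕ → ℕ} {O σ : Finset ℕ}
    (hρ : Set.InjOn ρ (Icc 1 m : Finset ℕ)) (hO : ∀ j ∈ Icc 1 m, ρ j ∉ O) (hσ : σ ⊆ Icc 1 m)
    (hj : j ∈ Icc 1 m) : ρ j ∈ O ∪ σ.image ρ ↔ j ∈ σ := by
  rw [mem_union, mem_image]; constructor
  · rintro (h | ⟨i, hi, he⟩)
    · exact absurd h (hO j hj)
    · rwa [← hρ (hσ hi) hj he]
  · exact fun h => Or.inr ⟨j, h, rfl⟩

lemma filter_union_image {m : ℕ} {ρ : ℕ → ℕ} {O σ : Finset ℕ}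
    (hρ : Set.InjOn ρ (Icc 1 m : Finset ℕ)) (hO : ∀ j ∈ Icc 1 m, ρ j ∉ O) (hσ : σ ⊆ Icc 1 m) :
    (Icc 1 m).filter (fun j => ρ j ∈ O ∪ σ.image ρ) = σ := by
  ext j; rw [mem_filter]
  exact ⟨fun h => (mem_union_image_iff hρ hO hσ h.1).1 h.2, fun h =>
    ⟨hσ h, (mem_union_image_iff hρ hO hσ (hσ h)).2 h⟩⟩

/-- The critical simplices of a relabelled recipe correspond to those of the recipe. -/
theorem ncard_critical_relabel {K' : Set (Finset ℕ)} {π' : Finset ℕ → Option ℕ} {m : ℕ}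
    {ρ : ℕ → ℕ} {O : Finset ℕ} (hρ : Set.InjOn ρ (Icc 1 m : Finset ℕ))
    (hO : ∀ j ∈ Icc 1 m, ρ j ∉ O) (hK' : ∀ σ' ∈ K', σ' ⊆ Icc 1 m)
    (hπ : ∀ σ ∈ K, π σ = relabel m ρ π' σ) (hK : ∀ σ, σ ∈ K ↔ ∃ σ' ∈ K', σ = O ∪ σ'.image ρ) :
    {σ | σ ∈ K ∧ π σ = none}.ncard = {σ' | σ' ∈ K' ∧ π' σ' = none}.ncard := by
  have hπ' : ∀ σ' ∈ K', (π (O ∪ σ'.image ρ) = none ↔ π' σ' = none) := fun σ' hσ' => by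
    rw [hπ _ ((hK _).2 ⟨σ', hσ', rfl⟩), relabel, filter_union_image hρ hO (hK' σ' hσ'),
      Option.map_eq_none_iff]
  symm; refine Set.ncard_congr (fun σ' _ => O ∪ σ'.image ρ) ?_ ?_ ?_
  · exact fun σ' h => ⟨(hK _).2 ⟨σ', h.1, rfl⟩, (hπ' σ' h.1).2 h.2⟩
  · intro σ τ h h' he
    rw [← filter_union_image hρ hO (hK' σ h.1), he, filter_union_image hρ hO (hK' τ h'.1)]
  · rintro σ ⟨h, hn⟩; obtain ⟨σ', h', rfl⟩ := (hK σ).1 h; exact ⟨σ', ⟨h', (hπ' σ' h').1 hn⟩, rfl⟩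

/-- The set `O` collects the vertices that are present throughout the fibre and ignored by the
smaller rule. Intersecting with the relabelled vertices sends steps to steps, so a cycle would give
a cycle of the smaller matching; `O` contributes the constant `c` to the weight. -/
theorem IsGood.of_relabel {K' : Set (Finset ℕ)} {w' : Finset ℕ → ℕ} {π' : Finset ℕ → Option ℕ}
    {L' : Finset ℕ → Prop} (H : IsGood K' w' π' L') (m : ℕ) (ρ : ℕ → ℕ) (O : Finset ℕ) (c : ℕ)
    (hπ : ∀ σ ∈ K, π σ = relabel m ρ π' σ) (hρ : Set.InjOn ρ (Icc 1 m : Finset ℕ))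
    (hO : ∀ j ∈ Icc 1 m, ρ j ∉ O) (hK' : ∀ σ' ∈ K', σ' ⊆ Icc 1 m)
    (hK : ∀ σ, σ ∈ K ↔ ∃ σ' ∈ K', σ = O ∪ σ'.image ρ)
    (hw : ∀ σ' ∈ K', w (O ∪ σ'.image ρ) = c + w' σ')
    (hL : ∀ σ' ∈ K', O ∪ σ'.image ρ ∈ K → L' σ' → L (O ∪ σ'.image ρ)) : IsGood K w π L := by
  have hmem : ∀ σ' ∈ K', ∀ j ∈ Icc 1 m, (ρ j ∈ O ∪ σ'.image ρ ↔ j ∈ σ') :=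
    fun σ' hσ' _ hj => mem_union_image_iff hρ hO (hK' σ' hσ') hj
  have hpull : ∀ σ' ∈ K', (Icc 1 m).filter (fun j => ρ j ∈ O ∪ σ'.image ρ) = σ' :=
    fun σ' hσ' => filter_union_image hρ hO (hK' σ' hσ')
  have hπ' : ∀ σ' ∈ K', π (O ∪ σ'.image ρ) = (π' σ').map ρ := by
    intro σ' hσ'; rw [hπ _ ((hK _).2 ⟨σ', hσ', rfl⟩), relabel, hpull σ' hσ']
  have hsupp : ∀ σ' ∈ K', ∀ v, π' σ' = some v → v ∈ Icc 1 m := by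
    intro σ' hσ' v hv
    by_cases h : v ∈ σ'
    · exact hK' σ' hσ' h
    · have := (H.mate σ' hσ' v hv).1; rw [toggle_of_notMem h] at this
      exact hK' _ this (mem_insert_self _ _)
  have htog : ∀ σ' ∈ K', ∀ v ∈ Icc 1 m,
      toggle (ρ v) (O ∪ σ'.image ρ) = O ∪ (toggle v σ').image ρ := by
    intro σ' hσ' v hv
    by_cases h : v ∈ σ'
    · rw [toggle_of_mem h, toggle_of_mem ((hmem σ' hσ' v hv).2 h)]; ext x
      simp only [mem_erase, mem_union, mem_image]; constructor
      · rintro ⟨h1, h2 | ⟨i, hi, rfl⟩⟩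
        · exact Or.inl h2
        · exact Or.inr ⟨i, ⟨by rintro rfl; exact h1 rfl, hi⟩, rfl⟩
      · rintro (h2 | ⟨i, ⟨h1, hi⟩, rfl⟩)
        · exact ⟨by rintro rfl; exact hO v hv h2, Or.inl h2⟩
        · exact ⟨fun he => h1 (hρ (hK' σ' hσ' hi) hv he), Or.inr ⟨i, hi, rfl⟩⟩
    · rw [toggle_of_notMem h, toggle_of_notMem (fun h' => h ((hmem σ' hσ' v hv).1 h')),
        image_insert, union_insert]
  have hstep : ∀ τ τ', Step K π τ τ' → Step K' π'
      ((Icc 1 m).filter (fun j => ρ j ∈ τ)) ((Icc 1 m).filter (fun j => ρ j ∈ τ')) := by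
    rintro τ τ' ⟨v, v', x, h1, h2, h3, h4, h5, h6, h7, h8⟩; obtain ⟨σ, hσ, rfl⟩ := (hK τ).1 h1
    obtain ⟨σ', hσ', rfl⟩ := (hK τ').1 h4; rw [hpull σ hσ, hpull σ' hσ']
    rw [hπ' _ hσ, Option.map_eq_some_iff] at h2; rw [hπ' _ hσ', Option.map_eq_some_iff] at h5
    obtain ⟨u, hu, rfl⟩ := h2; obtain ⟨u', hu', rfl⟩ := h5
    have hun : u ∉ σ := fun h => h3 ((hmem σ hσ u (hsupp σ hσ u hu)).2 h)
    have hun' : u' ∉ σ' := fun h => h6 ((hmem σ' hσ' u' (hsupp σ' hσ' u' hu')).2 h)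
    have hne : σ' ≠ σ := by rintro rfl; exact h7 rfl
    have hins := htog σ hσ u (hsupp σ hσ u hu); have hmt := (H.mate σ hσ u hu).1
    rw [toggle_of_notMem h3] at hins; rw [hins] at h8; rw [toggle_of_notMem hun] at h8 hmt
    by_cases hx : ∃ y ∈ Icc 1 m, ρ y = x
    · obtain ⟨y, hy, rfl⟩ := hx; refine ⟨u, u', y, hσ, hu, hun, hσ', hu', hun', hne, ?_⟩
      have : (Icc 1 m).filter (fun j => ρ j ∈ O ∪ σ'.image ρ) =
        (Icc 1 m).filter (fun j => ρ j ∈ (O ∪ (insert u σ).image ρ).erase (ρ y)) := by rw [← h8]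
      rw [hpull σ' hσ'] at this; rw [this]; ext j; simp only [mem_filter, mem_erase (s := O ∪ _)]
      constructor
      · rintro ⟨h9, h10, h11⟩
        exact mem_erase.2 ⟨by rintro rfl; exact h10 rfl, (hmem _ hmt j h9).1 h11⟩
      · intro h9; rw [mem_erase] at h9; have h10 := hK' _ hmt h9.2
        exact ⟨h10, fun he => h9.1 (hρ h10 hy he), (hmem _ hmt j h10).2 h9.2⟩
    -- If the removed vertex is not a relabelled one, the pulled back face is the upper end `insert
    -- u σ`, whose partner removes `u`; it cannot be a lower end.
    · exfalso
      have : (Icc 1 m).filter (fun j => ρ j ∈ O ∪ σ'.image ρ) =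
        (Icc 1 m).filter (fun j => ρ j ∈ (O ∪ (insert u σ).image ρ).erase x) := by rw [← h8]
      have h9 : (Icc 1 m).filter (fun j => ρ j ∈ (O ∪ (insert u σ).image ρ).erase x) =
        (Icc 1 m).filter (fun j => ρ j ∈ O ∪ (insert u σ).image ρ) := by
        refine filter_congr fun j hj => ?_; rw [mem_erase]
        exact ⟨fun h => h.2, fun h => ⟨fun he => hx ⟨j, hj, he⟩, h⟩⟩
      rw [h9, hpull σ' hσ', hpull _ hmt] at this; rw [this] at h8
      have h10 : x ∉ O ∪ (insert u σ).image ρ := by intro h; rw [h8] at h; exact notMem_erase _ _ h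
      have h11 : σ' = insert u σ := this; have h12 := H.mate σ hσ u hu
      rw [toggle_of_notMem hun, ← h11, hu'] at h12; have h13 : u' = u := by simpa using h12.2.1
      exact hun' (by rw [h13, h11]; exact mem_insert_self _ _)
  refine ⟨?_, ?_, ?_⟩
  · intro σ hσ v hv; obtain ⟨σ', hσ', rfl⟩ := (hK σ).1 hσ
    rw [hπ' _ hσ', Option.map_eq_some_iff] at hv; obtain ⟨u, hu, rfl⟩ := hv
    obtain ⟨h1, h2, h3⟩ := H.mate σ' hσ' u hu; rw [htog σ' hσ' u (hsupp σ' hσ' u hu)]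
    exact ⟨(hK _).2 ⟨_, h1, rfl⟩, by rw [hπ' _ h1, h2]; rfl, by rw [hw _ h1, hw _ hσ', h3]⟩
  · intro τ hτ
    have key : ∀ τ', Relation.TransGen (Step K π) τ τ' → Relation.TransGen (Step K' π')
        ((Icc 1 m).filter (fun j => ρ j ∈ τ))
        ((Icc 1 m).filter (fun j => ρ j ∈ τ')) := by
      intro τ' h
      induction h with
      | single h => exact Relation.TransGen.single (hstep _ _ h)
      | tail _ h ih => exact ih.tail (hstep _ _ h)
    exact H.acyclic _ (key τ hτ)
  · intro σ hσ hn; obtain ⟨σ', hσ', rfl⟩ := (hK σ).1 hσ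
    rw [hπ' _ hσ', Option.map_eq_none_iff] at hn; exact hL σ' hσ' hσ (H.crit σ' hσ' hn)

end Good

/-! ### Weights of the pieces cut out by a vertex -/

section Blocks

variable {Γ : SimpleGraph ℕ} {d : ℕ} {C s : Finset ℕ} {lam : ℕ → ℕ} {a b a' b' u u' v : ℕ}

lemma Icc_subset_iff : Icc a b ⊆ s ↔ ∀ j, a ≤ j → j ≤ b → j ∈ s :=
  ⟨fun h j h1 h2 => h (mem_Icc.2 ⟨h1, h2⟩),
    fun h j hj => h j (mem_Icc.1 hj).1 (mem_Icc.1 hj).2⟩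

lemma exists_run_end (s : Finset ℕ) (v : ℕ) :
    ∃ b, v ≤ b ∧ (∀ j, v < j → j ≤ b → j ∈ s) ∧ b + 1 ∉ s := by
  have hex : ∃ k, v + k + 1 ∉ s := by
    by_contra h
    push Not at h
    have h1 : (range (s.card + 1)).image (fun k => v + k + 1) ⊆ s := by grind
    have := card_le_card h1
    rw [card_image_of_injective _ (fun x y h => by simpa using h), card_range] at this; omega
  classical
  refine ⟨v + Nat.find hex, by omega, fun j h1 h2 => ?_, Nat.find_spec hex⟩
  have := Nat.find_min hex (m := j - v - 1) (by omega); grind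

lemma IsPath.restrict (H : IsPath Γ C lam a b) (ha : a ≤ a') (hb : b' ≤ b) :
    IsPath Γ (C.filter fun v => a' ≤ lam v ∧ lam v ≤ b') lam a' b' where
  le v hv := (mem_filter.1 hv).2
  surj j h1 h2 := by
    obtain ⟨v, hv, rfl⟩ := H.surj j (by omega) (by omega); exact ⟨v, mem_filter.2 ⟨hv, h1, h2⟩, rfl⟩
  adj v hv w hw := H.adj v (mem_filter.1 hv).1 w (mem_filter.1 hw).1
  inj v hv w hw := H.inj v (mem_filter.1 hv).1 w (mem_filter.1 hw).1

lemma IsFork.restrict (H : IsFork Γ C lam b u u') (h1 : 1 ≤ b') (hb : b' ≤ b) :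
    IsFork Γ (C.filter fun v => lam v ≤ b') lam b' u u' where
  le v hv := ⟨(H.le v (mem_filter.1 hv).1).1, (mem_filter.1 hv).2⟩
  surj j h1 h2 := by
    obtain ⟨v, hv, rfl⟩ := H.surj j (by omega) (by omega); exact ⟨v, mem_filter.2 ⟨hv, h2⟩, rfl⟩
  adj v hv w hw := H.adj v (mem_filter.1 hv).1 w (mem_filter.1 hw).1
  ne := H.ne
  mem_left := mem_filter.2 ⟨H.mem_left, by rw [H.lam_left]; exact h1⟩
  mem_right := mem_filter.2 ⟨H.mem_right, by rw [H.lam_right]; exact h1⟩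
  lam_left := H.lam_left
  lam_right := H.lam_right
  eq_or_eq v hv := H.eq_or_eq v (mem_filter.1 hv).1
  inj v hv w hw := H.inj v (mem_filter.1 hv).1 w (mem_filter.1 hw).1

lemma IsFork.restrict_tail (H : IsFork Γ C lam b u u') (ha : 2 ≤ a') :
    IsPath Γ (C.filter fun v => a' ≤ lam v) lam a' b where
  le v hv := ⟨(mem_filter.1 hv).2, (H.le v (mem_filter.1 hv).1).2⟩
  surj j h1 h2 := by
    obtain ⟨v, hv, rfl⟩ := H.surj j (by omega) (by omega); exact ⟨v, mem_filter.2 ⟨hv, h1⟩, rfl⟩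
  adj v hv w hw := H.adj v (mem_filter.1 hv).1 w (mem_filter.1 hw).1
  inj v hv w hw h := H.inj v (mem_filter.1 hv).1 w (mem_filter.1 hw).1 h
    (by have := (mem_filter.1 hv).2; omega)

lemma IsFork.erase_left (H : IsFork Γ C lam b u u') : IsPath Γ (C.erase u) lam 1 b where
  le v hv := H.le v (mem_of_mem_erase hv)
  surj j h1 h2 := by
    obtain ⟨v, hv, rfl⟩ := H.surj j h1 h2
    by_cases h : v = u
    · subst h; exact ⟨u', mem_erase.2 ⟨H.ne.symm, H.mem_right⟩, by rw [H.lam_left, H.lam_right]⟩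
    · exact ⟨v, mem_erase.2 ⟨h, hv⟩, rfl⟩
  adj v hv w hw := H.adj v (mem_of_mem_erase hv) w (mem_of_mem_erase hw)
  inj v hv w hw h := by
    rw [mem_erase] at hv hw
    by_cases h1 : lam v = 1
    · rw [(H.eq_or_eq v hv.2 h1).resolve_left hv.1,
        (H.eq_or_eq w hw.2 (h ▸ h1)).resolve_left hw.1]
    · exact H.inj v hv.2 w hw.2 h h1

lemma IsPath.gweight_erase (hd : 2 ≤ d) (H : IsPath Γ C lam a b) (hv : v ∈ C) (h1 : 1 ≤ lam v) :
    gweight Γ d (C.erase v) = (lam v + 1 - a) / d + (b + 1 - lam v) / d := by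
  have hle := H.le v hv
  have hE : C.erase v = (C.filter fun x => a ≤ lam x ∧ lam x ≤ lam v - 1) ∪
      C.filter fun x => lam v + 1 ≤ lam x ∧ lam x ≤ b := by
    ext x; simp only [mem_erase, mem_union, mem_filter]; constructor
    · rintro ⟨hx, hxC⟩; have h2 := H.le x hxC
      have h3 : lam x ≠ lam v := fun h => hx (H.inj x hxC v hv h); simp only [hxC, true_and]; omega
    · grind
  rw [hE, gweight_union, (H.restrict le_rfl (by omega)).gweight_eq hd (by omega),
    (H.restrict (by omega) le_rfl).gweight_eq hd (by omega)]
  · congr 2 <;> omega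
  · intro x hx y hy h; rw [mem_filter] at hx hy; have := (H.adj x hx.1 y hy.1).1 h; omega
  · rw [disjoint_left]; intro x hx hy; rw [mem_filter] at hx hy; omega

lemma IsFork.gweight_erase (hd : 2 ≤ d) (H : IsFork Γ C lam b u u') (hv : v ∈ C) (h1 : 3 ≤ lam v) :
    gweight Γ d (C.erase v) = weightD d (lam v) + (b + 1 - lam v) / d := by
  have hle := H.le v hv
  have hE : C.erase v = (C.filter fun x => lam x ≤ lam v - 1) ∪
      C.filter fun x => lam v + 1 ≤ lam x := by
    ext x; simp only [mem_erase, mem_union, mem_filter]; constructor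
    · rintro ⟨hx, hxC⟩; have h2 := H.le x hxC
      have h3 : lam x ≠ lam v := fun h => hx (H.inj x hxC v hv h (by omega))
      simp only [hxC, true_and]; omega
    · grind
  rw [hE, gweight_union, (H.restrict (by omega) (by omega)).gweight_eq hd (by omega),
    (H.restrict_tail (by omega)).gweight_eq hd (by omega)]
  · congr 2 <;> omega
  · intro x hx y hy h; rw [mem_filter] at hx hy; have := (H.adj x hx.1 y hy.1).1 h; omega
  · rw [disjoint_left]; intro x hx hy; rw [mem_filter] at hx hy; omega

lemma gweight_empty : gweight Γ d ∅ = 0 := by simp [gweight]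

lemma gweight_singleton (hd : 2 ≤ d) : gweight Γ d {v} = 2 / d := by
  have H : IsPath Γ {v} (fun _ => 1) 1 1 := by
    refine ⟨⟨by simp, fun j h1 h2 => ⟨v, by simp, by omega⟩, ?_⟩, ?_⟩
    · intro x hx y hy; rw [mem_singleton] at hx hy; subst hx; subst hy; simp
    · grind
  rw [H.gweight_eq hd (by omega)]

/-- If removing `v` does not change the weight of a union of components containing `v`, then it does
not change the total weight. -/
lemma gweight_insert_eq (hv : v ∉ s) (hvC : v ∈ C) (hC : C ⊆ insert v s)
    (hsep : Separated Γ C (insert v s \ C)) (h : gweight Γ d C = gweight Γ d (C.erase v)) :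
    gweight Γ d (insert v s) = gweight Γ d s := by
  have h1 := gweight_erase_sdiff (d := d) hC hsep hvC; rw [erase_insert hv] at h1
  rw [h1, gweight_sdiff hC hsep, h]

lemma eq_union_image {O σ : Finset ℕ} {ρ : ℕ → ℕ} {m : ℕ} (hO : O ⊆ σ)
    (h : ∀ x ∈ σ, x ∈ O ∨ ∃ j ∈ Icc 1 m, ρ j = x) :
    σ = O ∪ ((Icc 1 m).filter fun j => ρ j ∈ σ).image ρ := by grind

end Blocks

/-! ### The matching in type `A` -/

section TypeA

/-- The infinite path `0 - 1 - 2 - ⋯`. -/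
def graphA : SimpleGraph ℕ := SimpleGraph.fromRel fun a b => b = a + 1

lemma graphA_adj (a b : ℕ) : graphA.Adj a b ↔ a + 1 = b ∨ b + 1 = a := by
  unfold graphA; rw [SimpleGraph.fromRel_adj]; omega

lemma isPath_graphA (a b : ℕ) : IsPath graphA (Icc a b) (fun v => v) a b where
  le v hv := mem_Icc.1 hv
  surj j h1 h2 := ⟨j, mem_Icc.2 ⟨h1, h2⟩, rfl⟩
  adj v _ w _ := graphA_adj v w
  inj v _ w _ h := h

lemma gweight_graphA_Icc {d : ℕ} (hd : 2 ≤ d) {a b : ℕ} (hab : a ≤ b + 1) :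
    gweight graphA d (Icc a b) = (b + 2 - a) / d :=
  (isPath_graphA a b).gweight_eq hd hab

/-- Only the component `{1, …, b}` through `v` is affected, and it is cut into two paths; the weight
is unchanged when the integer parts add up. -/
lemma gweight_graphA_insert {d : ℕ} (hd : 2 ≤ d) {s : Finset ℕ} {v b : ℕ} (h0 : 0 ∉ s)
    (hv : v ∉ s) (hv1 : 1 ≤ v) (hlow : ∀ j, 1 ≤ j → j < v → j ∈ s) (hvb : v ≤ b)
    (hrun : ∀ j, v < j → j ≤ b → j ∈ s) (hb : b + 1 ∉ s)
    (h : (b + 1) / d = v / d + (b + 1 - v) / d) :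
    gweight graphA d (insert v s) = gweight graphA d s := by
  have hC : Icc 1 b ⊆ insert v s := by grind
  refine gweight_insert_eq (C := Icc 1 b) hv (mem_Icc.2 ⟨hv1, hvb⟩) hC ?_ ?_
  · intro x hx y hy hadj; rw [graphA_adj] at hadj; grind
  · rw [gweight_graphA_Icc hd (by omega), (isPath_graphA 1 b).gweight_erase hd
      (mem_Icc.2 ⟨hv1, hvb⟩) hv1]
    exact h

/-- The subsets of `{1, …, m}` containing the first `f` and the last `g` elements. -/
def simplicesA (m f g : ℕ) : Set (Finset ℕ) :=
  {σ | σ ⊆ Icc 1 m ∧ (∀ j, 1 ≤ j → j ≤ f → j ∈ σ) ∧ ∀ j, m < j + g → 1 ≤ j → j ≤ m → j ∈ σ}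

lemma simplicesA_insert {m f g v : ℕ} {σ : Finset ℕ} (hf : f < v) (hg : v + g ≤ m) :
    σ ∈ simplicesA m f g ∧ v ∉ σ ↔ insert v σ ∈ simplicesA m f g ∧ v ∉ σ := by
  unfold simplicesA; grind

/-- `d (|σ| - w) - (d - 2) m`, where `w` is the weight. -/
def defect (d m : ℕ) (card w : ℕ) : ℤ := d * ((card : ℤ) - w) - ((d : ℤ) - 2) * m

/-- What is known about critical simplices in type `A`. -/
def CriticalA (d m f g : ℕ) (σ : Finset ℕ) : Prop :=
  (m ≤ f + g ∧ σ = Icc 1 m) ∨ (f + g < m ∧ gweight graphA d σ ≤ 1 ∧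
    ((∃ i t, m + 1 = i + t * d ∧ i ≤ f ∧ i ≤ g ∧ f + g + 2 ≤ d + i ∧
        defect d m σ.card (gweight graphA d σ) = d - 2 + 2 * i) ∨
      ∃ i t, m = f + i + t * d ∧ f + i + 2 ≤ d ∧ i ≤ g ∧ g ≤ f + i ∧
        defect d m σ.card (gweight graphA d σ) = 2 * (f + i)))

/-- Case (d). If the component `{1, …, b}` created by `f + 1` stops before `m`, it also stops before
the forced last `g` vertices and is too short to have weight. If `b = m`, cutting at `f + 1` loses
weight exactly when `m + 1` is at most `f` modulo `d`, and this is the critical pair. -/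
lemma isGood_pivotA_tail {d m f g : ℕ} (hd : 2 ≤ d) (hf : f < d) (hg : g < d) (h1 : f + g < m)
    (h2 : m < d + g) :
    IsGood (simplicesA m f g) (gweight graphA d) (pivotA d m f g) (CriticalA d m f g) := by
  have hπ : ∀ σ, pivotA d m f g σ = if (m + 1) % d ≤ f ∧
      (σ = Icc 1 m ∨ σ = Icc 1 f ∪ Icc (f + 2) m) then none
      else some (f + 1) := by
    intro σ
    rw [pivotA, dif_neg (by omega), dif_neg (by omega), if_neg (by omega), if_neg (by omega)]
  have hE : Icc 1 f ∪ Icc (f + 2) m = (Icc 1 m).erase (f + 1) := by grind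
  have hpair : ∀ σ ⊆ Icc 1 m,
      ((σ = Icc 1 m ∨ σ = Icc 1 f ∪ Icc (f + 2) m) ↔
        ∀ j, 1 ≤ j → j ≤ m → j ≠ f + 1 → j ∈ σ) := by grind
  refine IsGood.split (fun σ => (m + 1) % d ≤ f ∧ ∀ j, 1 ≤ j → j ≤ m → j ≠ f + 1 → j ∈ σ)
    (fun σ _ τ _ hτσ h => ⟨h.1, fun j h3 h4 h5 => hτσ (h.2 j h3 h4 h5)⟩) ?_ ?_
  · refine IsGood.of_forall_none ?_ ?_
    · rintro σ ⟨hσ, h3, h4⟩; rw [hπ, if_pos ⟨h3, (hpair σ hσ.1).2 h4⟩]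
    · rintro σ ⟨hσ, h3, h4⟩; refine Or.inr ⟨h1, ?_⟩
      have h5 : d ≤ m + 1 := by by_contra h; rw [Nat.mod_eq_of_lt (by omega)] at h3; omega
      obtain ⟨i, hi⟩ := Nat.exists_eq_add_of_le h5
      rw [hi, Nat.add_mod_left, Nat.mod_eq_of_lt (by omega)] at h3
      have hw : (m + 1) / d = 1 := Nat.div_eq_of_lt_le (by omega) (by omega)
      -- `e` records whether `f + 1` is missing. Size and weight drop together, so both simplices of
      -- the critical pair have the same defect.
      have key : ∃ e : ℕ, e ≤ 1 ∧ σ.card + e = m ∧ gweight graphA d σ + e = 1 := by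
        rcases (hpair σ hσ.1).2 h4 with rfl | rfl
        · refine ⟨0, by omega, by simp, ?_⟩
          rw [gweight_graphA_Icc hd (by omega), show m + 2 - 1 = m + 1 by omega, hw]
        · refine ⟨1, le_rfl, ?_, ?_⟩
          · rw [hE, card_erase_add_one (mem_Icc.2 ⟨by omega, by omega⟩)]; simp
          · rw [hE, (isPath_graphA 1 m).gweight_erase hd (mem_Icc.2 ⟨by omega, by omega⟩)
              (by omega)]
            rw [Nat.div_eq_of_lt (a := m + 1 - (f + 1)) (by omega), Nat.div_eq_of_lt (by omega)]
      obtain ⟨e, he, hc, hwe⟩ := key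
      refine ⟨by omega, Or.inl ⟨i, 1, by omega, h3, by omega, by omega, ?_⟩⟩
      rw [defect, show (σ.card : ℤ) - (gweight graphA d σ : ℕ) = m - 1 by omega,
        show (m : ℤ) = d + i - 1 by omega]
      ring
  · refine IsGood.of_forall_some (f + 1) ?_ ?_ ?_
    · grind
    · intro σ hv
      have h3 := simplicesA_insert (m := m) (g := g) (σ := σ) (Nat.lt_succ_self f) (by omega); grind
    · rintro σ ⟨hσ, h3⟩ hv; obtain ⟨b, hb1, hb2, hb3⟩ := exists_run_end σ (f + 1)
      have hbm : b ≤ m := by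
        rcases Nat.eq_or_lt_of_le hb1 with h | h
        · omega
        · exact (mem_Icc.1 (hσ.1 (hb2 b h le_rfl))).2
      refine gweight_graphA_insert hd (fun h => by have := mem_Icc.1 (hσ.1 h); omega) hv
        (by omega) (fun j h4 h5 => hσ.2.1 j h4 (by omega)) hb1 hb2 hb3 ?_
      rw [Nat.div_eq_of_lt (a := f + 1) (by omega), zero_add]
      rcases Nat.eq_or_lt_of_le hbm with rfl | hlt
      · have h5 : ¬ (b + 1) % d ≤ f := by
          intro h5; apply h3; refine ⟨h5, fun j h6 h7 h8 => ?_⟩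
          by_cases h9 : j ≤ f
          · exact hσ.2.1 j h6 h9
          · exact hb2 j (by omega) h7
        by_cases h6 : d ≤ b + 1
        · obtain ⟨i, hi⟩ := Nat.exists_eq_add_of_le h6
          rw [hi, Nat.add_mod_left, Nat.mod_eq_of_lt (by omega)] at h5
          rw [show (b + 1) / d = 1 from Nat.div_eq_of_lt_le (by omega) (by omega),
            show (b + 1 - (f + 1)) / d = 1 from Nat.div_eq_of_lt_le (by omega) (by omega)]
        · rw [Nat.div_eq_of_lt (by omega), Nat.div_eq_of_lt (by omega)]
      · have h5 : b + 1 + g ≤ m := by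
          by_contra h; exact hb3 (hσ.2.2 (b + 1) (by omega) (by omega) (by omega))
        rw [Nat.div_eq_of_lt (by omega), Nat.div_eq_of_lt (by omega)]

lemma succ_notMem_of_mem_simplicesA {d m f g : ℕ} {σ : Finset ℕ} (hσ : σ ∈ simplicesA m f g)
    (h3 : ¬ ∀ j, 1 ≤ j → j ≤ d - 1 → j ∈ σ) (h4 : ∀ j, f + 2 ≤ j → j ≤ d - 1 → j ∈ σ) :
    f + 1 ∉ σ := by
  intro h5; apply h3; intro j h6 h7; rcases lt_trichotomy j (f + 1) with h8 | h8 | h8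
  · exact hσ.2.1 j h6 (by omega)
  · rwa [h8]
  · exact h4 j (by omega) h7

lemma mem_simplicesA_gap_iff {d m f g : ℕ} {σ : Finset ℕ} (hf : f + 1 < d) (hm : d + g ≤ m) :
    ((σ ∈ simplicesA m f g ∧ ¬ ∀ j, 1 ≤ j → j ≤ d - 1 → j ∈ σ) ∧
      ∀ j, f + 2 ≤ j → j ≤ d - 1 → j ∈ σ) ↔
    ∃ σ' ∈ simplicesA (m - f - 1) (d - 2 - f) g, σ = Icc 1 f ∪ σ'.image fun j => j + f + 1 := by
  constructor
  · intro hσ; have h3 := succ_notMem_of_mem_simplicesA hσ.1.1 hσ.1.2 hσ.2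
    obtain ⟨⟨hσ, h4⟩, h5⟩ := hσ
    refine ⟨(Icc 1 (m - f - 1)).filter fun j => j + f + 1 ∈ σ,
      ⟨filter_subset _ _, fun j h6 h7 => ?_, fun j h6 h7 h8 => ?_⟩, eq_union_image ?_ ?_⟩
    · grind
    · exact mem_filter.2 ⟨mem_Icc.2 ⟨h7, h8⟩, hσ.2.2 _ (by omega) (by omega)
        (by omega)⟩
    · rw [Icc_subset_iff]; exact hσ.2.1
    · intro x hx; have h6 := mem_Icc.1 (hσ.1 hx); have h7 : x ≠ f + 1 := by rintro rfl; exact h3 hx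
      simp only [mem_Icc]
      by_cases h8 : x ≤ f
      · exact Or.inl ⟨h6.1, h8⟩
      · exact Or.inr ⟨x - f - 1, by omega, by omega⟩
  · rintro ⟨σ', hσ', rfl⟩
    have hno : f + 1 ∉ Icc 1 f ∪ σ'.image fun j => j + f + 1 := by
      rw [mem_union, mem_image, mem_Icc]; rintro (h | ⟨j, hj, h⟩)
      · omega
      · have := mem_Icc.1 (hσ'.1 hj); omega
    refine ⟨⟨⟨?_, ?_, ?_⟩, fun h => hno (h _ (by omega) (by omega))⟩, ?_⟩
    · intro x hx; rw [mem_union, mem_image, mem_Icc] at hx; rw [mem_Icc]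
      rcases hx with h | ⟨j, hj, rfl⟩
      · omega
      · have := mem_Icc.1 (hσ'.1 hj); omega
    · grind
    · intro j h3 h4 h5
      exact mem_union_right _ (mem_image.2 ⟨j - f - 1,
        hσ'.2.2 _ (by omega) (by omega) (by omega), by omega⟩)
    · intro j h3 h4
      exact mem_union_right _ (mem_image.2 ⟨j - f - 1,
        hσ'.2.1 _ (by omega) (by omega), by omega⟩)

/-- For `f < d` case (b) does not occur at the top level, nor in the recursion, since (c4) replaces
`f` by `d - 2 - f`. In (c4) the vertices `1, …, f` with the gap `f + 1` contribute `2f + 2 - d` to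
the defect, which interchanges the two families of `CriticalA`. -/
theorem isGood_pivotA {d m f g : ℕ} (hd : 2 ≤ d) (hf : f < d) (hg : g < d) (hfm : f ≤ m)
    (hgm : g ≤ m) :
    IsGood (simplicesA m f g) (gweight graphA d) (pivotA d m f g) (CriticalA d m f g) := by
  induction m using Nat.strong_induction_on generalizing f with
  | _ m ih =>
  by_cases h1 : m ≤ f + g
  · refine IsGood.of_forall_none ?_ ?_
    · intro σ _; rw [pivotA, dif_neg (by omega), dif_pos h1]
    · intro σ hσ; refine Or.inl ⟨h1, Finset.Subset.antisymm hσ.1 ?_⟩; rw [Icc_subset_iff]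
      intro j h2 h3
      by_cases h4 : j ≤ f
      · exact hσ.2.1 j h2 h4
      · exact hσ.2.2 j (by omega) h2 h3
  by_cases h2 : m < d + g
  · exact isGood_pivotA_tail hd hf hg (by omega) h2
  have hπ : ∀ σ, pivotA d m f g σ = if Icc 1 (d - 1) ⊆ σ then some d
      else if f + 1 ∈ σ then some (f + 1)
      else if ¬ Icc (f + 2) (d - 1) ⊆ σ then some (f + 1)
      else relabel (m - f - 1) (fun j => j + f + 1) (pivotA d (m - f - 1) (d - 2 - f) g) σ := by
    intro σ
    rw [pivotA, dif_neg (by omega), dif_neg (by omega), if_neg (by omega), if_pos (by omega)]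
  simp only [Icc_subset_iff] at hπ
  refine IsGood.split (fun σ => ∀ j, 1 ≤ j → j ≤ d - 1 → j ∈ σ)
    (fun σ _ τ _ hτσ h => fun j h3 h4 => hτσ (h j h3 h4)) ?_ ?_
  · refine IsGood.of_forall_some d ?_ ?_ ?_
    · rintro σ ⟨hσ, h3⟩; rw [hπ, if_pos h3]
    · intro σ hv; have h3 := simplicesA_insert (m := m) (g := g) (σ := σ) hf (by omega); grind
    · rintro σ ⟨hσ, h3⟩ hv; obtain ⟨b, hb1, hb2, hb3⟩ := exists_run_end σ d
      refine gweight_graphA_insert hd (fun h => by have := mem_Icc.1 (hσ.1 h); omega) hv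
        (by omega) (fun j h4 h5 => h3 j h4 (by omega)) hb1 hb2 hb3 ?_
      -- A path with `d - 1` vertices has weight exactly one, so cutting it off at `d` is always
      -- neutral.
      obtain ⟨c, rfl⟩ := Nat.exists_eq_add_of_le hb1
      rw [Nat.div_self (by omega), show d + c + 1 = (c + 1) + d by omega,
        Nat.add_div_right _ (by omega), show c + 1 + d - d = c + 1 by omega]
      omega
  refine IsGood.split (fun σ => ∀ j, f + 2 ≤ j → j ≤ d - 1 → j ∈ σ)
    (fun σ _ τ _ hτσ h => fun j h3 h4 => hτσ (h j h3 h4)) ?_ ?_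
  swap
  · refine IsGood.of_forall_some (f + 1) ?_ ?_ ?_
    · grind
    · intro σ hv
      have h3 := simplicesA_insert (m := m) (g := g) (σ := σ) (Nat.lt_succ_self f) (by omega); grind
    · rintro σ ⟨⟨hσ, h3⟩, h4⟩ hv; obtain ⟨b, hb1, hb2, hb3⟩ := exists_run_end σ (f + 1)
      -- A vertex of `{f + 2, …, d - 1}` is missing, so the component through `f + 1` is too short
      -- to have weight.
      have hbd : b + 1 < d := by grind
      refine gweight_graphA_insert hd (fun h => by have := mem_Icc.1 (hσ.1 h); omega) hv
        (by omega) (fun j h4 h5 => hσ.2.1 j h4 (by omega)) hb1 hb2 hb3 ?_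
      rw [Nat.div_eq_of_lt (by omega), Nat.div_eq_of_lt (by omega), Nat.div_eq_of_lt (by omega)]
  -- For `f = d - 1` the fibre is empty; otherwise `d - 2 - f` is a genuine difference.
  · by_cases hfd : f = d - 1
    · refine IsGood.of_forall_none ?_ ?_ <;>
      · rintro σ ⟨⟨hσ, h3⟩, -⟩; exact absurd (fun j h4 h5 => hσ.2.1 j h4 (by omega)) h3
    have hnot : ∀ σ, (σ ∈ simplicesA m f g ∧ ¬ ∀ j, 1 ≤ j → j ≤ d - 1 → j ∈ σ) ∧
        (∀ j, f + 2 ≤ j → j ≤ d - 1 → j ∈ σ) → f + 1 ∉ σ :=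
      fun σ hσ => succ_notMem_of_mem_simplicesA hσ.1.1 hσ.1.2 hσ.2
    have hsep' : ∀ σ' ∈ simplicesA (m - f - 1) (d - 2 - f) g,
        Separated graphA (Icc 1 f) (σ'.image fun j => j + f + 1) ∧
        Disjoint (Icc 1 f) (σ'.image fun j => j + f + 1) := by
      intro σ' hσ'; refine ⟨?_, ?_⟩
      · intro x hx y hy h; obtain ⟨j, hj, rfl⟩ := mem_image.1 hy; have := mem_Icc.1 (hσ'.1 hj)
        rw [graphA_adj] at h; rw [mem_Icc] at hx; omega
      · rw [disjoint_left]; grind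
    have hwt : ∀ σ' ∈ simplicesA (m - f - 1) (d - 2 - f) g,
        gweight graphA d (Icc 1 f ∪ σ'.image fun j => j + f + 1) =
          0 + gweight graphA d σ' := by
      intro σ' hσ'
      rw [gweight_union (hsep' σ' hσ').1 (hsep' σ' hσ').2, gweight_graphA_Icc hd (by omega),
        Nat.div_eq_of_lt (by omega), gweight_image (Γ := graphA)]
      · intro x _ y _ h; simpa using h
      · intro x _ y _; simp only [graphA_adj]; omega
    refine IsGood.of_relabel (ih (m - f - 1) (by omega) (f := d - 2 - f) (by omega) (by omega)
      (by omega)) (m - f - 1) (fun j => j + f + 1) (Icc 1 f) 0 ?_ ?_ ?_ ?_ ?_ hwt ?_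
    · grind
    · intro x _ y _ h; simpa using h
    · intro j _ h; rw [mem_Icc] at h; omega
    · exact fun σ' hσ' => hσ'.1
    · exact fun σ => mem_simplicesA_gap_iff (by omega) (by omega)
    · intro σ' hσ' _ hcr
      have hcard : (Icc 1 f ∪ σ'.image fun j => j + f + 1).card = f + σ'.card := by
        rw [card_union_of_disjoint (hsep' σ' hσ').2,
          card_image_of_injective _ (fun x y h => by simpa using h)]
        simp
      rcases hcr with ⟨h3, -⟩ | ⟨-, h4, h5⟩
      · omega
      refine Or.inr ⟨by omega, by rw [hwt σ' hσ']; omega, ?_⟩; rw [hcard, hwt σ' hσ', zero_add]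
      have hdef : defect d m (f + σ'.card) (gweight graphA d σ') =
          defect d (m - f - 1) σ'.card (gweight graphA d σ') + (2 * f + 2 - d) := by
        have : ((m - f - 1 : ℕ) : ℤ) = m - f - 1 := by omega
        simp only [defect, this]; push_cast; ring
      rw [hdef]; rcases h5 with ⟨i, t, h6, h7, h8, h9, h10⟩ | ⟨i, t, h6, h7, h8, h9, h10⟩
      · refine Or.inr ⟨i, t, by omega, by omega, h8, by omega, ?_⟩; rw [h10]; ring
      · refine Or.inl ⟨i, t + 1, ?_, by omega, h8, by omega, ?_⟩
        · rw [add_mul]; omega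
        · grind

end TypeA

/-! ### Type `D`: the component containing the fork -/

section TypeD

variable {d h m g : ℕ} {s σ : Finset ℕ} {v b a : ℕ}

lemma graphD_adj (a b : ℕ) : graphD.Adj a b ↔
    ((a = 1 ∧ b = 3) ∨ (2 ≤ a ∧ b = a + 1)) ∨ ((b = 1 ∧ a = 3) ∨ (2 ≤ b ∧ a = b + 1)) := by
  unfold graphD; rw [SimpleGraph.fromRel_adj]; omega

lemma isFork_graphD (hb : 2 ≤ b) :
    IsFork graphD (Icc 1 b) (fun v => if v = 1 then 1 else v - 1) (b - 1) 1 2 where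
  le v hv := by have := mem_Icc.1 hv; split_ifs <;> omega
  surj j h1 h2 := ⟨j + 1, mem_Icc.2 ⟨by omega, by omega⟩, by simp; omega⟩
  adj v hv w hw := by
    have := mem_Icc.1 hv; have := mem_Icc.1 hw; rw [graphD_adj]; split_ifs <;> omega
  ne := by omega
  mem_left := mem_Icc.2 ⟨by omega, by omega⟩
  mem_right := mem_Icc.2 ⟨by omega, by omega⟩
  lam_left := by simp
  lam_right := by simp
  eq_or_eq v hv hl := by have := mem_Icc.1 hv; split_ifs at hl <;> omega
  inj v hv w hw hl hne := by grind

lemma isPath_graphD (ha : 2 ≤ a) (b : ℕ) : IsPath graphD (Icc a b) (fun v => v) a b where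
  le v hv := mem_Icc.1 hv
  surj j h1 h2 := ⟨j, mem_Icc.2 ⟨h1, h2⟩, rfl⟩
  adj v hv w hw := by have := mem_Icc.1 hv; have := mem_Icc.1 hw; rw [graphD_adj]; omega
  inj v _ w _ h := h

lemma gweight_graphD_Icc (hd : 2 ≤ d) (hb : 3 ≤ b) :
    gweight graphD d (Icc 1 b) = weightD d b := by
  rw [(isFork_graphD (by omega)).gweight_eq hd (by omega)]; congr 1; omega

lemma gweight_graphD_path (hd : 2 ≤ d) (ha : 2 ≤ a) (hab : a ≤ b + 1) :
    gweight graphD d (Icc a b) = (b + 2 - a) / d :=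
  (isPath_graphD ha b).gweight_eq hd hab

lemma separated_graphD_Icc (h0 : 0 ∉ s) (hb : 2 ≤ b) (hbs : b + 1 ∉ s) :
    Separated graphD (Icc 1 b) (s \ Icc 1 b) := by
  intro x hx y hy hadj; rw [graphD_adj] at hadj; grind

lemma component_graphD (h0 : 0 ∉ s) (hb : 3 ≤ b) (hC : Icc 1 b ⊆ s) (hbs : b + 1 ∉ s) :
    component graphD s 1 = Icc 1 b :=
  component_eq_of_separated hC (mem_Icc.2 ⟨le_rfl, by omega⟩)
    ((isFork_graphD (by omega)).preConn (by omega)) (separated_graphD_Icc h0 (by omega) hbs)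

/-- Adding `v` joins a component `D_{v-1}` and a path with `b - v` vertices into `D_b`. The bound `4
≤ v` keeps the left piece connected. -/
lemma gweight_graphD_insert (hd : 2 ≤ d) (h0 : 0 ∉ s) (hv : v ∉ s) (hv4 : 4 ≤ v)
    (hlow : ∀ j, 1 ≤ j → j < v → j ∈ s) (hvb : v ≤ b) (hrun : ∀ j, v < j → j ≤ b → j ∈ s)
    (hb : b + 1 ∉ s) (h : weightD d b = weightD d (v - 1) + (b - v + 1) / d) :
    gweight graphD d (insert v s) = gweight graphD d s := by
  have hC : Icc 1 b ⊆ insert v s := by grind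
  have hvC : v ∈ Icc 1 b := mem_Icc.2 ⟨by omega, hvb⟩
  refine gweight_insert_eq hv hvC hC (separated_graphD_Icc ?_ (by omega) ?_) ?_
  · grind
  · grind
  · rw [gweight_graphD_Icc hd (by omega), (isFork_graphD (by omega)).gweight_erase hd hvC
      (by split_ifs <;> omega), h]
    rw [if_neg (by omega)]; congr 2; omega

/-- The part of the matching in type `D` where the component of `1` has prescribed weight. -/
lemma isGood_graphD_run {v l q : ℕ} {π : Finset ℕ → Option ℕ} {L : Finset ℕ → Prop} (hd : 2 ≤ d)
    (hv : 5 ≤ v) (hl : l < d) (hg : g < d)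
    (hq : ∀ b, v - 1 ≤ b → b + 1 ≤ v + l → weightD d b = q)
    (hπ : ∀ σ ∈ simplicesA m 0 g, (∀ j, 1 ≤ j → j < v → j ∈ σ) →
      (¬ ∀ j, 1 ≤ j → j ≤ v + l → j ∈ σ) →
      π σ = if v ∈ σ then (if v + g ≤ m then some v else none) else if m < v then none
        else if ∀ j, v + 1 ≤ j → j ≤ v + l → j ∈ σ then
          relabel (m - v) (fun j => j + v) (pivotA d (m - v) l g) σ
        else some v)
    (hL : v ≤ m + 1 → m < v + l → m < v + g ∨ m < v → L (Icc 1 m))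
    (hL' : ∀ σ' ∈ simplicesA (m - v) l g, v + g ≤ m → v + l ≤ m → CriticalA d (m - v) l g σ' →
      ∀ σ, σ.card = v - 1 + σ'.card → gweight graphD d σ = q + gweight graphA d σ' →
      σ = Icc 1 (v - 1) ∪ σ'.image (fun j => j + v) → L σ) :
    IsGood {σ | σ ∈ simplicesA m 0 g ∧ (∀ j, 1 ≤ j → j < v → j ∈ σ) ∧
      ¬ ∀ j, 1 ≤ j → j ≤ v + l → j ∈ σ} (gweight graphD d) π L := by
  have hvm : ∀ σ ∈ simplicesA m 0 g, (∀ j, 1 ≤ j → j < v → j ∈ σ) → v ≤ m + 1 := by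
    intro σ hσ h1; have := (mem_Icc.1 (hσ.1 (h1 (v - 1) (by omega) (by omega)))).2; omega
  have hfull : ∀ σ ∈ simplicesA m 0 g, (∀ j, 1 ≤ j → j < v → j ∈ σ) → m < v →
      σ = Icc 1 m := by
    intro σ hσ h1 h2; refine Finset.Subset.antisymm hσ.1 ?_; grind
  -- If `v` does not exist, or is one of the forced last `g` vertices, only the full simplex is left
  -- in the fibre.
  by_cases hmv : m < v
  · refine IsGood.of_forall_none ?_ ?_
    · grind
    · grind
  by_cases hmg : m < v + g
  · have hE : ∀ σ ∈ simplicesA m 0 g, (∀ j, 1 ≤ j → j < v → j ∈ σ) → σ = Icc 1 m := by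
      intro σ hσ h1; refine Finset.Subset.antisymm hσ.1 ?_; rw [Icc_subset_iff]; intro j h3 h4
      by_cases h5 : j < v
      · exact h1 j h3 h5
      · exact hσ.2.2 j (by omega) h3 h4
    refine IsGood.of_forall_none ?_ ?_
    · grind
    · grind
  have h0 : ∀ σ ∈ simplicesA m 0 g, 0 ∉ σ := fun σ hσ h1 => by have := mem_Icc.1 (hσ.1 h1); omega
  -- All sizes from `v - 1` to `v + l - 1` of the component of `1` have weight `q`. If one of `v +
  -- 1, …, v + l` is missing, toggling `v` stays in this range; otherwise `v` is absent and the part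
  -- beyond `v` is an arbitrary simplex for the rule of type `A` with `f = l`.
  refine IsGood.split (fun σ => ∀ j, v + 1 ≤ j → j ≤ v + l → j ∈ σ)
    (fun σ _ τ _ hτσ h => fun j h3 h4 => hτσ (h j h3 h4)) ?_ ?_
  swap
  · refine IsGood.of_forall_some v ?_ ?_ ?_
    · grind
    · intro σ hvσ
      have h3 := simplicesA_insert (m := m) (g := g) (f := 0) (v := v) (σ := σ) (by omega)
        (by omega)
      have h4 : (∀ j, v + 1 ≤ j → j ≤ v + l → j ∈ insert v σ) ↔
          ∀ j, v + 1 ≤ j → j ≤ v + l → j ∈ σ := by grind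
      have h5 : (∀ j, 1 ≤ j → j < v → j ∈ insert v σ) ↔ ∀ j, 1 ≤ j → j < v → j ∈ σ := by grind
      grind
    · rintro σ ⟨⟨hσ, h1, h2⟩, h3⟩ hvσ; obtain ⟨b, hb1, hb2, hb3⟩ := exists_run_end σ v
      have hbl : b < v + l := by grind
      refine gweight_graphD_insert hd (h0 σ hσ) hvσ (by omega) h1 hb1 hb2 hb3 ?_
      rw [hq b (by omega) (by omega), hq (v - 1) le_rfl (by omega), Nat.div_eq_of_lt (by omega),
        add_zero]
  · have hnot : ∀ σ, (σ ∈ simplicesA m 0 g ∧ (∀ j, 1 ≤ j → j < v → j ∈ σ) ∧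
        ¬ ∀ j, 1 ≤ j → j ≤ v + l → j ∈ σ) ∧ (∀ j, v + 1 ≤ j → j ≤ v + l → j ∈ σ) → v ∉ σ := by grind
    by_cases hml : m < v + l
    · refine IsGood.of_forall_none ?_ ?_ <;>
      · rintro σ ⟨⟨hσ, h1, h2⟩, h3⟩; have := mem_Icc.1 (hσ.1 (h3 (v + l) (by omega) le_rfl)); omega
    have hsep' : ∀ σ' ∈ simplicesA (m - v) l g,
        Separated graphD (Icc 1 (v - 1)) (σ'.image fun j => j + v) ∧
        Disjoint (Icc 1 (v - 1)) (σ'.image fun j => j + v) := by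
      intro σ' hσ'; refine ⟨?_, ?_⟩
      · intro x hx y hy h; obtain ⟨j, hj, rfl⟩ := mem_image.1 hy; have := mem_Icc.1 (hσ'.1 hj)
        rw [graphD_adj] at h; rw [mem_Icc] at hx; omega
      · rw [disjoint_left]; grind
    have hwt : ∀ σ' ∈ simplicesA (m - v) l g,
        gweight graphD d (Icc 1 (v - 1) ∪ σ'.image fun j => j + v) =
          q + gweight graphA d σ' := by
      intro σ' hσ'
      rw [gweight_union (hsep' σ' hσ').1 (hsep' σ' hσ').2, gweight_graphD_Icc hd (by omega),
        hq _ le_rfl (by omega), gweight_image (Γ := graphA)]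
      · intro x _ y _ h; simpa using h
      · intro x _ y _; simp only [graphA_adj, graphD_adj]; omega
    refine IsGood.of_relabel (isGood_pivotA hd hl hg (m := m - v) (by omega) (by omega))
      (m - v) (fun j => j + v) (Icc 1 (v - 1)) q ?_ ?_ ?_ ?_ ?_ hwt ?_
    · grind
    · intro x _ y _ h; simpa using h
    · intro j _ h; rw [mem_Icc] at h; omega
    · exact fun σ' hσ' => hσ'.1
    · intro σ; constructor
      · intro hσ; have h3 := hnot σ hσ; obtain ⟨⟨hσ, h4, -⟩, h5⟩ := hσ
        refine ⟨(Icc 1 (m - v)).filter fun j => j + v ∈ σ,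
          ⟨filter_subset _ _, fun j h6 h7 => ?_, fun j h6 h7 h8 => ?_⟩, eq_union_image ?_ ?_⟩
        · grind
        · exact mem_filter.2 ⟨mem_Icc.2 ⟨h7, h8⟩, hσ.2.2 _ (by omega) (by omega)
            (by omega)⟩
        · grind
        · intro x hx; have h6 := mem_Icc.1 (hσ.1 hx); have h7 : x ≠ v := by rintro rfl; exact h3 hx
          simp only [mem_Icc]
          by_cases h8 : x ≤ v - 1
          · exact Or.inl ⟨h6.1, h8⟩
          · exact Or.inr ⟨x - v, by omega, by omega⟩
      · rintro ⟨σ', hσ', rfl⟩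
        have hno : v ∉ Icc 1 (v - 1) ∪ σ'.image fun j => j + v := by
          rw [mem_union, mem_image, mem_Icc]; rintro (h | ⟨j, hj, h⟩)
          · omega
          · have := mem_Icc.1 (hσ'.1 hj); omega
        refine ⟨⟨⟨?_, ?_, ?_⟩, ?_, fun h => hno (h _ (by omega) (by omega))⟩, ?_⟩
        · intro x hx; rw [mem_union, mem_image, mem_Icc] at hx; rw [mem_Icc]
          rcases hx with h | ⟨j, hj, rfl⟩
          · omega
          · have := mem_Icc.1 (hσ'.1 hj); omega
        · intro j h1 h2; omega
        · intro j h3 h4 h5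
          exact mem_union_right _ (mem_image.2 ⟨j - v,
            hσ'.2.2 _ (by omega) (by omega) (by omega), by omega⟩)
        · grind
        · intro j h3 h4
          exact mem_union_right _ (mem_image.2 ⟨j - v,
            hσ'.2.1 _ (by omega) (by omega), by omega⟩)
    · intro σ' hσ' _ hcr; refine hL' σ' hσ' (by omega) (by omega) hcr _ ?_ (hwt σ' hσ') rfl
      rw [card_union_of_disjoint (hsep' σ' hσ').2,
          card_image_of_injective _ (fun x y h => by simpa using h)]
      simp

/-- What is known about critical simplices in type `D`, for `d = 2 h`. -/
def CriticalD (h m g : ℕ) (σ : Finset ℕ) : Prop :=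
  (∃ j t, m = j + t * (2 * h) ∧ j ≤ g ∧
    defect (2 * h) m σ.card (gweight graphD (2 * h) σ) = 2 * j ∧
    (j = 1 → g = h → m ≤ σ.card + 1 ∧ (m = 2 * h + 1 → m = σ.card + 1 → σ = Icc 2 m))) ∨
  (∃ j t, m = h + j + t * (2 * h) ∧ 1 ≤ j ∧ j < h ∧
    defect (2 * h) m σ.card (gweight graphD (2 * h) σ) = 2 * j) ∨
  (∃ t, m = g + 1 + t * (2 * h) ∧ g + 1 < 2 * h ∧
    defect (2 * h) m σ.card (gweight graphD (2 * h) σ) = 2 * (g + 1) - 2 * h ∧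
    gweight graphD (2 * h) σ ≤ 1 ∧ 2 ∉ σ)

lemma defect_add {d M N c c' w w' : ℕ} :
    defect d (M + N) (c + c') (w + w') = defect d M c w + defect d N c' w' := by
  unfold defect; push_cast; ring

end TypeD

/-! ### Type `D`, `d = 2h`: large components of the fork -/

section TypeDEven

variable {h m g q v l : ℕ} {σ : Finset ℕ}

lemma evenQuot_eq_iff_of_even (hh : 0 < h) (hq : Even q) {b : ℕ} :
    evenQuot h b = q ↔ q * h ≤ b ∧ b ≤ q * h + h := by
  rw [evenQuot_eq_iff hh]; simp [hq]

lemma evenQuot_eq_iff_of_not_even (hh : 0 < h) (hq : ¬ Even q) {b : ℕ} :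
    evenQuot h b = q ↔ q * h + 1 ≤ b ∧ b + 1 ≤ q * h + h := by
  rw [evenQuot_eq_iff hh]; simp only [hq, not_false_eq_true, forall_const]; omega

lemma weightD_two_mul (b : ℕ) : weightD (2 * h) b = evenQuot h b := by unfold weightD; grind

lemma defect_Icc (hv : 1 ≤ v) : defect (2 * h) v (v - 1) q = 2 * v - 2 * h - 2 * (q * h) := by
  unfold defect; grind

lemma defect_full (m w : ℕ) : defect (2 * h) m m w = 2 * m - 2 * (w * h) := by
  unfold defect; push_cast; ring

lemma criticalD_full_of_even (hq : Even q) (hm : 3 ≤ m) (hh : 0 < h)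
    (hw : evenQuot h m = q) (hmg : m ≤ q * h + g) : CriticalD h m g (Icc 1 m) := by
  have h1 := (evenQuot_eq_iff_of_even hh hq).1 hw; obtain ⟨p, rfl⟩ := hq
  have e1 : (p + p) * h = p * (2 * h) := by ring
  refine Or.inl ⟨m - p * (2 * h), p, by omega, by omega, ?_, ?_⟩
  · rw [gweight_graphD_Icc (by omega) hm, weightD_two_mul, hw]
    simp only [Nat.card_Icc, Nat.add_sub_cancel]; rw [defect_full, ← Nat.cast_mul, e1]; omega
  · intro _ _; simp only [Nat.card_Icc, Nat.add_sub_cancel]; omega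

lemma criticalD_full_of_not_even (hq : ¬ Even q) (hm : 3 ≤ m) (hh : 0 < h)
    (hw : evenQuot h m = q) : CriticalD h m g (Icc 1 m) := by
  have h1 := (evenQuot_eq_iff_of_not_even hh hq).1 hw; rw [Nat.not_even_iff_odd] at hq
  obtain ⟨p, rfl⟩ := hq; have e1 : (2 * p + 1) * h = p * (2 * h) + h := by ring
  refine Or.inr (Or.inl ⟨m - p * (2 * h) - h, p, by omega, by omega, by omega, ?_⟩)
  rw [gweight_graphD_Icc (by omega) hm, weightD_two_mul, hw]
  simp only [Nat.card_Icc, Nat.add_sub_cancel]; rw [defect_full, ← Nat.cast_mul, e1]; omega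

/-- The `v` vertices up to the gap contribute `2 - 2h` to the defect. With `f = h` the two families
of `CriticalA`, of defects `2h - 2 + 2i` and `2(h + i)`, become the first family with `j = i` and
the second with `j = i + 1`. -/
lemma criticalD_of_even (hq : Even q) (hh : 0 < h) (hq0 : 5 ≤ q * h + 1)
    (hv : v = q * h + 1) (hg : g ≤ h) {σ' : Finset ℕ} (hvg : v + g ≤ m) (hvl : v + h ≤ m)
    (hcr : CriticalA (2 * h) (m - v) h g σ') (hc : σ.card = v - 1 + σ'.card)
    (hw : gweight graphD (2 * h) σ = q + gweight graphA (2 * h) σ') : CriticalD h m g σ := by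
  have hdef : defect (2 * h) m σ.card (gweight graphD (2 * h) σ) =
      2 - 2 * h + defect (2 * h) (m - v) σ'.card (gweight graphA (2 * h) σ') := by
    rw [hc, hw]
    conv_lhs => rw [show m = v + (m - v) by omega]
    rw [defect_add, defect_Icc (by omega), hv]; push_cast; ring
  obtain ⟨p, rfl⟩ := hq; have e1 : (p + p) * h = p * (2 * h) := by ring
  rw [e1] at hv hq0
  rcases hcr with ⟨h1, rfl⟩ | ⟨h1, -, ⟨i, t, h2, h3, h4, h5, h6⟩ | ⟨i, t, h2, h3, h4, h5, h6⟩⟩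
  · rw [gweight_graphA_Icc (by omega) (by omega), show m - v + 2 - 1 = m - v + 1 by omega] at hdef
    simp only [Nat.card_Icc, Nat.add_sub_cancel] at hdef hc; rw [defect_full] at hdef
    rcases lt_trichotomy (m - v + 1) (2 * h) with h7 | h7 | h7
    · rw [Nat.div_eq_of_lt h7] at hdef
      refine Or.inr (Or.inl ⟨m - v + 1 - h, p, by omega, by omega, by omega, ?_⟩)
      rw [hdef]; push_cast; omega
    · rw [h7, Nat.div_self (by omega)] at hdef
      refine Or.inl ⟨0, p + 1, by rw [add_mul]; omega, by omega, ?_, by omega⟩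
      rw [hdef]; push_cast; omega
    · rw [show (m - v + 1) / (2 * h) = 1 from Nat.div_eq_of_lt_le (by omega) (by omega)] at hdef
      refine Or.inl ⟨1, p + 1, by rw [add_mul]; omega, by omega, ?_, by omega⟩
      rw [hdef]; push_cast; omega
  · refine Or.inl ⟨i, p + t, by rw [add_mul]; omega, h4, ?_, by omega⟩
    rw [hdef, h6]; push_cast; ring
  · refine Or.inr (Or.inl ⟨i + 1, p + t, by rw [add_mul]; omega, by omega, by omega, ?_⟩)
    rw [hdef, h6]; push_cast; ring

/-- Now the left block contributes `4 - 2h` and `f = h - 2`; as `v` is shifted by an odd multiple of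
`h`, the first family of `CriticalA` goes to the second of `CriticalD` and conversely. -/
lemma criticalD_of_not_even (hq : ¬ Even q) (hh : 2 ≤ h)
    (hv : v = q * h + 2) (hg : g ≤ h) {σ' : Finset ℕ} (hvg : v + g ≤ m) (hvl : v + (h - 2) ≤ m)
    (hcr : CriticalA (2 * h) (m - v) (h - 2) g σ') (hc : σ.card = v - 1 + σ'.card)
    (hw : gweight graphD (2 * h) σ = q + gweight graphA (2 * h) σ') : CriticalD h m g σ := by
  have hdef : defect (2 * h) m σ.card (gweight graphD (2 * h) σ) =
      4 - 2 * h + defect (2 * h) (m - v) σ'.card (gweight graphA (2 * h) σ') := by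
    rw [hc, hw]
    conv_lhs => rw [show m = v + (m - v) by omega]
    rw [defect_add, defect_Icc (by omega), hv]; push_cast; ring
  rw [Nat.not_even_iff_odd] at hq; obtain ⟨p, rfl⟩ := hq
  have e1 : (2 * p + 1) * h = p * (2 * h) + h := by ring
  rw [e1] at hv
  rcases hcr with ⟨h1, rfl⟩ | ⟨h1, -, ⟨i, t, h2, h3, h4, h5, h6⟩ | ⟨i, t, h2, h3, h4, h5, h6⟩⟩
  · rw [gweight_graphA_Icc (by omega) (by omega), Nat.div_eq_of_lt (by omega)] at hdef
    simp only [Nat.card_Icc, Nat.add_sub_cancel] at hdef hc; rw [defect_full] at hdef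
    refine Or.inl ⟨m - v + 2 - h, p + 1, by rw [add_mul]; omega, by omega, ?_, by omega⟩
    rw [hdef]; push_cast; omega
  · refine Or.inr (Or.inl ⟨i + 1, p + t, by rw [add_mul]; omega, by omega, by omega, ?_⟩)
    rw [hdef, h6]; push_cast; ring
  · refine Or.inl ⟨i, p + t + 1, by rw [add_mul, add_mul]; omega, h4, ?_, by omega⟩; grind

/-- With `l` equal to `h` or `h - 2`, the even and the odd branch of case (g) become a single rule
in `v` and `l`. -/
lemma pivotDEven_of_connected (h1 : 1 ∈ σ) (h2 : 2 ∈ σ) (h3 : 3 ∈ σ) (h4 : 4 ∈ σ) {k : ℕ}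
    (hk : (component graphD σ 1).card = k) (hq : evenQuot h k = q)
    (hv : v = if Even q then q * h + 1 else q * h + 2)
    (hl : l = if Even q then h else h - 2) (hh : 0 < h) (hodd : ¬ Even q → 2 ≤ h) :
    pivotDEven (2 * h) m g σ = if v ∈ σ then (if v + g ≤ m then some v else none)
      else if m < v then none
      else if ∀ j, v + 1 ≤ j → j ≤ v + l → j ∈ σ then
        relabel (m - v) (fun j => j + v) (pivotA (2 * h) (m - v) l g) σ
      else some v := by
  have e0 : 2 * h / 2 = h := by omega
  have e1 : ({1, 2, 3, 4} : Finset ℕ) ⊆ σ := by simp [insert_subset_iff, h1, h2, h3, h4]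
  unfold pivotDEven; grind

/-- The component of `1` grows with `σ` and `evenQuot` is monotone, so its weight `q` cuts the
complex into fibres. A nonempty fibre consists of the `σ` that contain `{1, …, v - 1}` but not `{1,
…, v + l}`, which is the situation of `isGood_graphD_run`. The bound `max 4 (h + 1)` ensures `q > 0`
and `5 ≤ v`. -/
theorem isGood_pivotDEven_connected (hh : 0 < h) (hg : g ≤ h) :
    IsGood {σ | σ ∈ simplicesA m 0 g ∧ ∀ j, 1 ≤ j → j ≤ max 4 (h + 1) → j ∈ σ}
      (gweight graphD (2 * h)) (pivotDEven (2 * h) m g) (CriticalD h m g) := by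
  have h0 : ∀ σ ∈ simplicesA m 0 g, 0 ∉ σ := fun σ hσ h1 => by have := mem_Icc.1 (hσ.1 h1); omega
  refine IsGood.of_fibers (fun σ => evenQuot h (component graphD σ 1).card)
    (fun σ _ τ _ hτσ => evenQuot_mono hh (card_le_card (component_mono hτσ))) fun q => ?_
  have hrun : ∀ σ, (σ ∈ simplicesA m 0 g ∧ ∀ j, 1 ≤ j → j ≤ max 4 (h + 1) → j ∈ σ) →
      ∃ b, 4 ≤ b ∧ h + 1 ≤ b ∧ (component graphD σ 1).card = b ∧ (∀ j, 1 ≤ j → j ≤ b → j ∈ σ) ∧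
        b + 1 ∉ σ := by
    rintro σ ⟨hσ, h1⟩; obtain ⟨b, hb1, hb2, hb3⟩ := exists_run_end σ (max 4 (h + 1))
    have hb : ∀ j, 1 ≤ j → j ≤ b → j ∈ σ := fun j h2 h3 => by grind
    refine ⟨b, by omega, by omega, ?_, hb, hb3⟩
    rw [component_graphD (h0 σ hσ) (by omega) (Icc_subset_iff.2 hb) hb3]; simp
  have hrun' : ∀ {v l : ℕ}, 5 ≤ v → h + 2 ≤ v →
      (∀ b, evenQuot h b = q ↔ v - 1 ≤ b ∧ b + 1 ≤ v + l) →
      {σ | σ ∈ {σ | σ ∈ simplicesA m 0 g ∧ ∀ j, 1 ≤ j → j ≤ max 4 (h + 1) → j ∈ σ} ∧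
        evenQuot h (component graphD σ 1).card = q} =
      {σ | σ ∈ simplicesA m 0 g ∧ (∀ j, 1 ≤ j → j < v → j ∈ σ) ∧
      ¬ ∀ j, 1 ≤ j → j ≤ v + l → j ∈ σ} := by
    intro v l hv5 hvh hiff; ext σ; constructor
    · grind
    · rintro ⟨hσ, h1, h2⟩
      have h3 : ∀ j, 1 ≤ j → j ≤ max 4 (h + 1) → j ∈ σ := fun j h3 h4 => h1 j h3 (by omega); grind
  by_cases hemp : ∀ σ, σ ∈ simplicesA m 0 g ∧ (∀ j, 1 ≤ j → j ≤ max 4 (h + 1) → j ∈ σ) →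
      evenQuot h (component graphD σ 1).card ≠ q
  · refine IsGood.of_forall_none ?_ ?_ <;> exact fun σ hσ => absurd hσ.2 (hemp σ hσ.1)
  push Not at hemp
  obtain ⟨σ₀, hσ₀, hq₀⟩ := hemp; obtain ⟨k, hk4, hkh, hk, -, -⟩ := hrun σ₀ hσ₀; rw [hk] at hq₀
  by_cases he : Even q
  · have hiff : ∀ b, evenQuot h b = q ↔ (q * h + 1) - 1 ≤ b ∧ b + 1 ≤ q * h + 1 + h := fun b => by
      rw [evenQuot_eq_iff_of_even hh he]; omega
    have h1 := (hiff k).1 hq₀; have hq1 : 2 ≤ q := by obtain ⟨p, rfl⟩ := he; grind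
    have h2 : 2 * h ≤ q * h := Nat.mul_le_mul_right _ hq1
    have hv5 : 5 ≤ q * h + 1 := by
      by_contra h3; obtain rfl : h = 1 := by omega
      obtain ⟨p, rfl⟩ := he; omega
    rw [hrun' hv5 (by omega) hiff]
    refine isGood_graphD_run (q := q) (by omega) hv5 (by omega) (by omega) ?_ ?_ ?_ ?_
    · intro b h3 h4; rw [weightD_two_mul, hiff]; omega
    · intro σ hσ h3 h4
      have h5 : σ ∈ {σ | σ ∈ {σ | σ ∈ simplicesA m 0 g ∧
          ∀ j, 1 ≤ j → j ≤ max 4 (h + 1) → j ∈ σ} ∧ evenQuot h (component graphD σ 1).card = q} := by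
        rw [hrun' hv5 (by omega) hiff]; exact ⟨hσ, h3, h4⟩
      exact pivotDEven_of_connected (h3 1 (by omega) (by omega)) (h3 2 (by omega) (by omega))
        (h3 3 (by omega) (by omega)) (h3 4 (by omega) (by omega)) rfl h5.2 (by rw [if_pos he])
        (by rw [if_pos he]) hh (fun h => absurd he h)
    · intro h3 h4 h5
      exact criticalD_full_of_even he (by omega) hh ((hiff m).2 (by omega)) (by omega)
    · intro σ' hσ' h3 h4 h5 σ h6 h7 _; exact criticalD_of_even he hh hv5 rfl hg h3 h4 h5 h6 h7
  · have hiff : ∀ b, evenQuot h b = q ↔ (q * h + 2) - 1 ≤ b ∧ b + 2 ≤ q * h + 1 + h := fun b => by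
      rw [evenQuot_eq_iff_of_not_even hh he]; omega
    have h1 := (hiff k).1 hq₀; have hh2 : 2 ≤ h := by omega
    have hiff : ∀ b, evenQuot h b = q ↔ (q * h + 2) - 1 ≤ b ∧ b + 1 ≤ q * h + 2 + (h - 2) :=
      fun b => by rw [hiff]; omega
    have hq1 : 1 ≤ q := by grind
    have h2 : 1 * h ≤ q * h := Nat.mul_le_mul_right _ hq1; have hv5 : 5 ≤ q * h + 2 := by grind
    rw [hrun' hv5 (by omega) hiff]
    refine isGood_graphD_run (q := q) (by omega) hv5 (by omega) (by omega) ?_ ?_ ?_ ?_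
    · intro b h3 h4; rw [weightD_two_mul, hiff]; omega
    · intro σ hσ h3 h4
      have h5 : σ ∈ {σ | σ ∈ {σ | σ ∈ simplicesA m 0 g ∧
          ∀ j, 1 ≤ j → j ≤ max 4 (h + 1) → j ∈ σ} ∧ evenQuot h (component graphD σ 1).card = q} := by
        rw [hrun' hv5 (by omega) hiff]; exact ⟨hσ, h3, h4⟩
      exact pivotDEven_of_connected (h3 1 (by omega) (by omega)) (h3 2 (by omega) (by omega))
        (h3 3 (by omega) (by omega)) (h3 4 (by omega) (by omega)) rfl h5.2 (by rw [if_neg he])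
        (by rw [if_neg he]) hh (fun _ => hh2)
    · intro h3 h4 h5; exact criticalD_full_of_not_even he (by omega) hh ((hiff m).2 (by omega))
    · intro σ' hσ' h3 h4 h5 σ h6 h7 _; exact criticalD_of_not_even he hh2 rfl hg h3 h4 h5 h6 h7

end TypeDEven

/-! ### Type `D`, `d = 2h`: the remaining fibres and the assembly -/

section TypeDEven

variable {h m g : ℕ} {σ s : Finset ℕ}

lemma mem_insert_of_ne_iff {v j : ℕ} (hj : j ≠ v) : j ∈ insert v σ ↔ j ∈ σ := by
  rw [mem_insert]; exact or_iff_right hj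

lemma forall_mem_insert_iff {v a b : ℕ} (hv : v < a ∨ b < v) :
    (∀ j, a ≤ j → j ≤ b → j ∈ insert v σ) ↔ ∀ j, a ≤ j → j ≤ b → j ∈ σ := by grind

lemma zero_notMem_of_mem_simplicesA {f : ℕ} (hσ : σ ∈ simplicesA m f g) : 0 ∉ σ := fun h1 => by
  have := mem_Icc.1 (hσ.1 h1); omega

lemma defect_pred {d c w : ℕ} (hm : 1 ≤ m) : defect d m c w = defect d (m - 1) c w - (d - 2) := by
  unfold defect; rw [show ((m - 1 : ℕ) : ℤ) = m - 1 by omega]; ring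

/-- Without `2` the graph is the path `1 - 3 - 4 - ⋯`, so the rule of type `A` applies with `f = 0`.
The lost vertex lowers the defect by `d - 2`, and this produces the third, exceptional family of
`CriticalD`. -/
lemma isGood_pivotDEven_two_notMem (hh : 0 < h) (hg : g ≤ h) (hm : 2 ≤ m) :
    IsGood {σ | σ ∈ simplicesA m 0 g ∧ 2 ∉ σ} (gweight graphD (2 * h)) (pivotDEven (2 * h) m g)
      (CriticalD h m g) := by
  by_cases hmg : m < g + 2
  · refine IsGood.of_forall_none ?_ ?_ <;>
    · rintro σ ⟨hσ, h1⟩; exact absurd (hσ.2.2 2 (by omega) (by omega) (by omega)) h1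
  have hw : ∀ σ' ∈ simplicesA (m - 1) 0 g, gweight graphD (2 * h)
      (∅ ∪ σ'.image fun j => if j = 1 then 1 else j + 1) = 0 + gweight graphA (2 * h) σ' := by
    intro σ' hσ'; have h1 : ∀ j ∈ σ', 1 ≤ j := fun j hj => (mem_Icc.1 (hσ'.1 hj)).1
    rw [empty_union, zero_add, gweight_image (Γ := graphA)]
    · intro x hx y hy hxy; grind
    · intro x hx y hy; have := h1 x hx; have := h1 y hy; rw [graphA_adj, graphD_adj]
      split_ifs <;> omega
  refine IsGood.of_relabel (isGood_pivotA (d := 2 * h) (f := 0) (m := m - 1) (g := g) (by omega)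
    (by omega) (by omega) (by omega) (by omega)) (m - 1) (fun j => if j = 1 then 1 else j + 1) ∅ 0
    ?_ ?_ (by simp) (fun σ' hσ' => hσ'.1) ?_ hw ?_
  · rintro σ ⟨-, h1⟩; unfold pivotDEven; rw [if_pos h1]
  · intro x hx y hy hxy; grind
  · intro σ; constructor
    · rintro ⟨hσ, h1⟩
      refine ⟨(Icc 1 (m - 1)).filter fun j => (if j = 1 then 1 else j + 1) ∈ σ,
        ⟨filter_subset _ _, fun j h6 h7 => by omega, fun j h6 h7 h8 => ?_⟩,
        eq_union_image (by simp) ?_⟩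
      · refine mem_filter.2 ⟨mem_Icc.2 ⟨h7, h8⟩, ?_⟩; rw [if_neg (by omega)]
        exact hσ.2.2 _ (by omega) (by omega) (by omega)
      · intro x hx; have h6 := mem_Icc.1 (hσ.1 hx); have h7 : x ≠ 2 := by rintro rfl; exact h1 hx
        right
        by_cases h8 : x = 1
        · exact ⟨1, mem_Icc.2 ⟨by omega, by omega⟩, by rw [if_pos rfl, h8]⟩
        · exact ⟨x - 1, mem_Icc.2 ⟨by omega, by omega⟩, by rw [if_neg (by omega)]; omega⟩
    · rintro ⟨σ', hσ', rfl⟩; rw [empty_union]; refine ⟨⟨?_, ?_, ?_⟩, ?_⟩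
      · intro x hx; obtain ⟨j, hj, rfl⟩ := mem_image.1 hx; have := mem_Icc.1 (hσ'.1 hj)
        rw [mem_Icc]; split_ifs <;> omega
      · intro j h1 h2; omega
      · intro j h3 h4 h5
        exact mem_image.2 ⟨j - 1, hσ'.2.2 _ (by omega) (by omega) (by omega),
          by rw [if_neg (by omega)]; omega⟩
      · grind
  · intro σ' hσ' hσ hcr; have h2 := hσ.2
    have hinj : (∅ ∪ σ'.image fun j => if j = 1 then 1 else j + 1).card = σ'.card := by
      rw [empty_union, card_image_of_injOn]; intro x hx y hy hxy; have := mem_Icc.1 (hσ'.1 hx)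
      have := mem_Icc.1 (hσ'.1 hy); dsimp only at hxy; split_ifs at hxy <;> omega
    have hw' := (hw σ' hσ').trans (zero_add _); unfold CriticalD
    rw [hinj, hw', defect_pred (by omega)]
    rcases hcr with ⟨h3, -⟩ | ⟨-, h4, ⟨i, t, h5, h6, h7, h8, h9⟩ | ⟨i, t, h5, h6, h7, h8, h9⟩⟩
    · omega
    · grind
    · refine Or.inr (Or.inr ⟨t, by omega, by omega, ?_, h4, h2⟩); rw [h9]; push_cast; omega

lemma mem_simplicesA_shift_iff {f : ℕ} (hm : 1 ≤ m) :
    (σ ∈ simplicesA m 0 g ∧ (∀ j, 2 ≤ j → j ≤ f + 1 → j ∈ σ) ∧ 1 ∉ σ) ↔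
      g < m ∧ ∃ σ' ∈ simplicesA (m - 1) f g, σ = ∅ ∪ σ'.image fun j => j + 1 := by
  constructor
  · rintro ⟨hσ, h1, h2⟩
    have hgm : g < m := by by_contra h; exact h2 (hσ.2.2 1 (by omega) le_rfl (by omega))
    refine ⟨hgm, (Icc 1 (m - 1)).filter fun j => j + 1 ∈ σ,
      ⟨filter_subset _ _, fun j h6 h7 => ?_, fun j h6 h7 h8 => ?_⟩, eq_union_image (by simp) ?_⟩
    · have := h1 (j + 1) (by omega) (by omega); have := mem_Icc.1 (hσ.1 this); grind
    · exact mem_filter.2 ⟨mem_Icc.2 ⟨h7, h8⟩, hσ.2.2 _ (by omega) (by omega) (by omega)⟩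
    · intro x hx; have h6 := mem_Icc.1 (hσ.1 hx); have h7 : x ≠ 1 := by rintro rfl; exact h2 hx
      exact Or.inr ⟨x - 1, mem_Icc.2 ⟨by omega, by omega⟩, by omega⟩
  · rintro ⟨hgm, σ', hσ', rfl⟩; rw [empty_union]
    refine ⟨⟨?_, by omega, fun j h3 h4 h5 => ?_⟩, fun j h3 h4 => ?_, ?_⟩
    · intro x hx; obtain ⟨j, hj, rfl⟩ := mem_image.1 hx; have := mem_Icc.1 (hσ'.1 hj); rw [mem_Icc]
      omega
    · by_cases h6 : j = 1
      · omega
      · exact mem_image.2 ⟨j - 1, hσ'.2.2 _ (by omega) (by omega) (by omega), by omega⟩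
    · exact mem_image.2 ⟨j - 1, hσ'.2.1 _ (by omega) (by omega), by omega⟩
    · intro hx; obtain ⟨j, hj, h2⟩ := mem_image.1 hx; have := mem_Icc.1 (hσ'.1 hj); omega

/-- Without `1` the graph of type `D_m` is the path `2 - 3 - ⋯ - m`. -/
theorem IsGood.shift {d f : ℕ} {π π' : Finset ℕ → Option ℕ} {L L' : Finset ℕ → Prop}
    (hm : g < m)
    (H : IsGood (simplicesA (m - 1) f g) (gweight graphA d) π' L')
    (hπ : ∀ σ, (∀ j, 2 ≤ j → j ≤ f + 1 → j ∈ σ) → 1 ∉ σ →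
      π σ = relabel (m - 1) (fun j => j + 1) π' σ)
    (hL : ∀ s : Finset ℕ, L' s → (s.image fun j => j + 1).card = s.card →
      gweight graphD d (s.image fun j => j + 1) = gweight graphA d s →
      L (s.image fun j => j + 1)) :
    IsGood {σ | σ ∈ simplicesA m 0 g ∧ (∀ j, 2 ≤ j → j ≤ f + 1 → j ∈ σ) ∧ 1 ∉ σ}
      (gweight graphD d) π L := by
  have hw : ∀ σ' ∈ simplicesA (m - 1) f g, gweight graphD d (σ'.image fun j => j + 1) =
      gweight graphA d σ' := by
    intro σ' hσ'; have h1 : ∀ j ∈ σ', 1 ≤ j := fun j hj => (mem_Icc.1 (hσ'.1 hj)).1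
    rw [gweight_image (Γ := graphA)]
    · intro x _ y _ h; simpa using h
    · intro x hx y hy; have := h1 x hx; have := h1 y hy; rw [graphA_adj, graphD_adj]; omega
  refine IsGood.of_relabel H (m - 1) (fun j => j + 1) ∅ 0 (fun σ hσ => hπ σ hσ.2.1 hσ.2.2) ?_
    (by simp) (fun σ' hσ' => hσ'.1)
    (fun σ => (mem_simplicesA_shift_iff (by omega)).trans (and_iff_right hm)) ?_ ?_
  · intro x _ y _ h; simpa using h
  · intro σ' hσ'; rw [empty_union, zero_add, hw σ' hσ']
  · intro σ' hσ' _ hcr; rw [empty_union]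
    exact hL σ' hcr (card_image_of_injective _ fun x y h => by simpa using h) (hw σ' hσ')

/-- Case (f1). The maximum with `3` matters only for `d = 4`, where the vertex `4` is present
although `h + 1 = 3`. -/
lemma isGood_pivotDEven_one_notMem {f : ℕ} (hh : 2 ≤ h) (hg : g ≤ h) (hf : f = max h 3) :
    IsGood {σ | σ ∈ simplicesA m 0 g ∧ (∀ j, 2 ≤ j → j ≤ f + 1 → j ∈ σ) ∧ 1 ∉ σ}
      (gweight graphD (2 * h)) (pivotDEven (2 * h) m g) (CriticalD h m g) := by
  by_cases hmg : m < g + 1 ∨ m < f + 1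
  · refine IsGood.of_forall_none ?_ ?_ <;>
    · rintro σ ⟨hσ, h1, h2⟩; have h3 := mem_Icc.1 (hσ.1 (h1 (f + 1) (by omega) le_rfl)); grind
  refine IsGood.shift (by omega) (isGood_pivotA (d := 2 * h) (f := f) (m := m - 1) (g := g)
    (by omega) (by omega) (by omega) (by omega) (by omega)) ?_ ?_
  · intro σ h1 h2; unfold pivotDEven; have e0 : 2 * h / 2 = h := by omega
    simp only [e0]
    rw [if_neg (not_not.2 (h1 2 (by omega) (by omega))), if_neg (by omega),
      if_neg (fun hc => hc.2 (h1 3 (by omega) (by omega))),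
      if_neg (fun hc => hc.2 (h1 4 (by omega) (by omega))),
      if_neg (fun hc => hc.2 (h1 4 (by omega) (by omega))), if_pos ⟨by omega, h2⟩,
      if_pos (Icc_subset_iff.2 fun j h3 h4 => h1 j h3 (by omega)), hf]
  · intro σ' hcr hinj hw'; unfold CriticalD; rw [hinj, hw', defect_pred (by omega)]
    rcases hcr with ⟨h3, rfl⟩ | ⟨-, h4, ⟨i, t, h5, h6, h7, h8, h9⟩ | ⟨i, t, h5, h6, h7, h8, h9⟩⟩
    · rw [gweight_graphA_Icc (by omega) (by omega), show m - 1 + 2 - 1 = m by omega]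
      simp only [Nat.card_Icc, Nat.add_sub_cancel]; rw [defect_full]
      rcases Nat.lt_or_ge m (2 * h) with h10 | h10
      · rw [Nat.div_eq_of_lt h10]
        refine Or.inr (Or.inl ⟨m - h, 0, by omega, by omega, by omega, ?_⟩); push_cast; omega
      · rw [show m / (2 * h) = 1 from Nat.div_eq_of_lt_le (by omega) (by omega)]
        refine Or.inl ⟨m - 2 * h, 1, by omega, by omega, ?_, ?_⟩
        · push_cast; omega
        · refine fun _ _ => ⟨by omega, fun _ _ => ?_⟩; ext x; rw [mem_image, mem_Icc]; constructor
          · grind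
          · intro hx; exact ⟨x - 1, mem_Icc.2 ⟨by omega, by omega⟩, by omega⟩
    · grind
    · refine Or.inr (Or.inl ⟨i + 1, t, by omega, by omega, by omega, ?_⟩); rw [h9]; push_cast; omega

/-- Adding `1` turns a component `{2, …, b}` of type `A_{b-1}` into `D_b`. The weights of the two
types need to agree only for components that end before the gap `c`. -/
lemma gweight_graphD_insert_one {d : ℕ} (hd : 3 ≤ d) (hs : s ⊆ Icc 2 m) (h2 : 2 ∈ s)
    {c : ℕ} (hc : c ∉ s) (hc2 : 2 ≤ c) (hz : ∀ b, 3 ≤ b → b < c → weightD d b = b / d) :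
    gweight graphD d (insert 1 s) = gweight graphD d s := by
  have h1 : 1 ∉ s := fun h => by have := mem_Icc.1 (hs h); omega
  have h0 : 0 ∉ s := fun h => by have := mem_Icc.1 (hs h); omega
  by_cases h3 : 3 ∈ s
  · obtain ⟨b, hb1, hb2, hb3⟩ := exists_run_end s 2; have hb4 : 3 ≤ b := by grind
    have hC : Icc 1 b ⊆ insert 1 s := by grind
    refine gweight_insert_eq h1 (mem_Icc.2 ⟨le_rfl, by omega⟩) hC
      (separated_graphD_Icc ?_ (by omega) ?_) ?_
    · rw [mem_insert_of_ne_iff (by omega)]; exact h0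
    · rw [mem_insert_of_ne_iff (by omega)]; exact hb3
    · have hbc : b < c := by grind
      rw [gweight_graphD_Icc (by omega) hb4,
        (isFork_graphD (by omega)).erase_left.gweight_eq (by omega) (by omega), hz b hb4 hbc]
      congr 1; omega
  · refine gweight_insert_eq (C := {1}) h1 (by simp) (by simp) ?_ ?_
    · intro x hx y hy h; rw [mem_singleton] at hx; rw [mem_sdiff] at hy; rw [graphD_adj] at h; grind
    · rw [gweight_singleton (by omega), erase_singleton, gweight_empty,
        Nat.div_eq_of_lt (by omega)]

/-- Every case of the recipe that occurs here toggles `1`, case (g) because `q = 0` and `v = 1`. The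
component of `1` has at most `h` vertices, hence weight `0` with or without `1`. -/
lemma isGood_pivotDEven_run_short (hh : 2 ≤ h) (hgm : g < m) :
    IsGood {σ | σ ∈ simplicesA m 0 g ∧ 2 ∈ σ ∧ ¬ ∀ j, 2 ≤ j → j ≤ h + 1 → j ∈ σ}
      (gweight graphD (2 * h)) (pivotDEven (2 * h) m g) (CriticalD h m g) := by
  refine IsGood.of_forall_some 1 ?_ ?_ ?_
  · rintro σ ⟨hσ, h2, hn⟩; unfold pivotDEven; have e0 : 2 * h / 2 = h := by omega
    simp only [e0]; rw [if_neg (not_not.2 h2), if_neg (by omega)]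
    by_cases h3 : 3 ∈ σ
    · rw [if_neg (fun hc => hc.2 h3)]; rw [if_neg]
      · by_cases h4 : 4 ∈ σ
        · rw [if_neg (fun hc => hc.2 h4)]
          by_cases h1 : 1 ∈ σ
          · rw [if_neg (fun hc => hc.2 h1)]; obtain ⟨b, hb1, hb2, hb3⟩ := exists_run_end σ 4
            have hall : ∀ j, 1 ≤ j → j ≤ b → j ∈ σ := by grind
            have hbh : b ≤ h := by grind
            rw [component_graphD (zero_notMem_of_mem_simplicesA hσ) (by omega)
              (Icc_subset_iff.2 hall) hb3]
            have hq : evenQuot h b = 0 := by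
              rw [evenQuot_eq_iff_of_even (by omega) (by simp)]; omega
            simp only [Nat.card_Icc, Nat.add_sub_cancel, hq, Even.zero, if_true, zero_mul, zero_add]
            rw [if_pos h1, if_pos (by omega)]
          · grind
        · grind
      · grind
    · rw [if_pos ⟨by omega, h3⟩]
  · intro σ h1
    have h3 := simplicesA_insert (m := m) (g := g) (f := 0) (v := 1) (σ := σ) (by omega) (by omega)
    grind
  · rintro σ ⟨hσ, h2, hn⟩ h1
    push Not at hn
    obtain ⟨c, hc2, hch, hc⟩ := hn
    refine gweight_graphD_insert_one (m := m) (by omega) ?_ h2 hc hc2 ?_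
    · intro x hx; have h3 := mem_Icc.1 (hσ.1 hx); grind
    · intro b h3 h4
      rw [weightD_two_mul, Nat.div_eq_of_lt (by omega),
        evenQuot_eq_iff_of_even (by omega) (by simp)]
      omega

/-- For `d = 4` the block before the gap `4` is `{2, 3}` or `{1, 2, 3}`. In both cases its size
exceeds its weight by `2`, so its defect on four vertices is zero and the defect of the part beyond
`4` carries over. -/
lemma isGood_pivotDEven_four_notMem {e : ℕ} (he : e ≤ 1) (hg : g ≤ 2) :
    IsGood {σ | σ ∈ simplicesA m 0 g ∧ 2 ∈ σ ∧ 3 ∈ σ ∧ 4 ∉ σ ∧ (1 ∈ σ ↔ e = 1)}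
      (gweight graphD (2 * 2)) (pivotDEven (2 * 2) m g) (CriticalD 2 m g) := by
  have hπ : ∀ σ : Finset ℕ, 2 ∈ σ → 3 ∈ σ → 4 ∉ σ → pivotDEven (2 * 2) m g σ =
      relabel (m - 4) (fun j => j + 4) (pivotA 4 (m - 4) 0 g) σ := by
    intro σ h2 h3 h4; unfold pivotDEven; grind
  have hO : gweight graphD (2 * 2) (Icc (2 - e) 3) = e := by
    rcases Nat.le_one_iff_eq_zero_or_eq_one.1 he with rfl | rfl
    · rw [gweight_graphD_path (by omega) (by omega) (by omega)]
    · rw [show 2 - 1 = 1 by omega, gweight_graphD_Icc (by omega) (by omega),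
        weightD_three (by omega)]
  have hOd : defect (2 * 2) 4 (2 + e) e = 0 := by unfold defect; push_cast; ring
  by_cases hm : m < 4
  · refine IsGood.of_forall_none ?_ ?_
    · rintro σ ⟨hσ, h2, h3, h4, -⟩
      rw [hπ σ h2 h3 h4, relabel, show m - 4 = 0 by omega, pivotA, dif_neg (by omega),
        dif_pos (by omega)]
      rfl
    · rintro σ ⟨hσ, h2, h3, h4, h1⟩; have h5 : m = 3 := by have := mem_Icc.1 (hσ.1 h3); omega
      have hE : σ = Icc (2 - e) 3 := by
        ext x; rw [mem_Icc]; constructor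
        · intro hx; have h6 := mem_Icc.1 (hσ.1 hx); grind
        · grind
      refine Or.inr (Or.inl ⟨1, 0, by omega, le_rfl, by omega, ?_⟩); rw [hE, hO, h5]
      simp only [Nat.card_Icc, defect]; grind
  by_cases hmg : m < g + 4
  · refine IsGood.of_forall_none ?_ ?_ <;>
    · rintro σ ⟨hσ, -, -, h4, -⟩; exact absurd (hσ.2.2 4 (by omega) (by omega) (by omega)) h4
  have hsep' : ∀ σ' ∈ simplicesA (m - 4) 0 g,
      Separated graphD (Icc (2 - e) 3) (σ'.image fun j => j + 4) ∧
      Disjoint (Icc (2 - e) 3) (σ'.image fun j => j + 4) := by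
    intro σ' hσ'; refine ⟨?_, ?_⟩
    · intro x hx y hy h; obtain ⟨j, hj, rfl⟩ := mem_image.1 hy; have := mem_Icc.1 (hσ'.1 hj)
      rw [graphD_adj] at h; rw [mem_Icc] at hx; omega
    · rw [disjoint_left]; grind
  have hwt : ∀ σ' ∈ simplicesA (m - 4) 0 g,
      gweight graphD (2 * 2) (Icc (2 - e) 3 ∪ σ'.image fun j => j + 4) =
        e + gweight graphA (2 * 2) σ' := by
    intro σ' hσ'
    rw [gweight_union (hsep' σ' hσ').1 (hsep' σ' hσ').2, hO, gweight_image (Γ := graphA)]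
    · intro x _ y _ h; simpa using h
    · intro x _ y _; simp only [graphA_adj, graphD_adj]; omega
  refine IsGood.of_relabel (isGood_pivotA (d := 2 * 2) (f := 0) (g := g) (m := m - 4) (by omega)
    (by omega) (by omega) (by omega) (by omega))
    (m - 4) (fun j => j + 4) (Icc (2 - e) 3) e ?_ ?_ ?_ (fun σ' hσ' => hσ'.1) ?_ hwt ?_
  · rintro σ ⟨-, h2, h3, h4, -⟩; exact hπ σ h2 h3 h4
  · intro x _ y _ h; simpa using h
  · intro j _ h; rw [mem_Icc] at h; omega
  · intro σ; constructor
    · rintro ⟨hσ, h2, h3, h4, h1⟩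
      refine ⟨(Icc 1 (m - 4)).filter fun j => j + 4 ∈ σ,
        ⟨filter_subset _ _, fun j h6 h7 => by omega, fun j h6 h7 h8 => ?_⟩,
        eq_union_image ?_ ?_⟩
      · exact mem_filter.2 ⟨mem_Icc.2 ⟨h7, h8⟩, hσ.2.2 _ (by omega) (by omega)
          (by omega)⟩
      · grind
      · intro x hx; have h6 := mem_Icc.1 (hσ.1 hx); have h7 : x ≠ 4 := by rintro rfl; exact h4 hx
        simp only [mem_Icc]
        by_cases h8 : x ≤ 3
        · grind
        · exact Or.inr ⟨x - 4, by omega, by omega⟩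
    · rintro ⟨σ', hσ', rfl⟩
      have hmem : ∀ x, x < 5 → (x ∈ Icc (2 - e) 3 ∪ σ'.image (fun j => j + 4) ↔
          2 - e ≤ x ∧ x ≤ 3) := by
        intro x hx; rw [mem_union, mem_image, mem_Icc]; refine or_iff_left ?_; rintro ⟨j, hj, rfl⟩
        have := mem_Icc.1 (hσ'.1 hj); omega
      refine ⟨⟨?_, fun j h1 h2 => by omega, ?_⟩, ?_, ?_, ?_, ?_⟩
      · intro x hx; rw [mem_union, mem_image, mem_Icc] at hx; rw [mem_Icc]
        rcases hx with h | ⟨j, hj, rfl⟩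
        · omega
        · have := mem_Icc.1 (hσ'.1 hj); omega
      · intro j h3 h4 h5
        exact mem_union_right _ (mem_image.2 ⟨j - 4,
          hσ'.2.2 _ (by omega) (by omega) (by omega), by omega⟩)
      · rw [hmem _ (by omega)]; omega
      · rw [hmem _ (by omega)]; omega
      · rw [hmem _ (by omega)]; omega
      · rw [hmem _ (by omega)]; omega
  · intro σ' hσ' _ hcr
    have hcard : (Icc (2 - e) 3 ∪ σ'.image fun j => j + 4).card = (2 + e) + σ'.card := by
      rw [card_union_of_disjoint (hsep' σ' hσ').2,
          card_image_of_injective _ (fun x y h => by simpa using h)]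
      simp only [Nat.card_Icc]; omega
    unfold CriticalD; rw [hcard, hwt σ' hσ']
    have hdef : defect (2 * 2) m ((2 + e) + σ'.card) (e + gweight graphA (2 * 2) σ') =
        defect (2 * 2) (m - 4) σ'.card (gweight graphA (2 * 2) σ') := by
      conv_lhs => rw [show m = 4 + (m - 4) by omega]
      rw [defect_add, hOd, zero_add]
    rw [hdef]
    rcases hcr with ⟨h3, rfl⟩ | ⟨-, h4, ⟨i, t, h5, h6, h7, h8, h9⟩ | ⟨i, t, h5, h6, h7, h8, h9⟩⟩
    · rw [gweight_graphA_Icc (by omega) (by omega), Nat.div_eq_of_lt (by omega)]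
      simp only [Nat.card_Icc, Nat.add_sub_cancel]; rw [defect_full]
      refine Or.inl ⟨m - 4, 1, by omega, by omega, ?_, by omega⟩; push_cast; omega
    · refine Or.inr (Or.inl ⟨1, t, by omega, by omega, by omega, ?_⟩); rw [h9]; push_cast; omega
    · refine Or.inl ⟨i, t + 1, by omega, by omega, ?_, by omega⟩; rw [h9]; push_cast; omega

/-- For `d = 2`, removing the second vertex of a path cuts off a single vertex of weight one and
does not change the total weight. Here `4` is the first vertex of its path and `5` the second. -/
lemma isGood_pivotDEven_two_left (hg : g ≤ 1) :
    IsGood {σ | σ ∈ simplicesA m 0 g ∧ 1 ∈ σ ∧ 2 ∈ σ ∧ 4 ∈ σ ∧ 3 ∉ σ}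
      (gweight graphD (2 * 1)) (pivotDEven (2 * 1) m g) (CriticalD 1 m g) := by
  have hπ : ∀ σ : Finset ℕ, 1 ∈ σ → 2 ∈ σ → 4 ∈ σ → 3 ∉ σ → pivotDEven (2 * 1) m g σ =
      if g + 5 ≤ m then some 5 else none := by
    intro σ h1 h2 h4 h3; unfold pivotDEven; grind
  by_cases hmg : g + 5 ≤ m
  · refine IsGood.of_forall_some 5 ?_ ?_ ?_
    · grind
    · intro σ h5
      have h3 := simplicesA_insert (m := m) (g := g) (f := 0) (v := 5) (σ := σ) (by omega)
        (by omega)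
      grind
    · rintro σ ⟨hσ, h1, h2, h4, h3⟩ h5; obtain ⟨b, hb1, hb2, hb3⟩ := exists_run_end σ 5
      have hC : Icc 4 b ⊆ insert 5 σ := by grind
      refine gweight_insert_eq (C := Icc 4 b) h5 (mem_Icc.2 ⟨by omega, by omega⟩)
        hC ?_ ?_
      · intro x hx y hy h; rw [mem_Icc] at hx; rw [mem_sdiff, mem_Icc] at hy; rw [graphD_adj] at h
        grind
      · rw [gweight_graphD_path (by omega) (by omega) (by omega),
          (isPath_graphD (by omega) b).gweight_erase (by omega)
            (mem_Icc.2 ⟨by omega, by omega⟩) (by omega)]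
        omega
  · refine IsGood.of_forall_none ?_ ?_
    · grind
    · rintro σ ⟨hσ, h1, h2, h4, h3⟩; have hm4 := mem_Icc.1 (hσ.1 h4)
      have hE : σ = ({1} ∪ {2}) ∪ Icc 4 m := by
        ext x; simp only [mem_union, mem_singleton, mem_Icc]; constructor
        · intro hx; have h6 := mem_Icc.1 (hσ.1 hx); grind
        · rintro ((rfl | rfl) | hx)
          · exact h1
          · exact h2
          · rcases Nat.eq_or_lt_of_le hx.1 with rfl | h6
            · exact h4
            · exact hσ.2.2 x (by omega) (by omega) hx.2
      have hw : gweight graphD (2 * 1) σ = 1 + 1 + (m + 2 - 4) / 2 := by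
        rw [hE, gweight_union, gweight_union, gweight_singleton (by omega),
          gweight_singleton (by omega), gweight_graphD_path (by omega) (by omega) (by omega)]
        · intro x hx y hy h; rw [mem_singleton] at hx hy; rw [graphD_adj] at h; omega
        · simp
        · intro x hx y hy h; simp only [mem_union, mem_singleton] at hx; rw [mem_Icc] at hy
          rw [graphD_adj] at h; omega
        · rw [disjoint_left]; grind
      have hc : σ.card = m - 1 := by
        have h6 : σ = (Icc 1 m).erase 3 := by grind
        rw [h6, card_erase_of_mem (mem_Icc.2 ⟨by omega, by omega⟩)]; simp
      refine Or.inl ⟨m - 4, 2, by omega, by omega, ?_, fun _ _ => ⟨by omega, by omega⟩⟩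
      have h5 : m = 4 ∨ m = 5 := by omega
      rw [hw, hc]; rcases h5 with rfl | rfl <;> simp [defect]

/-- The same principle at `3`, which is the middle of the path on `{1, 2, 3}` if `1 ∈ σ` and `4 ∉
σ`, and the second vertex of a path starting at `2` if `1 ∉ σ`. -/
lemma isGood_pivotDEven_two_right (hg : g ≤ 1) (hgm : g < m) :
    IsGood {σ | σ ∈ simplicesA m 0 g ∧ 2 ∈ σ ∧ ¬ (1 ∈ σ ∧ 4 ∈ σ)}
      (gweight graphD (2 * 1)) (pivotDEven (2 * 1) m g) (CriticalD 1 m g) := by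
  have hπ : ∀ σ : Finset ℕ, 2 ∈ σ → ¬ (1 ∈ σ ∧ 4 ∈ σ) → pivotDEven (2 * 1) m g σ =
      if g + 3 ≤ m then some 3 else none := by
    intro σ h2 h4; unfold pivotDEven; grind
  by_cases hmg : g + 3 ≤ m
  · refine IsGood.of_forall_some 3 ?_ ?_ ?_
    · grind
    · intro σ h5
      have h3 := simplicesA_insert (m := m) (g := g) (f := 0) (v := 3) (σ := σ) (by omega)
        (by omega)
      grind
    · rintro σ ⟨hσ, h2, h4⟩ h3
      by_cases h1 : 1 ∈ σ
      · have h4' : 4 ∉ σ := fun h => h4 ⟨h1, h⟩; have hC : Icc 1 3 ⊆ insert 3 σ := by grind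
        refine gweight_insert_eq (C := Icc 1 3) h3 (mem_Icc.2 ⟨by omega, by omega⟩)
          hC (separated_graphD_Icc ?_ (by omega) ?_) ?_
        · rw [mem_insert_of_ne_iff (by omega)]; exact zero_notMem_of_mem_simplicesA hσ
        · rw [mem_insert_of_ne_iff (by omega)]; exact h4'
        · rw [gweight_graphD_Icc (by omega) (by omega), weightD_three (by omega),
            show (Icc 1 3).erase 3 = {1} ∪ {2} by decide, gweight_union,
            gweight_singleton (by omega), gweight_singleton (by omega)]
          · intro x hx y hy h; rw [mem_singleton] at hx hy; rw [graphD_adj] at h; omega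
          · simp
      · obtain ⟨b, hb1, hb2, hb3⟩ := exists_run_end σ 3; have hC : Icc 2 b ⊆ insert 3 σ := by grind
        refine gweight_insert_eq (C := Icc 2 b) h3 (mem_Icc.2 ⟨by omega, by omega⟩)
          hC ?_ ?_
        · intro x hx y hy h; rw [mem_Icc] at hx; rw [mem_sdiff, mem_Icc] at hy; rw [graphD_adj] at h
          grind
        · rw [gweight_graphD_path (by omega) (by omega) (by omega),
            (isPath_graphD (by omega) b).gweight_erase (by omega)
              (mem_Icc.2 ⟨by omega, by omega⟩) (by omega)]
          omega
  · refine IsGood.of_forall_none ?_ ?_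
    · grind
    · rintro σ ⟨hσ, h2, -⟩; have hm2 := mem_Icc.1 (hσ.1 h2)
      have h12 : gweight graphD (2 * 1) ({1} ∪ {2}) = 2 := by
        rw [gweight_union, gweight_singleton (by omega), gweight_singleton (by omega)]
        · intro x hx y hy h; rw [mem_singleton] at hx hy; rw [graphD_adj] at h; omega
        · simp
      have key : ∃ e, σ = Icc (2 - e) m ∧ e ≤ 1 ∧ gweight graphD (2 * 1) σ = 1 + e := by
        have hm : ∀ j, 3 ≤ j → j ≤ m → j ∈ σ := fun j h5 h6 => hσ.2.2 j (by omega) (by omega) h6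
        have hE : ∀ e, e ≤ 1 → (1 ∈ σ ↔ e = 1) → σ = Icc (2 - e) m := by
          intro e he h1; ext x; rw [mem_Icc]; constructor
          · intro hx; have h6 := mem_Icc.1 (hσ.1 hx); grind
          · grind
        by_cases h1 : 1 ∈ σ
        · have h3 := hE 1 le_rfl (by simp [h1]); refine ⟨1, h3, le_rfl, ?_⟩
          have h5 : m = 2 ∨ m = 3 := by omega
          rw [h3]; rcases h5 with rfl | rfl
          · exact h12
          · rw [show 2 - 1 = 1 by omega, gweight_graphD_Icc (by omega) (by omega),
              weightD_three (by omega)]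
        · have h3 := hE 0 (by omega) (by simp [h1]); refine ⟨0, h3, by omega, ?_⟩
          rw [h3, gweight_graphD_path (by omega) (by omega) (by omega)]; omega
      obtain ⟨e, hE, he, hw⟩ := key
      have hc : σ.card = m - 1 + e := by rw [hE]; simp only [Nat.card_Icc]; omega
      refine Or.inl ⟨m - 2, 1, by omega, by omega, ?_, fun _ _ => ⟨by omega, fun _ h => ?_⟩⟩
      · rw [hw, hc]; unfold defect; push_cast; omega
      · rw [hE, show e = 0 by omega]

/-- The cases of the recipe are regrouped so that all tests are upward closed. For `d ≥ 4` the cases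
toggling `1`, namely (c), (e), (f2) and (g) with `q = 0`, form the single fibre on which `{2, …, h +
1}` is not contained in `σ`. -/
theorem isGood_pivotDEven (hh : 0 < h) (hg : g ≤ h) (hm : 2 ≤ m) (hgm : g < m) :
    IsGood (simplicesA m 0 g) (gweight graphD (2 * h)) (pivotDEven (2 * h) m g)
      (CriticalD h m g) := by
  refine IsGood.split (fun σ => 2 ∈ σ) (fun σ _ τ _ hτσ h => hτσ h) ?_
    (isGood_pivotDEven_two_notMem hh hg hm)
  have hconn := isGood_pivotDEven_connected (m := m) hh hg
  rcases Nat.eq_or_lt_of_le (show 1 ≤ h from hh) with rfl | hh2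
  · refine IsGood.split (fun σ => 1 ∈ σ ∧ 4 ∈ σ) (fun σ _ τ _ hτσ h => ⟨hτσ h.1, hτσ h.2⟩) ?_ ?_
    · refine IsGood.split (fun σ => 3 ∈ σ) (fun σ _ τ _ hτσ h => hτσ h) ?_ ?_
      · convert hconn using 2; ext σ; constructor
        · rintro ⟨⟨⟨hσ, h2⟩, h1, h4⟩, h3⟩; grind
        · grind
      · convert isGood_pivotDEven_two_left (m := m) hg using 2; ext σ; simp only [Set.mem_ofPred_eq]
        tauto
    · convert isGood_pivotDEven_two_right hg hgm using 2; ext σ; simp only [Set.mem_ofPred_eq]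
      tauto
  refine IsGood.split (fun σ => ∀ j, 2 ≤ j → j ≤ h + 1 → j ∈ σ)
    (fun σ _ τ _ hτσ h j h1 h2 => hτσ (h j h1 h2)) ?_ ?_
  swap
  · convert isGood_pivotDEven_run_short (m := m) hh2 hgm using 2; ext σ
    simp only [Set.mem_ofPred_eq, and_assoc]
  refine IsGood.split (fun σ => ∀ j, 2 ≤ j → j ≤ max h 3 + 1 → j ∈ σ)
    (fun σ _ τ _ hτσ h j h1 h2 => hτσ (h j h1 h2)) ?_ ?_
  · refine IsGood.split (fun σ => 1 ∈ σ) (fun σ _ τ _ hτσ h => hτσ h) ?_ ?_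
    · convert hconn using 2; ext σ; constructor
      · grind
      · rintro ⟨hσ, h1⟩
        exact ⟨⟨⟨⟨hσ, h1 2 (by omega) (by omega)⟩, fun j h2 h3 => h1 j (by omega) (by omega)⟩,
          fun j h2 h3 => h1 j (by omega) (by omega)⟩, h1 1 (by omega) (by omega)⟩
    · convert isGood_pivotDEven_one_notMem (m := m) hh2 hg rfl using 2; ext σ; constructor
      · grind
      · rintro ⟨hσ, h1, h2⟩
        exact ⟨⟨⟨⟨hσ, h1 2 (by omega) (by omega)⟩, fun j h2 h3 => h1 j (by omega) (by omega)⟩,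
          h1⟩, h2⟩
  · by_cases hh3 : 3 ≤ h
    · refine IsGood.of_forall_none ?_ ?_ <;>
      · rintro σ ⟨⟨-, h1⟩, h2⟩; exact absurd (fun j h3 h4 => h1 j h3 (by omega)) h2
    obtain rfl : h = 2 := by omega
    have key : ∀ σ, (((σ ∈ simplicesA m 0 g ∧ 2 ∈ σ) ∧ ∀ j, 2 ≤ j → j ≤ 2 + 1 → j ∈ σ) ∧
        ¬ ∀ j, 2 ≤ j → j ≤ max 2 3 + 1 → j ∈ σ) ↔
        σ ∈ simplicesA m 0 g ∧ 2 ∈ σ ∧ 3 ∈ σ ∧ 4 ∉ σ := by grind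
    refine IsGood.split (fun σ => 1 ∈ σ) (fun σ _ τ _ hτσ h => hτσ h) ?_ ?_
    · convert isGood_pivotDEven_four_notMem (m := m) (e := 1) le_rfl hg using 2; grind
    · convert isGood_pivotDEven_four_notMem (m := m) (e := 0) (by omega) hg using 2; grind

end TypeDEven

/-! ### Type `D̃_n`: the component of `0` and the vertices to the right of a gap -/

section TypeAffine

variable {n d h q v l : ℕ} {σ s : Finset ℕ}

/-- The proper subsets of `{0, …, n}`. -/
def simplicesT (n : ℕ) : Set (Finset ℕ) := {σ | σ ⊆ range (n + 1) ∧ ∃ x, x ≤ n ∧ x ∉ σ}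

lemma le_of_mem_simplicesT (hσ : σ ∈ simplicesT n) {x : ℕ} (hx : x ∈ σ) : x ≤ n := by
  have := mem_range.1 (hσ.1 hx); omega

/-- `b` is the last place of the run through `c`. A proper simplex containing `0` and `1` whose run
reaches the right end cannot contain both `n - 1` and `n`, so the component of `0` is doubled at the
left end only. -/
lemma exists_fork (hn : 4 ≤ n) (hσ : σ ∈ simplicesT n) (h0 : 0 ∈ σ) (h1 : 1 ∈ σ) {c : ℕ}
    (hc2 : 2 ≤ c) (hcn : c + 1 ≤ n) (hc : ∀ j, 2 ≤ j → j ≤ c → j ∈ σ) :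
    ∃ b, c ≤ b ∧ b + 1 ≤ n ∧
      IsFork (graphDTilde n) (σ.filter fun x => place n x ≤ b) (place n) b 0 1 ∧
      Separated (graphDTilde n) (σ.filter fun x => place n x ≤ b)
        (σ \ σ.filter fun x => place n x ≤ b) ∧
      component (graphDTilde n) σ 0 = (σ.filter fun x => place n x ≤ b) ∧
      (component (graphDTilde n) σ 0).card = b + 1 ∧
      (∀ j, 2 ≤ j → j ≤ b → j + 2 ≤ n → j ∈ σ) ∧ (b + 1 = n → n - 1 ∈ σ ∨ n ∈ σ) ∧
      (b + 3 ≤ n → b + 1 ∉ σ) ∧ (b + 2 = n → n - 1 ∉ σ ∧ n ∉ σ) := by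
  have hle : ∀ v ∈ σ, v ≤ n := fun v hv => le_of_mem_simplicesT hσ hv
  have hpl : ∀ v ∈ σ, 1 ≤ place n v ∧ place n v + 1 ≤ n := fun v hv => by
    have := hle v hv; rcases place_cases n v with h | h | h <;> omega
  obtain ⟨b, hb1, hb2, hb3⟩ := exists_run_end (σ.image (place n)) c
  simp only [mem_image] at hb2 hb3; have hbn : b + 1 ≤ n := by grind
  have hocc : ∀ j, 1 ≤ j → j ≤ b → ∃ x ∈ σ, place n x = j := by
    intro j hj1 hj2
    by_cases hjc : c < j
    · exact hb2 j hjc hj2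
    · by_cases hj : j = 1
      · exact ⟨0, h0, by rcases place_cases n 0 with h | h | h <;> omega⟩
      · exact ⟨j, hc j (by omega) (by omega), by
          rcases place_cases n j with h | h | h <;> omega⟩
  have hmid : ∀ j, 2 ≤ j → j ≤ b → j + 2 ≤ n → j ∈ σ := by
    intro j hj1 hj2 hj3; obtain ⟨x, hx, hxj⟩ := hocc j (by omega) hj2
    have : x = j := by rcases place_cases n x with h | h | h <;> omega
    rwa [← this]
  have hends : b + 1 = n → n - 1 ∈ σ ∨ n ∈ σ := by
    intro hb; obtain ⟨x, hx, hxj⟩ := hocc b (by omega) le_rfl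
    have : x = n - 1 ∨ x = n := by rcases place_cases n x with h | h | h <;> omega
    grind
  have hnboth : b + 1 = n → ¬ (n - 1 ∈ σ ∧ n ∈ σ) := by
    rintro hb ⟨h2, h3⟩; obtain ⟨x, hx, hxn⟩ := hσ.2; apply hxn
    by_cases hx0 : x = 0
    · rwa [hx0]
    grind
  have hF : IsFork (graphDTilde n) (σ.filter fun x => place n x ≤ b) (place n) b 0 1 := by
    have p0 : place n 0 = 1 := by rcases place_cases n 0 with h | h | h <;> omega
    have p1 : place n 1 = 1 := by rcases place_cases n 1 with h | h | h <;> omega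
    refine ⟨⟨?_, ?_, ?_⟩, by omega, ?_, ?_, p0, p1, ?_, ?_⟩
    · grind
    · intro j hj1 hj2; obtain ⟨x, hx, hxj⟩ := hocc j hj1 hj2
      exact ⟨x, mem_filter.2 ⟨hx, by omega⟩, hxj⟩
    · intro x hx y hy; rw [mem_filter] at hx hy
      exact graphDTilde_adj_place hn (hle x hx.1) (hle y hy.1)
    · exact mem_filter.2 ⟨h0, by omega⟩
    · exact mem_filter.2 ⟨h1, by omega⟩
    · intro x hx hx1; rcases place_cases n x with h | h | h <;> omega
    · intro x hx y hy hxy hne; rw [mem_filter] at hx hy; have := hle x hx.1; have := hle y hy.1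
      by_contra hxy'
      rcases place_cases n x with h | h | h <;> rcases place_cases n y with h' | h' | h' <;>
        first
        | omega
        | (apply hnboth (by omega)
           first
           | (have e1 : x = n := by omega
              have e2 : y = n - 1 := by omega
              exact ⟨e2 ▸ hy.1, e1 ▸ hx.1⟩)
           | (have e1 : x = n - 1 := by omega
              have e2 : y = n := by omega
              exact ⟨e1 ▸ hx.1, e2 ▸ hy.1⟩))
  have hsep : Separated (graphDTilde n) (σ.filter fun x => place n x ≤ b)
        (σ \ σ.filter fun x => place n x ≤ b) := by
    intro x hx y hy hadj; rw [mem_filter] at hx; rw [mem_sdiff, mem_filter] at hy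
    rw [graphDTilde_adj_place hn (hle x hx.1) (hle y hy.1)] at hadj; grind
  have hcomp : component (graphDTilde n) σ 0 = (σ.filter fun x => place n x ≤ b) :=
    component_eq_of_separated (filter_subset _ _) hF.mem_left (hF.preConn (by omega)) hsep
  refine ⟨b, hb1, hbn, hF, hsep, hcomp, by rw [hcomp, hF.card_eq], hmid, hends, ?_, ?_⟩
  · intro hb hmem; exact hb3 ⟨b + 1, hmem, by rcases place_cases n (b + 1) with h | h | h <;> omega⟩
  · intro hb
    exact ⟨fun hmem => hb3 ⟨n - 1, hmem, by
        rcases place_cases n (n - 1) with h | h | h <;> omega⟩,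
      fun hmem => hb3 ⟨n, hmem, by rcases place_cases n n with h | h | h <;> omega⟩⟩

/-- Removing `v` from the fork leaves `D_v` and a path with `b - v` vertices. The size of the
component is offered to `hz` because the callers know its weight rather than `b`. -/
lemma gweight_graphDTilde_insert (hn : 4 ≤ n) (hd : 2 ≤ d) (hs : insert v s ∈ simplicesT n)
    (hv : v ∉ s) (hv3 : 3 ≤ v) (hvn : v + 1 ≤ n) (hlow : ∀ j, j < v → j ∈ s)
    (hz : ∀ b, v ≤ b → b + 1 ≤ n → (component (graphDTilde n) (insert v s) 0).card = b + 1 →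
      weightD d (b + 1) = weightD d v + (b + 1 - v) / d) :
    gweight (graphDTilde n) d (insert v s) = gweight (graphDTilde n) d s := by
  obtain ⟨b, hb1, hb2, hF, hsep, -, hk, -⟩ := exists_fork hn hs
    (mem_insert_of_mem (hlow 0 (by omega))) (mem_insert_of_mem (hlow 1 (by omega)))
    (c := v) (by omega) hvn (fun j h1 h2 => by
      rcases Nat.eq_or_lt_of_le h2 with rfl | h3
      · exact mem_insert_self _ _
      · exact mem_insert_of_mem (hlow j h3))
  have hpv : place n v = v := by rcases place_cases n v with h | h | h <;> omega
  have hvC : v ∈ (insert v s).filter fun x => place n x ≤ b :=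
    mem_filter.2 ⟨mem_insert_self _ _, by omega⟩
  refine gweight_insert_eq hv hvC (filter_subset _ _) hsep ?_
  rw [hF.gweight_eq hd (by omega), hF.gweight_erase hd hvC (by omega), hpv]; exact hz b hb1 hb2 hk

/-- Adding the twin `0` of `1` turns a path with `b` vertices into `D_{b+1}`, or adds an isolated
vertex when `2` is absent. -/
lemma gweight_graphDTilde_insert_zero (hn : 4 ≤ n) (hd : 3 ≤ d) (hs : insert 0 s ∈ simplicesT n)
    (h0 : 0 ∉ s) (h1 : 1 ∈ s)
    (hz : 2 ∈ s → ∀ b, 2 ≤ b → b + 1 ≤ n →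
      (component (graphDTilde n) (insert 0 s) 0).card = b + 1 → weightD d (b + 1) = (b + 1) / d) :
    gweight (graphDTilde n) d (insert 0 s) = gweight (graphDTilde n) d s := by
  by_cases h2 : 2 ∈ s
  · obtain ⟨b, hb1, hb2, hF, hsep, -, hk, -⟩ := exists_fork hn hs (mem_insert_self _ _)
      (mem_insert_of_mem h1) (c := 2) le_rfl (by omega) (fun j h3 h4 => by
        obtain rfl : j = 2 := by omega
        exact mem_insert_of_mem h2)
    refine gweight_insert_eq h0 hF.mem_left (filter_subset _ _) hsep ?_
    rw [hF.gweight_eq (by omega) (by omega), hF.erase_left.gweight_eq (by omega) (by omega),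
      hz h2 b hb1 hb2 hk]
    rfl
  · refine gweight_insert_eq (C := {0}) h0 (by simp) (by simp) ?_ ?_
    · intro x hx y hy h; rw [mem_singleton] at hx; rw [mem_sdiff] at hy
      rw [graphDTilde_adj hn] at h; grind
    · rw [gweight_singleton (by omega), erase_singleton, gweight_empty,
        Nat.div_eq_of_lt (by omega)]

lemma gweight_graphDTilde_image (hn : 4 ≤ n) (hs : s ⊆ Icc 1 n) :
    gweight (graphDTilde n) d (s.image fun j => n + 1 - j) = gweight graphD d s := by
  have h1 : ∀ j ∈ s, 1 ≤ j ∧ j ≤ n := fun j hj => mem_Icc.1 (hs hj); refine gweight_image ?_ ?_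
  · intro x hx y hy h; grind
  · intro x hx y hy; have := h1 x hx; have := h1 y hy; rw [graphDTilde_adj hn, graphD_adj]; omega

/-- Vertices on the right of `v`: the component of `v + 1`, or both ends if `v = n - 2`. -/
lemma exists_right_run (hn : 4 ≤ n) (hσ : σ ⊆ range (n + 1)) (hv2 : 2 ≤ v)
    (hvn : v + 2 ≤ n) (hv : v ∉ σ) {D : Finset ℕ}
    (hD : D = if v + 2 = n then σ ∩ {n - 1, n} else component (graphDTilde n) σ (v + 1)) :
    ∃ b, v ≤ b ∧ b + 1 ≤ n ∧ (∀ j, v < j → j ≤ b → j + 2 ≤ n → j ∈ σ) ∧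
      (b + 1 = n → n - 1 ∈ σ ∨ n ∈ σ) ∧ (b + 3 ≤ n → b + 1 ∉ σ) ∧
      (b + 2 = n → n - 1 ∉ σ ∧ n ∉ σ) ∧
      (n - 1 ∈ D ↔ b + 1 = n ∧ n - 1 ∈ σ) ∧ (n ∈ D ↔ b + 1 = n ∧ n ∈ σ) ∧
      D.card = if b + 1 = n ∧ n - 1 ∈ σ ∧ n ∈ σ then n - v else b - v := by
  have hle : ∀ v ∈ σ, v ≤ n := fun v hv => by have := mem_range.1 (hσ hv); omega
  obtain ⟨b, hb1, hb2, hb3⟩ := exists_run_end (σ.image (place n)) v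
  simp only [mem_image] at hb2 hb3
  have hpl : ∀ v ∈ σ, 1 ≤ place n v ∧ place n v + 1 ≤ n := fun v hv => by
    have := hle v hv; rcases place_cases n v with h | h | h <;> omega
  have hbn : b + 1 ≤ n := by grind
  have hmid : ∀ j, v < j → j ≤ b → j + 2 ≤ n → j ∈ σ := by
    intro j hj1 hj2 hj3; obtain ⟨x, hx, hxj⟩ := hb2 j hj1 hj2
    have : x = j := by rcases place_cases n x with h | h | h <;> omega
    rwa [← this]
  have hends : b + 1 = n → n - 1 ∈ σ ∨ n ∈ σ := by
    intro hb; obtain ⟨x, hx, hxj⟩ := hb2 b (by omega) le_rfl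
    have : x = n - 1 ∨ x = n := by rcases place_cases n x with h | h | h <;> omega
    grind
  have hh1 : b + 3 ≤ n → b + 1 ∉ σ := by
    intro hb hmem; exact hb3 ⟨b + 1, hmem, by rcases place_cases n (b + 1) with h | h | h <;> omega⟩
  have hh2 : b + 2 = n → n - 1 ∉ σ ∧ n ∉ σ := by
    intro hb
    exact ⟨fun hmem => hb3 ⟨n - 1, hmem, by
        rcases place_cases n (n - 1) with h | h | h <;> omega⟩,
      fun hmem => hb3 ⟨n, hmem, by rcases place_cases n n with h | h | h <;> omega⟩⟩
  -- For `v = n - 2` the vertices `n - 1` and `n` are no longer connected to each other; the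
  -- exceptional definition of `D` makes it in all cases the set of vertices on the places from `v +
  -- 1` to `b`.
  have hDC : ∀ x, x ∈ D ↔ x ∈ σ ∧ v < place n x ∧ place n x ≤ b := by
    intro x
    by_cases hvn' : v + 2 = n
    · rw [hD, if_pos hvn', mem_inter, mem_insert, mem_singleton]
      refine and_congr_right fun hx => ?_; have := hle x hx
      have h3 : b + 1 = n ∨ b + 2 = n := by omega
      rcases h3 with h3 | h3
      · rcases place_cases n x with h | h | h <;> omega
      · grind
    · rw [hD, if_neg hvn']
      have hpv : place n (v + 1) = v + 1 := by rcases place_cases n (v + 1) with h | h | h <;> omega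
      by_cases hv1 : v + 1 ∈ σ
      · have hvb : v + 1 ≤ b := by by_contra h; exact hb3 ⟨v + 1, hv1, by omega⟩
        have hlab : IsLabelling (graphDTilde n)
            (σ.filter fun x => v < place n x ∧ place n x ≤ b) (place n) (v + 1) b := by
          refine ⟨?_, ?_, ?_⟩
          · intro y hy; exact (mem_filter.1 hy).2
          · intro j h1 h2; obtain ⟨y, hy, hyj⟩ := hb2 j (by omega) h2; grind
          · intro y hy z hz; rw [mem_filter] at hy hz
            exact graphDTilde_adj_place hn (hle y hy.1) (hle z hz.1)
        have hvC : v + 1 ∈ σ.filter fun x => v < place n x ∧ place n x ≤ b :=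
          mem_filter.2 ⟨hv1, by omega, by omega⟩
        have hfrom : ∀ y ∈ σ.filter fun x => v < place n x ∧ place n x ≤ b,
            y ∈ component (graphDTilde n) (σ.filter fun x => v < place n x ∧ place n x ≤ b)
              (v + 1) := by
          intro y hy
          by_cases h3 : place n y = v + 1
          · have := hle y (mem_filter.1 hy).1
            have h4 : y = v + 1 := by rcases place_cases n y with h | h | h <;> omega
            rw [h4]; exact self_mem_component hvC
          · refine hlab.mem_component hvC hy ?_; have := hlab.le y hy; omega
        have hpre : PreConn (graphDTilde n)
            (σ.filter fun x => v < place n x ∧ place n x ≤ b) := fun y hy z hz =>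
          mem_component_trans (mem_component_symm (hfrom y hy)) (hfrom z hz)
        rw [component_eq_of_separated (filter_subset _ _) hvC hpre, mem_filter]
        intro y hy z hz hadj; rw [mem_filter] at hy; rw [mem_sdiff, mem_filter] at hz
        rw [graphDTilde_adj_place hn (hle y hy.1) (hle z hz.1)] at hadj
        have h3 : ¬ (v < place n z ∧ place n z ≤ b) := fun h => hz.2 ⟨hz.1, h⟩
        have h4 : place n z = v ∨ place n z = b + 1 := by omega
        rcases h4 with h4 | h4
        · have := hle z hz.1; have : z = v := by rcases place_cases n z with h | h | h <;> omega
          exact hv (this ▸ hz.1)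
        · exact hb3 ⟨z, hz.1, h4⟩
      · rw [component_eq_empty hv1]; grind
  have hp1 : place n (n - 1) = n - 1 := by rcases place_cases n (n - 1) with h | h | h <;> omega
  have hpn : place n n = n - 1 := by rcases place_cases n n with h | h | h <;> omega
  refine ⟨b, hb1, hbn, hmid, hends, hh1, hh2, ?_, ?_, ?_⟩
  · grind
  · grind
  · split_ifs with hboth
    · have : D = Icc (v + 1) n := by
        ext x; rw [hDC, mem_Icc]; constructor
        · rintro ⟨h1, h2, h3⟩; have := hle x h1; rcases place_cases n x with h | h | h <;> omega
        · rintro ⟨h1, h2⟩; have h3 : x ∈ σ := by grind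
          exact ⟨h3, by rcases place_cases n x with h | h | h <;> omega⟩
      rw [this, Nat.card_Icc]; omega
    · have himg : D.image (place n) = Icc (v + 1) b := by
        ext j; simp only [mem_image, hDC, mem_Icc]; constructor
        · rintro ⟨x, ⟨h1, h2, h3⟩, rfl⟩; exact ⟨h2, h3⟩
        · rintro ⟨h1, h2⟩; obtain ⟨x, hx, hxj⟩ := hb2 j h1 h2
          exact ⟨x, ⟨hx, by omega, by omega⟩, hxj⟩
      have hinj : Set.InjOn (place n) D := by
        intro x hx y hy hxy; rw [mem_coe, hDC] at hx hy; have := hle x hx.1; have := hle y hy.1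
        by_contra hne
        rcases place_cases n x with h | h | h <;> rcases place_cases n y with h' | h' | h' <;>
          first
          | omega
          | (apply hboth
             first
             | (have e1 : x = n := by omega
                have e2 : y = n - 1 := by omega
                exact ⟨by omega, e2 ▸ hy.1, e1 ▸ hx.1⟩)
             | (have e1 : x = n - 1 := by omega
                have e2 : y = n := by omega
                exact ⟨by omega, e1 ▸ hx.1, e2 ▸ hy.1⟩))
      have := card_image_of_injOn hinj; rw [himg, Nat.card_Icc] at this; omega

end TypeAffine

/-! ### Type `D̃_n`, `d = 2h`: invariants of the critical simplices -/

section TypeAffineEven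

variable {n d h q v l : ℕ} {σ s : Finset ℕ}

/-- The size and weight constraints satisfied by the critical simplices, for `d = 2 h`. -/
def CriticalT (h n : ℕ) (σ : Finset ℕ) : Prop :=
  (∃ j t, n = j + t * (2 * h) ∧ j ≤ h ∧
    defect (2 * h) n σ.card (gweight (graphDTilde n) (2 * h) σ) = 2 * j ∧
    (j = 1 → n ≤ σ.card + 1 ∧
      (n = 2 * h + 1 → n = σ.card + 1 → σ = Icc 1 (n - 1)))) ∨
  (∃ j t, n = h + j + t * (2 * h) ∧ 1 ≤ j ∧ j < h ∧
    defect (2 * h) n σ.card (gweight (graphDTilde n) (2 * h) σ) = 2 * j) ∨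
  (∃ t, n = 1 + t * (2 * h) ∧ 1 < 2 * h ∧
    defect (2 * h) n σ.card (gweight (graphDTilde n) (2 * h) σ) = 2 - 2 * h ∧
    gweight (graphDTilde n) (2 * h) σ ≤ 1 ∧ 1 ∉ σ ∧ n - 1 ∉ σ)

lemma gweight_insert_isolated {Γ : SimpleGraph ℕ} (hd : 2 ≤ d) (hv : v ∉ s)
    (h : ∀ x ∈ s, ¬ Γ.Adj v x) : gweight Γ d (insert v s) = 2 / d + gweight Γ d s := by
  rw [insert_eq, gweight_union, gweight_singleton hd]
  · intro u hu x hx; rw [mem_singleton] at hu; exact hu ▸ h x hx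
  · exact disjoint_singleton_left.2 hv

lemma gweight_graphD_Icc_two (hd : 4 ≤ d) : gweight graphD d (Icc 1 2) = 0 := by
  rw [show Icc 1 2 = insert 1 {2} from rfl,
    gweight_insert_isolated (by omega) (by simp), gweight_singleton (by omega),
    Nat.div_eq_of_lt (by omega)]
  intro x hx; rw [mem_singleton] at hx; rw [graphD_adj]; omega

lemma gweight_graphD_Icc_erase_two {M : ℕ} (hd : 2 ≤ d) (hM : 2 ≤ M) :
    gweight graphD d ((Icc 1 M).erase 2) = M / d := by
  have H : IsPath graphD ((Icc 1 M).erase 2) (fun x => if x = 1 then 2 else x) 2 M := by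
    have hmem : ∀ x, x ∈ (Icc 1 M).erase 2 ↔ x ≠ 2 ∧ 1 ≤ x ∧ x ≤ M := fun x => by
      rw [mem_erase, mem_Icc]
    refine ⟨⟨?_, ?_, ?_⟩, ?_⟩
    · grind
    · intro j hj1 hj2
      by_cases hj : j = 2
      · exact ⟨1, (hmem 1).2 (by omega), by simp [hj]⟩
      · exact ⟨j, (hmem j).2 (by omega), if_neg (by omega)⟩
    · intro x hx y hy; have := (hmem x).1 hx; have := (hmem y).1 hy; rw [graphD_adj]
      split_ifs <;> omega
    · grind
  rw [H.gweight_eq hd (by omega)]; congr 1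

lemma gweight_graphDTilde_range (hn : 4 ≤ n) (hd : 2 ≤ d) (hv3 : 3 ≤ v) (hvn : v + 2 ≤ n) :
    gweight (graphDTilde n) d (range v) = weightD d v := by
  have hT : range v ∈ simplicesT n := ⟨range_subset_range.2 (by omega), v, by omega, by simp⟩
  obtain ⟨b, hb1, hb2, hF, -, -, hk, hmid, hends, -, -⟩ := exists_fork hn hT (by simp; omega)
    (by simp; omega) (c := v - 1) (by omega) (by omega)
    (fun j h1 h2 => mem_range.2 (by omega))
  have hb : b = v - 1 := by grind
  have hf : (range v).filter (fun x => place n x ≤ b) = range v := by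
    rw [filter_eq_self]; intro x hx; have := mem_range.1 hx
    rcases place_cases n x with h | h | h <;> omega
  rw [hf] at hF; rw [hF.gweight_eq hd (by omega), hb]; congr 1; omega

lemma gweight_graphDTilde_union (hn : 4 ≤ n) (hd : 2 ≤ d) (hv3 : 3 ≤ v) (hvn : v + 2 ≤ n)
    (hs : s ⊆ Icc 1 (n - v)) :
    gweight (graphDTilde n) d (range v ∪ s.image fun j => n + 1 - j) =
      weightD d v + gweight graphD d s := by
  have h1 : ∀ j ∈ s, 1 ≤ j ∧ j ≤ n - v := fun j hj => mem_Icc.1 (hs hj)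
  have h2 : ∀ x ∈ s.image fun j => n + 1 - j, v < x ∧ x ≤ n := by grind
  rw [gweight_union, gweight_graphDTilde_range hn hd hv3 hvn, gweight_graphDTilde_image hn]
  · exact hs.trans (Icc_subset_Icc le_rfl (by omega))
  · intro x hx y hy; have := h2 y hy; have := mem_range.1 hx; rw [graphDTilde_adj hn]; omega
  · rw [disjoint_left]; grind

lemma gweight_graphDTilde_of_card (hn : 4 ≤ n) (hd : 2 ≤ d) (hσ : σ ∈ simplicesT n) (h0 : 0 ∈ σ)
    (h1 : 1 ∈ σ) (h2 : 2 ∈ σ) (hk : σ.card ≤ (component (graphDTilde n) σ 0).card) :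
    gweight (graphDTilde n) d σ = weightD d σ.card := by
  obtain ⟨b, hb1, hb2, hF, -, hC, hk', -⟩ := exists_fork hn hσ h0 h1 (c := 2) le_rfl (by omega)
    (fun j h3 h4 => by obtain rfl : j = 2 := by omega
                       exact h2)
  have hE : component (graphDTilde n) σ 0 = σ := eq_of_subset_of_card_le component_subset hk
  rw [← hC, hE] at hF; rw [hF.gweight_eq hd hb1, ← hk', hE]

/-- The relation between the invariants for the pieces cut out by a vertex `v`. -/
lemma defect_split (hq : v = if Even q then q * h else q * h + 1) {c w : ℕ} (hvn : v ≤ n) :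
    defect (2 * h) n (v + c) (q + w) =
      defect (2 * h) (n - v) c w + if Even q then 0 else 2 := by
  conv_lhs => rw [show n = v + (n - v) by omega]
  rw [defect_add, defect_full]; split_ifs at hq ⊢ <;> rw [hq] <;> push_cast <;> ring

/-- The left block of `v` vertices has weight `q` and defect `0` or `2`. For `q` even the residue of
`n` and the number `j` are kept; for `q` odd the residue moves by `h + 1`, so the first two families
are exchanged and `j` becomes `j + 1`. The third family of `CriticalD`, taken with `g = l`, becomes
an ordinary one. -/
lemma criticalT_of_criticalD (hq : v = if Even q then q * h else q * h + 1)
    (hl : l = if Even q then h else h - 2) (hv3 : 3 ≤ v) (hodd : ¬ Even q → 2 ≤ h) (hvn : v + 2 ≤ n)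
    {σ' : Finset ℕ} (hc : σ.card = v + σ'.card)
    (hw : gweight (graphDTilde n) (2 * h) σ = q + gweight graphD (2 * h) σ')
    (H : CriticalD h (n - v) l σ') : CriticalT h n σ := by
  have hdef : defect (2 * h) n σ.card (gweight (graphDTilde n) (2 * h) σ) =
      defect (2 * h) (n - v) σ'.card (gweight graphD (2 * h) σ') + if Even q then 0 else 2 := by
    rw [hc, hw, defect_split hq (by omega)]
  by_cases he : Even q
  · rw [if_pos he] at hq hl hdef; obtain ⟨p, rfl⟩ := he
    have e1 : (p + p) * h = p * (2 * h) := by ring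
    rw [e1] at hq
    rcases H with ⟨j, t, h1, h2, h3, h4⟩ | ⟨j, t, h1, h2, h3, h4⟩ | ⟨t, h1, h2, h3, -⟩
    · refine Or.inl ⟨j, p + t, by rw [add_mul]; omega, by omega, by omega, fun h5 => ?_⟩
      -- Since `q` is even and `v > 0`, one has `v ≥ 2h`; so `n = 2h + 1` is incompatible with `v ≤
      -- n - 2`.
      have h6 := (h4 h5 hl).1; refine ⟨by omega, fun h7 => ?_⟩
      rcases Nat.eq_zero_or_pos p with rfl | hp
      · omega
      · have := Nat.mul_le_mul_right (2 * h) hp; omega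
    · exact Or.inr (Or.inl ⟨j, p + t, by rw [add_mul]; omega, h2, h3, by omega⟩)
    · exact Or.inr (Or.inl ⟨1, p + t, by rw [add_mul]; omega, le_rfl, by omega, by omega⟩)
  · have hh := hodd he; rw [if_neg he] at hq hl hdef; rw [Nat.not_even_iff_odd] at he
    obtain ⟨p, rfl⟩ := he; have e1 : (2 * p + 1) * h = p * (2 * h) + h := by ring
    rw [e1] at hq
    rcases H with ⟨j, t, h1, h2, h3, h4⟩ | ⟨j, t, h1, h2, h3, h4⟩ | ⟨t, h1, h2, h3, -⟩
    · exact Or.inr (Or.inl ⟨j + 1, p + t, by rw [add_mul]; omega, by omega, by omega, by omega⟩)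
    · exact Or.inl ⟨j + 1, p + t + 1, by rw [add_mul, add_mul]; omega, by omega, by omega,
        by omega⟩
    · exact Or.inl ⟨0, p + t + 1, by rw [add_mul, add_mul]; omega, by omega, by omega, by omega⟩

/-- Cases (e) and (g) are treated together: for `d = 4` and `3 ∉ σ` the component of `0` is `{0, 1,
2}`, so `k = v = 3`, `q = 1`, and (e) is an instance of (g1). -/
lemma pivotTEven_connected (hn4 : ¬ (n = 4 ∧ 2 * h ≤ 6)) (hh : 0 < h) {c k : ℕ}
    (hc : c = if h = 1 then 3 else h) (hbase : ∀ j, j ≤ c → j ∈ σ)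
    (hk : (component (graphDTilde n) σ 0).card = k) (hq : evenQuot h k = q)
    (hv : v = if Even q then q * h else q * h + 1) (hl : l = if Even q then h else h - 2)
    (hk3 : h = 2 → 3 ∉ σ → k = 3) (hn : 5 ≤ n ∨ h ≠ 2) :
    pivotTEven (2 * h) n σ =
      if h = 2 ∧ ¬ Even q ∧ k = v then
        (if k ≤ n - 2 then relabel (n - k) (fun j => n + 1 - j) (pivotDEven (2 * h) (n - k) 0) σ
        else none)
      else if σ = insert n (Icc 0 (n - 2)) ∧ n - 1 ≤ v then none
      else if v ∈ σ then some v
      else if n ≤ v then none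
      else
        let D := if v + 2 = n then σ ∩ {n - 1, n} else component (graphDTilde n) σ (v + 1)
        if {n - 1, n} ⊆ D ∧ D.card ≤ l then none
        else if D.card < l then some v
        else if D.card = l ∧ n - 1 ∉ D ∧ n ∈ D then none
        else relabel (n - v) (fun j => n + 1 - j) (pivotDEven (2 * h) (n - v) l) σ := by
  have h0 := hbase 0 (by omega); have h1 := hbase 1 (by split_ifs at hc <;> omega)
  have e0 : 2 * h / 2 = h := by omega
  by_cases he : h = 2 ∧ 3 ∉ σ
  · obtain ⟨rfl, h3⟩ := he; have h2 := hbase 2 (by simpa using hc.ge); have hk' := hk3 rfl h3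
    subst hk'; have hq1 : q = 1 := hq.symm; subst hq1
    rw [if_pos ⟨rfl, by decide, by rw [hv]; decide⟩]; unfold pivotTEven; grind
  · have h2 : 2 ∈ σ := hbase 2 (by split_ifs at hc <;> omega); have h3 : 3 ∈ σ := by grind
    have e1 : ({0, 1, 2, 3} : Finset ℕ) ⊆ σ := by simp [insert_subset_iff, h0, h1, h2, h3]
    have e2 : (2 * h = 4 ∧ ¬ Even q ∧ k = q * h + 1) ↔ h = 2 ∧ ¬ Even q ∧ k = v := by grind
    unfold pivotTEven
    simp only [e0, hk, hq, ← hv, ← hl, h0, h1, h2, h3, e1, not_true_eq_false, and_false, if_false,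
      if_neg hn4, e2]

/-- The vertices `v + 1, …, v + l` belong to `σ`, or all those to the right of `v` except perhaps
one end. -/
def RightRun (n v l : ℕ) (σ : Finset ℕ) : Prop :=
  (∀ j, v < j → j ≤ v + l → j + 2 ≤ n → j ∈ σ) ∧ (n ≤ v + l + 1 → n - 1 ∈ σ ∨ n ∈ σ) ∧
    (n ≤ v + l → n - 1 ∈ σ ∧ n ∈ σ)

lemma RightRun.mono (h : RightRun n v l s) (hs : s ⊆ σ) : RightRun n v l σ :=
  ⟨fun j h1 h2 h3 => hs (h.1 j h1 h2 h3), fun h1 => (h.2.1 h1).imp (@hs _) (@hs _),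
    fun h1 => ⟨hs (h.2.2 h1).1, hs (h.2.2 h1).2⟩⟩

lemma rightRun_insert_iff (hv : v + 2 ≤ n) : RightRun n v l (insert v s) ↔ RightRun n v l s := by
  refine ⟨fun h => ⟨fun j h1 h2 h3 => ?_, fun h1 => ?_, fun h1 => ?_⟩,
    fun h => h.mono (subset_insert _ _)⟩
  · exact (mem_insert_of_ne_iff (by omega)).1 (h.1 j h1 h2 h3)
  · exact (h.2.1 h1).imp (mem_insert_of_ne_iff (by omega)).1 (mem_insert_of_ne_iff (by omega)).1
  · exact ⟨(mem_insert_of_ne_iff (by omega)).1 (h.2.2 h1).1,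
      (mem_insert_of_ne_iff (by omega)).1 (h.2.2 h1).2⟩

lemma exists_rightRun (hn : 4 ≤ n) (hσ : σ ∈ simplicesT n) (hv2 : 2 ≤ v) (hvn : v + 2 ≤ n)
    (hv : v ∉ σ) {D : Finset ℕ}
    (hD : D = if v + 2 = n then σ ∩ {n - 1, n} else component (graphDTilde n) σ (v + 1)) :
    ∃ b, v ≤ b ∧ b + 1 ≤ n ∧ (n - 1 ∈ D ↔ b + 1 = n ∧ n - 1 ∈ σ) ∧
      (n ∈ D ↔ b + 1 = n ∧ n ∈ σ) ∧
      (D.card = if b + 1 = n ∧ n - 1 ∈ σ ∧ n ∈ σ then n - v else b - v) ∧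
      (RightRun n v l σ ↔ (v + l + 2 ≤ n → v + l ≤ b) ∧ (n ≤ v + l + 1 → b + 1 = n) ∧
        (n ≤ v + l → n - 1 ∈ σ ∧ n ∈ σ)) ∧ (b + 1 = n → n - 1 ∈ σ ∨ n ∈ σ) := by
  obtain ⟨b, hb1, hb2, hb3, hb4, hb5, hb6, hb7, hb8, hb9⟩ := exists_right_run hn hσ.1 hv2 hvn hv hD
  refine ⟨b, hb1, hb2, hb7, hb8, hb9, ?_, hb4⟩; constructor
  · rintro ⟨h1, h2, h3⟩; grind
  · rintro ⟨h1, h2, h3⟩; exact ⟨fun j h4 h5 h6 => hb3 j h4 (by omega) h6, fun h4 => hb4 (h2 h4), h3⟩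

/-- The value of the recipe when `v ≤ n - 2`. -/
lemma pivotTEven_connected_eq (hn : 4 ≤ n) {π : Finset ℕ → Option ℕ} (hσ : σ ∈ simplicesT n)
    (hv2 : 2 ≤ v) (hvn : v + 2 ≤ n) {k : ℕ} {P : Prop} (hP : P → l = 0 ∧ k = v)
    (hP0 : v ∈ σ → ¬ P)
    {D : Finset ℕ} (hD : D = if v + 2 = n then σ ∩ {n - 1, n} else
      component (graphDTilde n) σ (v + 1)) {ρ : ℕ → ℕ} {τ : Finset ℕ} {p : ℕ → ℕ → Finset ℕ → Option ℕ}
    [Decidable P]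
    (hπ : π σ = if P then (if k ≤ n - 2 then relabel (n - k) ρ (p (n - k) 0) σ else none)
      else if σ = τ ∧ n - 1 ≤ v then none
      else if v ∈ σ then some v
      else if n ≤ v then none
      else if {n - 1, n} ⊆ D ∧ D.card ≤ l then none
      else if D.card < l then some v
      else if D.card = l ∧ n - 1 ∉ D ∧ n ∈ D then none
      else relabel (n - v) ρ (p (n - v) l) σ) :
    (v ∈ σ → π σ = some v) ∧ (¬ RightRun n v l σ → π σ = some v) ∧
    (v ∉ σ → RightRun n v l σ → n ≤ v + l ∨ (v + l + 1 = n ∧ n - 1 ∉ σ) → π σ = none) ∧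
    (v ∉ σ → RightRun n v l σ → (v + l < n ∧ (v + l + 1 = n → n - 1 ∈ σ)) →
      π σ = relabel (n - v) ρ (p (n - v) l) σ) := by
  have hmem : v ∈ σ → π σ = some v := fun h => by
    rw [hπ, if_neg (hP0 h), if_neg (by omega), if_pos h]
  have hinc : ({n - 1, n} : Finset ℕ) ⊆ D ↔ n - 1 ∈ D ∧ n ∈ D := by
    rw [insert_subset_iff, singleton_subset_iff]
  have key := fun hv => exists_rightRun (l := l) hn hσ hv2 hvn hv hD; grind

end TypeAffineEven

/-! ### Type `D̃_n`, `d = 2h`: a pivot `v ≤ n - 2` -/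

section TypeAffineConnected

variable {n d h q v l : ℕ} {σ s : Finset ℕ}

lemma card_range_union_image (hvn : v ≤ n) (hs : s ⊆ Icc 1 (n - v)) :
    (range v ∪ s.image fun j => n + 1 - j).card = v + s.card := by
  have h1 : ∀ j ∈ s, 1 ≤ j ∧ j ≤ n - v := fun j hj => mem_Icc.1 (hs hj)
  rw [card_union_of_disjoint, card_range, card_image_of_injOn]
  · intro x hx y hy h; grind
  · rw [disjoint_left]; grind

lemma eq_range_union_image (hσ : σ ∈ simplicesT n) (hlow : ∀ j, j < v → j ∈ σ) (hv : v ∉ σ) :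
    σ = range v ∪
      ((Icc 1 (n - v)).filter fun j => n + 1 - j ∈ σ).image fun j => n + 1 - j := by
  refine eq_union_image (fun j hj => hlow j (mem_range.1 hj)) fun x hx => ?_
  by_cases hxv : x < v
  · exact Or.inl (mem_range.2 hxv)
  · have := le_of_mem_simplicesT hσ hx; have : x ≠ v := by rintro rfl; exact hv hx
    exact Or.inr ⟨n + 1 - x, mem_Icc.2 (by omega), by omega⟩

/-- All vertices but `v`, and perhaps `n - 1`. -/
lemma criticalT_of_rightRun (hn : 4 ≤ n) (hh : 0 < h)
    (hq : v = if Even q then q * h else q * h + 1)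
    (hl : l = if Even q then h else h - 2) (hv3 : 3 ≤ v) (hodd : ¬ Even q → 2 ≤ h)
    (hvn : v + 2 ≤ n) (hwq : weightD (2 * h) v = q) (hσ : σ ∈ simplicesT n)
    (hlow : ∀ j, j < v → j ∈ σ) (hv : v ∉ σ) (hR : RightRun n v l σ)
    (hQ : ¬ (v + l < n ∧ (v + l + 1 = n → n - 1 ∈ σ))) : CriticalT h n σ := by
  have hE := eq_range_union_image hσ hlow hv
  have hsub : ((Icc 1 (n - v)).filter fun j => n + 1 - j ∈ σ) ⊆ Icc 1 (n - v) := filter_subset _ _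
  have hc := card_range_union_image (by omega) hsub
  have hw := gweight_graphDTilde_union hn (d := 2 * h) (by omega) hv3 hvn hsub; rw [← hE] at hc hw
  rw [hwq] at hw
  have hdef := defect_split hq (by omega : v ≤ n)
    (c := ((Icc 1 (n - v)).filter fun j => n + 1 - j ∈ σ).card)
    (w := gweight graphD (2 * h) ((Icc 1 (n - v)).filter fun j => n + 1 - j ∈ σ))
  rw [← hc, ← hw] at hdef
  -- Either everything beyond `v` is present, as in (g5.1), or everything but `n - 1`, as in (g5.3).
  by_cases h1 : n ≤ v + l
  · have hs : ((Icc 1 (n - v)).filter fun j => n + 1 - j ∈ σ) = Icc 1 (n - v) := by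
      rw [filter_eq_self]; intro j hj; rw [mem_Icc] at hj; have h2 := hR.2.2 h1
      have h3 : n + 1 - j = n - 1 ∨ n + 1 - j = n ∨ n + 1 - j + 2 ≤ n := by omega
      rcases h3 with h3 | h3 | h3
      · rw [h3]; exact h2.1
      · rw [h3]; exact h2.2
      · exact hR.1 _ (by omega) (by omega) h3
    have hlh : l ≤ h := by split_ifs at hl <;> omega
    have hw0 : gweight graphD (2 * h) (Icc 1 (n - v)) = 0 := by
      by_cases h2 : n - v = 2
      · rw [h2, gweight_graphD_Icc_two (by omega)]
      · rw [gweight_graphD_Icc (by omega) (by omega), weightD_two_mul,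
          evenQuot_eq_iff_of_even hh Even.zero]
        omega
    rw [hs, hw0, Nat.card_Icc, Nat.add_sub_cancel, defect_full] at hdef
    by_cases he : Even q
    · rw [if_pos he] at hq hl hdef; obtain ⟨p, rfl⟩ := he
      have e1 : (p + p) * h = p * (2 * h) := by ring
      rw [e1] at hq; exact Or.inl ⟨n - v, p, by omega, by omega, by omega, by omega⟩
    · have := hodd he; rw [if_neg he] at hq hl hdef; rw [Nat.not_even_iff_odd] at he
      obtain ⟨p, rfl⟩ := he; have e1 : (2 * p + 1) * h = p * (2 * h) + h := by ring
      rw [e1] at hq; exact Or.inr (Or.inl ⟨n - v + 1, p, by omega, by omega, by omega, by omega⟩)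
  · have h4 : v + l + 1 = n ∧ n - 1 ∉ σ := by grind
    obtain ⟨h4, h5⟩ := h4; have h6 := (hR.2.1 (by omega)).resolve_left h5
    have hs : ((Icc 1 (n - v)).filter fun j => n + 1 - j ∈ σ) =
        (Icc 1 (n - v)).erase 2 := by
      ext j; rw [mem_filter, mem_erase, mem_Icc]; constructor
      · grind
      · rintro ⟨h7, h8⟩; refine ⟨h8, ?_⟩
        by_cases h9 : j = 1
        · rw [h9]; exact h6
        · exact hR.1 _ (by omega) (by omega) (by omega)
    rw [hs, gweight_graphD_Icc_erase_two (by omega) (by omega), card_erase_of_mem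
      (mem_Icc.2 (by omega)), Nat.card_Icc, Nat.add_sub_cancel] at hdef
    rw [defect_Icc (by omega)] at hdef
    by_cases he : Even q
    · rw [if_pos he] at hq hl hdef; obtain ⟨p, rfl⟩ := he
      have e1 : (p + p) * h = p * (2 * h) := by ring
      rw [e1] at hq
      by_cases hh1 : h = 1
      · subst hh1; have h7 : n - v = 2 := by omega
        rw [h7] at hdef; refine Or.inl ⟨0, p + 1, by omega, by omega, ?_, by omega⟩
        rw [hdef]; norm_num
      · rw [Nat.div_eq_of_lt (by omega)] at hdef
        exact Or.inr (Or.inl ⟨1, p, by omega, le_rfl, by omega, by push_cast at hdef ⊢; omega⟩)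
    · have := hodd he; rw [if_neg he] at hq hl hdef; rw [Nat.not_even_iff_odd] at he
      obtain ⟨p, rfl⟩ := he; have e1 : (2 * p + 1) * h = p * (2 * h) + h := by ring
      rw [e1] at hq; rw [Nat.div_eq_of_lt (by omega)] at hdef
      exact Or.inl ⟨0, p + 1, by rw [add_mul]; omega, by omega, by push_cast at hdef ⊢; omega,
        by omega⟩

/-- All sizes of the component of `0` from `v` to `v + l` have weight `q`. If the run beyond `v` is
too short, toggling `v` stays in this range. If it is long enough, `v` is absent; then the part
beyond `v` is a simplex for the rule `D_{n-v,l}`, unless it is one of the configurations near the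
right end that are critical by `criticalT_of_rightRun`. -/
lemma isGood_graphDTilde_run (hn : 4 ≤ n) (hh : 0 < h)
    (hq : v = if Even q then q * h else q * h + 1)
    (hl : l = if Even q then h else h - 2) (hv3 : 3 ≤ v) (hodd : ¬ Even q → 2 ≤ h)
    (hvn : v + 2 ≤ n) (hiff : ∀ k, evenQuot h k = q ↔ v ≤ k ∧ k ≤ v + l)
    (hfib : ∀ σ ∈ simplicesT n, (∀ j, j < v → j ∈ σ) → ¬ (v ∈ σ ∧ RightRun n v l σ) →
      evenQuot h (component (graphDTilde n) σ 0).card = q)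
    (H : ∀ σ ∈ simplicesT n, (∀ j, j < v → j ∈ σ) → ¬ (v ∈ σ ∧ RightRun n v l σ) →
      (¬ RightRun n v l σ → pivotTEven (2 * h) n σ = some v) ∧
      (v ∉ σ → RightRun n v l σ → n ≤ v + l ∨ (v + l + 1 = n ∧ n - 1 ∉ σ) →
        pivotTEven (2 * h) n σ = none) ∧
      (v ∉ σ → RightRun n v l σ → (v + l < n ∧ (v + l + 1 = n → n - 1 ∈ σ)) →
        pivotTEven (2 * h) n σ =
          relabel (n - v) (fun j => n + 1 - j) (pivotDEven (2 * h) (n - v) l) σ)) :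
    IsGood {σ | σ ∈ simplicesT n ∧ (∀ j, j < v → j ∈ σ) ∧ ¬ (v ∈ σ ∧ RightRun n v l σ)}
      (gweight (graphDTilde n) (2 * h)) (pivotTEven (2 * h) n) (CriticalT h n) := by
  have hlh : l ≤ h := by split_ifs at hl <;> omega
  have hwq : weightD (2 * h) v = q := by rw [weightD_two_mul, hiff]; omega
  refine IsGood.split (RightRun n v l) (fun σ _ τ _ hτσ h => h.mono hτσ) ?_ ?_
  · have hvσ : ∀ σ, σ ∈ {σ | σ ∈ {σ | σ ∈ simplicesT n ∧ (∀ j, j < v → j ∈ σ) ∧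
        ¬ (v ∈ σ ∧ RightRun n v l σ)} ∧ RightRun n v l σ} → v ∉ σ :=
      fun σ hσ h => hσ.1.2.2 ⟨h, hσ.2⟩
    refine IsGood.split (fun σ => v + l < n ∧ (v + l + 1 = n → n - 1 ∈ σ))
      (fun σ _ τ _ hτσ h => ⟨h.1, fun h1 => hτσ (h.2 h1)⟩) ?_ ?_
    · by_cases hvl : v + l < n
      swap
      · refine IsGood.of_forall_none ?_ ?_ <;> exact fun σ hσ => absurd hσ.2.1 hvl
      have hsub : ∀ σ' ∈ simplicesA (n - v) 0 l, σ' ⊆ Icc 1 (n - v) := fun σ' h => h.1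
      have hK : ∀ σ, σ ∈ {σ | σ ∈ {σ | σ ∈ {σ | σ ∈ simplicesT n ∧ (∀ j, j < v → j ∈ σ) ∧
          ¬ (v ∈ σ ∧ RightRun n v l σ)} ∧ RightRun n v l σ} ∧
          (v + l < n ∧ (v + l + 1 = n → n - 1 ∈ σ))} ↔
          ∃ σ' ∈ simplicesA (n - v) 0 l,
            σ = range v ∪ σ'.image (fun j => n + 1 - j) := by
        intro σ; constructor
        · rintro ⟨hσ, h1, h2⟩
          refine ⟨_, ⟨filter_subset _ _, by omega, ?_⟩,
            eq_range_union_image hσ.1.1 hσ.1.2.1 (hvσ σ hσ)⟩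
          intro j h3 h4 h5; rw [mem_filter, mem_Icc]; refine ⟨⟨h4, h5⟩, ?_⟩
          by_cases h6 : n + 1 - j + 2 ≤ n
          · exact hσ.2.1 _ (by omega) (by omega) h6
          · rw [show n + 1 - j = n - 1 by omega]; exact h2 (by omega)
        · rintro ⟨σ', h1, rfl⟩
          have hmem : ∀ x, x ∈ range v ∪ σ'.image (fun j => n + 1 - j) ↔
              x < v ∨ (v < x ∧ x ≤ n ∧ n + 1 - x ∈ σ') := by
            intro x; rw [mem_union, mem_range, mem_image]
            refine or_congr_right ⟨?_, fun h2 => ⟨_, h2.2.2, by omega⟩⟩; rintro ⟨j, hj, rfl⟩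
            have := mem_Icc.1 (h1.1 hj); refine ⟨by omega, by omega, ?_⟩
            rwa [show n + 1 - (n + 1 - j) = j by omega]
          have hvn' : v ∉ range v ∪ σ'.image (fun j => n + 1 - j) := by rw [hmem]; omega
          have hrun : ∀ x, v < x → x ≤ v + l →
              x ∈ range v ∪ σ'.image (fun j => n + 1 - j) := by
            intro x h2 h3; rw [hmem]
            exact Or.inr ⟨h2, by omega, h1.2.2 _ (by omega) (by omega) (by omega)⟩
          refine ⟨⟨⟨⟨?_, v, by omega, hvn'⟩, ?_, fun h => hvn' h.1⟩, ?_, ?_, by omega⟩, hvl, ?_⟩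
          · grind
          · intro j hj; rw [hmem]; exact Or.inl hj
          · exact fun j h2 h3 _ => hrun j h2 h3
          · exact fun h2 => Or.inl (hrun _ (by omega) (by omega))
          · exact fun h2 => hrun _ (by omega) (by omega)
      have hweq : ∀ σ' ∈ simplicesA (n - v) 0 l, gweight (graphDTilde n) (2 * h)
          (range v ∪ σ'.image (fun j => n + 1 - j)) = q + gweight graphD (2 * h) σ' := by
        intro σ' h1; rw [gweight_graphDTilde_union hn (by omega) hv3 hvn h1.1, hwq]
      refine IsGood.of_relabel (isGood_pivotDEven hh hlh (by omega) (by omega)) (n - v)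
        (fun j => n + 1 - j) (range v) q ?_ ?_ ?_ hsub hK hweq ?_
      · grind
      · intro x hx y hy h; grind
      · grind
      · intro σ' h1 _ h2
        exact criticalT_of_criticalD hq hl hv3 hodd hvn
          (card_range_union_image (by omega) h1.1) (hweq σ' h1) h2
    · refine IsGood.of_forall_none ?_ ?_
      · grind
      · rintro σ ⟨hσ, h1⟩
        exact criticalT_of_rightRun hn hh hq hl hv3 hodd hvn hwq hσ.1.1 hσ.1.2.1 (hvσ σ hσ) hσ.2 h1
  · have hins : ∀ σ, v ∉ σ → (σ ∈ {σ | σ ∈ {σ | σ ∈ simplicesT n ∧ (∀ j, j < v → j ∈ σ) ∧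
        ¬ (v ∈ σ ∧ RightRun n v l σ)} ∧ ¬ RightRun n v l σ} ↔
        insert v σ ∈ {σ | σ ∈ {σ | σ ∈ simplicesT n ∧ (∀ j, j < v → j ∈ σ) ∧
        ¬ (v ∈ σ ∧ RightRun n v l σ)} ∧ ¬ RightRun n v l σ}) := by
      intro σ hv
      have hlow : (∀ j, j < v → j ∈ insert v σ) ↔ ∀ j, j < v → j ∈ σ :=
        forall_congr' fun j => forall_congr' fun h1 => mem_insert_of_ne_iff (by omega)
      constructor
      · rintro ⟨⟨h1, h2, h3⟩, h4⟩
        refine ⟨⟨⟨?_, ?_⟩, hlow.2 h2, fun h5 => h4 ((rightRun_insert_iff hvn).1 h5.2)⟩,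
          fun h5 => h4 ((rightRun_insert_iff hvn).1 h5)⟩
        · rw [insert_subset_iff]; exact ⟨mem_range.2 (by omega), h1.1⟩
        · by_contra h5
          push Not at h5
          have h6 : ∀ x, x ≤ n → x ≠ v → x ∈ σ := fun x h7 h8 =>
            (mem_insert_of_ne_iff h8).1 (h5 x h7)
          exact h4 ⟨fun j _ _ _ => h6 j (by omega) (by omega),
            fun _ => Or.inl (h6 _ (by omega) (by omega)),
            fun _ => ⟨h6 _ (by omega) (by omega), h6 _ (by omega) (by omega)⟩⟩
      · rintro ⟨⟨h1, h2, h3⟩, h4⟩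
        exact ⟨⟨⟨(subset_insert _ _).trans h1.1, v, by omega, hv⟩, hlow.1 h2,
          fun h5 => hv h5.1⟩, fun h5 => h4 ((rightRun_insert_iff hvn).2 h5)⟩
    refine IsGood.of_forall_some v ?_ hins ?_
    · grind
    · intro σ hσ hv; obtain ⟨⟨h1, h2, h3⟩, h4⟩ := (hins σ hv).1 hσ
      refine gweight_graphDTilde_insert hn (by omega) h1 hv hv3 (by omega) hσ.1.2.1 ?_
      intro b hb1 hb2 hb3; have h5 := hfib _ h1 h2 h3; rw [hb3] at h5
      rw [hwq, weightD_two_mul, h5, Nat.div_eq_of_lt]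
      · rfl
      · have := (hiff _).1 h5; omega

end TypeAffineConnected

/-! ### Type `D̃_n`, `d = 2h`: fibres with a large component of `0` -/

section TypeAffineBase

variable {n d h q v l c : ℕ} {σ s : Finset ℕ}

/-- The critical simplices in the case `v ≥ n - 1`. -/
lemma criticalT_of_fork (hn : 4 ≤ n) (hh : 0 < h) (hq : v = if Even q then q * h else q * h + 1)
    (hl : l = if Even q then h else h - 2) (hodd : ¬ Even q → 2 ≤ h) (hvn : n ≤ v + 1)
    (hiff : ∀ k, evenQuot h k = q ↔ v ≤ k ∧ k ≤ v + l) (hσ : σ ∈ simplicesT n) (h0 : 0 ∈ σ)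
    (h1 : 1 ∈ σ) (h2 : 2 ∈ σ) {k : ℕ} (hk : (component (graphDTilde n) σ 0).card = k)
    (hkv : v ≤ k) (hkl : k ≤ v + l) (hkn : k ≤ n) (hkσ : k = σ.card)
    (hcard : v < n → 0 < l → k = n) : CriticalT h n σ := by
  have hw : gweight (graphDTilde n) (2 * h) σ = q := by
    rw [gweight_graphDTilde_of_card hn (by omega) hσ h0 h1 h2 (by omega), ← hkσ, weightD_two_mul,
      hiff]
    exact ⟨hkv, hkl⟩
  unfold CriticalT; rw [hw, ← hkσ]
  by_cases he : Even q
  · rw [if_pos he] at hq hl; have hkn' : k = n := by grind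
    obtain ⟨p, rfl⟩ := he; have e1 : (p + p) * h = p * (2 * h) := by ring
    rw [hkn', defect_full, ← Nat.cast_mul, e1]; rw [e1] at hq
    exact Or.inl ⟨n - v, p, by omega, by omega, by omega, by omega⟩
  · have := hodd he; rw [if_neg he] at hq hl; rw [Nat.not_even_iff_odd] at he; obtain ⟨p, rfl⟩ := he
    have e1 : (2 * p + 1) * h = p * (2 * h) + h := by ring
    rw [e1] at hq
    by_cases hkn' : k = n
    · rw [hkn', defect_full, ← Nat.cast_mul, e1]
      exact Or.inr (Or.inl ⟨n - v + 1, p, by omega, by omega, by omega, by omega⟩)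
    · have hl0 : l = 0 := by grind
      have hkn2 : k = n - 1 := by omega
      rw [hkn2, defect_Icc (by omega), ← Nat.cast_mul, e1]
      exact Or.inl ⟨0, p + 1, by rw [add_mul]; omega, by omega, by omega, by omega⟩

/-- The complex is cut by the weight `q` of the component of `0`, and the bound `c` ensures `q > 0`.
If `v ≤ n - 2`, the fibre is that of `isGood_graphDTilde_run`. If `v ≥ n - 1`, all of `0, …, n - 2`
is present: the vertex `n - 1` is toggled when `v = n - 1`, `0 < l` and `n ∉ σ`, and every other
simplex is critical. -/
theorem isGood_pivotTEven_connected (hn : 4 ≤ n) (hn4 : ¬ (n = 4 ∧ 2 * h ≤ 6)) (hh : 0 < h)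
    (hc : c = if h = 1 then 3 else h) :
    IsGood {σ | σ ∈ simplicesT n ∧ ∀ j, j ≤ c → j ∈ σ}
      (gweight (graphDTilde n) (2 * h)) (pivotTEven (2 * h) n) (CriticalT h n) := by
  refine IsGood.of_fibers (fun σ => evenQuot h (component (graphDTilde n) σ 0).card)
    (fun σ _ τ _ hτσ => evenQuot_mono hh (card_le_card (component_mono hτσ))) fun q => ?_
  have hc2 : 2 ≤ c ∧ h ≤ c ∧ (h = 1 → c = 3) ∧ (h ≠ 1 → c = h) := by split_ifs at hc <;> omega
  have hcn : ∀ σ, (σ ∈ simplicesT n ∧ ∀ j, j ≤ c → j ∈ σ) → c + 1 ≤ n := by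
    rintro σ ⟨⟨-, x, hx1, hx2⟩, h2⟩; by_contra h3; exact hx2 (h2 x (by omega))
  have hfork : ∀ σ, (σ ∈ simplicesT n ∧ ∀ j, j ≤ c → j ∈ σ) → ∃ b, c ≤ b ∧ b + 1 ≤ n ∧
      (component (graphDTilde n) σ 0).card = b + 1 ∧
      (∀ j, 2 ≤ j → j ≤ b → j + 2 ≤ n → j ∈ σ) ∧ (b + 1 = n → n - 1 ∈ σ ∨ n ∈ σ) ∧
      (b + 3 ≤ n → b + 1 ∉ σ) ∧ (b + 2 = n → n - 1 ∉ σ ∧ n ∉ σ) := by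
    rintro σ ⟨h1, h2⟩
    obtain ⟨b, hb1, hb2, -, -, -, hk, hb⟩ := exists_fork hn h1 (h2 0 (by omega)) (h2 1 (by omega))
      hc2.1 (hcn σ ⟨h1, h2⟩) (fun j _ h3 => h2 j h3)
    exact ⟨b, hb1, hb2, hk, hb⟩
  by_cases hemp : ∀ σ, (σ ∈ simplicesT n ∧ ∀ j, j ≤ c → j ∈ σ) →
      evenQuot h (component (graphDTilde n) σ 0).card ≠ q
  · refine IsGood.of_forall_none ?_ ?_ <;> exact fun σ hσ => absurd hσ.2 (hemp σ hσ.1)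
  push Not at hemp
  obtain ⟨σ₀, hσ₀, hq₀⟩ := hemp; obtain ⟨b₀, hb₀, -, hk₀, -⟩ := hfork σ₀ hσ₀; have hcn := hcn σ₀ hσ₀
  rw [hk₀] at hq₀
  have hodd : ¬ Even q → 2 ≤ h := fun he => by
    have := (evenQuot_eq_iff_of_not_even hh he).1 hq₀; omega
  obtain ⟨v, hv⟩ : ∃ v, v = if Even q then q * h else q * h + 1 := ⟨_, rfl⟩
  obtain ⟨l, hl⟩ : ∃ l, l = if Even q then h else h - 2 := ⟨_, rfl⟩
  have hiff : ∀ k, evenQuot h k = q ↔ v ≤ k ∧ k ≤ v + l := by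
    intro k
    by_cases he : Even q
    · rw [if_pos he] at hv hl; rw [evenQuot_eq_iff_of_even hh he, hv, hl]
    · have := hodd he; rw [if_neg he] at hv hl; rw [evenQuot_eq_iff_of_not_even hh he, hv, hl]
      omega
  have hv3 : 3 ≤ v ∧ c < v := by
    have h1 := (hiff _).1 hq₀
    by_cases he : Even q
    · rw [if_pos he] at hv hl; obtain ⟨p, rfl⟩ := he; have e1 : (p + p) * h = p * (2 * h) := by ring
      rw [e1] at hv; rcases Nat.eq_zero_or_pos p with rfl | hp
      · omega
      · have := Nat.mul_le_mul_right (2 * h) hp; grind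
    · have := hodd he; rw [if_neg he] at hv hl
      have : 1 * h ≤ q * h := Nat.mul_le_mul_right _ (by
        rcases Nat.eq_zero_or_pos q with rfl | hp
        · simp at he
        · exact hp)
      omega
  have hpiv : ∀ σ, (σ ∈ simplicesT n ∧ ∀ j, j ≤ c → j ∈ σ) →
      evenQuot h (component (graphDTilde n) σ 0).card = q → _ := fun σ hσ hqσ =>
    pivotTEven_connected (n := n) (l := l) hn4 hh hc hσ.2 rfl hqσ hv hl (fun h1 h2 => by
      obtain ⟨b, hb1, hb2, hk, hb3, -⟩ := hfork σ hσ; rw [hk]; by_contra h3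
      exact h2 (hb3 3 (by omega) (by omega) (by omega))) (by omega)
  by_cases hvn : v + 2 ≤ n
  · have hset : ∀ σ, σ ∈ simplicesT n → (((∀ j, j ≤ c → j ∈ σ) ∧
        evenQuot h (component (graphDTilde n) σ 0).card = q) ↔
        ((∀ j, j < v → j ∈ σ) ∧ ¬ (v ∈ σ ∧ RightRun n v l σ))) := by
      intro σ hσ; constructor
      · rintro ⟨h1, h2⟩; obtain ⟨b, hb1, hb2, hk, hb3, hb4, hb5, hb6⟩ := hfork σ ⟨hσ, h1⟩
        rw [hk, hiff] at h2; have hlow : ∀ j, j < v → j ∈ σ := fun j hj => by grind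
        refine ⟨hlow, ?_⟩; rintro ⟨h3, h4, h5, h6⟩; have hbv : v ≤ b := by grind
        by_cases h7 : b + 3 ≤ n
        · exact hb5 h7 (h4 _ (by omega) (by omega) (by omega))
        · by_cases h8 : b + 2 = n
          · grind
          · obtain ⟨x, hx1, hx2⟩ := hσ.2; have h9 := h6 (by omega)
            have h10 : x < v ∨ x = v ∨ x = n - 1 ∨ x = n ∨ (v < x ∧ x + 2 ≤ n) := by omega
            grind
      · rintro ⟨hlow, h2⟩; have h1 : ∀ j, j ≤ c → j ∈ σ := fun j hj => hlow j (by omega)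
        refine ⟨h1, ?_⟩; obtain ⟨b, hb1, hb2, hk, hb3, hb4, hb5, hb6⟩ := hfork σ ⟨hσ, h1⟩
        rw [hk, hiff]; constructor
        · grind
        · by_contra h3
          refine h2 ⟨hb3 v (by omega) (by omega) hvn, fun j h4 h5 h6 => hb3 j (by omega) (by omega)
            h6, fun h4 => hb4 (by omega), by omega⟩
    have hset' : {σ | σ ∈ {σ | σ ∈ simplicesT n ∧ ∀ j, j ≤ c → j ∈ σ} ∧
        evenQuot h (component (graphDTilde n) σ 0).card = q} =
        {σ | σ ∈ simplicesT n ∧ (∀ j, j < v → j ∈ σ) ∧ ¬ (v ∈ σ ∧ RightRun n v l σ)} := by grind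
    rw [hset']; refine isGood_graphDTilde_run hn hh hv hl hv3.1 hodd hvn hiff ?_ ?_
    · exact fun σ h1 h2 h3 => ((hset σ h1).2 ⟨h2, h3⟩).2
    · intro σ h1 h2 h3; obtain ⟨h4, h5⟩ := (hset σ h1).2 ⟨h2, h3⟩; have hp := hpiv σ ⟨h1, h4⟩ h5
      have hP : (h = 2 ∧ ¬ Even q ∧ (component (graphDTilde n) σ 0).card = v) →
          l = 0 ∧ (component (graphDTilde n) σ 0).card = v := by grind
      have hP0 : v ∈ σ → ¬ (h = 2 ∧ ¬ Even q ∧ (component (graphDTilde n) σ 0).card = v) := by grind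
      exact (pivotTEven_connected_eq (l := l) hn h1 (by omega) hvn hP hP0 rfl
        (p := pivotDEven (2 * h)) hp).2
  · have hvals : ∀ σ, (σ ∈ simplicesT n ∧ ∀ j, j ≤ c → j ∈ σ) →
        evenQuot h (component (graphDTilde n) σ 0).card = q →
        ∃ k, (component (graphDTilde n) σ 0).card = k ∧ v ≤ k ∧ k ≤ v + l ∧ k ≤ n ∧
          (∀ j, j + 2 ≤ n → j ∈ σ) ∧ (k = n → n - 1 ∈ σ ∨ n ∈ σ) ∧
          (k + 1 = n → n - 1 ∉ σ ∧ n ∉ σ) ∧ k = σ.card := by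
      intro σ hσ h1; obtain ⟨b, hb1, hb2, hk, hb3, hb4, hb5, hb6⟩ := hfork σ hσ
      obtain ⟨-, -, -, -, -, hC, -⟩ := exists_fork hn hσ.1 (hσ.2 0 (by omega)) (hσ.2 1 (by omega))
        hc2.1 hcn (fun j _ h3 => hσ.2 j h3)
      rw [hk, hiff] at h1; have hall : ∀ j, j + 2 ≤ n → j ∈ σ := fun j hj => by grind
      refine ⟨b + 1, hk, h1.1, h1.2, hb2, hall, hb4, fun h' => hb6 (by omega), ?_⟩
      have hle : ∀ x ∈ σ, x ≤ n := fun x hx => le_of_mem_simplicesT hσ.1 hx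
      by_cases hb : b + 1 = n
      · obtain ⟨x, hx1, hx2⟩ := hσ.1.2
        have hx3 : x = n - 1 ∨ x = n := by by_contra h3; exact hx2 (hall x (by omega))
        have hE : σ = (range (n + 1)).erase x := by
          ext y; rw [mem_erase, mem_range]; constructor
          · grind
          · rintro ⟨hy1, hy2⟩
            by_cases hy3 : y + 2 ≤ n
            · exact hall y hy3
            · have h5 := hb4 hb; rcases hx3 with hx3 | hx3
              · rw [show y = n by omega]; exact h5.resolve_left (hx3 ▸ hx2)
              · rw [show y = n - 1 by omega]; exact h5.resolve_right (hx3 ▸ hx2)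
        grind
      · have h5 := hb6 (by omega)
        have hE : σ = range (n - 1) := by
          ext y; rw [mem_range]; constructor
          · intro hy; have := hle y hy; have : y ≠ n - 1 := by rintro rfl; exact h5.1 hy
            have : y ≠ n := by rintro rfl; exact h5.2 hy
            omega
          · exact fun hy => hall y (by omega)
        rw [hE, card_range]; omega
    have hcrit : ∀ σ, (σ ∈ simplicesT n ∧ ∀ j, j ≤ c → j ∈ σ) →
        evenQuot h (component (graphDTilde n) σ 0).card = q →
        (v < n → 0 < l → n ∈ σ) → CriticalT h n σ := by
      intro σ hσ h1 h2; obtain ⟨k, hk, hkv, hkl, hkn, hall, h3, h4, h5⟩ := hvals σ hσ h1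
      refine criticalT_of_fork hn hh hv hl hodd (by omega) hiff hσ.1 (hσ.2 0 (by omega))
        (hσ.2 1 (by omega)) (hσ.2 2 (by omega)) hk hkv hkl hkn h5 fun h6 h7 => ?_
      by_contra h8; exact (h4 (by omega)).2 (h2 h6 h7)
    have hτ : ∀ σ ∈ simplicesT n, (∀ j, j + 2 ≤ n → j ∈ σ) → n ∈ σ →
        σ = insert n (Icc 0 (n - 2)) := by
      intro σ hσ hall h1
      have h2 : n - 1 ∉ σ := by
        intro h2; obtain ⟨x, hx1, hx2⟩ := hσ.2; have h3 : x + 2 ≤ n ∨ x = n - 1 ∨ x = n := by omega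
        grind
      ext y; rw [mem_insert, mem_Icc]; constructor
      · intro hy; have := le_of_mem_simplicesT hσ hy; have : y ≠ n - 1 := by rintro rfl; exact h2 hy
        omega
      · grind
    -- For `l = 0` the only admissible size is `v`, so there is no room to toggle; for `v ≥ n` there
    -- is no vertex to toggle.
    by_cases hcase : v < n ∧ 0 < l
    · have hvn1 : v = n - 1 := by omega
      have hset : {σ | σ ∈ {σ | σ ∈ simplicesT n ∧ ∀ j, j ≤ c → j ∈ σ} ∧
          evenQuot h (component (graphDTilde n) σ 0).card = q} =
          {σ | σ ∈ simplicesT n ∧ ∀ j, j < v → j ∈ σ} := by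
        ext σ; constructor
        · grind
        · rintro ⟨h1, h2⟩; have h3 : ∀ j, j ≤ c → j ∈ σ := fun j hj => h2 j (by omega); grind
      have hmem : ∀ σ ∈ {σ | σ ∈ simplicesT n ∧ ∀ j, j < v → j ∈ σ},
          (σ ∈ simplicesT n ∧ ∀ j, j ≤ c → j ∈ σ) ∧
          evenQuot h (component (graphDTilde n) σ 0).card = q := fun σ hσ => by
        rw [← hset] at hσ; exact hσ
      have hnP : ∀ σ : Finset ℕ,
          ¬ (h = 2 ∧ ¬ Even q ∧ (component (graphDTilde n) σ 0).card = v) := by grind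
      rw [hset]; refine IsGood.split (fun σ => n ∈ σ) (fun σ _ τ _ hτσ h => hτσ h) ?_ ?_
      · refine IsGood.of_forall_none ?_ ?_
        · rintro σ ⟨hσ, h1⟩; grind
        · grind
      · have hins : ∀ σ, v ∉ σ → (σ ∈ {σ | σ ∈ {σ | σ ∈ simplicesT n ∧ ∀ j, j < v → j ∈ σ} ∧
            n ∉ σ} ↔ insert v σ ∈ {σ | σ ∈ {σ | σ ∈ simplicesT n ∧ ∀ j, j < v → j ∈ σ} ∧
            n ∉ σ}) := by
          intro σ h1
          have hlow : (∀ j, j < v → j ∈ insert v σ) ↔ ∀ j, j < v → j ∈ σ :=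
            forall_congr' fun j => forall_congr' fun h1 => mem_insert_of_ne_iff (by omega)
          have hnn : n ∈ insert v σ ↔ n ∈ σ := mem_insert_of_ne_iff (by omega); constructor
          · rintro ⟨⟨h2, h3⟩, h4⟩
            refine ⟨⟨⟨?_, n, le_rfl, fun h => h4 (hnn.1 h)⟩, hlow.2 h3⟩, fun h => h4 (hnn.1 h)⟩
            rw [insert_subset_iff]; exact ⟨mem_range.2 (by omega), h2.1⟩
          · rintro ⟨⟨h2, h3⟩, h4⟩
            exact ⟨⟨⟨(subset_insert _ _).trans h2.1, v, by omega, h1⟩, hlow.1 h3⟩,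
              fun h => h4 (hnn.2 h)⟩
        refine IsGood.of_forall_some v ?_ hins ?_
        · rintro σ ⟨hσ, h1⟩; obtain ⟨h2, h3⟩ := hmem σ hσ
          have h4 : σ ≠ insert n (Icc 0 (n - 2)) := by rintro rfl; exact h1 (mem_insert_self _ _)
          rw [hpiv σ h2 h3, if_neg (hnP σ), if_neg (fun h => h4 h.1)]
          by_cases h5 : v ∈ σ
          · rw [if_pos h5]
          · have h6 : component (graphDTilde n) σ (v + 1) = ∅ :=
              component_eq_empty (by rwa [show v + 1 = n by omega])
            rw [if_neg h5, if_neg (by omega)]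
            simp only [if_neg (show ¬ v + 2 = n by omega), h6, card_empty]; grind
        · intro σ hσ h1; have h2 := (hins σ h1).1 hσ
          refine gweight_graphDTilde_insert hn (by omega) h2.1.1 h1 hv3.1 (by omega) hσ.1.2 ?_
          intro b hb1 hb2 hb3; have h3 := (hmem _ h2.1).2; rw [hb3] at h3
          rw [weightD_two_mul, weightD_two_mul, h3, (hiff v).2 (by omega), Nat.div_eq_of_lt]
          · rfl
          · omega
    · refine IsGood.of_forall_none ?_ ?_
      · rintro σ ⟨hσ, h1⟩; obtain ⟨k, hk, hkv, hkl, hkn, hall, h3, h4, h5⟩ := hvals σ hσ h1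
        rw [hpiv σ hσ h1, hk]; grind
      · grind

end TypeAffineBase

/-! ### Type `D̃_n`, `d = 2h`: simplices without `1` or without `0` -/

section TypeAffineFibers

variable {n d h q v l c : ℕ} {σ s : Finset ℕ}

lemma injOn_fold (n : ℕ) :
    Set.InjOn (fun j => if j = n then 0 else n + 1 - j) (Icc 1 n : Finset ℕ) := by
  intro x hx y hy h; grind

lemma injOn_reverse (n : ℕ) : Set.InjOn (fun j => n + 1 - j) (Icc 1 n : Finset ℕ) := by
  intro x hx y hy h; grind

lemma gweight_graphDTilde_fold (hn : 4 ≤ n) (hs : s ⊆ Icc 1 n) :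
    gweight (graphDTilde n) d (s.image fun j => if j = n then 0 else n + 1 - j) =
      gweight graphD d s := by
  have h1 : ∀ j ∈ s, 1 ≤ j ∧ j ≤ n := fun j hj => mem_Icc.1 (hs hj)
  refine gweight_image ((injOn_fold n).mono hs) ?_; intro x hx y hy; have := h1 x hx
  have := h1 y hy
  have key : ∀ z, z ≤ n → ∃ w, w = (if z = n then 0 else n + 1 - z) ∧
      ((z = n ∧ w = 0) ∨ (z < n ∧ w + z = n + 1)) := fun z hz =>
    ⟨_, rfl, by by_cases h : z = n
                · rw [if_pos h]; omega
                · rw [if_neg h]; omega⟩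
  obtain ⟨u, hu, hu'⟩ := key x (by omega); obtain ⟨w, hw, hw'⟩ := key y (by omega)
  rw [← hu, ← hw, graphDTilde_adj hn, graphD_adj]; omega

/-- Membership in the image of a set of vertices of the graph of type `D_n`. -/
lemma mem_image_fold (hs : s ⊆ Icc 1 n) (x : ℕ) :
    x ∈ s.image (fun j => if j = n then 0 else n + 1 - j) ↔
      (x = 0 ∧ n ∈ s) ∨ (2 ≤ x ∧ x ≤ n ∧ n + 1 - x ∈ s) := by grind

lemma mem_image_reverse (hs : s ⊆ Icc 1 n) (x : ℕ) :
    x ∈ s.image (fun j => n + 1 - j) ↔ 1 ≤ x ∧ x ≤ n ∧ n + 1 - x ∈ s := by grind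

lemma eq_image_fold (hn : 1 ≤ n) (hσ : σ ∈ simplicesT n) (h1 : 1 ∉ σ) :
    ∃ s ⊆ Icc 1 n, σ = s.image (fun j => if j = n then 0 else n + 1 - j) := by
  refine ⟨(Icc 1 n).filter fun j => (if j = n then 0 else n + 1 - j) ∈ σ,
    filter_subset _ _, ?_⟩
  ext x
  rw [mem_image_fold (filter_subset _ _), mem_filter, mem_filter,
    mem_Icc, mem_Icc]
  constructor
  · intro hx; have := le_of_mem_simplicesT hσ hx; grind
  · grind

lemma eq_image_reverse (hσ : σ ∈ simplicesT n) (h0 : 0 ∉ σ) :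
    ∃ s ⊆ Icc 1 n, σ = s.image (fun j => n + 1 - j) := by
  refine ⟨(Icc 1 n).filter fun j => n + 1 - j ∈ σ, filter_subset _ _, ?_⟩; ext x
  rw [mem_image_reverse (filter_subset _ _), mem_filter, mem_Icc]; constructor
  · intro hx; have := le_of_mem_simplicesT hσ hx; grind
  · grind

lemma mem_simplicesT_fold_iff (hn : 1 ≤ n) : (σ ∈ simplicesT n ∧ 1 ∉ σ) ↔
    ∃ s ∈ simplicesA n 0 0, σ = ∅ ∪ s.image fun j => if j = n then 0 else n + 1 - j := by
  constructor
  · rintro ⟨h1, h2⟩; obtain ⟨s, hs, rfl⟩ := eq_image_fold hn h1 h2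
    exact ⟨s, ⟨hs, by omega, by omega⟩, by rw [empty_union]⟩
  · rintro ⟨s, hs, rfl⟩; rw [empty_union]
    have h1 : 1 ∉ s.image fun j => if j = n then 0 else n + 1 - j := by
      rw [mem_image_fold hs.1]; omega
    refine ⟨⟨fun x hx => ?_, 1, by omega, h1⟩, h1⟩; rw [mem_image_fold hs.1] at hx
    rw [mem_range]; omega

/-- Without `1`, the graph is of type `D_n` when read from the right, with twins `n, n - 1` and with
`0` as the far end. -/
theorem IsGood.fold {π' : Finset ℕ → Option ℕ} {L L' : Finset ℕ → Prop}
    {π : Finset ℕ → Option ℕ} (hn : 4 ≤ n)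
    (H : IsGood (simplicesA n 0 0) (gweight graphD d) π' L')
    (hπ : ∀ σ ∈ simplicesT n, 1 ∉ σ →
      π σ = relabel n (fun j => if j = n then 0 else n + 1 - j) π' σ)
    (hL : ∀ s ⊆ Icc 1 n, L' s → L (s.image fun j => if j = n then 0 else n + 1 - j)) :
    IsGood {σ | σ ∈ simplicesT n ∧ 1 ∉ σ} (gweight (graphDTilde n) d) π L := by
  refine IsGood.of_relabel H n (fun j => if j = n then 0 else n + 1 - j) ∅ 0 ?_ (injOn_fold n)
    (by simp) (fun σ' h => h.1) ?_ ?_ ?_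
  · rintro σ ⟨h1, h2⟩; exact hπ σ h1 h2
  · exact fun σ => mem_simplicesT_fold_iff (by omega)
  · intro σ' h; rw [empty_union, gweight_graphDTilde_fold hn h.1, zero_add]
  · intro σ' h _ h1; rw [empty_union]; exact hL σ' h.1 h1

/-- This is the source of the exceptional third family of `CriticalT`: that of `CriticalD` for `g =
0`, in which the absence of `2` becomes the absence of `n - 1`. -/
lemma isGood_pivotTEven_one_notMem (hn : 4 ≤ n) (hn4 : ¬ (n = 4 ∧ 2 * h ≤ 6)) (hh : 0 < h) :
    IsGood {σ | σ ∈ simplicesT n ∧ 1 ∉ σ} (gweight (graphDTilde n) (2 * h))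
      (pivotTEven (2 * h) n) (CriticalT h n) := by
  refine IsGood.fold hn (isGood_pivotDEven hh (Nat.zero_le h) (by omega) (by omega)) ?_ ?_
  · intro σ _ h1; unfold pivotTEven; rw [if_neg hn4, if_pos h1]
  · intro s hs H; unfold CriticalT
    rw [gweight_graphDTilde_fold hn hs, card_image_of_injOn ((injOn_fold n).mono hs)]
    rcases H with ⟨j, t, h1, h2, h3, h4⟩ | ⟨j, t, h1, h2, h3, h4⟩ | ⟨t, h1, h2, h3, h4, h5⟩
    · exact Or.inl ⟨j, t, h1, by omega, h3, by omega⟩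
    · exact Or.inr (Or.inl ⟨j, t, h1, h2, h3, h4⟩)
    · refine Or.inr (Or.inr ⟨t, by omega, by omega, by omega, h4, ?_, ?_⟩)
      · rw [mem_image_fold hs]; omega
      · grind

lemma card_image_reverse (hs : s ⊆ Icc 1 n) : (s.image fun j => n + 1 - j).card = s.card :=
  card_image_of_injOn ((injOn_reverse n).mono hs)

lemma isGood_pivotTEven_zero_notMem (hn : 4 ≤ n) (hn4 : ¬ (n = 4 ∧ 2 * h ≤ 6)) (hh : 2 ≤ h) :
    IsGood {σ | σ ∈ simplicesT n ∧ (∀ j, 1 ≤ j → j ≤ h → j ∈ σ) ∧ 0 ∉ σ}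
      (gweight (graphDTilde n) (2 * h)) (pivotTEven (2 * h) n) (CriticalT h n) := by
  have hπ : ∀ σ : Finset ℕ, (∀ j, 1 ≤ j → j ≤ h → j ∈ σ) → 0 ∉ σ → pivotTEven (2 * h) n σ =
      relabel n (fun j => n + 1 - j) (pivotDEven (2 * h) n h) σ := by
    intro σ h1 h0; unfold pivotTEven; grind
  by_cases hnh : n < h
  · refine IsGood.of_forall_none ?_ ?_ <;>
    · rintro σ ⟨h1, h2, -⟩; have := le_of_mem_simplicesT h1 (h2 h (by omega) le_rfl); omega
  have hK : ∀ σ, σ ∈ {σ | σ ∈ simplicesT n ∧ (∀ j, 1 ≤ j → j ≤ h → j ∈ σ) ∧ 0 ∉ σ} ↔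
      ∃ s ∈ simplicesA n 0 h, σ = ∅ ∪ s.image fun j => n + 1 - j := by
    intro σ; constructor
    · rintro ⟨h1, h2, h3⟩; obtain ⟨s, hs, rfl⟩ := eq_image_reverse h1 h3
      refine ⟨s, ⟨hs, by omega, fun j h4 h5 h6 => ?_⟩, by rw [empty_union]⟩
      have := h2 (n + 1 - j) (by omega) (by omega); grind
    · rintro ⟨s, hs, rfl⟩; rw [empty_union]
      have h0 : 0 ∉ s.image fun j => n + 1 - j := by rw [mem_image_reverse hs.1]; omega
      refine ⟨⟨fun x hx => ?_, 0, by omega, h0⟩, fun j h1 h2 => ?_, h0⟩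
      · rw [mem_image_reverse hs.1] at hx; rw [mem_range]; omega
      · rw [mem_image_reverse hs.1]; exact ⟨h1, by omega, hs.2.2 _ (by omega) (by omega) (by omega)⟩
  have hLt : ∀ s ⊆ Icc 1 n, CriticalD h n h s →
      CriticalT h n (s.image fun j => n + 1 - j) := by
    intro s hs H; unfold CriticalT; rw [gweight_graphDTilde_image hn hs, card_image_reverse hs]
    rcases H with ⟨j, t, h1, h2, h3, h4⟩ | ⟨j, t, h1, h2, h3, h4⟩ | ⟨t, h1, h2, h3, h4, h5⟩
    · refine Or.inl ⟨j, t, h1, by omega, h3, fun h5 => ⟨(h4 h5 rfl).1, fun h6 h7 => ?_⟩⟩; ext x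
      rw [mem_image_reverse hs, (h4 h5 rfl).2 h6 h7, mem_Icc, mem_Icc]; omega
    · exact Or.inr (Or.inl ⟨j, t, h1, h2, h3, h4⟩)
    · exact Or.inr (Or.inl ⟨1, t, by omega, le_rfl, by omega, by omega⟩)
  -- For `n = h` all vertices are forced, a case outside `isGood_pivotDEven`; the fibre is the
  -- single simplex `{1, …, n}`.
  by_cases hnh' : n = h
  · have hE : ∀ σ, σ ∈ {σ | σ ∈ simplicesT n ∧ (∀ j, 1 ≤ j → j ≤ h → j ∈ σ) ∧ 0 ∉ σ} →
        σ = Icc 1 n := by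
      rintro σ ⟨h1, h2, h3⟩; ext x; rw [mem_Icc]; constructor
      · intro hx; have := le_of_mem_simplicesT h1 hx; have : x ≠ 0 := by rintro rfl; exact h3 hx
        omega
      · exact fun hx => h2 x hx.1 (by omega)
    subst hnh'
    have hcomp : component graphD (Icc 1 n) 1 = Icc 1 n :=
      component_graphD (by simp) (by omega) subset_rfl (by simp)
    have hq0 : evenQuot n n = 0 := (evenQuot_eq_iff_of_even (by omega) Even.zero).2 (by omega)
    refine IsGood.of_forall_none ?_ ?_
    · intro σ hσ; have h1 := hE σ hσ
      have h2 : (Icc 1 n).filter (fun j => n + 1 - j ∈ σ) = Icc 1 n := by grind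
      rw [hπ σ hσ.2.1 hσ.2.2, relabel, h2, pivotDEven_of_connected (q := 0) (v := 1) (l := n)
        (mem_Icc.2 (by omega)) (mem_Icc.2 (by omega)) (mem_Icc.2 (by omega))
        (mem_Icc.2 (by omega)) (by rw [hcomp, Nat.card_Icc, Nat.add_sub_cancel]) hq0 (by simp)
        (by simp) (by omega) (by simp), if_pos (mem_Icc.2 (by omega)), if_neg (by omega)]
      rfl
    · intro σ hσ
      have h3 : σ = (Icc 1 n).image fun j => n + 1 - j := by
        ext x; rw [hE σ hσ, mem_image_reverse subset_rfl, mem_Icc, mem_Icc]; omega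
      rw [h3]; refine hLt _ subset_rfl (Or.inl ⟨n, 0, by omega, le_rfl, ?_, by omega⟩)
      rw [gweight_graphD_Icc (by omega) (by omega), weightD_two_mul, hq0, Nat.card_Icc,
        Nat.add_sub_cancel, defect_full]
      simp
  refine IsGood.of_relabel (isGood_pivotDEven (by omega) le_rfl (by omega) (by omega)) n
    (fun j => n + 1 - j) ∅ 0 (fun σ hσ => hπ σ hσ.2.1 hσ.2.2) (injOn_reverse n)
    (by simp) (fun σ' h => h.1) hK ?_ ?_
  · intro σ' h; rw [empty_union, gweight_graphDTilde_image hn h.1, zero_add]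
  · intro σ' h _ h1; rw [empty_union]; exact hLt σ' h.1 h1

end TypeAffineFibers

/-! ### Type `D̃_n`, `d = 2h`: short runs starting at `1` -/

section TypeAffineShort

variable {n d h q v l c : ℕ} {σ s : Finset ℕ}

/-- The fibre on which `1 ∈ σ` and `{2, …, h} ⊄ σ`. -/
lemma isGood_pivotTEven_run_short (hn : 4 ≤ n) (hn4 : ¬ (n = 4 ∧ 2 * h ≤ 6)) (hh : 2 ≤ h) :
    IsGood {σ | σ ∈ simplicesT n ∧ 1 ∈ σ ∧ ¬ ∀ j, 2 ≤ j → j ≤ h → j ∈ σ}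
      (gweight (graphDTilde n) (2 * h)) (pivotTEven (2 * h) n) (CriticalT h n) := by
  have e0 : 2 * h / 2 = h := by omega
  have hfull : ∀ σ ∈ simplicesT n, (∀ j, 1 ≤ j → j ≤ n → j ∈ σ) → 0 ∉ σ := by
    rintro σ ⟨-, x, hx1, hx2⟩ h1 h0; grind
  have hπ0 : ∀ σ : Finset ℕ, 1 ∈ σ → (¬ ∀ j, 2 ≤ j → j ≤ h → j ∈ σ) → 0 ∉ σ →
      pivotTEven (2 * h) n σ = if n = h + 1 ∧ σ = insert n (Icc 1 (n - 2)) then none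
      else if σ = Icc 1 n then none else some 0 := by
    intro σ h1 h2 h0; unfold pivotTEven; grind
  have hcomp : ∀ σ ∈ simplicesT n, 0 ∈ σ → 1 ∈ σ → 2 ∈ σ → (¬ ∀ j, 2 ≤ j → j ≤ h → j ∈ σ) →
      (component (graphDTilde n) σ 0).card ≤ h ∨
      (n = h + 1 ∧ n - 1 ∉ σ ∧ n ∈ σ ∧ (∀ j, 2 ≤ j → j + 2 ≤ n → j ∈ σ) ∧
        (component (graphDTilde n) σ 0).card = n) := by
    intro σ hσ h0 h1 h2 hr
    obtain ⟨b, hb1, hb2, -, -, -, hk, hb3, hb4, hb5, hb6⟩ := exists_fork hn hσ h0 h1 (c := 2) le_rfl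
      (by omega) (fun j h3 h4 => by rwa [show j = 2 by omega])
    push Not at hr
    grind
  -- The predicate isolates the critical simplices of (c2) and (c3), which miss `0`, and of (g2),
  -- which contains it. Elsewhere `0` is toggled, and the component of `0`, when it contains `2`,
  -- has at most `h` vertices and hence weight `0`.
  refine IsGood.split (fun σ => (n = h + 1 ∧ (∀ j, 2 ≤ j → j + 2 ≤ n → j ∈ σ) ∧ n ∈ σ) ∨
    (n < h ∧ ∀ j, 2 ≤ j → j ≤ n → j ∈ σ)) ?_ ?_ ?_
  · grind
  · have hcase : ∀ σ, σ ∈ {σ | σ ∈ {σ | σ ∈ simplicesT n ∧ 1 ∈ σ ∧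
        ¬ ∀ j, 2 ≤ j → j ≤ h → j ∈ σ} ∧
        ((n = h + 1 ∧ (∀ j, 2 ≤ j → j + 2 ≤ n → j ∈ σ) ∧ n ∈ σ) ∨
        (n < h ∧ ∀ j, 2 ≤ j → j ≤ n → j ∈ σ))} →
        (n = h + 1 ∧ σ = insert n (Icc 1 (n - 2))) ∨
        (n = h + 1 ∧ σ = insert n (Icc 0 (n - 2))) ∨ (n < h ∧ σ = Icc 1 n) := by
      rintro σ ⟨⟨hσ, h1, h2⟩, ⟨h3, h4, h5⟩ | ⟨h3, h4⟩⟩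
      · have h6 : n - 1 ∉ σ := fun h6 => h2 fun j h7 h8 => by
          by_cases h9 : j + 2 ≤ n
          · exact h4 j h7 h9
          · rwa [show j = n - 1 by omega]
        have h7 : ∀ x, 1 ≤ x → (x ∈ σ ↔ x = n ∨ x ≤ n - 2) := by
          intro x hx; constructor
          · intro h8; have := le_of_mem_simplicesT hσ h8
            have : x ≠ n - 1 := by rintro rfl; exact h6 h8
            omega
          · grind
        by_cases h0 : 0 ∈ σ
        · refine Or.inr (Or.inl ⟨h3, ?_⟩); ext x; rw [mem_insert, mem_Icc]
          by_cases hx : x = 0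
          · simp [hx, h0]
          · rw [h7 x (by omega)]; omega
        · refine Or.inl ⟨h3, ?_⟩; ext x; rw [mem_insert, mem_Icc]; grind
      · refine Or.inr (Or.inr ⟨h3, ?_⟩)
        have h5 : ∀ j, 1 ≤ j → j ≤ n → j ∈ σ := fun j h6 h7 => by grind
        ext x; rw [mem_Icc]; constructor
        · intro hx; have := le_of_mem_simplicesT hσ hx; grind
        · exact fun hx => h5 x hx.1 hx.2
    refine IsGood.of_forall_none ?_ ?_
    · intro σ hσ; have ⟨⟨h1, h2, h3⟩, _⟩ := hσ
      rcases hcase σ hσ with ⟨h4, h5⟩ | ⟨h4, h5⟩ | ⟨h4, h5⟩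
      · grind
      · have hm : ∀ x, x ≤ n - 2 → x ∈ σ := fun x hx => by rw [h5, mem_insert, mem_Icc]; omega
        have h6 : n - 1 ∉ σ := by rw [h5, mem_insert, mem_Icc]; omega
        obtain ⟨b, hb1, hb2, -, -, -, hk, hb3, hb4, hb5, hb6⟩ := exists_fork hn h1
          (hm 0 (by omega)) (hm 1 (by omega)) (c := 2) le_rfl (by omega)
          (fun j h3 h4 => hm j (by omega))
        have hbn : b + 1 = n := by grind
        have hq1 : evenQuot h n = 1 := by
          rw [evenQuot_eq_iff_of_not_even (by omega) (by decide)]; omega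
        have e1 : ({0, 1, 2, 3} : Finset ℕ) ⊆ σ ↔ True := by
          simp only [iff_true, insert_subset_iff, singleton_subset_iff]; grind
        have h33 : 3 ∈ σ := hm 3 (by omega); unfold pivotTEven; grind
      · grind
    · intro σ hσ; have ⟨⟨h1, h2, h3⟩, _⟩ := hσ
      rcases hcase σ hσ with ⟨h4, h5⟩ | ⟨h4, h5⟩ | ⟨h4, h5⟩
      · have h6 : σ = ((Icc 1 n).erase 2).image fun j => n + 1 - j := by
          ext x
          rw [mem_image_reverse (erase_subset _ _), h5, mem_insert, mem_erase,
            mem_Icc, mem_Icc]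
          omega
        refine Or.inr (Or.inl ⟨1, 0, by omega, le_rfl, by omega, ?_⟩)
        rw [h6, gweight_graphDTilde_image hn (erase_subset _ _),
          gweight_graphD_Icc_erase_two (by omega) (by omega),
          card_image_reverse (erase_subset _ _), card_erase_of_mem
          (mem_Icc.2 (by omega)), Nat.card_Icc, Nat.add_sub_cancel, Nat.div_eq_of_lt (by omega),
          defect_Icc (by omega)]
        push_cast; omega
      · have hm : ∀ x, x ≤ n - 2 → x ∈ σ := fun x hx => by rw [h5, mem_insert, mem_Icc]; omega
        have h6 : n - 1 ∉ σ := by rw [h5, mem_insert, mem_Icc]; omega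
        obtain ⟨b, hb1, hb2, -, -, -, hk, hb3, hb4, hb5, hb6⟩ := exists_fork hn h1
          (hm 0 (by omega)) (hm 1 (by omega)) (c := 2) le_rfl (by omega)
          (fun j h3 h4 => hm j (by omega))
        have hbn : b + 1 = n := by grind
        have hcard : σ.card = n := by
          rw [h5, card_insert_of_notMem (by rw [mem_Icc]; omega), Nat.card_Icc]; omega
        have hq1 : evenQuot h n = 1 := by
          rw [evenQuot_eq_iff_of_not_even (by omega) (by decide)]; omega
        refine Or.inr (Or.inl ⟨1, 0, by omega, le_rfl, by omega, ?_⟩)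
        rw [gweight_graphDTilde_of_card hn (by omega) h1 (hm 0 (by omega)) (hm 1 (by omega))
          (hm 2 (by omega)) (by omega), hcard, weightD_two_mul, hq1, defect_full]
        push_cast; omega
      · have h6 : σ = (Icc 1 n).image fun j => n + 1 - j := by
          ext x; rw [mem_image_reverse subset_rfl, h5, mem_Icc, mem_Icc]; omega
        have hq0 : evenQuot h n = 0 := (evenQuot_eq_iff_of_even (by omega) Even.zero).2 (by omega)
        refine Or.inl ⟨n, 0, by omega, by omega, ?_, by omega⟩
        rw [h6, gweight_graphDTilde_image hn subset_rfl, gweight_graphD_Icc (by omega) (by omega),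
          weightD_two_mul, hq0, card_image_reverse subset_rfl, Nat.card_Icc, Nat.add_sub_cancel,
          defect_full]
        simp
  · have hins : ∀ σ, 0 ∉ σ → (σ ∈ {σ | σ ∈ {σ | σ ∈ simplicesT n ∧ 1 ∈ σ ∧
        ¬ ∀ j, 2 ≤ j → j ≤ h → j ∈ σ} ∧
        ¬ ((n = h + 1 ∧ (∀ j, 2 ≤ j → j + 2 ≤ n → j ∈ σ) ∧ n ∈ σ) ∨
        (n < h ∧ ∀ j, 2 ≤ j → j ≤ n → j ∈ σ))} ↔
        insert 0 σ ∈ {σ | σ ∈ {σ | σ ∈ simplicesT n ∧ 1 ∈ σ ∧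
        ¬ ∀ j, 2 ≤ j → j ≤ h → j ∈ σ} ∧
        ¬ ((n = h + 1 ∧ (∀ j, 2 ≤ j → j + 2 ≤ n → j ∈ σ) ∧ n ∈ σ) ∨
        (n < h ∧ ∀ j, 2 ≤ j → j ≤ n → j ∈ σ))}) := by
      intro σ h0; have e1 : (1 ∈ insert 0 σ) ↔ 1 ∈ σ := mem_insert_of_ne_iff (by omega)
      have e2 : n ∈ insert 0 σ ↔ n ∈ σ := mem_insert_of_ne_iff (by omega)
      have e3 : (∀ j, 2 ≤ j → j + 2 ≤ n → j ∈ insert 0 σ) ↔ ∀ j, 2 ≤ j → j + 2 ≤ n → j ∈ σ :=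
        forall_congr' fun j => forall_congr' fun h1 => by rw [mem_insert_of_ne_iff (by omega)]
      simp only [Set.mem_ofPred_eq, e1, e2, e3, forall_mem_insert_iff (Or.inl (by omega : 0 < 2))]
      refine and_congr_left fun h1 => and_congr_left fun h2 => ?_; constructor
      · intro h3; refine ⟨by rw [insert_subset_iff]; exact ⟨by simp, h3.1⟩, ?_⟩; grind
      · intro h3; exact ⟨(subset_insert _ _).trans h3.1, 0, by omega, h0⟩
    have hk : ∀ σ, σ ∈ {σ | σ ∈ {σ | σ ∈ simplicesT n ∧ 1 ∈ σ ∧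
        ¬ ∀ j, 2 ≤ j → j ≤ h → j ∈ σ} ∧
        ¬ ((n = h + 1 ∧ (∀ j, 2 ≤ j → j + 2 ≤ n → j ∈ σ) ∧ n ∈ σ) ∨
        (n < h ∧ ∀ j, 2 ≤ j → j ≤ n → j ∈ σ))} → 0 ∈ σ → 2 ∈ σ →
        evenQuot h (component (graphDTilde n) σ 0).card = 0 := by
      rintro σ ⟨⟨h1, h2, h3⟩, h4⟩ h0 h5; rw [evenQuot_eq_iff_of_even (by omega) Even.zero]; grind
    refine IsGood.of_forall_some 0 ?_ hins ?_
    · intro σ hσ; have hk' := hk σ hσ; obtain ⟨⟨h1, h2, h3⟩, h4⟩ := hσ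
      by_cases h0 : 0 ∈ σ
      · by_cases h5 : 2 ∈ σ
        · have hk' := hk' h0 h5; unfold pivotTEven
          by_cases h6 : 3 ∈ σ
          · simp only [e0, hk', h0, h2, h5, h6, not_true_eq_false, and_false, if_false, if_neg hn4,
              Even.zero, false_and, if_true, zero_mul]
            rw [if_neg (by omega), if_neg (by omega)]
          · have h7 : 3 ≤ h := by grind
            grind
        · unfold pivotTEven; grind
      · rw [hπ0 σ h2 h3 h0]; grind
    · intro σ hσ h0; have h1 := (hins σ h0).1 hσ
      refine gweight_graphDTilde_insert_zero hn (by omega) h1.1.1 h0 hσ.1.2.1 ?_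
      intro h2 b hb1 hb2 hb3; have h3 := hk _ h1 (mem_insert_self _ _) (mem_insert_of_mem h2)
      rw [hb3] at h3; have h4 := (evenQuot_eq_iff_of_even (by omega) Even.zero).1 h3
      rw [weightD_two_mul, h3, Nat.div_eq_of_lt (by omega)]

end TypeAffineShort

/-! ### Type `D̃_n`, `d = 2` -/

section TypeAffineTwo

variable {n d h q v l c a : ℕ} {σ s : Finset ℕ}

/-- `ha` says that the component of `v` begins at `a`. The missing vertex beyond `v` prevents it
from containing both `n - 1` and `n`, so it is a path. -/
lemma gweight_graphDTilde_insert_path (hn : 4 ≤ n) (hd : 2 ≤ d)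
    (hs : insert v s ⊆ range (n + 1)) (hv : v ∉ s) (ha1 : 1 ≤ a)
    (ha : (a = 1 ∧ 0 ∉ s) ∨ (3 ≤ a ∧ a - 1 ∉ s)) (hav : a ≤ v) (hvn : v + 1 ≤ n)
    (hlow : ∀ j, a ≤ j → j < v → j ∈ s) (hxx : ∃ x, v < x ∧ x ≤ n ∧ x ∉ s)
    (hz : ∀ b, v ≤ b → (b + 2 - a) / d = (v + 1 - a) / d + (b + 1 - v) / d) :
    gweight (graphDTilde n) d (insert v s) = gweight (graphDTilde n) d s := by
  have hle : ∀ x ∈ insert v s, x ≤ n := fun x hx => by have := mem_range.1 (hs hx); omega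
  have hpl : ∀ x, 1 ≤ x → x ≤ n → (x = n ∧ place n x = n - 1) ∨ (x < n ∧ place n x = x) := by
    intro x h1 h2; rcases place_cases n x with h | h | h <;> omega
  obtain ⟨b, hb1, hb2, hb3⟩ := exists_run_end ((insert v s).image (place n)) v
  simp only [mem_image] at hb2 hb3
  have hbn : b + 1 ≤ n := by
    rcases Nat.eq_or_lt_of_le hb1 with h | h
    · omega
    · obtain ⟨x, hx, hxb⟩ := hb2 b h le_rfl; have := hle x hx
      rcases place_cases n x with h | h | h <;> omega
  have hmid : ∀ j, v < j → j ≤ b → j + 2 ≤ n → j ∈ s := by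
    intro j hj1 hj2 hj3; obtain ⟨x, hx, hxj⟩ := hb2 j hj1 hj2
    have : x = j := by rcases place_cases n x with h | h | h <;> omega
    grind
  have hC : ∀ x, x ∈ (insert v s).filter (fun x => a ≤ x ∧ place n x ≤ b) ↔
      x ∈ insert v s ∧ a ≤ x ∧ place n x ≤ b := fun x => mem_filter
  have H : IsPath (graphDTilde n) ((insert v s).filter fun x => a ≤ x ∧ place n x ≤ b)
      (place n) a b := by
    refine ⟨⟨?_, ?_, ?_⟩, ?_⟩
    · intro x hx; obtain ⟨h1, h2, h3⟩ := (hC x).1 hx; have := hpl x (by omega) (hle x h1); omega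
    · intro j hj1 hj2; rcases lt_trichotomy j v with h | h | h
      · refine ⟨j, (hC j).2 ⟨mem_insert_of_mem (hlow j hj1 h), hj1, ?_⟩, ?_⟩ <;>
        have := hpl j (by omega) (by omega) <;> omega
      · refine ⟨v, (hC v).2 ⟨mem_insert_self _ _, hav, ?_⟩, ?_⟩ <;>
        have := hpl v (by omega) (by omega) <;> omega
      · obtain ⟨x, hx, hxj⟩ := hb2 j h hj2; refine ⟨x, (hC x).2 ⟨hx, ?_, by omega⟩, hxj⟩
        rcases place_cases n x with h | h | h <;> omega
    · intro x hx y hy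
      exact graphDTilde_adj_place hn (hle x ((hC x).1 hx).1) (hle y ((hC y).1 hy).1)
    · intro x hx y hy h; obtain ⟨h1, h2, h3⟩ := (hC x).1 hx; obtain ⟨h4, h5, h6⟩ := (hC y).1 hy
      by_contra hxy; have := hpl x (by omega) (hle x h1); have := hpl y (by omega) (hle y h4)
      have h7 : (n ∈ insert v s ∧ n - 1 ∈ insert v s) ∧ b + 1 = n := by grind
      obtain ⟨z, hz1, hz2, hz3⟩ := hxx; have h8 : z + 2 ≤ n ∨ z = n - 1 ∨ z = n := by omega
      rcases h8 with h8 | h8 | h8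
      · exact hz3 (hmid z hz1 (by omega) h8)
      · exact hz3 (h8 ▸ (mem_insert_of_ne_iff (by omega)).1 h7.1.2)
      · exact hz3 (h8 ▸ (mem_insert_of_ne_iff (by omega)).1 h7.1.1)
  have hpv := hpl v (by omega) (by omega)
  have hvC : v ∈ (insert v s).filter fun x => a ≤ x ∧ place n x ≤ b :=
    (hC v).2 ⟨mem_insert_self _ _, hav, by omega⟩
  refine gweight_insert_eq hv hvC (filter_subset _ _) ?_ ?_
  · intro x hx y hy hadj; obtain ⟨h1, h2, h3⟩ := (hC x).1 hx; rw [mem_sdiff, hC] at hy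
    obtain ⟨hy1, hy2⟩ := hy
    by_cases hya : a ≤ y
    · have h4 : b < place n y := by by_contra h4; exact hy2 ⟨hy1, hya, by omega⟩
      rw [graphDTilde_adj_place hn (hle x h1) (hle y hy1)] at hadj; exact hb3 ⟨y, hy1, by omega⟩
    · have h4 : y ∈ s := (mem_insert_of_ne_iff (by omega)).1 hy1; rw [graphDTilde_adj hn] at hadj
      rcases ha with ⟨ha, h5⟩ | ⟨ha, h5⟩
      · exact h5 (by rwa [show 0 = y by omega])
      · exact h5 (by rwa [show a - 1 = y by omega])
  · rw [H.gweight_eq hd (by omega), H.gweight_erase hd hvC (by omega)]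
    rw [show place n v = v by omega]; exact hz b hb1

/-- For `d = 2` the weight of `D_k` is the largest even number not exceeding `k`. -/
lemma evenQuot_one (k : ℕ) : evenQuot 1 k + k % 2 = k := by unfold evenQuot; grind

lemma gweight_graphD_Icc_two_mul_one {m : ℕ} (hm : 2 ≤ m) :
    gweight graphD (2 * 1) (Icc 1 m) = evenQuot 1 m := by
  rcases Nat.eq_or_lt_of_le hm with rfl | hm
  · rw [show Icc 1 2 = insert 1 {2} from rfl,
      gweight_insert_isolated (by omega) (by simp), gweight_singleton (by omega)]
    · rfl
    · intro x hx; rw [mem_singleton] at hx; rw [graphD_adj]; omega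
  · rw [gweight_graphD_Icc (by omega) hm, weightD_two_mul]

/-- For `d = 2` the defect is twice `|σ| - v(σ)`, which for these simplices is the residue of `n`
modulo 2. -/
lemma criticalT_one (hn : 5 ≤ n) (hc : n ≤ σ.card + 1)
    (hw : gweight (graphDTilde n) (2 * 1) σ + n % 2 = σ.card) : CriticalT 1 n σ := by
  refine Or.inl ⟨n % 2, n / 2, by omega, by omega, ?_, by omega⟩; rw [← hw]; unfold defect
  push_cast; ring

/-- The fibre on which `0, 1, 3 ∈ σ` and `2 ∉ σ`, for `d = 2`. -/
lemma isGood_pivotTEven_two_left (hn : 5 ≤ n) :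
    IsGood {σ | σ ∈ simplicesT n ∧ 0 ∈ σ ∧ 1 ∈ σ ∧ 3 ∈ σ ∧ 2 ∉ σ}
      (gweight (graphDTilde n) (2 * 1)) (pivotTEven (2 * 1) n) (CriticalT 1 n) := by
  have hπ : ∀ σ : Finset ℕ, 0 ∈ σ → 1 ∈ σ → 3 ∈ σ → 2 ∉ σ → pivotTEven (2 * 1) n σ =
      if ¬ Icc 5 n ⊆ σ then some 4 else none := by
    intro σ h0 h1 h3 h2; unfold pivotTEven
    rw [if_neg (by omega), if_neg (not_not.2 h1), if_pos, if_pos]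
    · simp [insert_subset_iff, h0, h1, h3]
    · refine ⟨by omega, fun h => h2 (h (by simp))⟩
  refine IsGood.split (fun σ => ∀ j, 5 ≤ j → j ≤ n → j ∈ σ)
    (fun σ _ τ _ hτσ h j h1 h2 => hτσ (h j h1 h2)) ?_ ?_
  · refine IsGood.of_forall_none ?_ ?_
    · grind
    · rintro σ ⟨⟨h1, h2, h3, h4, h5⟩, h6⟩
      have h7 : ∀ x ∈ σ, x ≤ n ∧ x ≠ 2 := fun x hx =>
        ⟨le_of_mem_simplicesT h1 hx, by rintro rfl; exact h5 hx⟩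
      -- `0` and `1` are isolated, each with size and weight one, so only the part `s` to the right
      -- of `2` matters.
      have hE : ∀ s ⊆ Icc 1 (n - 2), (∀ x, 3 ≤ x → x ≤ n → (x ∈ σ ↔ n + 1 - x ∈ s)) →
          gweight graphD (2 * 1) s + n % 2 = s.card → n ≤ s.card + 3 → CriticalT 1 n σ := by
        intro s hs h8 h9 h10; have hs' : s ⊆ Icc 1 n := hs.trans (Icc_subset_Icc le_rfl (by omega))
        have h11 : ∀ x ∈ s.image fun j => n + 1 - j, 3 ≤ x := by grind
        have h12 : σ = insert 0 (insert 1 (s.image fun j => n + 1 - j)) := by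
          ext x; rw [mem_insert, mem_insert, mem_image_reverse hs']; grind
        have h13 : 1 ∉ s.image fun j => n + 1 - j := fun h => by have := h11 1 h; omega
        have h14 : 0 ∉ insert 1 (s.image fun j => n + 1 - j) := fun h => by grind
        have h15 : ∀ x, 3 ≤ x → ¬ (graphDTilde n).Adj 1 x ∧ ¬ (graphDTilde n).Adj 0 x := by
          intro x hx; rw [graphDTilde_adj (by omega), graphDTilde_adj (by omega)]; omega
        have hc : σ.card = s.card + 2 := by
          rw [h12, card_insert_of_notMem h14, card_insert_of_notMem h13,
            card_image_reverse hs']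
        refine criticalT_one hn (by omega) ?_
        rw [hc, h12, gweight_insert_isolated (by omega) h14, gweight_insert_isolated (by omega) h13,
          gweight_graphDTilde_image (by omega) hs']
        · omega
        · exact fun x hx => (h15 x (h11 x hx)).1
        · intro x hx; rcases mem_insert.1 hx with rfl | hx
          · rw [graphDTilde_adj (by omega)]; omega
          · exact (h15 x (h11 x hx)).2
      by_cases h44 : 4 ∈ σ
      · refine hE (Icc 1 (n - 2)) subset_rfl ?_ ?_ ?_
        · grind
        · rw [gweight_graphD_Icc_two_mul_one (by omega), Nat.card_Icc]; have := evenQuot_one (n - 2)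
          omega
        · rw [Nat.card_Icc]; omega
      · have hmem : ∀ x, 3 ≤ x → x ≤ n → (x ∈ σ ↔ n + 1 - x ∈ (Icc 1 (n - 2)).erase (n - 3)) := by
          grind
        have hcard : ((Icc 1 (n - 2)).erase (n - 3)).card = n - 3 := by
          rw [card_erase_of_mem (mem_Icc.2 (by omega)), Nat.card_Icc]; omega
        refine hE _ (erase_subset _ _) hmem ?_ (by omega); rw [hcard]
        by_cases hn5 : n = 5
        · subst hn5; rw [gweight_graphD_Icc_erase_two (by omega) (by omega)]
        · have h8 : (Icc 1 (n - 2)).erase (n - 3) = insert (n - 2) (Icc 1 (n - 4)) := by grind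
          rw [h8, gweight_insert_isolated (by omega) (by rw [mem_Icc]; omega),
            gweight_graphD_Icc_two_mul_one (by omega)]
          · have := evenQuot_one (n - 4); omega
          · intro x hx; rw [mem_Icc] at hx; rw [graphD_adj]; omega
  · have hins : ∀ σ, 4 ∉ σ → (σ ∈ {σ | σ ∈ {σ | σ ∈ simplicesT n ∧ 0 ∈ σ ∧ 1 ∈ σ ∧ 3 ∈ σ ∧ 2 ∉ σ} ∧
        ¬ ∀ j, 5 ≤ j → j ≤ n → j ∈ σ} ↔ insert 4 σ ∈ {σ | σ ∈ {σ | σ ∈ simplicesT n ∧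
        0 ∈ σ ∧ 1 ∈ σ ∧ 3 ∈ σ ∧ 2 ∉ σ} ∧ ¬ ∀ j, 5 ≤ j → j ≤ n → j ∈ σ}) := by
      intro σ h4
      have e1 : (∀ j, 5 ≤ j → j ≤ n → j ∈ insert 4 σ) ↔ ∀ j, 5 ≤ j → j ≤ n → j ∈ σ :=
        forall_mem_insert_iff (by omega)
      have e2 : 0 ∈ insert 4 σ ↔ 0 ∈ σ := mem_insert_of_ne_iff (by omega)
      have e3 : 1 ∈ insert 4 σ ↔ 1 ∈ σ := mem_insert_of_ne_iff (by omega)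
      have e4 : 2 ∈ insert 4 σ ↔ 2 ∈ σ := mem_insert_of_ne_iff (by omega)
      have e5 : 3 ∈ insert 4 σ ↔ 3 ∈ σ := mem_insert_of_ne_iff (by omega)
      simp only [Set.mem_ofPred_eq, e1, e2, e3, e4, e5]
      refine and_congr_left fun _ => and_congr_left fun h2 => ?_; constructor
      · exact fun h3 => ⟨by rw [insert_subset_iff]; exact ⟨mem_range.2 (by omega),
          h3.1⟩, 2, by omega, by rw [mem_insert_of_ne_iff (by omega)]; exact h2.2.2.2⟩
      · exact fun h3 => ⟨(subset_insert _ _).trans h3.1, 4, by omega, h4⟩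
    refine IsGood.of_forall_some 4 ?_ hins ?_
    · grind
    · intro σ hσ h4; have h1 := (hins σ h4).1 hσ; obtain ⟨⟨h1', h2, h3, h6, h5⟩, h7⟩ := hσ
      push Not at h7
      obtain ⟨x, hx1, hx2, hx3⟩ := h7
      refine gweight_graphDTilde_insert_path (a := 3) (by omega) (by omega) h1.1.1.1 h4 (by omega)
        (Or.inr ⟨le_rfl, h5⟩) (by omega) (by omega)
        (fun j h8 h9 => by rwa [show j = 3 by omega]) ⟨x, by omega, hx2, hx3⟩ ?_
      intro b hb; omega

/-- The fibre on which `1 ∈ σ` and `{0, 3} ⊄ σ`, for `d = 2`. -/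
lemma isGood_pivotTEven_two_right (hn : 5 ≤ n) :
    IsGood {σ | σ ∈ simplicesT n ∧ 1 ∈ σ ∧ ¬ (0 ∈ σ ∧ 3 ∈ σ)}
      (gweight (graphDTilde n) (2 * 1)) (pivotTEven (2 * 1) n) (CriticalT 1 n) := by
  have hπ : ∀ σ : Finset ℕ, 1 ∈ σ → ¬ (0 ∈ σ ∧ 3 ∈ σ) → pivotTEven (2 * 1) n σ =
      if ¬ insert 1 (Icc 3 n) ⊆ σ then some 2 else none := by
    intro σ h1 h3; unfold pivotTEven; grind
  refine IsGood.split (fun σ => ∀ j, 3 ≤ j → j ≤ n → j ∈ σ)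
    (fun σ _ τ _ hτσ h j h1 h2 => hτσ (h j h1 h2)) ?_ ?_
  · refine IsGood.of_forall_none ?_ ?_
    · grind
    · rintro σ ⟨⟨h1, h2, h3⟩, h6⟩; have h0 : 0 ∉ σ := fun h => h3 ⟨h, h6 3 le_rfl (by omega)⟩
      have h7 : ∀ x ∈ σ, x ≤ n ∧ x ≠ 0 := fun x hx =>
        ⟨le_of_mem_simplicesT h1 hx, by rintro rfl; exact h0 hx⟩
      by_cases h8 : 2 ∈ σ
      · have hE : σ = (Icc 1 n).image fun j => n + 1 - j := by
          ext x; rw [mem_image_reverse subset_rfl, mem_Icc]; grind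
        have hc : σ.card = n := by
          rw [hE, card_image_reverse subset_rfl, Nat.card_Icc, Nat.add_sub_cancel]
        refine criticalT_one hn (by omega) ?_
        rw [hc, hE, gweight_graphDTilde_image (by omega) subset_rfl,
          gweight_graphD_Icc_two_mul_one (by omega)]
        exact evenQuot_one n
      · have hs' : Icc 1 (n - 2) ⊆ Icc 1 n := Icc_subset_Icc le_rfl (by omega)
        have hmem : ∀ x, x ∈ (Icc 1 (n - 2)).image (fun j => n + 1 - j) ↔ 3 ≤ x ∧ x ≤ n := by
          intro x; rw [mem_image_reverse hs', mem_Icc]; omega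
        have hE : σ = insert 1 ((Icc 1 (n - 2)).image fun j => n + 1 - j) := by grind
        have h13 : 1 ∉ (Icc 1 (n - 2)).image fun j => n + 1 - j := by rw [hmem]; omega
        have hc : σ.card = n - 1 := by
          rw [hE, card_insert_of_notMem h13, card_image_reverse hs', Nat.card_Icc]; omega
        refine criticalT_one hn (by omega) ?_
        rw [hc, hE, gweight_insert_isolated (by omega) h13, gweight_graphDTilde_image (by omega) hs',
          gweight_graphD_Icc_two_mul_one (by omega)]
        · have := evenQuot_one (n - 2); omega
        · intro x hx; rw [hmem] at hx; rw [graphDTilde_adj (by omega)]; omega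
  · have hins : ∀ σ, 2 ∉ σ → (σ ∈ {σ | σ ∈ {σ | σ ∈ simplicesT n ∧ 1 ∈ σ ∧ ¬ (0 ∈ σ ∧ 3 ∈ σ)} ∧
        ¬ ∀ j, 3 ≤ j → j ≤ n → j ∈ σ} ↔ insert 2 σ ∈ {σ | σ ∈ {σ | σ ∈ simplicesT n ∧
        1 ∈ σ ∧ ¬ (0 ∈ σ ∧ 3 ∈ σ)} ∧ ¬ ∀ j, 3 ≤ j → j ≤ n → j ∈ σ}) := by
      intro σ h4
      have e1 : (∀ j, 3 ≤ j → j ≤ n → j ∈ insert 2 σ) ↔ ∀ j, 3 ≤ j → j ≤ n → j ∈ σ :=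
        forall_mem_insert_iff (by omega)
      have e2 : 0 ∈ insert 2 σ ↔ 0 ∈ σ := mem_insert_of_ne_iff (by omega)
      have e3 : 1 ∈ insert 2 σ ↔ 1 ∈ σ := mem_insert_of_ne_iff (by omega)
      have e4 : 3 ∈ insert 2 σ ↔ 3 ∈ σ := mem_insert_of_ne_iff (by omega)
      simp only [Set.mem_ofPred_eq, e1, e2, e3, e4]
      refine and_congr_left fun h1 => and_congr_left fun h2 => ?_; constructor
      · intro h3; refine ⟨by rw [insert_subset_iff]; exact ⟨mem_range.2 (by omega), h3.1⟩, ?_⟩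
        grind
      · exact fun h3 => ⟨(subset_insert _ _).trans h3.1, 2, by omega, h4⟩
    refine IsGood.of_forall_some 2 ?_ hins ?_
    · grind
    · intro σ hσ h4; have h1 := (hins σ h4).1 hσ; obtain ⟨⟨h1', h2, h3⟩, h7⟩ := hσ
      push Not at h7
      obtain ⟨x, hx1, hx2, hx3⟩ := h7
      by_cases h0 : 0 ∈ σ
      · have h33 : 3 ∉ σ := fun h => h3 ⟨h0, h⟩
        have hmem : ∀ x, x ∈ ({0, 1, 2} : Finset ℕ) ↔ x ≤ 2 := fun x => by
          simp only [mem_insert, mem_singleton]; omega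
        have H : IsPath (graphDTilde n) {0, 1, 2}
            (fun x => if x = 0 then 1 else if x = 1 then 3 else 2) 1 3 := by
          refine ⟨⟨?_, ?_, ?_⟩, ?_⟩
          · intro x hx; split_ifs <;> omega
          · intro j hj1 hj2; obtain rfl | rfl | rfl : j = 1 ∨ j = 2 ∨ j = 3 := by omega
            · exact ⟨0, by simp⟩
            · exact ⟨2, by simp⟩
            · exact ⟨1, by simp⟩
          · intro x hx y hy; rw [hmem] at hx hy; rw [graphDTilde_adj (by omega)]
            interval_cases x <;> interval_cases y <;> simp <;> omega
          · grind
        refine gweight_insert_eq h4 ((hmem 2).2 le_rfl) ?_ ?_ ?_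
        · grind
        · intro x hx y hy hadj; rw [hmem] at hx; rw [mem_sdiff, hmem] at hy
          rw [graphDTilde_adj (by omega)] at hadj; grind
        · rw [H.gweight_eq (by omega) (by omega), H.gweight_erase (by omega) ((hmem 2).2 le_rfl)
            (by simp)]
          rfl
      · refine gweight_graphDTilde_insert_path (a := 1) (by omega) (by omega) h1.1.1.1 h4 (by omega)
          (Or.inl ⟨rfl, h0⟩) (by omega) (by omega)
          (fun j h8 h9 => by rwa [show j = 1 by omega]) ⟨x, by omega, hx2, hx3⟩ ?_
        intro b hb; omega

end TypeAffineTwo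

/-! ### Type `D̃_4` for `d ≤ 6`, and the assembly for `d` even -/

section TypeAffineFour

variable {n d h v c : ℕ} {σ s : Finset ℕ}

theorem IsGood.of_toggle_insert {K : Set (Finset ℕ)} {w : Finset ℕ → ℕ} {π : Finset ℕ → Option ℕ}
    {L : Finset ℕ → Prop} (v : ℕ) (hπ : ∀ σ ∈ K, π σ = some v ∨ (π σ = none ∧ L σ))
    (hK : ∀ σ, v ∉ σ → ((σ ∈ K ∧ π σ = some v) ↔ (insert v σ ∈ K ∧ π (insert v σ) = some v)))
    (hw : ∀ σ ∈ K, π σ = some v → v ∉ σ → w (insert v σ) = w σ) : IsGood K w π L := by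
  refine IsGood.of_toggle v hπ fun σ hσ h => ?_
  by_cases hv : v ∈ σ
  · have h1 : v ∉ σ.erase v := notMem_erase v σ; have h2 := insert_erase hv
    have h3 := (hK _ h1).2 (by rw [h2]; exact ⟨hσ, h⟩); have h4 := hw _ h3.1 h3.2 h1; rw [h2] at h4
    rw [toggle_of_mem hv]; exact ⟨h3.1, h3.2, h4.symm⟩
  · rw [toggle_of_notMem hv]; grind

lemma mem_simplicesT_four : σ ∈ simplicesT 4 ↔ σ ⊆ range 5 ∧ σ.card ≤ 4 := by
  constructor
  · rintro ⟨h1, x, h2, h3⟩; refine ⟨h1, ?_⟩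
    have h4 : σ ⊆ (range 5).erase x := fun y hy => mem_erase.2 ⟨by rintro rfl; exact h3 hy, h1 hy⟩
    have h5 := card_le_card h4; grind
  · rintro ⟨h1, h2⟩; refine ⟨h1, ?_⟩; by_contra h3
    push Not at h3
    have h4 : range 5 ⊆ σ := fun x hx => h3 x (by have := mem_range.1 hx; omega); grind

lemma graphDTilde_four_adj {x y : ℕ} (hx : x ≤ 4) (hy : y ≤ 4) :
    (graphDTilde 4).Adj x y ↔ (x = 2 ∧ y ≠ 2) ∨ (y = 2 ∧ x ≠ 2) := by
  rw [graphDTilde_adj le_rfl]; omega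

lemma gweight_graphDTilde_four_of_notMem (hd : 2 ≤ d) (hσ : σ ⊆ range 5) (h2 : 2 ∉ σ) :
    gweight (graphDTilde 4) d σ = σ.card * (2 / d) := by
  induction σ using Finset.induction_on with
  | empty => rw [gweight_empty, card_empty, zero_mul]
  | insert a s ha ih =>
    have h1 : ∀ x ∈ insert a s, x ≤ 4 ∧ x ≠ 2 := fun x hx =>
      ⟨by have := mem_range.1 (hσ hx); omega, by rintro rfl; exact h2 hx⟩
    rw [gweight_insert_isolated hd ha, ih ((subset_insert _ _).trans hσ)
      (fun h => h2 (mem_insert_of_mem h)), card_insert_of_notMem ha]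
    · ring
    · intro x hx; have h3 := h1 a (mem_insert_self _ _); have h4 := h1 x (mem_insert_of_mem hx)
      rw [graphDTilde_four_adj h3.1 h4.1]; omega

open Classical in
-- `D̃_4` is a star with centre `2`: a set containing `2` is connected, and a proper one has three
-- leaves exactly when its size is four.
lemma gweight_graphDTilde_four_of_mem (hd : 2 ≤ d) (hσ : σ ∈ simplicesT 4) (h2 : 2 ∈ σ) :
    gweight (graphDTilde 4) d σ = if σ.card = 4 then weightD d 4 else (σ.card + 1) / d := by
  have hle : ∀ x ∈ σ, x ≤ 4 := fun x hx => le_of_mem_simplicesT hσ hx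
  have hcard := (mem_simplicesT_four.1 hσ).2
  have hpre : PreConn (graphDTilde 4) σ := by
    have h3 : ∀ x ∈ σ, x ∈ component (graphDTilde 4) σ 2 := by
      intro x hx
      by_cases hx2 : x = 2
      · rw [hx2]; exact self_mem_component h2
      · rw [mem_component_iff]; refine ⟨h2, Relation.ReflTransGen.single ⟨h2, hx, ?_⟩⟩
        rw [graphDTilde_four_adj (by omega) (hle x hx)]; omega
    exact fun x hx y hy => mem_component_trans (mem_component_symm (h3 x hx)) (h3 y hy)
  rw [gweight_of_preConn hd hpre]; unfold compWeight
  have h4 : (σ.filter ((graphDTilde 4).Adj 2)) = σ.erase 2 := by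
    ext x; rw [mem_filter, mem_erase]; constructor
    · rintro ⟨h5, h6⟩; rw [graphDTilde_four_adj (by omega) (hle x h5)] at h6; exact ⟨by omega, h5⟩
    · rintro ⟨h5, h6⟩; exact ⟨h6, by rw [graphDTilde_four_adj (by omega) (hle x h6)]; omega⟩
  have h5 : (∃ x ∈ σ, 3 ≤ (σ.filter ((graphDTilde 4).Adj x)).card) ↔ σ.card = 4 := by
    constructor
    · rintro ⟨x, hx, h6⟩
      have h7 : (σ.filter ((graphDTilde 4).Adj x)) ⊆ σ.erase x := fun y hy => by
        rw [mem_filter] at hy; exact mem_erase.2 ⟨hy.2.ne', hy.1⟩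
      have h8 := card_le_card h7; rw [card_erase_of_mem hx] at h8; omega
    · grind
  simp only [h5]; split_ifs with h6
  · rw [h6]
  · rfl

lemma isGood_pivotTFour_two :
    IsGood (simplicesT 4) (gweight (graphDTilde 4) (2 * 1)) (pivotTFour (2 * 1))
      (CriticalT 1 4) := by
  have hπ : ∀ σ, pivotTFour (2 * 1) σ =
      if (σ.card = 1 ∧ 2 ∉ σ) ∨ σ.card = 2 ∨ (σ.card = 3 ∧ 2 ∈ σ) then some 2 else none :=
    fun σ => by unfold pivotTFour; rw [if_pos (by omega)]
  refine IsGood.of_toggle_insert 2 ?_ ?_ ?_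
  · intro σ hσ; rw [hπ]; split_ifs with h1
    · exact Or.inl rfl
    · refine Or.inr ⟨rfl, Or.inl ⟨0, 2, by omega, by omega, ?_, by omega⟩⟩
      have hc := (mem_simplicesT_four.1 hσ)
      have hw : gweight (graphDTilde 4) (2 * 1) σ = σ.card := by
        by_cases h2 : 2 ∈ σ
        · have : σ.card ≠ 0 := card_ne_zero_of_mem h2
          rw [gweight_graphDTilde_four_of_mem (by omega) hσ h2]
          have h3 : σ.card = 1 ∨ σ.card = 4 := by grind
          rcases h3 with h3 | h3 <;> rw [h3] <;> rfl
        · rw [gweight_graphDTilde_four_of_notMem (by omega) hc.1 h2]; omega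
      rw [hw]; unfold defect; norm_num
  · intro σ h2
    rw [hπ, hπ, card_insert_of_notMem h2, mem_simplicesT_four, mem_simplicesT_four,
      card_insert_of_notMem h2, insert_subset_iff]
    grind
  · intro σ hσ h1 h2; rw [hπ] at h1; split_ifs at h1 with h3
    have h4 : σ.card = 1 ∨ σ.card = 2 := by simpa [h2] using h3
    have hσ' := mem_simplicesT_four.1 hσ
    have h5 : insert 2 σ ∈ simplicesT 4 := by
      rw [mem_simplicesT_four, card_insert_of_notMem h2, insert_subset_iff]
      exact ⟨⟨by simp, hσ'.1⟩, by omega⟩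
    rw [gweight_graphDTilde_four_of_notMem (by omega) hσ'.1 h2,
      gweight_graphDTilde_four_of_mem (by omega) h5 (mem_insert_self _ _),
      card_insert_of_notMem h2]
    rcases h4 with h4 | h4 <;> rw [h4] <;> rfl

lemma gweight_graphDTilde_four_insert_zero (hd : 4 ≤ d) (hσ : σ ∈ simplicesT 4) (h0 : 0 ∉ σ)
    (h2 : 2 ∈ σ → σ.card + 2 < d ∧ σ.card + 1 < 4) :
    gweight (graphDTilde 4) d (insert 0 σ) = gweight (graphDTilde 4) d σ := by
  have hσ' := mem_simplicesT_four.1 hσ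
  have h5 : insert 0 σ ⊆ range 5 := by rw [insert_subset_iff]; exact ⟨by simp, hσ'.1⟩
  by_cases h : 2 ∈ σ
  · obtain ⟨h3, h4⟩ := h2 h
    have h6 : insert 0 σ ∈ simplicesT 4 := by
      rw [mem_simplicesT_four, card_insert_of_notMem h0]; exact ⟨h5, by omega⟩
    rw [gweight_graphDTilde_four_of_mem (by omega) h6 (mem_insert_of_mem h),
      gweight_graphDTilde_four_of_mem (by omega) hσ h, card_insert_of_notMem h0,
      if_neg (by omega), if_neg (by omega), Nat.div_eq_of_lt (by omega), Nat.div_eq_of_lt (by omega)]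
  · rw [gweight_graphDTilde_four_of_notMem (by omega) h5
      (by rwa [mem_insert_of_ne_iff (by omega)]),
      gweight_graphDTilde_four_of_notMem (by omega) hσ'.1 h, Nat.div_eq_of_lt (by omega), mul_zero,
      mul_zero]

lemma isGood_pivotTFour_four :
    IsGood (simplicesT 4) (gweight (graphDTilde 4) (2 * 2)) (pivotTFour (2 * 2))
      (CriticalT 2 4) := by
  have hleaf : ∀ σ : Finset ℕ, σ ∩ {1, 3, 4} = ∅ ↔ 1 ∉ σ ∧ 3 ∉ σ ∧ 4 ∉ σ := by
    intro σ; rw [← disjoint_iff_inter_eq_empty]; simp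
  have hπ : ∀ σ, pivotTFour (2 * 2) σ =
      if 2 ∉ σ ∨ (1 ∉ σ ∧ 3 ∉ σ ∧ 4 ∉ σ) then some 0 else none :=
    fun σ => by unfold pivotTFour; rw [if_neg (by omega), if_pos (by omega)]; simp only [hleaf]
  refine IsGood.of_toggle_insert 0 ?_ ?_ ?_
  · intro σ hσ; rw [hπ]; split_ifs with h1
    · exact Or.inl rfl
    · push Not at h1
      obtain ⟨h2, h3⟩ := h1; refine Or.inr ⟨rfl, Or.inl ⟨0, 1, by omega, by omega, ?_, by omega⟩⟩
      have hc := (mem_simplicesT_four.1 hσ)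
      have h4 : 2 ≤ σ.card := by
        by_contra h4; have h5 := card_le_one.1 (by omega : σ.card ≤ 1); grind
      have h5 : σ.card = 2 ∨ σ.card = 3 ∨ σ.card = 4 := by omega
      rw [gweight_graphDTilde_four_of_mem (by omega) hσ h2]
      rcases h5 with h5 | h5 | h5 <;> rw [h5] <;> unfold defect <;> norm_num; rfl
  · intro σ h0; have e1 : 2 ∈ insert 0 σ ↔ 2 ∈ σ := mem_insert_of_ne_iff (by omega)
    have e2 : 1 ∈ insert 0 σ ↔ 1 ∈ σ := mem_insert_of_ne_iff (by omega)
    have e3 : 3 ∈ insert 0 σ ↔ 3 ∈ σ := mem_insert_of_ne_iff (by omega)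
    have e4 : 4 ∈ insert 0 σ ↔ 4 ∈ σ := mem_insert_of_ne_iff (by omega); rw [hπ, hπ]
    simp only [e1, e2, e3, e4]; constructor
    · rintro ⟨h3, h4⟩; refine ⟨⟨by rw [insert_subset_iff]; exact ⟨by simp, h3.1⟩, ?_⟩, h4⟩; grind
    · rintro ⟨h3, h4⟩; exact ⟨⟨(subset_insert _ _).trans h3.1, 0, by omega, h0⟩, h4⟩
  · intro σ hσ h1 h0; rw [hπ] at h1; split_ifs at h1 with h3
    refine gweight_graphDTilde_four_insert_zero le_rfl hσ h0 fun h2 => ?_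
    obtain ⟨h4, h5, h6⟩ := h3.resolve_left (not_not.2 h2)
    have h7 : σ ⊆ {2} := by intro x hx; have h8 := le_of_mem_simplicesT hσ hx; grind
    have h8 := card_le_card h7; rw [card_singleton] at h8; omega

lemma isGood_pivotTFour_six :
    IsGood (simplicesT 4) (gweight (graphDTilde 4) (2 * 3)) (pivotTFour (2 * 3))
      (CriticalT 3 4) := by
  have hπ : ∀ σ, pivotTFour (2 * 3) σ =
      if (2 ∈ σ ∧ 0 ∉ σ ∧ 3 ≤ σ.card) ∨ ((0 ∈ σ ∧ 2 ∈ σ) ∧ σ.card = 4) then none else some 0 :=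
    fun σ => by unfold pivotTFour; grind
  refine IsGood.of_toggle_insert 0 ?_ ?_ ?_
  · intro σ hσ; rw [hπ]; split_ifs with h1
    · have h2 : 2 ∈ σ := by tauto
      have hc := (mem_simplicesT_four.1 hσ)
      have h3 : σ.card = 3 ∨ σ.card = 4 := by rcases h1 with h1 | h1 <;> omega
      refine Or.inr ⟨rfl, Or.inr (Or.inl ⟨1, 0, by omega, by omega, by omega, ?_⟩)⟩
      rw [gweight_graphDTilde_four_of_mem (by omega) hσ h2]
      have h4 : weightD (2 * 3) 4 = 1 := by rw [weightD_two_mul]; rfl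
      rcases h3 with h3 | h3 <;> rw [h3] <;> unfold defect
      · norm_num
      · rw [if_pos rfl, h4]; norm_num
    · exact Or.inl rfl
  · intro σ h0; have e1 : 2 ∈ insert 0 σ ↔ 2 ∈ σ := mem_insert_of_ne_iff (by omega)
    rw [hπ, hπ, mem_simplicesT_four, mem_simplicesT_four, card_insert_of_notMem h0,
      insert_subset_iff]
    simp only [e1, h0, mem_insert_self, mem_range, not_true_eq_false,
      not_false_eq_true, true_and, false_and, and_false, false_or, or_false]
    constructor
    · rintro ⟨h3, h4⟩; split_ifs at h4 with h5
      by_cases h2 : 2 ∈ σ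
      · grind
      · refine ⟨⟨⟨by omega, h3.1⟩, ?_⟩, if_neg fun h => h2 h.1⟩
        have h7 : σ ⊆ (((range 5).erase 0).erase 2) := fun x hx =>
          mem_erase.2 ⟨by rintro rfl; exact h2 hx, mem_erase.2
            ⟨by rintro rfl; exact h0 hx, h3.1 hx⟩⟩
        have h8 := card_le_card h7; grind
    · grind
  · intro σ hσ h1 h0; rw [hπ] at h1; split_ifs at h1 with h3
    refine gweight_graphDTilde_four_insert_zero (by omega) hσ h0 fun h2 => ?_; grind

/-- As in type `D`, the tests are regrouped into upward closed ones: outside the small cases and for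
`d ≥ 4`, first `1 ∈ σ`, then `{2, …, h} ⊆ σ`, then `0 ∈ σ`. -/
theorem isGood_pivotTEven (hn : 4 ≤ n) (hh : 0 < h) :
    IsGood (simplicesT n) (gweight (graphDTilde n) (2 * h)) (pivotTEven (2 * h) n)
      (CriticalT h n) := by
  by_cases hn4 : n = 4 ∧ 2 * h ≤ 6
  · obtain ⟨rfl, h1⟩ := hn4
    have h2 : pivotTEven (2 * h) 4 = pivotTFour (2 * h) := by
      funext σ; unfold pivotTEven; rw [if_pos ⟨rfl, h1⟩]
    rw [h2]; obtain rfl | rfl | rfl : h = 1 ∨ h = 2 ∨ h = 3 := by omega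
    · exact isGood_pivotTFour_two
    · exact isGood_pivotTFour_four
    · exact isGood_pivotTFour_six
  refine IsGood.split (fun σ => 1 ∈ σ) (fun σ _ τ _ hτσ h => hτσ h) ?_
    (isGood_pivotTEven_one_notMem hn hn4 hh)
  rcases Nat.eq_or_lt_of_le (show 1 ≤ h from hh) with rfl | hh2
  · refine IsGood.split (fun σ => 0 ∈ σ ∧ 3 ∈ σ) (fun σ _ τ _ hτσ h => ⟨hτσ h.1, hτσ h.2⟩) ?_ ?_
    · refine IsGood.split (fun σ => 2 ∈ σ) (fun σ _ τ _ hτσ h => hτσ h) ?_ ?_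
      · convert isGood_pivotTEven_connected (c := 3) hn hn4 hh (by simp) using 2; ext σ; constructor
        · grind
        · grind
      · convert isGood_pivotTEven_two_left (n := n) (by omega) using 2; ext σ
        simp only [Set.mem_ofPred_eq]; tauto
    · convert isGood_pivotTEven_two_right (n := n) (by omega) using 2; ext σ
      simp only [Set.mem_ofPred_eq]; tauto
  refine IsGood.split (fun σ => ∀ j, 2 ≤ j → j ≤ h → j ∈ σ)
    (fun σ _ τ _ hτσ h j h1 h2 => hτσ (h j h1 h2)) ?_ ?_
  · refine IsGood.split (fun σ => 0 ∈ σ) (fun σ _ τ _ hτσ h => hτσ h) ?_ ?_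
    · convert isGood_pivotTEven_connected (c := h) hn hn4 hh (by rw [if_neg (by omega)]) using 2
      grind
    · convert isGood_pivotTEven_zero_notMem hn hn4 hh2 using 2; grind
  · convert isGood_pivotTEven_run_short hn hn4 hh2 using 2; ext σ
    simp only [Set.mem_ofPred_eq, and_assoc]

end TypeAffineFour

/-! ### The matching for `d` odd, and the number of its critical simplices -/

section Odd

variable {d n m f : ℕ} {s σ : Finset ℕ}

lemma weightD_of_odd (hd : Odd d) (b : ℕ) : weightD d b = b / d :=
  if_neg (Nat.not_even_iff_odd.2 hd)

/-- For `d` odd, `D_k` and `A_{k-1}` have the same weight `⌊k/d⌋`, so a twin end does not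
contribute. Since the symmetry exchanging `1` and `2` preserves weights, it is enough to know this
for the vertex `1`. -/
lemma gweight_graphD_insert_two (hd : 3 ≤ d) (ho : Odd d) (h0 : 0 ∉ s) (h1 : 1 ∈ s) (h2 : 2 ∉ s) :
    gweight graphD d (insert 2 s) = gweight graphD d s := by
  have h3 : ∀ x ∈ s.erase 1, 3 ≤ x := fun x hx => by grind
  have h4 : insert 2 (s.erase 1) ⊆ Icc 2 (s.sup id + 2) := by
    intro x hx; rw [mem_insert] at hx; rw [mem_Icc]; rcases hx with rfl | hx
    · omega
    · have := le_sup (f := id) (mem_of_mem_erase hx); have := h3 x hx; simp only [id] at *; omega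
  have h5 : insert 1 (insert 2 (s.erase 1)) = insert 2 s := by rw [insert_comm, insert_erase h1]
  rw [← h5, gweight_graphD_insert_one hd h4 (mem_insert_self _ _) (c := s.sup id + 3)
    (fun h => by have := mem_Icc.1 (h4 h); omega) (by omega) fun b _ _ => weightD_of_odd ho b]
  have h6 : s = (insert 2 (s.erase 1)).image fun j => if j = 2 then 1 else j := by
    rw [image_insert, if_pos rfl, image_congr (g := id), image_id, insert_erase h1]; intro x hx
    have := h3 x hx; exact if_neg (by omega)
  conv_rhs => rw [h6]
  have h7 : ∀ x ∈ insert 2 (s.erase 1), 2 ≤ x := fun x hx => (mem_Icc.1 (h4 hx)).1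
  refine (gweight_image ?_ ?_).symm
  · intro x hx y hy h; grind
  · intro x hx y hy; have := h7 x hx; have := h7 y hy; rw [graphD_adj, graphD_adj]
    split_ifs <;> omega

/-- What is known about the size and the weight of the critical simplices that are not
`{1, …, n}`. -/
def CriticalOdd (d n card w : ℕ) : Prop :=
  w ≤ 1 ∧ ((∃ t, n = t * d ∧ (card : ℤ) = w + n - 2 * t) ∨
    ∃ t, n = 1 + t * d ∧ (card : ℤ) = w + n - 1 - 2 * t)

/-- For `d` odd, the simplices of type `D_n` form an acyclic matching. -/
theorem isGood_pivotDOdd (hd : 3 ≤ d) (ho : Odd d) (hn : 2 ≤ n) :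
    IsGood (simplicesA n 0 0) (gweight graphD d) (pivotDOdd d n)
      fun σ => CriticalOdd d n σ.card (gweight graphD d σ) := by
  refine IsGood.split (fun σ => 1 ∈ σ) (fun σ _ τ _ h h1 => h h1) ?_ ?_
  · refine IsGood.of_forall_some 2 ?_ ?_ ?_
    · exact fun σ hσ => if_pos hσ.2
    · intro σ hv
      have := simplicesA_insert (m := n) (f := 0) (g := 0) (v := 2) (σ := σ) (by omega) (by omega)
      grind
    · exact fun σ hσ hv =>
        gweight_graphD_insert_two hd ho (zero_notMem_of_mem_simplicesA hσ.1) hσ.2 hv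
  · have H := IsGood.shift (π := pivotDOdd d n) 
      (L := fun σ => CriticalOdd d n σ.card (gweight graphD d σ)) (g := 0) (m := n)
      (by omega) (isGood_pivotA (d := d) (m := n - 1) (f := 0) (g := 0) (by omega) (by omega)
      (by omega) (by omega) (by omega)) (fun σ _ h1 => if_neg h1) ?_
    · grind
    · intro s H hc hw; rw [hc, hw]
      rcases H with ⟨h1, -⟩ | ⟨-, h1, ⟨i, t, h2, h3, -, -, h4⟩ | ⟨i, t, h2, -, h3, -, h4⟩⟩
      · omega
      -- With `f = g = 0` only `i = 0` survives in both families of `CriticalA`.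
      · obtain rfl : i = 0 := by omega
        refine ⟨h1, Or.inl ⟨t, by omega, ?_⟩⟩
        have h5 : (n : ℤ) = t * d := by rw [← Nat.cast_mul]; omega
        rw [defect, show ((n - 1 : ℕ) : ℤ) = t * d - 1 by omega] at h4
        have : (d : ℤ) * (s.card - (gweight graphA d s + n - 2 * t)) = 0 := by
          rw [h5]; push_cast at h4; linarith
        rw [mul_eq_zero] at this; omega
      · obtain rfl : i = 0 := by omega
        refine ⟨h1, Or.inr ⟨t, by omega, ?_⟩⟩
        have h5 : (n : ℤ) = 1 + t * d := by rw [← Nat.cast_mul]; omega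
        rw [defect, show ((n - 1 : ℕ) : ℤ) = t * d by omega] at h4
        have : (d : ℤ) * (s.card - (gweight graphA d s + n - 1 - 2 * t)) = 0 := by
          rw [h5]; push_cast at h4; linarith
        rw [mul_eq_zero] at this; omega

lemma mem_simplicesT_insert_zero_iff (h0 : 0 ∉ σ) (h : σ ≠ Icc 1 n) :
    σ ∈ simplicesT n ↔ insert 0 σ ∈ simplicesT n := by
  constructor
  · intro hσ
    obtain ⟨x, hx, hx'⟩ : ∃ x ∈ Icc 1 n, x ∉ σ := by
      by_contra h1
      push Not at h1
      refine h (Subset.antisymm (fun y hy => mem_Icc.2 ⟨?_, le_of_mem_simplicesT hσ hy⟩) h1); grind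
    rw [mem_Icc] at hx; refine ⟨insert_subset_iff.2 ⟨mem_range.2 (by omega), hσ.1⟩, x, hx.2, ?_⟩
    rwa [mem_insert_of_ne_iff (by omega)]
  · exact fun hσ => ⟨(subset_insert _ _).trans hσ.1, 0, by omega, h0⟩

/-- For `d` odd, the simplices of type `D̃_n` form an acyclic matching. -/
theorem isGood_pivotTOdd (hd : 3 ≤ d) (ho : Odd d) (hn : 4 ≤ n) :
    IsGood (simplicesT n) (gweight (graphDTilde n) d) (pivotTOdd d n) fun σ =>
      σ = Icc 1 n ∨ 1 ∉ σ ∧ CriticalOdd d n σ.card (gweight (graphDTilde n) d σ) := by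
  refine IsGood.split (fun σ => 1 ∈ σ) (fun σ _ τ _ h h1 => h h1) ?_ ?_
  -- Beside `1`, the twin `0` never affects the weight. The only simplex without a partner is `{1,
  -- …, n}`, since adding `0` would give all vertices.
  · have hE : ∀ σ : Finset ℕ, 0 ∈ σ → σ ≠ Icc 1 n := by rintro σ h0 rfl; simp at h0
    refine IsGood.of_toggle_insert 0 ?_ ?_ ?_
    · rintro σ ⟨-, h1⟩; unfold pivotTOdd; grind
    · intro σ h0; unfold pivotTOdd
      simp only [Set.mem_ofPred_eq, mem_insert_of_ne_iff one_ne_zero, hE _ (mem_insert_self 0 σ),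
        if_false]
      by_cases h1 : 1 ∈ σ
      swap
      · simp [h1]
      by_cases h2 : σ = Icc 1 n
      · subst h2; simp only [if_true, reduceCtorEq, and_false, false_iff]
        rintro ⟨⟨⟨-, x, hx, hx'⟩, -⟩, -⟩; rw [mem_insert, mem_Icc] at hx'; omega
      · simp only [h1, h2, not_true, if_false, and_true]; exact mem_simplicesT_insert_zero_iff h0 h2
    · rintro σ ⟨hσ, h1⟩ h2 h0
      refine gweight_graphDTilde_insert_zero hn hd ((mem_simplicesT_insert_zero_iff h0 ?_).1 hσ)
        h0 h1 fun _ b _ _ _ => weightD_of_odd ho _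
      rintro rfl; simp [pivotTOdd] at h2
  · refine IsGood.fold hn (isGood_pivotDOdd hd ho (by omega)) ?_ ?_
    · intro σ _ h1; unfold pivotTOdd; grind
    · intro s hs H
      rw [gweight_graphDTilde_fold hn hs, card_image_of_injOn ((injOn_fold n).mono hs)]; grind

/-- Starting from `f = 0` the recursion alternates between `f = 0` and `f = d - 2`; the shift `c`
keeps track of which it is, so that `(m + c) % d` is invariant. Critical simplices arise only at the
end, as the pair of case (d) for `m + 1 = d`. -/
lemma ncard_critical_pivotA (hd : 3 ≤ d) {c : ℕ} (hf : f = 0 ∧ c = 1 ∨ f + 2 = d ∧ c = 2)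
    (hfm : f < m) : {σ | σ ∈ simplicesA m f 0 ∧ pivotA d m f 0 σ = none}.ncard =
      if (m + c) % d ≤ 1 then 2 else 0 := by
  induction m using Nat.strong_induction_on generalizing f c with
  | _ m ih =>
  rcases Nat.lt_or_ge m d with hmd | hmd
  · have hπ : ∀ σ, pivotA d m f 0 σ = if (m + 1) % d ≤ f ∧
        (σ = Icc 1 m ∨ σ = Icc 1 f ∪ Icc (f + 2) m) then none else some (f + 1) := by
      intro σ
      rw [pivotA, dif_neg (by omega), dif_neg (by omega), if_neg (by omega), if_neg (by omega)]
    by_cases h1 : m + 1 = d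
    · have h2 : (m + c) % d ≤ 1 := by
        rcases hf with ⟨-, rfl⟩ | ⟨-, rfl⟩
        · rw [h1, Nat.mod_self]; omega
        · rw [show m + 2 = 1 + d by omega, Nat.add_mod_right]; exact Nat.mod_le _ _
      rw [if_pos h2]; rw [h1, Nat.mod_self] at hπ; simp only [Nat.zero_le, true_and] at hπ
      have h3 : {σ | σ ∈ simplicesA m f 0 ∧ pivotA d m f 0 σ = none} =
          {Icc 1 m, Icc 1 f ∪ Icc (f + 2) m} := by
        ext σ; rw [Set.mem_ofPred_eq, hπ, Set.mem_insert_iff, Set.mem_singleton_iff]; constructor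
        · grind
        · refine fun h4 => ⟨?_, if_pos h4⟩; rcases h4 with rfl | rfl
          · exact ⟨subset_rfl, fun j h4 h5 => mem_Icc.2 ⟨h4, by omega⟩, by omega⟩
          · refine ⟨fun x hx => ?_, fun j h4 h5 => mem_union_left _ (mem_Icc.2 ⟨h4, h5⟩), by omega⟩
            grind
      rw [h3, Set.ncard_pair]; intro h4; have : f + 1 ∈ Icc 1 m := mem_Icc.2 (by omega)
      rw [h4, mem_union, mem_Icc, mem_Icc] at this; omega
    · rw [show {σ | σ ∈ simplicesA m f 0 ∧ pivotA d m f 0 σ = none} = ∅ from ?_, Set.ncard_empty,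
        if_neg]
      · rw [Nat.mod_eq_of_lt (by omega)]; omega
      · rw [Set.eq_empty_iff_forall_notMem]; rintro σ ⟨-, h2⟩
        rw [hπ, Nat.mod_eq_of_lt (by omega), if_neg (by omega)] at h2; simp at h2
  · have hπ : ∀ σ, pivotA d m f 0 σ = if Icc 1 (d - 1) ⊆ σ then some d
        else if f + 1 ∈ σ then some (f + 1)
        else if ¬ Icc (f + 2) (d - 1) ⊆ σ then some (f + 1)
        else relabel (m - f - 1) (fun j => j + f + 1) (pivotA d (m - f - 1) (d - 2 - f) 0) σ := by
      intro σ
      rw [pivotA, dif_neg (by omega), dif_neg (by omega), if_neg (by omega), if_pos (by omega)]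
    simp only [Icc_subset_iff] at hπ
    have h1 := ncard_critical_relabel (π := pivotA d m f 0) (O := Icc 1 f) (m := m - f - 1)
      (ρ := fun j => j + f + 1) (K' := simplicesA (m - f - 1) (d - 2 - f) 0)
      (K := {σ | (σ ∈ simplicesA m f 0 ∧ ¬ ∀ j, 1 ≤ j → j ≤ d - 1 → j ∈ σ) ∧
        ∀ j, f + 2 ≤ j → j ≤ d - 1 → j ∈ σ}) (π' := pivotA d (m - f - 1) (d - 2 - f) 0)
      (fun x _ y _ h => by simpa using h)
      (fun j _ h => by rw [mem_Icc] at h; omega) (fun σ' hσ' => hσ'.1) (fun σ hσ => by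
        rw [hπ, if_neg hσ.1.2, if_neg (succ_notMem_of_mem_simplicesA hσ.1.1 hσ.1.2 hσ.2),
          if_neg (not_not.2 hσ.2)]) fun σ => mem_simplicesA_gap_iff (by omega) (by omega)
    rw [ih (m - f - 1) (by omega) (f := d - 2 - f) (c := 3 - c) (by omega) (by omega)] at h1
    rw [show (m + c) % d = (m - f - 1 + (3 - c)) % d from ?_, ← h1]
    · congr 1; ext σ; simp only [Set.mem_ofPred_eq]
      refine ⟨fun h => ⟨?_, h.2⟩, fun h => ⟨h.1.1.1, h.2⟩⟩; obtain ⟨h2, h3⟩ := h; rw [hπ] at h3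
      grind
    · rcases hf with ⟨rfl, rfl⟩ | ⟨h2, rfl⟩
      · congr 1; omega
      · rw [show m + 2 = m - f - 1 + (3 - 2) + d by omega, Nat.add_mod_right]

lemma ncard_critical_pivotTOdd (hd : 3 ≤ d) (hn : 4 ≤ n) :
    {σ | (σ ∈ simplicesT n ∧ 1 ∉ σ) ∧ pivotTOdd d n σ = none}.ncard =
      if n % d ≤ 1 then 2 else 0 := by
  refine (ncard_critical_relabel (K := {σ | σ ∈ simplicesT n ∧ 1 ∉ σ}) (K' := simplicesA n 0 0)
    (π' := pivotDOdd d n) (injOn_fold n) (by simp) (fun σ' h => h.1) ?_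
    fun σ => mem_simplicesT_fold_iff (by omega)).trans ?_
  rotate_left
  · have h1 := ncard_critical_relabel (π := pivotDOdd d n) (m := n - 1) (ρ := fun j => j + 1)
      (K' := simplicesA (n - 1) 0 0) (O := ∅) (π' := pivotA d (n - 1) 0 0)
      (K := {σ | σ ∈ simplicesA n 0 0 ∧ (∀ j, 2 ≤ j → j ≤ 0 + 1 → j ∈ σ) ∧ 1 ∉ σ})
      (fun x _ y _ h => by simpa using h) (by simp) (fun σ' hσ' => hσ'.1)
      (fun σ hσ => if_neg hσ.2.2)
      fun σ => (mem_simplicesA_shift_iff (by omega)).trans (and_iff_right (by omega))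
    rw [ncard_critical_pivotA hd (Or.inl ⟨rfl, rfl⟩) (by omega), Nat.sub_add_cancel (by omega)] at h1
    rw [← h1]; congr 1; ext σ; simp only [Set.mem_ofPred_eq]
    refine ⟨fun h => ⟨⟨h.1, by omega, fun h2 => ?_⟩, h.2⟩, fun h => ⟨h.1.1, h.2⟩⟩; have := h.2
    rw [pivotDOdd, if_pos h2] at this; simp at this
  · rintro σ ⟨-, h1⟩; unfold pivotTOdd; grind

end Odd

/-! ### From recipes on sets of natural numbers to the matching on `K_n` -/

section Transfer

variable {W : Type*} [Group W] {n d : ℕ} {cs : CoxeterSystem (matrixDTilde n) W}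
  {π : Finset ℕ → Option ℕ} {L : Finset ℕ → Prop} {σ τ : Finset (Fin (n + 1))} {v : Fin (n + 1)}

lemma map_valEmbedding_mem_simplicesT (hn : 4 ≤ n) :
    σ.map Fin.valEmbedding ∈ simplicesT n ↔ σ ∈ simplices cs := by
  rw [mem_simplices_iff cs hn, Ne, eq_univ_iff_forall, not_forall]; constructor
  · rintro ⟨-, x, hx, h⟩; exact ⟨⟨x, by omega⟩, fun h' => h (mem_map_of_mem Fin.valEmbedding h')⟩
  · rintro ⟨x, hx⟩; refine ⟨fun y hy => ?_, x, by omega, fun h => hx ((mem_map' _).1 h)⟩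
    obtain ⟨i, -, rfl⟩ := mem_map.1 hy; exact mem_range.2 i.2

lemma weight_eq_gweight (hn : 4 ≤ n) (hd : 2 ≤ d) (hσ : σ ∈ simplices cs) :
    weight cs d σ = gweight (graphDTilde n) d (σ.map Fin.valEmbedding) :=
  (mem_simplices_and_weight_eq cs hn hd σ ((mem_simplices_iff cs hn σ).1 hσ)).2

/-- The recipe `π` prescribes the matching on the complex of type `D̃_n`. -/
structure IsRecipe (cs : CoxeterSystem (matrixDTilde n) W) (d : ℕ) (π : Finset ℕ → Option ℕ)
    (L : Finset ℕ → Prop) : Prop where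
  four_le : 4 ≤ n
  two_le : 2 ≤ d
  good : IsGood (simplicesT n) (gweight (graphDTilde n) d) π L
  recipe_eq : ∀ σ, recipe d n σ = π (σ.map Fin.valEmbedding)

namespace IsRecipe

lemma mate (H : IsRecipe cs d π L) (hσ : σ ∈ simplices cs) (h : recipe d n σ = some (v : ℕ))
    (hτ : τ = insert v σ ∨ τ = σ.erase v) :
    τ ∈ simplices cs ∧ recipe d n τ = some (v : ℕ) ∧ weight cs d τ = weight cs d σ := by
  by_cases h1 : τ = σ
  · rw [h1]; exact ⟨hσ, h, rfl⟩
  have hσ' := (map_valEmbedding_mem_simplicesT H.four_le).2 hσ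
  have h2 : toggle v (σ.map Fin.valEmbedding) = τ.map Fin.valEmbedding := by
    have h3 : (v : ℕ) ∈ σ.map Fin.valEmbedding ↔ v ∈ σ := mem_map' Fin.valEmbedding
    by_cases hv : v ∈ σ
    · rw [toggle_of_mem (h3.2 hv), hτ.resolve_left (by rwa [insert_eq_of_mem hv]), map_erase]; rfl
    · rw [toggle_of_notMem (fun h => hv (h3.1 h)),
        hτ.resolve_right (by rwa [erase_eq_of_notMem hv]), map_insert]
      rfl
  rw [H.recipe_eq] at h ⊢; obtain ⟨h3, h4, h5⟩ := H.good.mate _ hσ' _ h; rw [h2] at h3 h4 h5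
  have h6 := (map_valEmbedding_mem_simplicesT (cs := cs) H.four_le).1 h3
  exact ⟨h6, h4, by rw [weight_eq_gweight H.four_le H.two_le h6,
    weight_eq_gweight H.four_le H.two_le hσ, h5]⟩

lemma mem_matching (H : IsRecipe cs d π L) (hσ : σ ∈ simplices cs)
    (h : recipe d n σ = some (v : ℕ)) : (insert v σ, σ.erase v) ∈ matching cs d :=
  ⟨v, mem_insert_self _ _, (erase_insert_eq_erase _ _).symm,
    Or.inl ⟨(H.mate hσ h (Or.inl rfl)).1, (H.mate hσ h (Or.inl rfl)).2.1⟩⟩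

/-- An edge may be prescribed at either end, but the two ends prescribe the same vertex; so an edge
through `σ` is determined by the recipe at `σ`. -/
lemma exists_of_mem_matching (H : IsRecipe cs d π L) {e : Finset (Fin (n + 1)) × Finset (Fin (n + 1))}
    (he : e ∈ matching cs d) (h : e.1 = σ ∨ e.2 = σ) :
    ∃ v : Fin (n + 1), σ ∈ simplices cs ∧ recipe d n σ = some (v : ℕ) ∧
      e = (insert v σ, σ.erase v) := by
  obtain ⟨ρ, τ⟩ := e; obtain ⟨v, hv, rfl : τ = ρ.erase v, h1⟩ := he; simp only at hv h h1
  have h2 : ρ = insert v (ρ.erase v) := (insert_erase hv).symm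
  have h3 : ρ ∈ simplices cs ∧ recipe d n ρ = some (v : ℕ) := by
    rcases h1 with h1 | h1
    · exact h1
    · have := H.mate h1.1 h1.2 (Or.inl h2); exact ⟨this.1, this.2.1⟩
  refine ⟨v, ?_⟩; rcases h with rfl | rfl
  · exact ⟨h3.1, h3.2, by rw [insert_eq_of_mem hv]⟩
  · have := H.mate h3.1 h3.2 (Or.inr rfl); exact ⟨this.1, this.2.1, by rw [← h2, erase_idem]⟩

lemma isMatching (H : IsRecipe cs d π L) : IsMatching (simplices cs) (matching cs d) := by
  refine ⟨fun e he => ?_, fun σ _ e he e' he' h h' => ?_⟩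
  · obtain ⟨v, h1, -⟩ := H.exists_of_mem_matching he (Or.inl rfl)
    obtain ⟨v', h2, -⟩ := H.exists_of_mem_matching he (Or.inr rfl); obtain ⟨u, hu, hu', -⟩ := he
    exact ⟨h1, h2, hu' ▸ erase_covBy hu⟩
  · obtain ⟨v, -, h1, rfl⟩ := H.exists_of_mem_matching he h
    obtain ⟨v', -, h2, rfl⟩ := H.exists_of_mem_matching he' h'; rw [h1, Option.some_inj] at h2
    rw [Fin.ext h2]

lemma weight_eq (H : IsRecipe cs d π L) (h : (σ, τ) ∈ matching cs d) :
    σ ∈ simplices cs ∧ τ ∈ simplices cs ∧ weight cs d σ = weight cs d τ ∧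
      σ.card = τ.card + 1 := by
  obtain ⟨v, h1, h2, h3⟩ := H.exists_of_mem_matching h (Or.inl rfl)
  obtain ⟨h4, -, h5⟩ := H.mate h1 h2 (Or.inr (congrArg Prod.snd h3)); grind

lemma isAcyclic (H : IsRecipe cs d π L) : IsAcyclic (matching cs d) := by
  intro τ hτ
  -- `AltStep` does not ask its target to be a lower end, whereas `Step` does; the next step,
  -- towards `c`, supplies this.
  have hstep : ∀ a b c, AltStep (matching cs d) a b → AltStep (matching cs d) b c →
      Step (simplicesT n) π (a.map Fin.valEmbedding) (b.map Fin.valEmbedding) := by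
    rintro a b c ⟨ρ, h1, h2, h3⟩ ⟨ρ', h4, -, -⟩
    have hlow : ∀ ρ a, (ρ, a) ∈ matching cs d → ∃ v : Fin (n + 1), a ∈ simplices cs ∧
        recipe d n a = some (v : ℕ) ∧ v ∉ a ∧ ρ = insert v a := fun ρ a h => by
      obtain ⟨v, h5, h6, h7⟩ := H.exists_of_mem_matching h (Or.inr rfl); grind
    obtain ⟨v, h5, h6, h7, rfl⟩ := hlow _ _ h1; obtain ⟨v', h8, h9, h10, -⟩ := hlow _ _ h4
    obtain ⟨x, -, rfl⟩ := covBy_iff_exists_erase.1 h2; rw [H.recipe_eq] at h6 h9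
    refine ⟨v, v', x, (map_valEmbedding_mem_simplicesT H.four_le).2 h5, h6,
      fun h => h7 ((mem_map' Fin.valEmbedding).1 h),
      (map_valEmbedding_mem_simplicesT H.four_le).2 h8, h9,
      fun h => h10 ((mem_map' Fin.valEmbedding).1 h), fun h => h3 ?_, ?_⟩
    · rwa [map_injective Fin.valEmbedding h]
    · rw [map_erase, map_insert]; rfl
  have key : ∀ b, Relation.TransGen (AltStep (matching cs d)) τ b →
      ∀ c, AltStep (matching cs d) b c →
      Relation.TransGen (Step (simplicesT n) π) (τ.map Fin.valEmbedding)
        (b.map Fin.valEmbedding) := by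
    intro b hb
    induction hb with
    | single h => exact fun c hc => Relation.TransGen.single (hstep _ _ _ h hc)
    | tail _ h ih => exact fun c hc => (ih _ h).tail (hstep _ _ _ h hc)
  obtain ⟨c, hc, -⟩ := Relation.TransGen.head'_iff.1 hτ; exact H.good.acyclic _ (key τ hτ c hc)

lemma isCritical_iff (H : IsRecipe cs d π L) (hσ : σ ∈ simplices cs) :
    IsCritical (simplices cs) (matching cs d) σ ↔ recipe d n σ = none := by
  constructor
  · rintro ⟨-, h⟩; by_contra h1; obtain ⟨v, hv⟩ := Option.ne_none_iff_exists'.1 h1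
    have hσ' := (map_valEmbedding_mem_simplicesT H.four_le).2 hσ
    have hvn : v ≤ n := by
      by_cases h2 : v ∈ σ.map Fin.valEmbedding
      · exact le_of_mem_simplicesT hσ' h2
      · have := (H.good.mate _ hσ' v (by rw [← H.recipe_eq, hv])).1
        rw [toggle_of_notMem h2] at this; exact le_of_mem_simplicesT this (mem_insert_self _ _)
    obtain ⟨v, rfl⟩ : ∃ u : Fin (n + 1), (u : ℕ) = v := ⟨⟨v, by omega⟩, rfl⟩
    have h2 := h _ (H.mem_matching hσ hv); grind
  · refine fun h => ⟨hσ, fun e he => ?_⟩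
    have h1 : ¬ (e.1 = σ ∨ e.2 = σ) := fun h1 => by
      obtain ⟨v, -, h2, -⟩ := H.exists_of_mem_matching he h1; rw [h] at h2; simp at h2
    exact not_or.1 h1

/-- Matched edges preserve the weight and passing to a face cannot increase it. The sizes go down
and up alternately, so the path as a whole loses one vertex. -/
lemma weight_le_of_isAltPath (H : IsRecipe cs d π L) {p} (hσ : σ ∈ simplices cs)
    (h : IsAltPath (matching cs d) σ p τ) :
    weight cs d τ ≤ weight cs d σ ∧ σ.card = τ.card + 1 := by
  have hcov : ∀ {σ ρ}, σ ∈ simplices cs → ρ ⋖ σ →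
      weight cs d ρ ≤ weight cs d σ ∧ σ.card = ρ.card + 1 := fun hσ h =>
    ⟨weight_mono cs H.two_le h.le hσ, (Order.covBy_iff_add_one_eq.1 h.card_finset).symm⟩
  induction p generalizing σ with
  | nil => exact hcov hσ h.1
  | cons e p ih =>
    obtain ⟨h1, -, h2, h3⟩ := h; obtain ⟨h4, -, h5, h6⟩ := H.weight_eq h2; have h7 := ih h4 h3
    have h8 := hcov hσ h1; omega

/-- Precision has to be checked only for critical simplices joined by an alternating path. -/
theorem isPrecise (H : IsRecipe cs d π L)
    (h : ∀ σ τ, IsCritical (simplices cs) (matching cs d) σ →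
      IsCritical (simplices cs) (matching cs d) τ →
      L (σ.map Fin.valEmbedding) → π (τ.map Fin.valEmbedding) = none → L (τ.map Fin.valEmbedding) →
      σ.card = τ.card + 1 → weight cs d τ ≤ weight cs d σ →
      morseInc (matching cs d) σ τ ≠ 0 → weight cs d σ = weight cs d τ + 1) :
    IsPrecise cs d (matching cs d) := by
  refine ⟨H.isMatching, H.isAcyclic, fun e he => (H.weight_eq he).2.2.1, fun σ τ hσ hτ hne => ?_⟩
  have hL : ∀ σ, IsCritical (simplices cs) (matching cs d) σ →
      π (σ.map Fin.valEmbedding) = none ∧ L (σ.map Fin.valEmbedding) := fun σ hσ => by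
    have h1 := (H.isCritical_iff hσ.1).1 hσ; rw [H.recipe_eq] at h1
    exact ⟨h1, H.good.crit _ ((map_valEmbedding_mem_simplicesT H.four_le).2 hσ.1) h1⟩
  obtain ⟨p, hp⟩ : ∃ p, IsAltPath (matching cs d) σ p τ := by
    by_contra h1
    push Not at h1
    exact hne (by simp [morseInc, h1])
  obtain ⟨h1, h2⟩ := H.weight_le_of_isAltPath hσ.1 hp; grind

end IsRecipe

end Transfer

/-! ### Cancellation of two alternating paths -/

section Cancellation

variable {V : Type*} [LinearOrder V] {ρ x y z : Finset V} {u v : V}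

lemma inc_insert (hv : v ∉ z) : inc (insert v z) z = (-1) ^ (z.filter (· < v)).card := by
  unfold inc; rw [insert_sdiff_cancel hv, prod_singleton, filter_insert, if_neg (lt_irrefl v)]

lemma inc_mul_self (h : x ⋖ ρ) : inc ρ x * inc ρ x = 1 := by
  obtain ⟨v, hv, rfl⟩ := covBy_iff_exists_insert.1 h; rw [inc_insert hv, ← mul_pow]; simp

/-- The two faces of a simplex along a common face of codimension two have opposite signs. -/
lemma inc_square (hx : x ⋖ ρ) (hy : y ⋖ ρ) (hzx : z ⋖ x) (hzy : z ⋖ y) (hne : x ≠ y) :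
    inc ρ x * inc ρ y * (inc x z * inc y z) = -1 := by
  obtain ⟨u, hu, rfl⟩ := covBy_iff_exists_insert.1 hzx
  obtain ⟨v, hv, rfl⟩ := covBy_iff_exists_insert.1 hzy
  have huv : u ≠ v := by rintro rfl; exact hne rfl
  have hv' : v ∉ insert u z := by simp [hv, huv.symm]
  have hu' : u ∉ insert v z := by simp [hu, huv]
  obtain ⟨w, hw, rfl⟩ := covBy_iff_exists_insert.1 hx
  have hw' : w = v := by
    have h : v ∈ insert w (insert u z) := hy.le (mem_insert_self _ _)
    exact ((mem_insert.1 h).resolve_right hv').symm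
  subst hw'
  rw [inc_insert hv', insert_comm, inc_insert hu', inc_insert hu, inc_insert hv, filter_insert,
    filter_insert]
  have hs : ∀ k l : ℕ, (-1 : ℤ) ^ (k + 1) * (-1) ^ l * ((-1) ^ l * (-1) ^ k) = -1 := fun k l => by
    have h1 : ((-1 : ℤ) ^ k) * (-1) ^ k = 1 := by rw [← mul_pow]; simp
    have h2 : ((-1 : ℤ) ^ l) * (-1) ^ l = 1 := by rw [← mul_pow]; simp
    grind
  grind

variable {K : Set (Finset V)} {M : Set (Finset V × Finset V)} {σ τ a b a' b' c e : Finset V}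

/-- Two alternating paths along an octagon cancel. -/
theorem morseInc_eq_zero_of_octagon (hM : IsMatching K M)
    (hσa : a ⋖ σ) (hσa' : a' ⋖ σ) (hba : (b, a) ∈ M) (hbτ : τ ⋖ b) (hba' : (b', a') ∈ M)
    (hbc : c ⋖ b') (hec : (e, c) ∈ M) (heτ : τ ⋖ e) (hσ : ∀ x, (σ, x) ∉ M) (hτ : ∀ y, (y, τ) ∉ M)
    (hστ : ¬ τ ⋖ σ) (hbτ' : ¬ τ ⋖ b') (ha : a ≠ a') (hac : a' ≠ c) (hcτ : c ≠ τ)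
    (hz : (z ⋖ a ∧ z ⋖ a' ∧ z ⋖ c ∧ z ⋖ τ) ∨
      (σ ⋖ z ∧ b ⋖ z ∧ b' ⋖ z ∧ e ⋖ z ∧ b ≠ e ∧ b' ≠ e))
    (h₁ : ∀ x y p, x ⋖ σ → (y, x) ∈ M → IsAltPath M y p τ → x = a ∨ x = a')
    (h₂ : ∀ x y p, x ⋖ b → (y, x) ∈ M → IsAltPath M y p τ → x = a ∨ x = τ)
    (h₃ : ∀ x y p, x ⋖ b' → (y, x) ∈ M → IsAltPath M y p τ → x = a' ∨ x = c)
    (h₄ : ∀ x y p, x ⋖ e → (y, x) ∈ M → IsAltPath M y p τ → x = c ∨ x = τ) :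
    morseInc M σ τ = 0 := by
  have hup : ∀ {x y y'}, (y, x) ∈ M → (y', x) ∈ M → y = y' := fun h h' =>
    congrArg Prod.fst (hM.2 _ (hM.1 h).2.1 _ h _ h' (Or.inr rfl) (Or.inr rfl))
  have hdown : ∀ {x x' y}, (y, x) ∈ M → (y, x') ∈ M → x = x' := fun h h' =>
    congrArg Prod.snd (hM.2 _ (hM.1 h).1 _ h _ h' (Or.inl rfl) (Or.inl rfl))
  have haτ : a ≠ τ := by rintro rfl; exact hτ _ hba
  have haτ' : a' ≠ τ := by rintro rfl; exact hτ _ hba'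
  -- By `h₁`, …, `h₄` a path that leaves the octagon never reaches `τ`, so only the two ways around
  -- it remain.
  have hP : {p | IsAltPath M σ p τ} = {[(a, b)], [(a', b'), (c, e)]} := by
    ext p; rw [Set.mem_insert_iff, Set.mem_singleton_iff]; constructor
    · intro hp; obtain _ | ⟨⟨x, y⟩, p⟩ := p
      · exact absurd hp.1 hστ
      obtain ⟨h1, -, h2, h3⟩ := hp; rcases h₁ x y p h1 h2 h3 with rfl | rfl
      · obtain rfl := hup h2 hba; obtain _ | ⟨⟨x', y'⟩, p⟩ := p
        · exact Or.inl rfl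
        obtain ⟨h4, h5, h6, h7⟩ := h3; grind
      · obtain rfl := hup h2 hba'; obtain _ | ⟨⟨x', y'⟩, p⟩ := p
        · exact absurd h3.1 hbτ'
        obtain ⟨h4, h5, h6, h7⟩ := h3; rcases h₃ x' y' p h4 h6 h7 with rfl | rfl
        · exact absurd h2 h5
        obtain rfl := hup h6 hec; obtain _ | ⟨⟨x'', y''⟩, p⟩ := p
        · exact Or.inr rfl
        obtain ⟨h8, h9, h10, h11⟩ := h7; grind
    · rintro (rfl | rfl)
      · exact ⟨hσa, hσ _, hba, hbτ, fun h => haτ (hdown hba h)⟩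
      · exact ⟨hσa', hσ _, hba', hbc, fun h => hac (hdown hba' h), hec, heτ,
          fun h => hcτ (hdown hec h)⟩
  have hcov := fun {e} (h : e ∈ M) => (hM.1 h).2.2
  have hsum : morseInc M σ τ = pathSign σ [(a, b)] τ + pathSign σ [(a', b'), (c, e)] τ := by
    rw [← finsum_mem_pair (f := fun p => pathSign σ p τ) (by simp), ← hP]; rfl
  -- Four squares, all having `z` as their common face or common coface, contribute `-1` each, so
  -- the eight incidence numbers around the octagon have product `1`. The two paths contain one and
  -- two matched edges, hence have opposite signs.
  have hprod : (inc σ a * inc b a * inc b τ) *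
      (inc σ a' * inc b' a' * inc b' c * inc e c * inc e τ) = 1 := by
    rcases hz with ⟨z1, z2, z3, z4⟩ | ⟨z1, z2, z3, z4, z5, z6⟩
    · have q1 := inc_square hσa hσa' z1 z2 ha; have q2 := inc_square (hcov hba) hbτ z1 z4 haτ
      have q3 := inc_square (hcov hba') hbc z2 z3 hac
      have q4 := inc_square (hcov hec) heτ z3 z4 hcτ; have s1 := inc_mul_self z1
      have s2 := inc_mul_self z2; have s3 := inc_mul_self z3; have s4 := inc_mul_self z4; grind
    · have n1 : σ ≠ b := by rintro rfl; exact hσ _ hba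
      have n2 : σ ≠ b' := by rintro rfl; exact hσ _ hba'
      have q1 := inc_square z1 z2 hσa (hcov hba) n1; have q2 := inc_square z1 z3 hσa' (hcov hba') n2
      have q3 := inc_square z3 z4 hbc (hcov hec) z6; have q4 := inc_square z2 z4 hbτ heτ z5
      have s1 := inc_mul_self z1; have s2 := inc_mul_self z2; have s3 := inc_mul_self z3
      have s4 := inc_mul_self z4; grind
  rw [hsum]; simp only [pathSign]
  linear_combination -Int.eq_of_mul_eq_one hprod

end Cancellation

/-! ### Comparing critical simplices, and the exceptional pairs -/

section Drop

variable {n d h x y v : ℕ} {σ τ s : Finset ℕ}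

lemma mem_insert_insert_Icc {z a b : ℕ} : z ∈ insert x (insert y (Icc a b)) ↔
    z = x ∨ z = y ∨ a ≤ z ∧ z ≤ b := by
  rw [mem_insert, mem_insert, mem_Icc]

lemma isPath_graphDTilde (hn : 4 ≤ n) (hx : x ≤ 1) (hy : n ≤ y + 1) (hyn : y ≤ n) :
    IsPath (graphDTilde n) (insert x (insert y (Icc 2 (n - 2)))) (place n) 1 (n - 1) := by
  refine ⟨⟨?_, ?_, ?_⟩, ?_⟩
  · intro v hv; rw [mem_insert_insert_Icc] at hv; rcases place_cases n v with h | h | h <;> omega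
  · intro j h1 h2; have hj : j = 1 ∨ j = n - 1 ∨ 2 ≤ j ∧ j ≤ n - 2 := by omega
    rcases hj with hj | hj | hj
    · refine ⟨x, mem_insert_self _ _, ?_⟩; rcases place_cases n x with h | h | h <;> omega
    · refine ⟨y, mem_insert_of_mem (mem_insert_self _ _), ?_⟩
      rcases place_cases n y with h | h | h <;> omega
    · refine ⟨j, mem_insert_insert_Icc.2 (Or.inr (Or.inr hj)), ?_⟩
      rcases place_cases n j with h | h | h <;> omega
  · intro v hv w hw; rw [mem_insert_insert_Icc] at hv hw
    exact graphDTilde_adj_place hn (by omega) (by omega)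
  · intro v hv w hw hvw; rw [mem_insert_insert_Icc] at hv hw
    rcases place_cases n v with h | h | h <;> rcases place_cases n w with h' | h' | h' <;> omega

/-- The path has `n - 1 ≤ d` vertices. Removing an inner one leaves pieces with at most `d - 2`
vertices, which have no weight. -/
lemma eq_or_eq_of_gweight_erase (hn : 4 ≤ n) (hd : 2 ≤ d) (hnd : n ≤ d + 1) (hx : x ≤ 1)
    (hy : n ≤ y + 1) (hyn : y ≤ n) (hv : v ∈ insert x (insert y (Icc 2 (n - 2))))
    (h : 1 ≤ gweight (graphDTilde n) d ((insert x (insert y (Icc 2 (n - 2)))).erase v)) :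
    v = x ∨ v = y := by
  have H := isPath_graphDTilde hn hx hy hyn; have h1 := H.le v hv
  rw [H.gweight_erase hd hv h1.1] at h; by_contra h2; rw [mem_insert_insert_Icc] at hv
  rw [Nat.div_eq_of_lt, Nat.div_eq_of_lt] at h
  · omega
  all_goals rcases place_cases n v with h | h | h <;> omega

lemma relabel_of_filter_eq {m : ℕ} {ρ : ℕ → ℕ} {π : Finset ℕ → Option ℕ} {s : Finset ℕ}
    (h : ∀ j, (1 ≤ j ∧ j ≤ m) ∧ ρ j ∈ σ ↔ j ∈ s) : relabel m ρ π σ = (π s).map ρ := by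
  rw [relabel, show (Icc 1 m).filter (fun j => ρ j ∈ σ) = s from ?_]; ext j
  rw [mem_filter, mem_Icc, h]

lemma pivotA_Icc (hd : 2 ≤ d) {f : ℕ} (hf : f < d) {b : ℕ} (hb : d ≤ b + 1) :
    pivotA d d f 0 (Icc 1 b) = some d := by
  rw [pivotA, dif_neg (by omega), dif_neg (by omega), if_neg (by omega), if_pos (by omega),
    if_pos (Icc_subset_Icc le_rfl (by omega))]

lemma pivotTEven_of_one_notMem (hn : 5 ≤ n) (h1 : 1 ∉ σ)
    (hs : ∀ j, (1 ≤ j ∧ j ≤ n) ∧ (if j = n then 0 else n + 1 - j) ∈ σ ↔ j ∈ s) :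
    pivotTEven d n σ =
      (pivotDEven d n 0 s).map fun j => if j = n then 0 else n + 1 - j := by
  unfold pivotTEven; rw [if_neg (by omega), if_pos h1]; exact relabel_of_filter_eq hs

/-- The three matched simplices between the exceptional pair of critical simplices. -/
lemma pivotTEven_exceptional (hh : 2 ≤ h) :
    pivotTEven (2 * h) (2 * h + 1) (insert (2 * h) (Icc 2 (2 * h - 1))) = some 0 ∧
    pivotTEven (2 * h) (2 * h + 1) (insert 1 (Icc 2 (2 * h - 1))) = some (2 * h + 1) ∧
    pivotTEven (2 * h) (2 * h + 1) (insert (2 * h + 1) (Icc 2 (2 * h - 1))) = some 0 := by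
  have e0 : 2 * h / 2 = h := by omega
  refine ⟨?_, ?_, ?_⟩
  · rw [pivotTEven_of_one_notMem (s := Icc 2 (2 * h)) (by omega)
      (by rw [mem_insert, mem_Icc]; omega)
      fun j => by rw [mem_insert, mem_Icc, mem_Icc]; split_ifs <;> omega]
    unfold pivotDEven; simp only [e0]
    rw [if_neg (not_not.2 (mem_Icc.2 (by omega))), if_neg (by omega),
      if_neg (fun hc => hc.2 (mem_Icc.2 (by omega))),
      if_neg (fun hc => hc.2 (mem_Icc.2 (by omega))),
      if_neg (fun hc => hc.2 (mem_Icc.2 (by omega))),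
      if_pos ⟨by omega, by rw [mem_Icc]; omega⟩, if_pos (Icc_subset_Icc le_rfl (by omega)),
      relabel_of_filter_eq (s := Icc 1 (2 * h - 1)) fun j => by rw [mem_Icc, mem_Icc]; omega,
      Nat.add_sub_cancel, pivotA_Icc (by omega) (by omega) (by omega)]
    simp
  · unfold pivotTEven; simp only [e0]
    rw [if_neg (by omega), if_neg (not_not.2 (mem_insert_self _ _)), if_neg (by omega),
      if_pos ⟨by omega, by simp⟩, if_pos, relabel_of_filter_eq (s := Icc 3 (2 * h + 1)) fun j => by
        rw [mem_insert, mem_Icc, mem_Icc]; omega]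
    · unfold pivotDEven
      rw [if_pos (by simp), relabel_of_filter_eq (s := Icc 2 (2 * h)) fun j => by
        rw [mem_Icc, mem_Icc]; split_ifs <;> omega, Nat.add_sub_cancel, pivotA,
        dif_neg (by omega), dif_neg (by omega), if_neg (by omega), if_neg (by omega), if_neg]
      · simp
      · rw [Nat.add_mod_left, Nat.mod_eq_of_lt (by omega)]; omega
    · grind
  · rw [pivotTEven_of_one_notMem (s := insert 1 (Icc 3 (2 * h))) (by omega)
      (by rw [mem_insert, mem_Icc]; omega)
      fun j => by rw [mem_insert, mem_Icc, mem_insert, mem_Icc]; split_ifs <;> try rw [false_or]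
                  all_goals omega]
    unfold pivotDEven
    rw [if_pos (by simp), relabel_of_filter_eq (s := Icc 1 (2 * h - 1)) fun j => by
      rw [mem_insert, mem_Icc, mem_Icc]; split_ifs <;> omega, Nat.add_sub_cancel,
      pivotA_Icc (by omega) (by omega) (by omega)]
    grind

lemma mod_eq_of_eq_add_mul {k j t : ℕ} (h : n = j + t * k) (hj : j < k) : n % k = j := by
  rw [h, Nat.add_mul_mod_self_right, Nat.mod_eq_of_lt hj]

lemma eq_of_defect_eq (hd : 0 < d) {c c' w w' : ℕ} {x x' : ℤ} (k : ℤ)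
    (h : defect d n c w = x) (h' : defect d n c' w' = x') (hk : x = x' + d * k) :
    (c : ℤ) - w = c' - w' + k := by
  unfold defect at h h'; have : (d : ℤ) * ((c - w) - (c' - w' + k)) = 0 := by linarith
  rw [mul_eq_zero] at this; omega

/-- The residue of `n` modulo `2h` determines `j`, so any two critical simplices of the first two
families have the same `|σ| - v(σ)`, and likewise within the third. If only `σ` is in the third
family, its weight would be at least `2`. If only `τ` is, the weights are equal, and comparing `|τ|
- v(τ) = n - 1 - 2t` with `v(τ) ≤ 1` and `|τ| ≥ n - 2` gives `t = 1`: thus `n = 2h + 1`, `|τ| = n -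
2` and `v(τ) = 1`. Then `τ` is the path on `0, 2, …, n - 2, n` without one end, and the one without
`0` is matched. -/
theorem CriticalT.drop (hn : 4 ≤ n) (hh : 0 < h) (hσ : CriticalT h n σ) (hτ : CriticalT h n τ)
    (hτn : τ ∈ simplicesT n) (hπ : pivotTEven (2 * h) n τ = none) (hc : σ.card = τ.card + 1)
    (hw : gweight (graphDTilde n) (2 * h) τ ≤ gweight (graphDTilde n) (2 * h) σ) :
    gweight (graphDTilde n) (2 * h) σ = gweight (graphDTilde n) (2 * h) τ + 1 ∨
      (2 ≤ h ∧ n = 2 * h + 1 ∧ gweight (graphDTilde n) (2 * h) τ = 1 ∧ σ = Icc 1 (n - 1) ∧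
        τ = insert 0 (Icc 2 (n - 2))) := by
  have key : ∀ σ, CriticalT h n σ →
      (∃ j, (n % (2 * h) = j ∧ j ≤ h ∨ n % (2 * h) = h + j ∧ 1 ≤ j) ∧
        defect (2 * h) n σ.card (gweight (graphDTilde n) (2 * h) σ) = 2 * j ∧
        (n % (2 * h) = 1 → n ≤ σ.card + 1 ∧
          (n = 2 * h + 1 → n = σ.card + 1 → σ = Icc 1 (n - 1)))) ∨
      (n % (2 * h) = 1 ∧
        defect (2 * h) n σ.card (gweight (graphDTilde n) (2 * h) σ) = 2 - 2 * h ∧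
        gweight (graphDTilde n) (2 * h) σ ≤ 1 ∧ 1 ∉ σ ∧ n - 1 ∉ σ) := by
    intro σ hσ; rcases hσ with ⟨j, t, h1, h2, h3, h4⟩ | ⟨j, t, h1, h2, h3, h4⟩ | ⟨t, h1, h2, h3, h4⟩
    · have := mod_eq_of_eq_add_mul h1 (by omega); grind
    · have := mod_eq_of_eq_add_mul h1 (by omega); exact Or.inl ⟨j, by omega, h4, by omega⟩
    · exact Or.inr ⟨mod_eq_of_eq_add_mul h1 h2, h3, h4⟩
  rcases key σ hσ with ⟨j, h1, h2, h3⟩ | ⟨h1, h2, h3, -⟩ <;>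
    rcases key τ hτ with ⟨j', h1', h2', h3'⟩ | ⟨h1', h2', h3', h4', h5'⟩
  · have := eq_of_defect_eq (d := 2 * h) (by omega) 0 h2 h2' (by omega); omega
  · obtain ⟨h4, h5⟩ := h3 h1'
    have h6 := eq_of_defect_eq (d := 2 * h) (by omega) 1 h2 h2' (by omega); right
    have h7 : n = 1 + n / (2 * h) * (2 * h) := by have := Nat.div_add_mod' n (2 * h); omega
    generalize n / (2 * h) = t at h7
    have h8 : (τ.card : ℤ) - gweight (graphDTilde n) (2 * h) τ = n - 1 - 2 * t := by
      have h9 : (n : ℤ) = 1 + t * (2 * h) := by exact_mod_cast h7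
      rw [defect, h9] at h2'
      have : (h : ℤ) * ((τ.card : ℤ) - gweight (graphDTilde n) (2 * h) τ - (n - 1 - 2 * t)) = 0 := by
        rw [h9]; push_cast at h2'; linarith
      rw [mul_eq_zero] at this; omega
    have ht : t ≠ 0 := by rintro rfl; omega
    obtain rfl : t = 1 := by omega
    refine ⟨by omega, by omega, by omega, h5 (by omega) (by omega), ?_⟩
    have hsub : τ ⊆ insert 0 (insert n (Icc 2 (n - 2))) := by
      intro z hz; have h9 := le_of_mem_simplicesT hτn hz; grind
    have hcov : τ ⋖ insert 0 (insert n (Icc 2 (n - 2))) := by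
      rw [covBy_iff_card_sdiff_eq_one, card_sdiff_of_subset hsub, card_insert_of_notMem,
        card_insert_of_notMem, Nat.card_Icc]
      · exact ⟨hsub, by omega⟩
      · rw [mem_Icc]; omega
      · rw [mem_insert, mem_Icc]; omega
    obtain ⟨v, hv, rfl⟩ := covBy_iff_exists_erase.1 hcov
    rcases eq_or_eq_of_gweight_erase (d := 2 * h) hn (by omega) (by omega) (by omega) (by omega) le_rfl hv
      (by omega) with rfl | rfl
    · rw [erase_insert (by rw [mem_insert, mem_Icc]; omega)] at hπ
      have h12 := (pivotTEven_exceptional (h := h) (by omega)).2.2; grind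
    · grind
  · have := eq_of_defect_eq (d := 2 * h) (by omega) (-1) h2 h2' (by omega); omega
  · have := eq_of_defect_eq (d := 2 * h) (by omega) 0 h2 h2' (by omega); omega

lemma gweight_graphDTilde_Icc_one (hn : 4 ≤ n) (hd : 2 ≤ d) :
    gweight (graphDTilde n) d (Icc 1 n) = weightD d n := by
  rw [← gweight_graphD_Icc hd (by omega), ← gweight_graphDTilde_image hn subset_rfl]; congr 1; ext x
  rw [mem_image_reverse subset_rfl, mem_Icc, mem_Icc]; omega

/-- Deleting an inner vertex splits the graph of type `D̃_n` into pieces of weight `0`. -/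
lemma gweight_graphDTilde_erase (hn : 5 ≤ n) (ho : Odd n) (hv : 2 ≤ v) (hvn : v + 2 ≤ n) :
    gweight (graphDTilde n) n ((range (n + 1)).erase v) = 0 := by
  have hI : ∀ m, 2 ≤ m → m < n → gweight graphD n (Icc 1 m) = 0 := fun m h1 h2 => by
    rcases Nat.eq_or_lt_of_le h1 with rfl | h3
    · exact gweight_graphD_Icc_two (by omega)
    · rw [gweight_graphD_Icc (by omega) h3, weightD_of_odd ho, Nat.div_eq_of_lt h2]
  have hr : ∀ k, (Icc 1 (n - k)).image (fun j => n + 1 - j) = Icc (k + 1) n := fun k => by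
    ext x; rw [mem_image_reverse (Icc_subset_Icc le_rfl (by omega)), mem_Icc, mem_Icc]; omega
  rcases Nat.eq_or_lt_of_le hv with rfl | h3
  · rw [show (range (n + 1)).erase 2 = insert 0 (insert 1 (Icc (2 + 1) n)) by
      ext x; rw [mem_erase, mem_range, mem_insert_insert_Icc]; omega,
      gweight_insert_isolated (by omega) (by rw [mem_insert, mem_Icc]; omega),
      gweight_insert_isolated (by omega) (by rw [mem_Icc]; omega), ← hr,
      gweight_graphDTilde_image (by omega) (Icc_subset_Icc le_rfl (by omega)),
      hI _ (by omega) (by omega), Nat.div_eq_of_lt (by omega)]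
    · intro x hx; rw [mem_Icc] at hx; rw [graphDTilde_adj (by omega)]; omega
    · intro x hx; rw [mem_insert, mem_Icc] at hx; rw [graphDTilde_adj (by omega)]; omega
  · rw [show (range (n + 1)).erase v = range v ∪ (Icc 1 (n - v)).image fun j => n + 1 - j by
      rw [hr]; ext x; rw [mem_erase, mem_range, mem_union, mem_range, mem_Icc]; omega,
      gweight_graphDTilde_union (by omega) (by omega) h3 hvn subset_rfl, weightD_of_odd ho,
      Nat.div_eq_of_lt (by omega), hI _ (by omega) (by omega)]

end Drop

/-! ### Vanishing incidence numbers for the exceptional pairs -/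

section Final

variable {W : Type*} [Group W] {n d h : ℕ} {cs : CoxeterSystem (matrixDTilde n) W}
  {π : Finset ℕ → Option ℕ} {L : Finset ℕ → Prop} {σ τ : Finset (Fin (n + 1))}

lemma coe_mem_map_iff (v : Fin (n + 1)) : (v : ℕ) ∈ σ.map Fin.valEmbedding ↔ v ∈ σ :=
  mem_map' Fin.valEmbedding

lemma eq_of_forall_coe_mem {s : Finset ℕ} (h : σ.map Fin.valEmbedding = s)
    (h' : ∀ v : Fin (n + 1), v ∈ τ ↔ (v : ℕ) ∈ s) : σ = τ := by
  ext v; rw [h', ← h, coe_mem_map_iff]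

namespace IsRecipe

lemma insert_mem_matching (H : IsRecipe cs d π L) {v : Fin (n + 1)} (hσ : σ ∈ simplices cs)
    (h : recipe d n σ = some (v : ℕ)) (hv : v ∉ σ) : (insert v σ, σ) ∈ matching cs d := by
  have := H.mem_matching hσ h; rwa [erase_eq_of_notMem hv] at this

lemma erase_mem_matching (H : IsRecipe cs d π L) {v : Fin (n + 1)} (hσ : σ ∈ simplices cs)
    (h : recipe d n σ = some (v : ℕ)) (hv : v ∈ σ) : (σ, σ.erase v) ∈ matching cs d := by
  have := H.mem_matching hσ h; rwa [insert_eq_of_mem hv] at this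

lemma weight_le_of_mem (H : IsRecipe cs d π L) {x y : Finset (Fin (n + 1))} {p}
    (h : (y, x) ∈ matching cs d) (hp : IsAltPath (matching cs d) y p τ) :
    weight cs d τ ≤ weight cs d x := by
  obtain ⟨h1, -, h2, -⟩ := H.weight_eq h; exact h2 ▸ (H.weight_le_of_isAltPath h1 hp).1

/-- Let `z = {2, …, 2h - 1}`. The octagon consists of `σ = z ∪ {1, 2h}`, `τ = z ∪ {0}` and of the
matched pairs adding `0` to `z ∪ {2h}`, `2h + 1` to `z ∪ {1}` and `0` to `z ∪ {2h + 1}`. Its squares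
share the face `z`. -/
theorem morseInc_eq_zero_of_even (H : IsRecipe cs (2 * h) π L) (hh : 2 ≤ h) (hn : n = 2 * h + 1)
    (hπ : ∀ σ, recipe (2 * h) n σ = pivotTEven (2 * h) n (σ.map Fin.valEmbedding))
    (hσ : IsCritical (simplices cs) (matching cs (2 * h)) σ)
    (hτ : IsCritical (simplices cs) (matching cs (2 * h)) τ)
    (hσ' : σ.map Fin.valEmbedding = Icc 1 (n - 1))
    (hτ' : τ.map Fin.valEmbedding = insert 0 (Icc 2 (n - 2))) (hw : weight cs (2 * h) τ = 1) :
    morseInc (matching cs (2 * h)) σ τ = 0 := by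
  subst hn; obtain ⟨p, hp⟩ : ∃ p : Fin (2 * h + 2), (p : ℕ) = 0 := ⟨⟨0, by omega⟩, rfl⟩
  obtain ⟨r, hr⟩ : ∃ r : Fin (2 * h + 2), (r : ℕ) = 1 := ⟨⟨1, by omega⟩, rfl⟩
  obtain ⟨s, hs⟩ : ∃ s : Fin (2 * h + 2), (s : ℕ) = 2 * h := ⟨⟨2 * h, by omega⟩, rfl⟩
  obtain ⟨t, ht⟩ : ∃ t : Fin (2 * h + 2), (t : ℕ) = 2 * h + 1 := ⟨⟨2 * h + 1, by omega⟩, rfl⟩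
  obtain ⟨z, hz⟩ : ∃ z : Finset (Fin (2 * h + 2)), ∀ x, x ∈ z ↔ 2 ≤ (x : ℕ) ∧ (x : ℕ) ≤ 2 * h - 1 :=
    ⟨univ.filter fun x => 2 ≤ (x : ℕ) ∧ (x : ℕ) ≤ 2 * h - 1, by simp⟩
  have hzm : z.map Fin.valEmbedding = Icc 2 (2 * h - 1) := by
    ext x; rw [mem_Icc]; constructor
    · intro hx; obtain ⟨y, hy, rfl⟩ := mem_map.1 hx; exact (hz y).1 hy
    · exact fun hx => (coe_mem_map_iff ⟨x, by omega⟩).2 ((hz _).2 hx)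
  obtain rfl : σ = insert r (insert s z) := eq_of_forall_coe_mem hσ' fun v => by
    simp only [mem_insert, Fin.ext_iff, hz, mem_Icc]; omega
  obtain rfl : τ = insert p z := eq_of_forall_coe_mem hτ' fun v => by
    simp only [mem_insert, Fin.ext_iff, hz, mem_Icc]; omega
  have hK : ∀ x : Fin (2 * h + 2), insert x z ∈ simplices cs := fun x => by
    rw [mem_simplices_iff cs H.four_le]; intro h1; have h2 := mem_univ p; have h3 := mem_univ r
    grind
  -- Since `v(τ) = 1`, a face from which `τ` can be reached must have positive weight; removing an
  -- inner vertex of the path destroys it.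
  have hfacet : ∀ (ρ x : Finset (Fin (2 * h + 2))) (u v : Fin (2 * h + 2)) (y p'),
      ρ = insert u (insert v z) → (u : ℕ) ≤ 1 → 2 * h + 1 ≤ v + 1 → x ⋖ ρ →
      (y, x) ∈ matching cs (2 * h) → IsAltPath (matching cs (2 * h)) y p' (insert p z) →
      x = insert v z ∨ x = insert u z := by
    rintro ρ x u v y p' rfl hu hv hx h1 h2; have h3 := H.weight_le_of_mem h1 h2
    rw [hw, weight_eq_gweight H.four_le H.two_le (H.weight_eq h1).2.1] at h3
    obtain ⟨w, hw, rfl⟩ := covBy_iff_exists_erase.1 hx; have hw' := (coe_mem_map_iff w).2 hw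
    rw [map_erase] at h3; rw [map_insert, map_insert, hzm] at h3 hw'
    rcases eq_or_eq_of_gweight_erase H.four_le H.two_le (by omega) hu hv (by omega) hw' h3
      with h4 | h4 <;> rw [Fin.ext h4]
    · grind
    · right; rw [insert_comm, erase_insert]; simp only [mem_insert, Fin.ext_iff, hz]; omega
  obtain ⟨e1, e2, e3⟩ := pivotTEven_exceptional hh
  have hrec : ∀ x y : Fin (2 * h + 2), pivotTEven (2 * h) (2 * h + 1)
      (insert (x : ℕ) (Icc 2 (2 * h - 1))) = some (y : ℕ) →
      recipe (2 * h) (2 * h + 1) (insert x z) = some (y : ℕ) := fun x y h1 => by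
    rw [hπ, map_insert, hzm]; exact h1
  have hins : ∀ u v : Fin (2 * h + 2), u ∉ insert v z → insert v z ⋖ insert u (insert v z) :=
    fun u v h => covBy_insert h
  refine morseInc_eq_zero_of_octagon (z := z) (a := insert s z) (b := insert p (insert s z))
    (a' := insert r z) (b' := insert t (insert r z)) (c := insert t z)
    (e := insert p (insert t z)) H.isMatching ?_ ?_ ?_ ?_ ?_ ?_ ?_ ?_ (fun x h1 => (hσ.2 _ h1).1 rfl)
    (fun x h1 => (hτ.2 _ h1).2 rfl) ?_ ?_ ?_ ?_ ?_ ?_ ?_ ?_ ?_ ?_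
  · grind
  · rw [insert_comm]; exact hins _ _ (by simp only [mem_insert, Fin.ext_iff, hz]; omega)
  · refine H.insert_mem_matching (hK _) (hrec _ _ ?_)
      (by simp only [mem_insert, Fin.ext_iff, hz]; omega)
    rw [hs, hp]; exact e1
  · rw [insert_comm]; exact hins _ _ (by simp only [mem_insert, Fin.ext_iff, hz]; omega)
  · refine H.insert_mem_matching (hK _) (hrec _ _ ?_)
      (by simp only [mem_insert, Fin.ext_iff, hz]; omega)
    rw [hr, ht]; exact e2
  · rw [insert_comm]; exact hins _ _ (by simp only [mem_insert, Fin.ext_iff, hz]; omega)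
  · refine H.insert_mem_matching (hK _) (hrec _ _ ?_)
      (by simp only [mem_insert, Fin.ext_iff, hz]; omega)
    rw [ht, hp]; exact e3
  · rw [insert_comm]; exact hins _ _ (by simp only [mem_insert, Fin.ext_iff, hz]; omega)
  · intro h1; have := h1.le (mem_insert_self p z)
    simp only [mem_insert, Fin.ext_iff, hz] at this; omega
  · intro h1; have := h1.le (mem_insert_self p z)
    simp only [mem_insert, Fin.ext_iff, hz] at this; omega
  · grind
  · grind
  · intro h1; have := mem_insert_self t z; grind
  · exact Or.inl ⟨covBy_insert (by rw [hz]; omega), covBy_insert (by rw [hz]; omega),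
      covBy_insert (by rw [hz]; omega), covBy_insert (by rw [hz]; omega)⟩
  · grind
  · grind
  · exact fun x y p' h1 h2 h3 =>
      (hfacet _ x r t y p' (insert_comm _ _ _) (by omega) (by omega) h1 h2 h3).symm
  · grind

/-- Here the octagon is formed by complements of one or two of the vertices `0, 1, n - 1, n`, and
its squares share the coface `univ`. A path to `τ` cannot pass through the complement of an inner
vertex, because that has weight `0 < v(τ)`. -/
theorem morseInc_eq_zero_of_odd (H : IsRecipe cs n π L) (ho : Odd n)
    (hπ : ∀ σ, recipe n n σ = pivotTOdd n n (σ.map Fin.valEmbedding))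
    (hσ : IsCritical (simplices cs) (matching cs n) σ)
    (hτ : IsCritical (simplices cs) (matching cs n) τ)
    (hσ' : σ.map Fin.valEmbedding = Icc 1 n)
    (hτ' : τ.map Fin.valEmbedding = insert 0 (Icc 2 (n - 1))) (hw : weight cs n τ = 1)
    (hc : σ.card = τ.card + 1) : morseInc (matching cs n) σ τ = 0 := by
  have hn : 5 ≤ n := by have := H.four_le; obtain ⟨k, rfl⟩ := ho; omega
  obtain ⟨p, hp⟩ : ∃ p : Fin (n + 1), (p : ℕ) = 0 := ⟨⟨0, by omega⟩, rfl⟩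
  obtain ⟨r, hr⟩ : ∃ r : Fin (n + 1), (r : ℕ) = 1 := ⟨⟨1, by omega⟩, rfl⟩
  obtain ⟨s, hs⟩ : ∃ s : Fin (n + 1), (s : ℕ) = n - 1 := ⟨⟨n - 1, by omega⟩, rfl⟩
  obtain ⟨t, ht⟩ : ∃ t : Fin (n + 1), (t : ℕ) = n := ⟨⟨n, by omega⟩, rfl⟩
  obtain rfl : σ = univ.erase p := eq_of_forall_coe_mem hσ' fun v => by grind
  obtain rfl : τ = (univ.erase r).erase t := eq_of_forall_coe_mem hτ' fun v => by grind
  have hK : ∀ v : Fin (n + 1), univ.erase v ∈ simplices cs := fun v =>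
    (mem_simplices_iff cs H.four_le _).2 fun h => by grind
  have hmem : ∀ u v : Fin (n + 1), (u : ℕ) ∈ (univ.erase v).map Fin.valEmbedding ↔
      (u : ℕ) ≠ v := fun u v => by
    rw [coe_mem_map_iff, mem_erase, Ne, Fin.ext_iff]; simp
  have hzero : ∀ v : Fin (n + 1), n ≤ v + 1 → (univ.erase v, (univ.erase v).erase p) ∈
      matching cs n := fun v hv => by
    refine H.erase_mem_matching (hK v) ?_ (by
      simp only [mem_erase, ne_eq, Fin.ext_iff, mem_univ, and_true]; omega)
    rw [hπ, pivotTOdd, if_neg, if_neg, hp]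
    · grind
    · intro h1; have h2 := (hmem p v).2 (by omega); rw [h1, mem_Icc] at h2; omega
  have hba := hzero t (by omega); have hba' := hzero s (by omega)
  have hec : (univ.erase r, (univ.erase r).erase s) ∈ matching cs n := by
    refine H.erase_mem_matching (hK r) ?_ (by
      simp only [mem_erase, ne_eq, Fin.ext_iff, mem_univ, and_true]; omega)
    have h1 : 1 ∉ (univ.erase r).map Fin.valEmbedding := by
      have h2 := (hmem r r).not.2 (by simp); rwa [hr] at h2
    have h2 : (univ.erase r).map Fin.valEmbedding ≠ Icc 1 n := fun h2 => by
      rw [h2, mem_Icc] at h1; omega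
    rw [hπ, pivotTOdd, if_neg h2, if_pos h1, relabel,
      pivotDOdd, if_pos]
    · rw [Option.map_some, if_neg (by omega), hs]; congr 1
    · grind
  have hM := H.isMatching
  have hdown : ∀ {x x' y}, (y, x) ∈ matching cs n → (y, x') ∈ matching cs n → x = x' :=
    fun h h' => congrArg Prod.snd (hM.2 _ (hM.1 h).1 _ h _ h' (Or.inl rfl) (Or.inl rfl))
  -- All upper ends on a path to `τ` have `n` vertices, hence are complements of one vertex; of
  -- these only the complements of `1`, `n - 1` and `n` can occur.
  have htop : ∀ x y p', (y, x) ∈ matching cs n →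
      IsAltPath (matching cs n) y p' ((univ.erase r).erase t) →
      x = (univ.erase t).erase p ∨ x = (univ.erase s).erase p ∨ x = (univ.erase r).erase s := by
    intro x y p' h1 h2; obtain ⟨h3, -⟩ := H.weight_eq h1
    obtain ⟨h4, h5⟩ := H.weight_le_of_isAltPath h3 h2
    obtain ⟨v, -, rfl⟩ : ∃ v ∈ univ, univ.erase v = y := by
      refine covBy_iff_exists_erase.1 (covBy_iff_card_sdiff_eq_one.2 ⟨subset_univ _, ?_⟩); grind
    have h6 : ¬ (2 ≤ (v : ℕ) ∧ (v : ℕ) + 2 ≤ n) := by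
      rintro ⟨h6, h7⟩
      rw [hw, weight_eq_gweight H.four_le H.two_le h3, map_erase,
        show univ.map Fin.valEmbedding = range (n + 1) from ?_] at h4
      · have := gweight_graphDTilde_erase hn ho h6 h7
        change 1 ≤ gweight (graphDTilde n) n ((range (n + 1)).erase (v : ℕ)) at h4; omega
      · ext x; simp
    have h8 : v = p ∨ v = r ∨ v = s ∨ v = t := by simp only [Fin.ext_iff]; omega
    rcases h8 with rfl | rfl | rfl | rfl
    · exact absurd rfl (hσ.2 _ h1).1
    · exact Or.inr (Or.inr (hdown h1 hec))
    · exact Or.inr (Or.inl (hdown h1 hba'))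
    · exact Or.inl (hdown h1 hba)
  have hcov : ∀ u v : Fin (n + 1), (u : ℕ) ≠ v → (univ.erase u).erase v ⋖ univ.erase v :=
    fun u v huv => by
      rw [erase_right_comm]
      exact erase_covBy (mem_erase.2 ⟨fun h => huv (congrArg Fin.val h), mem_univ u⟩)
  have hnot : ∀ (u v w : Fin (n + 1)), (w : ℕ) ≠ u → (w : ℕ) ≠ v →
      ¬ (univ.erase u).erase v ⋖ univ.erase w := fun u v w h1 h2 h3 => by
    have : w ∈ (univ.erase u).erase v := by grind
    exact notMem_erase _ _ (h3.le this)
  have hne : ∀ {u v : Fin (n + 1)}, (u : ℕ) ≠ v → univ.erase u ≠ univ.erase v := fun {u v} h1 h2 => by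
    grind
  have hne' : ∀ {x y : Finset (Fin (n + 1))} (v : Fin (n + 1)), v ∈ x → v ∉ y → x ≠ y :=
    fun v h1 h2 h3 => h2 (h3 ▸ h1)
  refine morseInc_eq_zero_of_octagon (z := univ) hM (hcov t p (by omega)) (hcov s p (by omega)) hba
    (hcov r t (by omega)) hba' (hcov r s (by omega)) hec
    (erase_covBy (mem_erase.2 ⟨fun h => by simp only [Fin.ext_iff] at h; omega, mem_univ t⟩))
    (fun x h1 => (hσ.2 _ h1).1 rfl) (fun x h1 => (hτ.2 _ h1).2 rfl)
    (hnot r t p (by omega) (by omega)) (hnot r t s (by omega) (by omega))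
    (hne' s ?_ (by simp)) (hne' r ?_ (by simp)) (hne' t ?_ (by simp))
    (Or.inr ⟨erase_covBy (mem_univ _), erase_covBy (mem_univ _), erase_covBy (mem_univ _),
      erase_covBy (mem_univ _), hne (by omega), hne (by omega)⟩) ?_ ?_ ?_ ?_
  iterate 3 (simp only [mem_erase, ne_eq, Fin.ext_iff, mem_univ, and_true]; omega)
  · grind
  · grind
  · grind
  · grind

end IsRecipe

end Final

/-! ### Precision and the values on the critical simplices -/

section Main

variable {W : Type*} [Group W] {n d h : ℕ} {cs : CoxeterSystem (matrixDTilde n) W}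
  {σ τ : Finset ℕ}

lemma IsRecipe.of_even (hn : 4 ≤ n) (hh : 0 < h) :
    IsRecipe cs (2 * h) (pivotTEven (2 * h) n) (CriticalT h n) where
  four_le := hn
  two_le := by omega
  good := isGood_pivotTEven hn hh
  recipe_eq _ := if_neg (by simp)

lemma IsRecipe.of_odd (hn : 4 ≤ n) (hd : 3 ≤ d) (ho : Odd d) :
    IsRecipe cs d (pivotTOdd d n)
      fun σ => σ = Icc 1 n ∨ 1 ∉ σ ∧ CriticalOdd d n σ.card (gweight (graphDTilde n) d σ) where
  four_le := hn
  two_le := by omega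
  good := isGood_pivotTOdd hd ho hn
  recipe_eq _ := if_pos ho

theorem isPrecise_of_even (hn : 4 ≤ n) (hh : 0 < h) :
    IsPrecise cs (2 * h) (matching cs (2 * h)) := by
  have H := IsRecipe.of_even (cs := cs) hn hh
  refine H.isPrecise fun σ τ hσ hτ hLσ hπτ hLτ hc hw hne => ?_
  rw [weight_eq_gweight hn H.two_le hσ.1, weight_eq_gweight hn H.two_le hτ.1] at hw ⊢
  rcases hLσ.drop hn hh hLτ ((map_valEmbedding_mem_simplicesT hn).2 hτ.1) hπτ
    (by rwa [card_map, card_map]) hw with h1 | ⟨h1, h2, h3, h4, h5⟩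
  · exact h1
  · rw [← weight_eq_gweight hn H.two_le hτ.1] at h3
    exact absurd (H.morseInc_eq_zero_of_even h1 h2 H.recipe_eq hσ hτ h4 h5 h3) hne

/-- The critical simplices not containing `1` have a constant difference of size and weight. -/
lemma CriticalOdd.eq {c w : ℕ} (hd : 3 ≤ d) (H : CriticalOdd d n c w) :
    w ≤ 1 ∧ (n % d = 0 ∧ (c : ℤ) - w = n - 2 * (n / d : ℕ) ∨
      n % d = 1 ∧ (c : ℤ) - w = n - 2 * ((n - 1) / d : ℕ) - 1) := by
  obtain ⟨h1, ⟨t, h2, h3⟩ | ⟨t, h2, h3⟩⟩ := H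
  · refine ⟨h1, Or.inl ⟨by rw [h2, Nat.mul_mod_left], ?_⟩⟩
    have : n / d = t := by rw [h2, Nat.mul_div_left _ (by omega)]
    omega
  · refine ⟨h1, Or.inr ⟨mod_eq_of_eq_add_mul h2 (by omega), ?_⟩⟩
    have : (n - 1) / d = t := by rw [h2, Nat.add_sub_cancel_left, Nat.mul_div_left _ (by omega)]
    omega

/-- Critical simplices without `1` all have the same `|σ| - v(σ)`, so between two of them the weight
drops by one. The simplex `{1, …, n}` has maximal size and can only be the source of a path; there
the weight `⌊n/d⌋` is compared with the weight of `τ`, which is at most `1`. -/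
theorem isPrecise_of_odd (hn : 4 ≤ n) (hd : 3 ≤ d) (ho : Odd d) :
    IsPrecise cs d (matching cs d) := by
  have H := IsRecipe.of_odd (cs := cs) hn hd ho
  refine H.isPrecise fun σ τ hσ hτ hLσ hπτ hLτ hc hw hne => ?_
  have hwσ := weight_eq_gweight hn H.two_le hσ.1; have hwτ := weight_eq_gweight hn H.two_le hτ.1
  rw [card_map, ← hwσ] at hLσ; rw [card_map, ← hwτ] at hLτ
  have hcard : ∀ ρ : Finset (Fin (n + 1)), ρ.map Fin.valEmbedding = Icc 1 n → ρ.card = n := by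
    intro ρ h1; rw [← card_map Fin.valEmbedding, h1, Nat.card_Icc, Nat.add_sub_cancel]
  have hle : σ.card ≤ n := by
    have h1 := card_le_univ σ; rw [Fintype.card_fin] at h1
    rcases Nat.eq_or_lt_of_le h1 with h2 | h2
    · exact absurd (eq_univ_of_card σ (by rw [h2, Fintype.card_fin]))
        ((mem_simplices_iff cs hn σ).1 hσ.1)
    · omega
  rcases hLτ with h1 | ⟨h1, h2⟩
  · have := hcard τ h1; omega
  have h3 := h2.eq hd; rcases hLσ with h4 | ⟨-, h4⟩
  swap
  · have := h4.eq hd; omega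
  have h5 := hcard σ h4
  rw [h4, gweight_graphDTilde_Icc_one hn (by omega), weightD_of_odd ho] at hwσ
  have hdm := Nat.div_add_mod' n d; rcases h3 with ⟨h6, ⟨h7, h8⟩ | ⟨h7, h8⟩⟩
  -- From `|τ| = n - 1` the weight of `τ` is `2(n/d) - 1 ≤ 1`, so `n = d` and both weights are `1`;
  -- this is the pair whose two paths cancel.
  · by_contra h9; have h10 : n / d = 1 := by omega
    rw [h10, h7] at hdm; obtain rfl : d = n := by omega
    refine hne (H.morseInc_eq_zero_of_odd ho H.recipe_eq hσ hτ h4 ?_ (by omega) hc)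
    have hτn := (map_valEmbedding_mem_simplicesT (cs := cs) hn).2 hτ.1
    -- In the relabelling from the right, `d = n` is the first vertex of type `D`; a simplex
    -- containing it is matched by toggling its twin.
    have h11 : d ∉ τ.map Fin.valEmbedding := by
      intro h11
      have h12 : τ.map Fin.valEmbedding ≠ Icc 1 d := fun h12 => by rw [h12, mem_Icc] at h1; omega
      rw [pivotTOdd, if_neg h12, if_pos h1, relabel,
        pivotDOdd, if_pos] at hπτ
      · simp at hπτ
      · grind
    refine eq_of_subset_of_card_le (fun x hx => ?_) ?_
    · have := le_of_mem_simplicesT hτn hx; grind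
    · rw [card_map, card_insert_of_notMem (by rw [mem_Icc]; omega), Nat.card_Icc]; omega
  -- For `n ≡ 1` the weight of `τ` would be `2(n-1)/d`, an even number at most `1`, hence zero; but
  -- `d < n`.
  · have h9 : (n - 1) / d ≠ 0 := by
      rw [Ne, Nat.div_eq_zero_iff_lt (by omega)]; intro h9
      have : n = d := by by_contra h10; rw [Nat.mod_eq_of_lt (by omega)] at h7; omega
      rw [this, Nat.mod_self] at h7; omega
    omega

open Classical in
-- Apart from `{1, …, n}`, of weight `⌊n/d⌋`, the critical simplices are those without `1`. There
-- are two of them if `n ≡ 0` or `n ≡ 1` modulo `d` and none otherwise (`ncard_critical_pivotTOdd`),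
-- and `CriticalOdd.eq` gives their common value.
theorem criticalValues_of_odd (hn : 4 ≤ n) (hd : 3 ≤ d) (ho : Odd d) :
    criticalValues cs d = ((n : ℤ) - (n / d : ℕ)) ::ₘ
      if n % d = 0 then Multiset.replicate 2 ((n : ℤ) - 2 * (n / d : ℕ))
      else if n % d = 1 then Multiset.replicate 2 ((n : ℤ) - 2 * ((n - 1) / d : ℕ) - 1) else 0 := by
  have H := IsRecipe.of_odd (cs := cs) hn hd ho
  have hmap : univ.map (Fin.valEmbedding (n := n + 1)) = range (n + 1) := by ext x; simp
  have hz : (univ.erase (0 : Fin (n + 1))).map Fin.valEmbedding = Icc 1 n := by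
    rw [map_erase, hmap]; ext x; rw [mem_erase, mem_range, mem_Icc]; change x ≠ 0 ∧ _ ↔ _; omega
  have h1z : 1 ∈ (univ.erase (0 : Fin (n + 1))).map Fin.valEmbedding := by rw [hz, mem_Icc]; omega
  have hK0 : univ.erase (0 : Fin (n + 1)) ∈ simplices cs := (mem_simplices_iff cs hn _).2 (by simp)
  obtain ⟨S, hS⟩ : ∃ S : Finset (Finset (Fin (n + 1))), ∀ σ, σ ∈ S ↔
      IsCritical (simplices cs) (matching cs d) σ ∧ 1 ∉ σ.map Fin.valEmbedding :=
    ⟨univ.filter fun σ => IsCritical (simplices cs) (matching cs d) σ ∧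
      1 ∉ σ.map Fin.valEmbedding, by simp⟩
  have hcr : ∀ σ, IsCritical (simplices cs) (matching cs d) σ ↔
      σ ∈ simplices cs ∧ pivotTOdd d n (σ.map Fin.valEmbedding) = none := fun σ =>
    ⟨fun h => ⟨h.1, (H.recipe_eq σ).symm.trans ((H.isCritical_iff h.1).1 h)⟩,
      fun h => (H.isCritical_iff h.1).2 ((H.recipe_eq σ).trans h.2)⟩
  have hT : (univ.filter fun σ => IsCritical (simplices cs) (matching cs d) σ) =
      cons (univ.erase 0) S (fun h => ((hS _).1 h).2 h1z) := by
    ext σ; rw [mem_filter, mem_cons, hS]; constructor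
    · rintro ⟨-, h⟩; have h1 := ((hcr σ).1 h).2
      by_cases h2 : 1 ∈ σ.map Fin.valEmbedding
      · left; rw [pivotTOdd, if_neg (not_not.2 h2)] at h1; split_ifs at h1 with h3
        exact map_injective Fin.valEmbedding (h3.trans hz.symm)
      · exact Or.inr ⟨h, h2⟩
    · rintro (rfl | h)
      · exact ⟨mem_univ _, (hcr _).2 ⟨hK0, by rw [hz]; exact if_pos rfl⟩⟩
      · exact ⟨mem_univ _, h.1⟩
  have hcard : S.card = if n % d ≤ 1 then 2 else 0 := by
    rw [← ncard_critical_pivotTOdd hd hn, ← Set.ncard_coe_finset, ← Set.ncard_image_of_injective _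
      (map_injective (Fin.valEmbedding (n := n + 1)))]
    congr 1; ext σ; constructor
    · rintro ⟨ρ, h, rfl⟩; obtain ⟨h1, h2⟩ := (hS ρ).1 h; have h3 := (hcr ρ).1 h1
      exact ⟨⟨(map_valEmbedding_mem_simplicesT hn).2 h3.1, h2⟩, h3.2⟩
    · rintro ⟨⟨h1, h2⟩, h3⟩
      obtain ⟨ρ, -, rfl⟩ : ∃ ρ ⊆ univ, σ = ρ.map (Fin.valEmbedding (n := n + 1)) :=
        subset_map_iff.1 (by rw [hmap]; exact h1.1)
      exact ⟨ρ, (hS ρ).2 ⟨(hcr ρ).2 ⟨(map_valEmbedding_mem_simplicesT hn).1 h1, h3⟩, h2⟩, rfl⟩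
  have hval : ∀ σ ∈ S, n % d = 0 ∧ (σ.card : ℤ) - weight cs d σ = n - 2 * (n / d : ℕ) ∨
      n % d = 1 ∧ (σ.card : ℤ) - weight cs d σ = n - 2 * ((n - 1) / d : ℕ) - 1 := by
    intro σ hσ; obtain ⟨h1, h2⟩ := (hS σ).1 hσ; have h3 := (hcr σ).1 h1
    rcases H.good.crit _ ((map_valEmbedding_mem_simplicesT hn).2 h3.1) h3.2 with h4 | ⟨-, h4⟩
    · exact absurd (h4 ▸ mem_Icc.2 (by omega)) h2
    · rw [card_map, ← weight_eq_gweight hn H.two_le h3.1] at h4; exact (h4.eq hd).2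
  unfold criticalValues
  rw [hT, cons_val, Multiset.map_cons, weight_eq_gweight hn H.two_le hK0,
    ← card_map Fin.valEmbedding, hz, gweight_graphDTilde_Icc_one hn H.two_le, weightD_of_odd ho,
    Nat.card_Icc, Nat.add_sub_cancel]
  congr 1; split_ifs with h1 h2
  · rw [Multiset.eq_replicate, Multiset.card_map, card_val, hcard, if_pos (by omega)]
    refine ⟨rfl, fun b hb => ?_⟩; obtain ⟨σ, hσ, rfl⟩ := Multiset.mem_map.1 hb; have := hval σ hσ
    omega
  · rw [Multiset.eq_replicate, Multiset.card_map, card_val, hcard, if_pos (by omega)]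
    refine ⟨rfl, fun b hb => ?_⟩; obtain ⟨σ, hσ, rfl⟩ := Multiset.mem_map.1 hb; have := hval σ hσ
    omega
  · rw [if_neg (by omega), card_eq_zero] at hcard; rw [hcard]; rfl

end Main
end PreciseMatching

theorem lemma9p1 {W : Type*} [Group W] (n d : ℕ) (hn : 4 ≤ n) (hd : 2 ≤ d)
    (cs : CoxeterSystem (PreciseMatching.matrixDTilde n) W) :
    PreciseMatching.IsPrecise cs d (PreciseMatching.matching cs d) ∧
    (∀ σ ∈ PreciseMatching.simplices cs,
      PreciseMatching.IsCritical (PreciseMatching.simplices cs)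
        (PreciseMatching.matching cs d) σ ↔ PreciseMatching.recipe d n σ = none) ∧
    (Odd d →
      (n ≡ 0 [MOD d] → PreciseMatching.criticalValues cs d =
        {(n : ℤ) - (n / d : ℕ), (n : ℤ) - 2 * (n / d : ℕ), (n : ℤ) - 2 * (n / d : ℕ)}) ∧
      (n ≡ 1 [MOD d] → PreciseMatching.criticalValues cs d =
        {(n : ℤ) - ((n - 1) / d : ℕ), (n : ℤ) - 2 * ((n - 1) / d : ℕ) - 1,
          (n : ℤ) - 2 * ((n - 1) / d : ℕ) - 1}) ∧
      (¬ n ≡ 0 [MOD d] → ¬ n ≡ 1 [MOD d] → PreciseMatching.criticalValues cs d =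
        {(n : ℤ) - (n / d : ℕ)})) := by
  rcases Nat.even_or_odd d with he | ho
  · obtain ⟨h, rfl⟩ := he.two_dvd
    exact ⟨PreciseMatching.isPrecise_of_even hn (by omega), fun σ hσ =>
      (PreciseMatching.IsRecipe.of_even hn (by omega)).isCritical_iff hσ,
      fun ho => absurd he (Nat.not_even_iff_odd.2 ho)⟩
  · have hd3 : 3 ≤ d := by obtain ⟨k, rfl⟩ := ho; omega
    refine ⟨PreciseMatching.isPrecise_of_odd hn hd3 ho, fun σ hσ =>
      (PreciseMatching.IsRecipe.of_odd hn hd3 ho).isCritical_iff hσ, fun _ => ?_⟩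
    rw [PreciseMatching.criticalValues_of_odd hn hd3 ho]; unfold Nat.ModEq
    rw [Nat.zero_mod, Nat.mod_eq_of_lt (show 1 < d by omega)]
    refine ⟨fun h => ?_, fun h => ?_, fun h h' => ?_⟩
    · rw [if_pos h]; rfl
    · rw [if_neg (by omega), if_pos h]
      have h1 : n / d = (n - 1) / d := by
        have h2 := Nat.div_add_mod n d
        rw [show n - 1 = d * (n / d) by omega, Nat.mul_div_cancel_left _ (by omega)]
      rw [h1]; rfl
    · rw [if_neg h, if_neg h']; rfl
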